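/- Computations take place on a randomized word RAM with words of $O(\log n)$ bits; algorithms always give correct answers and running times are expected numbers of steps. In incremental (decremental) $st$-shortest path one preprocesses an undirected weighted graph on $n$ vertices with two fixed vertices $s,t$, and then handles online a sequence of requests, each of which is an edge insertion (respectively an edge deletion) or a query for the distance between $s$ and $t$ in the current graph. In incremental (decremental) bipartite maximum-weight matching the graph is an undirected bipartite weighted graph on $n$ vertices with given parts, and a query asks for the maximum weight of a matching of the current graph. The edge weights are integers in $\{1,\dots,n^{c}\}$, where $c$ is an arbitrary constant: to solve the problem with given time bounds means that for every constant $c$ there is an algorithm with these bounds (with implied constants that may depend on $c$). Amortized update and query time $O(f(n))$ means that, after the preprocessing, every sequence of $k$ updates and queries takes expected total time $O(k\cdot f(n))$. **Theorem.** Suppose that for some $\varepsilon>0$ at least one of the four problems decremental $st$-shortest path, incremental $st$-shortest path, decremental bipartite maximum-weight matching, and incremental bipartite maximum-weight matching can be solved with preprocessing time $O(n^{3-\varepsilon})$ and amortized update and query time $O(n^{2-\varepsilon})$. Then the APSP conjecture is false; that is, for every constant $c$ there are an $\varepsilon'>0$ and an algorithm that, given a directed graph on $n$ vertices with edge weights in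 $\{1,\dots,n^{c}\}$, computes the distances between all pairs of vertices in expected time $O(n^{3-\varepsilon'})$ on a word RAM with words of $O(\log n)$ bits. -/

import Mathlib

open scoped ENNReal

noncomputable section

namespace WordRAM

/-! ## The randomized word RAM

Words are natural numbers below `2 ^ w`, where `w` is the word length. The machine has registers
and a random access memory whose addresses are words. A program is one fixed finite piece of
code (the same for all inputs), written with sequencing, branching and loops. -/

/-- The unit-cost arithmetic, bitwise and comparison operations on words. -/
inductive BinOp
  | add | sub | mul | div | mod | band | bor | bxor | shl | shr | lt | eq

/-- `sub` is truncated at `0`, `div` by `0` gives `0`, and the comparisons give `0` or `1`. -/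
def BinOp.eval : BinOp → ℕ → ℕ → ℕ
  | add, x, y => x + y
  | sub, x, y => x - y
  | mul, x, y => x * y
  | div, x, y => x / y
  | mod, x, y => x % y
  | band, x, y => x &&& y
  | bor, x, y => x ||| y
  | bxor, x, y => x ^^^ y
  | shl, x, y => x <<< y
  | shr, x, y => x >>> y
  | lt, x, y => if x < y then 1 else 0
  | eq, x, y => if x = y then 1 else 0

/-- Programs; `r`, `a`, `b` are register numbers and `R[a]` is the content of register `a`.
* `const r k`: `R[r] := k`
* `op o r a b`: `R[r] := R[a] o R[b]`
* `load r a`: `R[r] := M[R[a]]`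
* `store a b`: `M[R[a]] := R[b]`
* `rand r a`: `R[r] :=` a fresh uniformly random element of `{0, …, R[a] - 1}`
* `cond a P Q`: run `P` if `R[a] ≠ 0`, otherwise `Q`
* `loop a P`: while `R[a] ≠ 0`, run `P`. -/
inductive Prog
  | skip
  | const (r k : ℕ)
  | op (o : BinOp) (r a b : ℕ)
  | load (r a : ℕ)
  | store (a b : ℕ)
  | rand (r a : ℕ)
  | seq (P Q : Prog)
  | cond (a : ℕ) (P Q : Prog)
  | loop (a : ℕ) (P : Prog)

/-- Contents of the registers and of the memory. -/
structure Store where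
  reg : ℕ → ℕ
  mem : ℕ → ℕ

def Store.setReg (σ : Store) (r x : ℕ) : Store := { σ with reg := Function.update σ.reg r x }

def Store.setMem (σ : Store) (a x : ℕ) : Store := { σ with mem := Function.update σ.mem a x }

/-- A configuration: the code that remains to be run, and the store. The machine has halted when
no code is left. -/
structure Config where
  code : List Prog
  store : Store

/-- Write the word `x` to register `r` and go on with `k`. If `x` does not fit into `w` bits, the
machine stays in the configuration `stuck` (and hence never halts). -/
def assign (w r x : ℕ) (k : List Prog) (stuck : Config) : Config :=
  if x < 2 ^ w then ⟨k, stuck.store.setReg r x⟩ else stuck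

/-- One step of the machine with word length `w`: a random next configuration. -/
def step (w : ℕ) (c : Config) : PMF Config :=
  match c.code with
  | [] => PMF.pure c
  | .skip :: k => PMF.pure ⟨k, c.store⟩
  | .const r x :: k => PMF.pure (assign w r x k c)
  | .op o r a b :: k => PMF.pure (assign w r (o.eval (c.store.reg a) (c.store.reg b)) k c)
  | .load r a :: k => PMF.pure (assign w r (c.store.mem (c.store.reg a)) k c)
  | .store a b :: k => PMF.pure ⟨k, c.store.setMem (c.store.reg a) (c.store.reg b)⟩
  | .rand r a :: k =>
    match c.store.reg a with
    | 0 => PMF.pure c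
    | m + 1 => (PMF.uniformOfFintype (Fin (m + 1))).map fun i => assign w r i.val k c
  | .seq P Q :: k => PMF.pure ⟨P :: Q :: k, c.store⟩
  | .cond a P Q :: k => PMF.pure ⟨(if c.store.reg a ≠ 0 then P else Q) :: k, c.store⟩
  | .loop a P :: k =>
    PMF.pure ⟨if c.store.reg a ≠ 0 then P :: .loop a P :: k else k, c.store⟩

/-- The distribution of the state of a Markov chain after `t` steps. -/
def iter {α : Type} (next : α → PMF α) (x : α) : ℕ → PMF α
  | 0 => PMF.pure x
  | t + 1 => (iter next x t).bind next

/-- The expected number of times `t` at which the state of the chain lies in `S`. -/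
def expectedVisits {α : Type} (next : α → PMF α) (x : α) (S : Set α) : ℝ≥0∞ :=
  ∑' t, (iter next x t).toOuterMeasure S

/-- The expected number of steps until `P` halts, started from the store `σ`. -/
def expectedTime (w : ℕ) (P : Prog) (σ : Store) : ℝ≥0∞ :=
  expectedVisits (step w) ⟨[P], σ⟩ {c | c.code ≠ []}

/-- `σ'` is a possible (positive probability) final store of `P` started from `σ`. -/
def PossibleResult (w : ℕ) (P : Prog) (σ σ' : Store) : Prop :=
  ∃ t, (⟨[], σ'⟩ : Config) ∈ (iter (step w) ⟨[P], σ⟩ t).support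

/-- Words of `O(log n)` bits, with the constant `C`. -/
def wordLength (C n : ℕ) : ℕ := C * (Nat.log 2 n + 1)

/-! ## Weighted graphs

Edge weights are positive integers, so a weighted graph is given by its weight matrix, in which the
entry `0` means that there is no edge. -/

/-- Row-by-row layout of a matrix in the memory, starting at address `0`; the rest is zero. -/
def matrixMem {a b : ℕ} (W : Fin a → Fin b → ℕ) (p : ℕ) : ℕ :=
  if h : p < b * a then
    W ⟨p / b, Nat.div_lt_of_lt_mul h⟩ ⟨p % b, Nat.mod_lt _ (Nat.pos_of_mul_pos_right (Nat.zero_lt_of_lt h))⟩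
  else 0

/-- The store with `x`, `y`, `z` in the registers `0`, `1`, `2`, zero in all other registers, and
the matrix `W` in the memory. -/
def inputStore {a b : ℕ} (x y z : ℕ) (W : Fin a → Fin b → ℕ) : Store where
  reg r := if r = 0 then x else if r = 1 then y else if r = 2 then z else 0
  mem := matrixMem W

/-- `HasWalk W u v ℓ`: the weighted directed graph `W` has a walk from `u` to `v` of total
weight `ℓ`. -/
inductive HasWalk {n : ℕ} (W : Fin n → Fin n → ℕ) : Fin n → Fin n → ℕ → Prop
  | nil (u : Fin n) : HasWalk W u u 0
  | cons {u v x : Fin n} {l : ℕ} : W u v ≠ 0 → HasWalk W v x l → HasWalk W u x (W u v + l)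

/-- The distance from `u` to `v`; it is `⊤` if `v` cannot be reached from `u`. -/
def distance {n : ℕ} (W : Fin n → Fin n → ℕ) (u v : Fin n) : ℕ∞ :=
  ⨅ l ∈ {l : ℕ | HasWalk W u v l}, (l : ℕ∞)

/-- How a distance is output as a word: `0` stands for `⊤`, and `k + 1` for the number `k`. -/
def EncodesDistance (d : ℕ∞) (x : ℕ) : Prop :=
  (d = ⊤ ∧ x = 0) ∨ ∃ k : ℕ, d = k ∧ x = k + 1

/-! ## All pairs shortest paths -/

/-- APSP in directed graphs with `n` vertices and edge weights in `{1, …, n ^ c}` can be solved by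
a (zero-error) randomized algorithm in expected time `O(n ^ (3 - ε))` on a word RAM with words
of `O(log n)` bits. The input is `n` and the weight matrix, and the output replaces the latter. -/
def APSPSolvable (c : ℕ) (ε : ℝ) : Prop :=
  ∃ (P : Prog) (C : ℕ) (K : ℝ), ∀ (n : ℕ), 0 < n → ∀ W : Fin n → Fin n → ℕ,
    (∀ i j, W i j ≤ n ^ c) →
      expectedTime (wordLength C n) P (inputStore n 0 0 W)
          ≤ ENNReal.ofReal (K * (n : ℝ) ^ (3 - ε)) ∧
      ∀ σ', PossibleResult (wordLength C n) P (inputStore n 0 0 W) σ' →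
        ∀ i j : Fin n, EncodesDistance (distance W i j) (σ'.mem (i * n + j))

/-- The conjecture that APSP has no truly subcubic algorithm. -/
def APSPConjecture : Prop := ∃ c : ℕ, ∀ ε : ℝ, 0 < ε → ¬ APSPSolvable c ε

/-! ## Dynamic problems -/

/-- The update that gives weight `x` to the edge between the vertices number `u` and `v`; for
`x = 0` it deletes the edge. -/
structure Update where
  u : ℕ
  v : ℕ
  x : ℕ

inductive Request
  | update (e : Update)
  | query

/-- A dynamic problem whose instances are graphs (together with fixed data). -/
structure DynamicProblem where
  Inst : Type
  /-- the number of vertices -/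
  size : Inst → ℕ
  /-- the store in which an instance is handed to the preprocessing procedure -/
  input : Inst → Store
  /-- the admissible initial instances with edge weights in `{1, …, size ^ c}` -/
  Valid : ℕ → Inst → Prop
  /-- the updates that are allowed in the current instance -/
  Legal : ℕ → Inst → Update → Prop
  apply : Inst → Update → Inst
  /-- the correct answers to a query in the current instance -/
  Answer : Inst → ℕ → Prop

namespace DynamicProblem

variable (P : DynamicProblem)

/-- All updates of the sequence are allowed at the time when they are made. -/
def LegalSeq (c : ℕ) : P.Inst → List Request → Prop
  | _, [] => True
  | I, .query :: rs => LegalSeq c I rs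
  | I, .update e :: rs => P.Legal c I e ∧ LegalSeq c (P.apply I e) rs

/-- The instances at the times of the queries of the sequence. -/
def queried : P.Inst → List Request → List P.Inst
  | _, [] => []
  | I, .query :: rs => I :: queried I rs
  | I, .update e :: rs => queried (P.apply I e) rs

end DynamicProblem

/-- A dynamic algorithm: three procedures that share registers and memory. An update is passed in
the registers `0`, `1`, `2`, and the answer to a query is returned in register `0`. -/
structure DynAlg where
  prep : Prog
  upd : Prog
  qry : Prog

inductive Phase
  | prep | update | query | done

/-- A configuration during the treatment of a sequence of requests: the procedure that is being
run, its configuration, the requests to come, and the answers given so far. -/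
structure DynConfig where
  phase : Phase
  run : Config
  pending : List Request
  answers : List ℕ

/-- When a procedure has halted, the answer is recorded if it was a query, and the procedure for
the next request is started; the algorithm sees requests one by one. -/
def DynAlg.nextRequest (A : DynAlg) (d : DynConfig) : DynConfig :=
  let σ := d.run.store
  let ans := match d.phase with
    | .query => d.answers ++ [σ.reg 0]
    | _ => d.answers
  match d.pending with
  | [] => ⟨.done, d.run, [], ans⟩
  | .update e :: rs =>
    ⟨.update, ⟨[A.upd], ((σ.setReg 0 e.u).setReg 1 e.v).setReg 2 e.x⟩, rs, ans⟩
  | .query :: rs => ⟨.query, ⟨[A.qry], σ⟩, rs, ans⟩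

/-- One step of the dynamic algorithm. -/
def DynAlg.dynStep (A : DynAlg) (w : ℕ) (d : DynConfig) : PMF DynConfig :=
  match d.phase with
  | .done => PMF.pure d
  | _ =>
    match d.run.code with
    | [] => PMF.pure (A.nextRequest d)
    | _ :: _ => (step w d.run).map fun r => { d with run := r }

/-- The start: preprocessing of the input `σ`, with the requests `rs` to come. -/
def DynAlg.start (A : DynAlg) (σ : Store) (rs : List Request) : DynConfig :=
  ⟨.prep, ⟨[A.prep], σ⟩, rs, []⟩

/-- Expected time of the preprocessing. -/
def DynAlg.prepTime (A : DynAlg) (w : ℕ) (σ : Store) (rs : List Request) : ℝ≥0∞ :=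
  expectedVisits (A.dynStep w) (A.start σ rs) {d | d.phase = .prep}

/-- Expected total time of the updates and queries in `rs`, after the preprocessing. -/
def DynAlg.requestTime (A : DynAlg) (w : ℕ) (σ : Store) (rs : List Request) : ℝ≥0∞ :=
  expectedVisits (A.dynStep w) (A.start σ rs) {d | d.phase = .update ∨ d.phase = .query}

/-- The dynamic problem `P`, on `n`-vertex graphs with polynomially bounded edge weights
(`{1, …, n ^ c}` for an arbitrary constant `c`), can be solved by a (zero-error) randomized
algorithm with expected preprocessing time `O(n ^ p)` and expected amortized update and query
time `O(n ^ q)` on a word RAM with words of `O(log n)` bits. Amortized means that any sequence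
of `k` updates and queries takes total time `O(k * n ^ q)`. -/
def DynamicProblem.Solvable (P : DynamicProblem) (p q : ℝ) : Prop :=
  ∀ c : ℕ, ∃ (A : DynAlg) (C : ℕ) (K : ℝ), ∀ I : P.Inst, P.Valid c I →
    ∀ rs : List Request, P.LegalSeq c I rs →
      A.prepTime (wordLength C (P.size I)) (P.input I) rs
          ≤ ENNReal.ofReal (K * (P.size I : ℝ) ^ p) ∧
      A.requestTime (wordLength C (P.size I)) (P.input I) rs
          ≤ ENNReal.ofReal (K * (rs.length * (P.size I : ℝ) ^ q)) ∧
      ∀ t, ∀ d ∈ (iter (A.dynStep (wordLength C (P.size I))) (A.start (P.input I) rs) t).support,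
        d.phase = .done → List.Forall₂ P.Answer (P.queried I rs) d.answers

inductive Mode
  | incremental | decremental

/-- Which changes of the weight of an edge, from `old` to `new`, are allowed: insertions of absent
edges with weight in `{1, …, B}`, or deletions of present edges. -/
def Mode.Allows (B old new : ℕ) : Mode → Prop
  | incremental => old = 0 ∧ 1 ≤ new ∧ new ≤ B
  | decremental => old ≠ 0 ∧ new = 0

/-! ### st-shortest path -/

/-- A weight matrix on `n` vertices with two vertices `s` and `t`. -/
structure STInst where
  n : ℕ
  W : Fin n → Fin n → ℕ
  s : Fin n
  t : Fin n

/-- Incremental or decremental st-shortest path in simple undirected weighted graphs. -/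
def stSP (m : Mode) : DynamicProblem where
  Inst := STInst
  size I := I.n
  input I := inputStore I.n I.s I.t I.W
  Valid c I := (∀ i, I.W i i = 0) ∧ (∀ i j, I.W i j = I.W j i) ∧ ∀ i j, I.W i j ≤ I.n ^ c
  Legal c I e := e.u ≠ e.v ∧ ∃ (hu : e.u < I.n) (hv : e.v < I.n),
    m.Allows (I.n ^ c) (I.W ⟨e.u, hu⟩ ⟨e.v, hv⟩) e.x
  apply I e := { I with
    W := fun i j =>
      if (i.val = e.u ∧ j.val = e.v) ∨ (i.val = e.v ∧ j.val = e.u) then e.x else I.W i j }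
  Answer I x := EncodesDistance (distance I.W I.s I.t) x

/-! ### Bipartite maximum weight matching -/

/-- A bipartite weighted graph with parts of size `a` and `b`; `W i j` is the weight of the edge
between the vertex `i` of the first part and the vertex `j` of the second part. -/
structure BipInst where
  a : ℕ
  b : ℕ
  W : Fin a → Fin b → ℕ

/-- `M` is a set of pairwise disjoint edges of the graph. -/
def IsMatching {a b : ℕ} (W : Fin a → Fin b → ℕ) (M : Finset (Fin a × Fin b)) : Prop :=
  (∀ e ∈ M, W e.1 e.2 ≠ 0) ∧ ∀ e ∈ M, ∀ f ∈ M, e.1 = f.1 ∨ e.2 = f.2 → e = f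

/-- Incremental or decremental maximum weight matching in bipartite graphs. -/
def bwMatch (m : Mode) : DynamicProblem where
  Inst := BipInst
  size I := I.a + I.b
  input I := inputStore I.a I.b 0 I.W
  Valid c I := 0 < I.a + I.b ∧ ∀ i j, I.W i j ≤ (I.a + I.b) ^ c
  Legal c I e := ∃ (hu : e.u < I.a) (hv : e.v < I.b),
    m.Allows ((I.a + I.b) ^ c) (I.W ⟨e.u, hu⟩ ⟨e.v, hv⟩) e.x
  apply I e := { I with W := fun i j => if i.val = e.u ∧ j.val = e.v then e.x else I.W i j }
  Answer I x := IsGreatest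
    {y | ∃ M : Finset (Fin I.a × Fin I.b), IsMatching I.W M ∧ y = ∑ e ∈ M, I.W e.1 e.2} x

end WordRAM

end

/-! The proof is a reduction in two layers, followed by its implementation on the word RAM.

A single run of the dynamic algorithm answers `N` triangle questions. For three parts of size `N`
with weights `x`, `y`, `z` in `[δ, 2 * δ]`, the `Gadget` is the layered graph on `i`, `k`, `j` and a
second copy of `i`, with a source joined to the first layer and a sink joined to the last. The
weights of the edges at source and sink are multiples of `2 * δ`, and the updates go through the
vertices in such an order that, when `i` is queried, its two terminal edges are the cheapest present
ones by a margin of `2 * δ` (`Active`). Entering or leaving elsewhere then cannot help, and the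
distance is below `2 * weight i + 4 * δ` exactly if some triangle at `i` weighs less than `4 * δ`
(`Light`). One direction is an explicit walk. The other is the dual solution `potential`, which is
feasible for both orientations of every edge (`potential_feasible`). The same potential serves for
matchings: split every vertex into a left and a right copy, replace a length by a large number minus
that length, and add heavy edges between the copies of inner vertices. A path together with these
heavy edges is a matching, and the potential becomes a vertex cover (`exists_matching`,
`matching_le`). With two updates and one query for each vertex, a run costs `O(N ^ (3 - ε))`
including the preprocessing (`exists_dynAlg`, `exists_dynTime_le`).

Shortest paths reduce to such runs. Let `N` be a power of two with `n ≤ m = N ^ 4`. Distances come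
from repeated squaring in the `min`-plus sense (`distMatrix_encodes`), and a square is found by a
binary search that is carried out for all entries at the same time (`ARuns.bits`). Each round of the
search compares a matrix `F` of thresholds with the square of `D` (`ARuns.compare`): for each of the
`N ^ 9` triples of blocks of side `N`, the gadget with `x = δ + D`, `y = δ + D`, `z = 2 * δ - F` has
a light triangle exactly where `D i k + D k j < F i j`. A row that is reported is scanned in time
`O(N ^ 2)`, and each such scan sets an entry of `F` to zero, so there are at most `m ^ 2` of them
(`ARuns.scan`). The runs dominate with `N ^ 9 * N ^ (3 - ε) = m ^ (3 - ε / 4)` for `ε ≤ 1`. Half of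
the gain is spent on the logarithmic factors (`exists_rpow_bound`), which leaves the exponent `3 -
min ε 1 / 8`.

The dynamic algorithm is an arbitrary randomized program with its own word length. It is run inside
the larger machine, on a stretch of fresh memory, with a slowdown by the factor `12`
(`costWithin_reloc_le`). Time and correctness are proved together in a logic with credits: `Runs`
bounds the expected number of steps plus the credits left at the end, where a violated postcondition
counts as infinite. The expected remaining time of the dynamic run is itself such a credit, handed
on from request to request, so the amortized bound for the whole sequence can be used as it stands
(`ARuns.call`).

The memory consists of five slabs of `m * m` cells (input and output, `D`, the partial square, `F`,
the answers), followed by one stretch of `stride` cells for each call. -/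

namespace WordRAM

/-! ## Expectations -/

/-- The expectation of `f` under `p`. -/
noncomputable def expect {α : Type} (p : PMF α) (f : α → ℝ≥0∞) : ℝ≥0∞ := ∑' a, p a * f a

section expect

variable {α β : Type}

theorem expect_pure (a : α) (f : α → ℝ≥0∞) : expect (PMF.pure a) f = f a := by
  classical
  unfold expect
  rw [tsum_eq_single a]
  · simp
  · intro b hb
    simp [PMF.pure_apply, hb]

theorem expect_bind (p : PMF α) (q : α → PMF β) (f : β → ℝ≥0∞) :
    expect (p.bind q) f = expect p fun a => expect (q a) f := by
  unfold expect
  simp_rw [PMF.bind_apply, ← ENNReal.tsum_mul_right, ← ENNReal.tsum_mul_left]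
  rw [ENNReal.tsum_comm]
  simp_rw [mul_assoc]

theorem expect_map (p : PMF α) (g : α → β) (f : β → ℝ≥0∞) :
    expect (p.map g) f = expect p (f ∘ g) := by
  rw [← PMF.bind_pure_comp, expect_bind]
  simp only [Function.comp_apply, expect_pure]
  rfl

theorem expect_mono {p : PMF α} {f g : α → ℝ≥0∞} (h : ∀ a ∈ p.support, f a ≤ g a) :
    expect p f ≤ expect p g := by
  refine ENNReal.tsum_le_tsum fun a => ?_
  by_cases ha : p a = 0
  · simp [ha]
  · exact mul_le_mul_right (h a ((PMF.mem_support_iff _ _).2 ha)) _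

theorem expect_const (p : PMF α) (x : ℝ≥0∞) : expect p (fun _ => x) = x := by
  unfold expect
  rw [ENNReal.tsum_mul_right, p.tsum_coe, one_mul]

theorem expect_add (p : PMF α) (f g : α → ℝ≥0∞) :
    expect p (fun a => f a + g a) = expect p f + expect p g := by
  unfold expect
  simp_rw [mul_add]
  exact ENNReal.tsum_add

theorem expect_mul_left (p : PMF α) (x : ℝ≥0∞) (f : α → ℝ≥0∞) :
    expect p (fun a => x * f a) = x * expect p f := by
  unfold expect
  rw [← ENNReal.tsum_mul_left]
  congr 1
  ext a
  ring

theorem expect_sum {ι : Type} (s : Finset ι) (p : PMF α) (f : ι → α → ℝ≥0∞) :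
    expect p (fun a => ∑ i ∈ s, f i a) = ∑ i ∈ s, expect p (f i) := by
  classical
  induction s using Finset.induction_on with
  | empty => simp [expect]
  | insert i s hi ih => simp only [Finset.sum_insert hi, expect_add, ih]

/-- Monotone convergence, proved on finite partial sums, where sum and monotone supremum commute.
Only this direction is needed to unfold `cost` by one step. -/
theorem expect_iSup_le {p : PMF α} {f : ℕ → α → ℝ≥0∞} (hf : Monotone f) :
    expect p (fun a => ⨆ n, f n a) ≤ ⨆ n, expect p (f n) := by
  unfold expect
  rw [ENNReal.tsum_eq_iSup_sum]
  refine iSup_le fun s => ?_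
  simp_rw [ENNReal.mul_iSup]
  rw [ENNReal.finsetSum_iSup_of_monotone]
  · exact iSup_mono fun n => ENNReal.sum_le_tsum s
  · intro a n m hnm
    exact mul_le_mul_right (hf hnm a) _

theorem toOuterMeasure_eq_expect (p : PMF α) (S : Set α) :
    p.toOuterMeasure S = expect p (S.indicator 1) := by
  rw [PMF.toOuterMeasure_apply]
  refine tsum_congr fun a => ?_
  by_cases h : a ∈ S <;> simp [h]

theorem expect_eq_top_of_mem {p : PMF α} {f : α → ℝ≥0∞} {a : α} (ha : a ∈ p.support)
    (h : f a = ⊤) : expect p f = ⊤ := by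
  rw [eq_top_iff]
  refine le_trans ?_ (ENNReal.le_tsum a)
  rw [h, ENNReal.mul_top ((PMF.mem_support_iff _ _).1 ha)]

/-! ## Markov chains -/

theorem iter_succ_left (next : α → PMF α) (x : α) (t : ℕ) :
    iter next x (t + 1) = (next x).bind fun y => iter next y t := by
  induction t with
  | zero => simp [iter]
  | succ t ih =>
    rw [iter, ih, PMF.bind_bind]
    rfl

/-- First-step analysis: time `0` contributes the indicator, and all later visits are averaged over
the first move. -/
theorem expectedVisits_eq (next : α → PMF α) (x : α) (S : Set α) :
    expectedVisits next x S = S.indicator 1 x + expect (next x) fun y => expectedVisits next y S := by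
  unfold expectedVisits
  rw [tsum_eq_zero_add' ENNReal.summable]
  congr 1
  · rw [iter, toOuterMeasure_eq_expect, expect_pure]
  · simp_rw [iter_succ_left, toOuterMeasure_eq_expect, expect_bind]
    unfold expect
    rw [ENNReal.tsum_comm]
    simp_rw [ENNReal.tsum_mul_left]

theorem mem_support_iter_succ {next : α → PMF α} {x y z : α} {t : ℕ}
    (hy : y ∈ (iter next x t).support) (hz : z ∈ (next y).support) :
    z ∈ (iter next x (t + 1)).support := by
  rw [iter, PMF.mem_support_bind_iff]
  exact ⟨y, hy, hz⟩

/-- A function that dominates the running cost of a chain dominates its expected visits. -/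
theorem expectedVisits_le_of_supersolution (next : α → PMF α) (S : Set α) (G : α → ℝ≥0∞)
    (hG : ∀ x, S.indicator 1 x + expect (next x) G ≤ G x) (x : α) :
    expectedVisits next x S ≤ G x := by
  -- For truncated sums, splitting off the first step turns `hG` into exactly the induction step.
  have key : ∀ n x, ∑ t ∈ Finset.range n, (iter next x t).toOuterMeasure S ≤ G x := by
    intro n
    induction n with
    | zero => simp
    | succ n ih =>
      intro x
      refine le_trans ?_ (hG x)
      rw [Finset.sum_range_succ', add_comm]
      refine add_le_add ?_ ?_
      · rw [iter, toOuterMeasure_eq_expect, expect_pure]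
      · simp_rw [iter_succ_left, toOuterMeasure_eq_expect, expect_bind]
        rw [← expect_sum]
        refine expect_mono fun y _ => ?_
        simpa only [toOuterMeasure_eq_expect] using ih y
  unfold expectedVisits
  rw [ENNReal.tsum_eq_iSup_nat]
  exact iSup_le fun n => key n x

end expect

/-! ## Expected cost of programs -/

/-- Expected number of steps, cut off after `n` steps, plus the expected value of `f` at the end. -/
noncomputable def costWithin (w : ℕ) (f : Store → ℝ≥0∞) : ℕ → Config → ℝ≥0∞
  | 0, _ => 0
  | n + 1, c => if c.code = [] then f c.store else 1 + expect (step w c) (costWithin w f n)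

/-- Expected number of steps until the machine halts plus the expected value of `f` at the end. -/
noncomputable def cost (w : ℕ) (f : Store → ℝ≥0∞) (c : Config) : ℝ≥0∞ := ⨆ n, costWithin w f n c

variable {w : ℕ}

theorem costWithin_mono (f : Store → ℝ≥0∞) : Monotone (costWithin w f) := by
  refine monotone_nat_of_le_succ fun n => ?_
  induction n with
  | zero => intro c; exact zero_le
  | succ n ih =>
    intro c
    rw [costWithin, costWithin]
    split_ifs
    · exact le_rfl
    · exact add_le_add le_rfl (expect_mono fun a _ => ih a)

theorem costWithin_le_cost (f : Store → ℝ≥0∞) (n : ℕ) (c : Config) :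
    costWithin w f n c ≤ cost w f c := le_iSup (fun n => costWithin w f n c) n

theorem cost_halted (f : Store → ℝ≥0∞) (σ : Store) : cost w f ⟨[], σ⟩ = f σ := by
  refine le_antisymm (iSup_le fun n => ?_) ?_
  · cases n <;> simp [costWithin]
  · simpa [costWithin] using costWithin_le_cost (w := w) f 1 ⟨[], σ⟩

/-- One inequality drops a unit of fuel, the other is monotone convergence. Since every step counts
even if the machine never halts, a positive probability of not halting makes `cost` infinite. -/
theorem cost_eq (f : Store → ℝ≥0∞) (c : Config) (hc : c.code ≠ []) :
    cost w f c = 1 + expect (step w c) (cost w f) := by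
  refine le_antisymm (iSup_le fun n => ?_) ?_
  · cases n with
    | zero => exact zero_le
    | succ n =>
      rw [costWithin, if_neg hc]
      exact add_le_add le_rfl (expect_mono fun a _ => costWithin_le_cost f n a)
  · have h1 : expect (step w c) (cost w f) ≤ ⨆ n, expect (step w c) (costWithin w f n) :=
      expect_iSup_le (costWithin_mono f)
    refine (add_le_add le_rfl h1).trans ?_
    rw [ENNReal.add_iSup]
    refine iSup_le fun n => ?_
    have := costWithin_le_cost (w := w) f (n + 1) c
    rwa [costWithin, if_neg hc] at this

/-- Appending code does not change the steps before it. -/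
theorem step_append (l k : List Prog) (hl : l ≠ []) (σ : Store) :
    step w ⟨l ++ k, σ⟩ = (step w ⟨l, σ⟩).map fun c => ⟨c.code ++ k, c.store⟩ := by
  cases l with
  | nil => exact absurd rfl hl
  | cons P l =>
    cases P with
    | skip => simp [step, PMF.pure_map]
    | const r x => simp only [step, List.cons_append, PMF.pure_map, assign]; split_ifs <;> simp
    | op o r a b => simp only [step, List.cons_append, PMF.pure_map, assign]; split_ifs <;> simp
    | load r a => simp only [step, List.cons_append, PMF.pure_map, assign]; split_ifs <;> simp
    | store a b => simp [step, PMF.pure_map]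
    | rand r a =>
      simp only [step, List.cons_append]
      rcases σ.reg a with _ | m
      · simp [PMF.pure_map]
      · simp only [PMF.map_comp]
        congr 1
        ext i
        simp only [assign, Function.comp_apply]
        split_ifs <;> simp
    | seq P Q => simp [step, PMF.pure_map]
    | cond a P Q => simp [step, PMF.pure_map]
    | loop a P => simp only [step, List.cons_append, PMF.pure_map]; split_ifs <;> simp

/-- Until `l` is finished the code behind it has no influence (`step_append`), so the cost of `k`
can be charged as the final value of `l`. The upper bound suffices for running times, and it follows
by induction on the fuel. -/
theorem cost_append_le (f : Store → ℝ≥0∞) (l k : List Prog) (σ : Store) :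
    cost w f ⟨l ++ k, σ⟩ ≤ cost w (fun σ' => cost w f ⟨k, σ'⟩) ⟨l, σ⟩ := by
  refine iSup_le fun n => ?_
  induction n generalizing l σ with
  | zero => exact zero_le
  | succ n ih =>
    by_cases hl : l = []
    · subst hl
      rw [cost_halted]
      exact costWithin_le_cost f _ _
    · rw [costWithin, if_neg (by simp [hl]), cost_eq _ _ hl, step_append l k hl, expect_map]
      exact add_le_add le_rfl (expect_mono fun c _ => ih c.code c.store)

theorem cost_mono {f g : Store → ℝ≥0∞} (h : ∀ σ, f σ ≤ g σ) (c : Config) :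
    cost w f c ≤ cost w g c := by
  refine iSup_mono fun n => ?_
  induction n generalizing c with
  | zero => exact le_rfl
  | succ n ih =>
    rw [costWithin, costWithin]
    split_ifs
    · exact h _
    · exact add_le_add le_rfl (expect_mono fun a _ => ih a)

/-- By `cost_eq`, `cost` is a supersolution for the visits to configurations that have not halted,
whatever final value `f` is charged. -/
theorem expectedTime_le_cost (f : Store → ℝ≥0∞) (P : Prog) (σ : Store) :
    expectedTime w P σ ≤ cost w f ⟨[P], σ⟩ := by
  refine expectedVisits_le_of_supersolution (step w) _ (cost w f) (fun c => ?_) _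
  by_cases hc : c.code = []
  · obtain ⟨l, σ⟩ := c
    obtain rfl : l = [] := hc
    simp [step, expect_pure]
  · rw [cost_eq _ _ hc]
    simp [hc]

/-- An infinite value propagates backwards along any trajectory of positive probability. -/
theorem cost_eq_top_of_reachable (f : Store → ℝ≥0∞) {σ' : Store} (hf : f σ' = ⊤) (t : ℕ)
    (c : Config) (h : (⟨[], σ'⟩ : Config) ∈ (iter (step w) c t).support) : cost w f c = ⊤ := by
  induction t generalizing c with
  | zero =>
    rw [iter, PMF.mem_support_pure_iff] at h
    rw [← h, cost_halted, hf]
  | succ t ih =>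
    rw [iter_succ_left, PMF.mem_support_bind_iff] at h
    obtain ⟨d, hd, h⟩ := h
    by_cases hc : c.code = []
    · obtain ⟨l, σ⟩ := c
      obtain rfl : l = [] := hc
      rw [step, PMF.mem_support_pure_iff] at hd
      rw [← hd]
      exact ih d h
    · rw [cost_eq _ _ hc, expect_eq_top_of_mem hd (ih d h), add_top]

/-! ## A program logic with time credits -/

/-- The least amount of credits that `R` accepts at the end. -/
noncomputable def leftover (R : Store → ℝ≥0∞ → Prop) (σ : Store) : ℝ≥0∞ := ⨅ (x) (_ : R σ x), x

/-- Started from `σ` with `T` credits, `P` halts almost surely in a store `σ'` with `R σ' x`, where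
`x` credits are left; each step costs one credit, in expectation. -/
def Runs (w : ℕ) (P : Prog) (σ : Store) (T : ℝ≥0∞) (R : Store → ℝ≥0∞ → Prop) : Prop :=
  cost w (leftover R) ⟨[P], σ⟩ ≤ T

theorem leftover_le {R : Store → ℝ≥0∞ → Prop} {σ : Store} {x : ℝ≥0∞} (h : R σ x) :
    leftover R σ ≤ x := iInf₂_le x h

theorem cost_le_of_step {f : Store → ℝ≥0∞} {c d : Config} {T : ℝ≥0∞} (hc : c.code ≠ [])
    (h : step w c = PMF.pure d) (hd : cost w f d ≤ T) : cost w f c ≤ T + 1 := by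
  rw [cost_eq _ _ hc, h, expect_pure, add_comm]
  exact add_le_add hd le_rfl

namespace Runs

variable {P Q : Prog} {σ : Store} {T T' : ℝ≥0∞} {R R' : Store → ℝ≥0∞ → Prop}

/-- Code that remains on the stack becomes part of the postcondition. This is what makes the rules
for `seq` and `loop` compositional. -/
theorem of_cost_code {l : List Prog} (h : Runs w P σ T fun σ' x => cost w (leftover R) ⟨l, σ'⟩ ≤ x) :
    cost w (leftover R) ⟨P :: l, σ⟩ ≤ T := by
  refine (cost_append_le (leftover R) [P] l σ).trans (le_trans (cost_mono (fun σ' => ?_) _) h)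
  exact le_iInf₂ fun x hx => hx

theorem mono (h : Runs w P σ T R) (hT : T ≤ T') : Runs w P σ T' R := le_trans h hT

theorem conseq (h : Runs w P σ T R) (hR : ∀ σ' x, R σ' x → ∃ y ≤ x, R' σ' y) :
    Runs w P σ T R' := by
  refine le_trans (cost_mono (fun σ' => le_iInf₂ fun x hx => ?_) _) h
  obtain ⟨y, hy, hy'⟩ := hR σ' x hx
  exact (leftover_le hy').trans hy

theorem imp (h : Runs w P σ T R) (hR : ∀ σ' x, R σ' x → R' σ' x) : Runs w P σ T R' :=
  h.conseq fun σ' x hx => ⟨x, le_rfl, hR σ' x hx⟩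

theorem skip (h : R σ T) : Runs w .skip σ (T + 1) R :=
  cost_le_of_step (by simp) rfl (by rw [cost_halted]; exact leftover_le h)

theorem const {r k : ℕ} (hk : k < 2 ^ w) (h : R (σ.setReg r k) T) :
    Runs w (.const r k) σ (T + 1) R :=
  cost_le_of_step (d := ⟨[], σ.setReg r k⟩) (by simp) (by simp [step, assign, hk])
    (by rw [cost_halted]; exact leftover_le h)

theorem op {o : BinOp} {r a b : ℕ} (hk : o.eval (σ.reg a) (σ.reg b) < 2 ^ w)
    (h : R (σ.setReg r (o.eval (σ.reg a) (σ.reg b))) T) : Runs w (.op o r a b) σ (T + 1) R :=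
  cost_le_of_step (d := ⟨[], σ.setReg r _⟩) (by simp) (by simp only [step, assign, hk]; rfl)
    (by rw [cost_halted]; exact leftover_le h)

theorem load {r a : ℕ} (hk : σ.mem (σ.reg a) < 2 ^ w)
    (h : R (σ.setReg r (σ.mem (σ.reg a))) T) : Runs w (.load r a) σ (T + 1) R :=
  cost_le_of_step (d := ⟨[], σ.setReg r _⟩) (by simp) (by simp only [step, assign, hk]; rfl)
    (by rw [cost_halted]; exact leftover_le h)

theorem store {a b : ℕ} (h : R (σ.setMem (σ.reg a) (σ.reg b)) T) :
    Runs w (.store a b) σ (T + 1) R :=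
  cost_le_of_step (d := ⟨[], σ.setMem _ _⟩) (by simp) rfl
    (by rw [cost_halted]; exact leftover_le h)

theorem seq (h : Runs w P σ T fun σ' x => Runs w Q σ' x R) : Runs w (.seq P Q) σ (T + 1) R :=
  cost_le_of_step (by simp) rfl (of_cost_code h)

theorem cond_true {a : ℕ} (ha : σ.reg a ≠ 0) (h : Runs w P σ T R) :
    Runs w (.cond a P Q) σ (T + 1) R :=
  cost_le_of_step (d := ⟨[P], σ⟩) (by simp) (by simp [step, ha]) h

theorem cond_false {a : ℕ} (ha : σ.reg a = 0) (h : Runs w Q σ T R) :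
    Runs w (.cond a P Q) σ (T + 1) R :=
  cost_le_of_step (d := ⟨[Q], σ⟩) (by simp) (by simp [step, ha]) h

theorem loop_true {a : ℕ} (ha : σ.reg a ≠ 0)
    (h : Runs w P σ T fun σ' x => Runs w (.loop a P) σ' x R) : Runs w (.loop a P) σ (T + 1) R :=
  cost_le_of_step (d := ⟨P :: [.loop a P], σ⟩) (by simp) (by simp [step, ha]) (of_cost_code h)

theorem loop_false {a : ℕ} (ha : σ.reg a = 0) (h : R σ T) : Runs w (.loop a P) σ (T + 1) R :=
  cost_le_of_step (d := ⟨[], σ⟩) (by simp) (by simp [step, ha])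
    (by rw [cost_halted]; exact leftover_le h)

theorem expectedTime_le (h : Runs w P σ T R) : expectedTime w P σ ≤ T :=
  (expectedTime_le_cost _ P σ).trans h

/-- If `R` fails at a store for all amounts of credit, `leftover` is an infimum over the empty set,
hence `⊤`, and reaching that store with positive probability makes the cost infinite. So a finite
budget yields both the time bound and zero-error correctness. -/
theorem of_possibleResult (h : Runs w P σ T R) (hT : T ≠ ⊤) {σ' : Store}
    (hσ' : PossibleResult w P σ σ') : ∃ x, R σ' x := by
  by_contra hcon
  push Not at hcon
  obtain ⟨t, ht⟩ := hσ'
  refine hT (top_le_iff.1 (le_trans (top_le_iff.2 ?_) h))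
  refine cost_eq_top_of_reachable _ ?_ t _ ht
  simp [leftover, hcon]

end Runs

theorem costWithin_add_le (w : ℕ) (f : Store → ℝ≥0∞) (a : ℝ≥0∞) (n : ℕ) (c : Config) :
    costWithin w (fun σ => f σ + a) n c ≤ costWithin w f n c + a := by
  induction n generalizing c with
  | zero => exact zero_le
  | succ n ih =>
    rw [costWithin, costWithin]
    split_ifs
    · exact le_rfl
    · rw [add_assoc, ← expect_const (step w c) a, ← expect_add]
      refine add_le_add le_rfl (expect_mono fun d _ => ?_)
      rw [expect_const]
      exact ih d

/-- Credits that are not needed are kept. -/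
theorem Runs.frame {w : ℕ} {P : Prog} {σ : Store} {T : ℝ≥0∞} {R : Store → ℝ≥0∞ → Prop}
    (h : Runs w P σ T R) (a : ℝ≥0∞) :
    Runs w P σ (T + a) fun σ' x => ∃ y, x = y + a ∧ R σ' y := by
  have h1 : cost w (fun σ' => leftover R σ' + a) ⟨[P], σ⟩ ≤ cost w (leftover R) ⟨[P], σ⟩ + a :=
    iSup_le fun n => (costWithin_add_le w _ a n _).trans
      (add_le_add (costWithin_le_cost _ _ _) le_rfl)
  refine le_trans (cost_mono (fun σ' => ?_) _) (h1.trans (add_le_add h le_rfl))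
  unfold leftover
  rw [ENNReal.iInf_add]
  refine le_iInf fun x => ?_
  by_cases hx : R σ' x
  · rw [iInf_pos hx]
    exact iInf₂_le (x + a) ⟨x, rfl, hx⟩
  · simp [hx]

/-! ## Expressions -/

/-- The operations needed by the main program. A result is always below the product of bounds for
the operands that are at least `2`; left shifts would destroy this. -/
inductive ArithOp
  | add | sub | mul | div | mod | lt | eq

def ArithOp.toBinOp : ArithOp → BinOp
  | add => .add
  | sub => .sub
  | mul => .mul
  | div => .div
  | mod => .mod
  | lt => .lt
  | eq => .eq

/-- Values of variables, of memory cells, and of the registers that are left to other programs. -/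
structure Env where
  reg : ℕ → ℕ
  mem : ℕ → ℕ
  low : ℕ → ℕ

namespace Env

def setReg (s : Env) (v x : ℕ) : Env := { s with reg := Function.update s.reg v x }

def setMem (s : Env) (a x : ℕ) : Env := { s with mem := Function.update s.mem a x }

def setLow (s : Env) (r x : ℕ) : Env := { s with low := Function.update s.low r x }

@[simp] theorem setReg_reg_self (s : Env) (r x : ℕ) : (s.setReg r x).reg r = x :=
  Function.update_self ..

@[simp] theorem setReg_mem (s : Env) (r x : ℕ) : (s.setReg r x).mem = s.mem := rfl

@[simp] theorem setReg_low (s : Env) (r x : ℕ) : (s.setReg r x).low = s.low := rfl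

theorem setReg_reg (s : Env) (r x r' : ℕ) :
    (s.setReg r x).reg r' = if r' = r then x else s.reg r' := by
  simp [setReg, Function.update_apply]

/-- All values are below `X`. -/
def Below (X : ℕ) (s : Env) : Prop := (∀ v, s.reg v < X) ∧ (∀ a, s.mem a < X) ∧ ∀ r, s.low r < X

end Env

/-- Arithmetic expressions in variables, memory cells, and the register `0`. -/
inductive Expr
  | reg0
  | const (k : ℕ)
  | var (v : ℕ)
  | op (o : ArithOp) (a b : Expr)
  | load (a : Expr)

namespace Expr

instance : Add Expr := ⟨op .add⟩
instance : Sub Expr := ⟨op .sub⟩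
instance : Mul Expr := ⟨op .mul⟩
instance : Div Expr := ⟨op .div⟩
instance : Mod Expr := ⟨op .mod⟩
instance (n : ℕ) : OfNat Expr n := ⟨const n⟩

def lt (a b : Expr) : Expr := op .lt a b
def eq (a b : Expr) : Expr := op .eq a b

def eval (s : Env) : Expr → ℕ
  | reg0 => s.low 0
  | const k => k
  | var v => s.reg v
  | op o a b => o.toBinOp.eval (a.eval s) (b.eval s)
  | load a => s.mem (a.eval s)

/-- An exponent: if all contents are below `X`, the value is below `X ^ size`. A constant `k` gets
`k + 1` because `k < 2 ^ (k + 1)`. -/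
def size : Expr → ℕ
  | reg0 => 1
  | const k => k + 1
  | var _ => 1
  | op _ a b => a.size + b.size
  | load a => a.size + 1

/-- The exact number of steps of the compiled code `Machine.comp`. The `3` for an operation stands
for two `seq` steps and the operation, the `2` for a load for one `seq` step and the load. -/
def time : Expr → ℕ
  | reg0 => 1
  | const _ => 1
  | var _ => 1
  | op _ a b => a.time + b.time + 3
  | load a => a.time + 2

section simp_lemmas

variable (s : Env) (a b : Expr) (n : ℕ)

@[simp] theorem eval_const : (const n).eval s = n := rfl
@[simp] theorem eval_ofNat : (ofNat(n) : Expr).eval s = n := rfl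
@[simp] theorem eval_var : (var n).eval s = s.reg n := rfl
@[simp] theorem eval_reg0 : reg0.eval s = s.low 0 := rfl
@[simp] theorem eval_load : (load a).eval s = s.mem (a.eval s) := rfl
@[simp] theorem eval_add : (a + b).eval s = a.eval s + b.eval s := rfl
@[simp] theorem eval_sub : (a - b).eval s = a.eval s - b.eval s := rfl
@[simp] theorem eval_mul : (a * b).eval s = a.eval s * b.eval s := rfl
@[simp] theorem eval_div : (a / b).eval s = a.eval s / b.eval s := rfl
@[simp] theorem eval_mod : (a % b).eval s = a.eval s % b.eval s := rfl
@[simp] theorem eval_lt : (lt a b).eval s = if a.eval s < b.eval s then 1 else 0 := rfl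
@[simp] theorem eval_eq : (eq a b).eval s = if a.eval s = b.eval s then 1 else 0 := rfl
@[simp] theorem size_const : (const n).size = n + 1 := rfl
@[simp] theorem size_ofNat : (ofNat(n) : Expr).size = n + 1 := rfl
@[simp] theorem size_var : (var n).size = 1 := rfl
@[simp] theorem size_reg0 : reg0.size = 1 := rfl
@[simp] theorem size_load : (load a).size = a.size + 1 := rfl
@[simp] theorem size_add : (a + b).size = a.size + b.size := rfl
@[simp] theorem size_sub : (a - b).size = a.size + b.size := rfl
@[simp] theorem size_mul : (a * b).size = a.size + b.size := rfl
@[simp] theorem size_div : (a / b).size = a.size + b.size := rfl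
@[simp] theorem size_mod : (a % b).size = a.size + b.size := rfl
@[simp] theorem size_lt : (lt a b).size = a.size + b.size := rfl
@[simp] theorem size_eq : (eq a b).size = a.size + b.size := rfl

end simp_lemmas

theorem size_pos (e : Expr) : 0 < e.size := by
  induction e with
  | op o a b iha ihb => rw [size]; omega
  | _ => simp [size]

end Expr

/-- For bounds `A, B ≥ 2`, the sum of a number below `A` and one below `B` stays below `A * B`, as
does their product. The other operations do not exceed their first operand or are at most `1`. -/
theorem Expr.eval_lt_pow {X : ℕ} (hX : 2 ≤ X) {s : Env} (hs : s.Below X) (e : Expr) :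
    e.eval s < X ^ e.size := by
  induction e with
  | reg0 => simpa using hs.2.2 0
  | const k =>
    exact (Nat.lt_two_pow_self.trans (Nat.pow_lt_pow_right one_lt_two k.lt_succ_self)).trans_le
      (Nat.pow_le_pow_left hX _)
  | var v => simpa using hs.1 v
  | load a _ => exact (hs.2.1 _).trans_le (Nat.le_self_pow (by rw [Expr.size]; omega) X)
  | op o a b iha ihb =>
    have ha : 2 ≤ X ^ a.size := hX.trans (Nat.le_self_pow a.size_pos.ne' X)
    have hb : 2 ≤ X ^ b.size := hX.trans (Nat.le_self_pow b.size_pos.ne' X)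
    rw [size, pow_add, eval]
    generalize X ^ a.size = A at *
    generalize X ^ b.size = B at *
    generalize a.eval s = x at *
    generalize b.eval s = y at *
    have h1 : A ≤ A * B := Nat.le_mul_of_pos_right _ (by omega)
    cases o <;> simp only [ArithOp.toBinOp, BinOp.eval]
    · nlinarith
    · omega
    · exact Nat.mul_lt_mul'' iha ihb
    · exact ((Nat.div_le_self x y).trans_lt iha).trans_le h1
    · exact ((Nat.mod_le x y).trans_lt iha).trans_le h1
    · split_ifs <;> omega
    · split_ifs <;> omega

/-! ## Compilation of expressions and statements -/

/-- The word length `w`; the number `R₀` of registers that are left to other programs; a bound `X`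
for the contents of variables and memory cells; a bound `S` for the size of expressions. -/
structure Machine where
  w : ℕ
  R₀ : ℕ
  X : ℕ
  S : ℕ
  two_le : 2 ≤ X
  three_le : 3 ≤ R₀
  pow_le : X ^ S ≤ 2 ^ w

namespace Machine

/-- The register of a variable. -/
def V (R₀ v : ℕ) : ℕ := R₀ + 2 * v

/-- The register of a temporary value. -/
def Tmp (R₀ d : ℕ) : ℕ := R₀ + 2 * d + 1

/-- `comp R₀ e d` computes the value of `e` in the temporary register `d`. -/
def comp (R₀ : ℕ) : Expr → ℕ → Prog
  | .reg0, d => .op .bor (Tmp R₀ d) 0 0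
  | .const k, d => .const (Tmp R₀ d) k
  | .var v, d => .op .bor (Tmp R₀ d) (V R₀ v) (V R₀ v)
  | .op o a b, d => .seq (comp R₀ a d) (.seq (comp R₀ b (d + 1))
      (.op o.toBinOp (Tmp R₀ d) (Tmp R₀ d) (Tmp R₀ (d + 1))))
  | .load a, d => .seq (comp R₀ a d) (.load (Tmp R₀ d) (Tmp R₀ d))

/-- `v := e` -/
def assign (R₀ v : ℕ) (e : Expr) : Prog :=
  .seq (comp R₀ e 0) (.op .bor (V R₀ v) (Tmp R₀ 0) (Tmp R₀ 0))

/-- Set the register `r` to `e`. -/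
def setLow (R₀ r : ℕ) (e : Expr) : Prog :=
  .seq (comp R₀ e 0) (.op .bor r (Tmp R₀ 0) (Tmp R₀ 0))

/-- `M[a] := e` -/
def write (R₀ : ℕ) (a e : Expr) : Prog :=
  .seq (comp R₀ a 0) (.seq (comp R₀ e 1) (.store (Tmp R₀ 0) (Tmp R₀ 1)))

/-- if `e ≠ 0` then `P` else `Q` -/
def ite (R₀ : ℕ) (e : Expr) (P Q : Prog) : Prog :=
  .seq (comp R₀ e 0) (.cond (Tmp R₀ 0) P Q)

/-- for `v := 0` to `e - 1` do `P` -/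
def forLoop (R₀ v : ℕ) (e : Expr) (P : Prog) : Prog :=
  .seq (assign R₀ v (.const 0)) (.seq (comp R₀ (.lt (.var v) e) 0) (.loop (Tmp R₀ 0)
    (.seq P (.seq (assign R₀ v (.var v + .const 1)) (comp R₀ (.lt (.var v) e) 0)))))

/-- The store `σ` represents the values of the variables and memory cells given by `s`. -/
structure Sim (Γ : Machine) (s : Env) (σ : Store) : Prop where
  reg : ∀ v, σ.reg (V Γ.R₀ v) = s.reg v
  mem : σ.mem = s.mem
  low : ∀ r < Γ.R₀, σ.reg r = s.low r
  below : s.Below Γ.X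

/-- `P` runs correctly from all stores that represent `s`. -/
def ARuns (Γ : Machine) (P : Prog) (s : Env) (T : ℝ≥0∞) (R : Env → ℝ≥0∞ → Prop) : Prop :=
  ∀ σ, Γ.Sim s σ → Runs Γ.w P σ T fun σ' x => ∃ s', Γ.Sim s' σ' ∧ R s' x

variable {Γ : Machine}

theorem lt_of_size {s : Env} (hs : s.Below Γ.X) {e : Expr} (he : e.size ≤ Γ.S) :
    e.eval s < 2 ^ Γ.w :=
  ((e.eval_lt_pow Γ.two_le hs).trans_le (Nat.pow_le_pow_right (by have := Γ.two_le; omega) he)).trans_le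
    Γ.pow_le

/-- `σ'` differs from `σ` at most in the temporary registers from number `d` on. -/
def SameUpTo (Γ : Machine) (d : ℕ) (σ σ' : Store) : Prop :=
  σ'.mem = σ.mem ∧ ∀ r, (∀ d' ≥ d, r ≠ Tmp Γ.R₀ d') → σ'.reg r = σ.reg r

theorem SameUpTo.setReg {d d' : ℕ} (h : d ≤ d') {σ σ' : Store} (hσ : Γ.SameUpTo d σ σ') (x : ℕ) :
    Γ.SameUpTo d σ (σ'.setReg (Tmp Γ.R₀ d') x) := by
  refine ⟨hσ.1, fun r hr => ?_⟩
  rw [← hσ.2 r hr]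
  exact Function.update_of_ne (hr d' h) _ _

theorem SameUpTo.trans {d d' : ℕ} (h : d ≤ d') {σ σ' σ'' : Store} (h1 : Γ.SameUpTo d σ σ')
    (h2 : Γ.SameUpTo d' σ' σ'') : Γ.SameUpTo d σ σ'' :=
  ⟨h2.1.trans h1.1, fun r hr => (h2.2 r fun e he => hr e (h.trans he)).trans (h1.2 r hr)⟩

theorem SameUpTo.rfl {d : ℕ} {σ : Store} : Γ.SameUpTo d σ σ := ⟨Eq.refl _, fun _ _ => Eq.refl _⟩

theorem SameUpTo.tmp {d d' : ℕ} {σ σ' : Store} (h : Γ.SameUpTo d σ σ') (hd : d' < d) :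
    σ'.reg (Tmp Γ.R₀ d') = σ.reg (Tmp Γ.R₀ d') := by
  refine h.2 _ fun e he => ?_
  simp only [Tmp]
  omega

theorem SameUpTo.low {d r : ℕ} {σ σ' : Store} (h : Γ.SameUpTo d σ σ') (hr : r < Γ.R₀) :
    σ'.reg r = σ.reg r := by
  refine h.2 _ fun e he => ?_
  simp only [Tmp]
  omega

theorem SameUpTo.sim {d : ℕ} {s : Env} {σ σ' : Store} (h : Γ.SameUpTo d σ σ') (hs : Γ.Sim s σ) :
    Γ.Sim s σ' := by
  refine ⟨fun v => ?_, h.1.trans hs.mem, fun r hr => (h.low hr).trans (hs.low r hr), hs.below⟩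
  rw [h.2 _ fun d' _ => ?_, hs.reg]
  simp only [V, Tmp]
  omega

@[simp] theorem _root_.WordRAM.Store.setReg_reg_self (σ : Store) (r x : ℕ) :
    (σ.setReg r x).reg r = x := Function.update_self ..

@[simp] theorem _root_.WordRAM.Store.setReg_mem (σ : Store) (r x : ℕ) :
    (σ.setReg r x).mem = σ.mem := rfl

theorem _root_.WordRAM.Store.setReg_reg (σ : Store) (r x r' : ℕ) :
    (σ.setReg r x).reg r' = if r' = r then x else σ.reg r' := by
  simp [Store.setReg, Function.update_apply]

/-- The code for a subexpression at depth `d` writes only temporaries from `d` on, so the left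
operand survives while the right one is evaluated at depth `d + 1`. Every intermediate value fits
into a word since the size of a subexpression is at most that of the whole. -/
theorem runs_comp (e : Expr) (d : ℕ) {s : Env} {σ : Store} (hs : Γ.Sim s σ) (he : e.size ≤ Γ.S)
    {T : ℝ≥0∞} {R : Store → ℝ≥0∞ → Prop}
    (h : ∀ σ', Γ.SameUpTo d σ σ' → σ'.reg (Tmp Γ.R₀ d) = e.eval s → R σ' T) :
    Runs Γ.w (comp Γ.R₀ e d) σ (T + e.time) R := by
  induction e generalizing d σ T R with
  | reg0 =>
    rw [Expr.time, Nat.cast_one]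
    -- A bitwise or of a register with itself is used as the copy instruction.
    have hv : BinOp.bor.eval (σ.reg 0) (σ.reg 0) = s.low 0 := by
      simp [BinOp.eval, hs.low 0 (by have := Γ.three_le; omega)]
    refine Runs.op ?_ (h _ (SameUpTo.rfl.setReg le_rfl _) ?_)
    · rw [hv]; exact lt_of_size hs.below he
    · simp [hv]
  | const k =>
    rw [Expr.time, Nat.cast_one]
    exact Runs.const (by simpa using lt_of_size hs.below he) (h _ (SameUpTo.rfl.setReg le_rfl _) (by simp))
  | var v =>
    rw [Expr.time, Nat.cast_one]
    have hv : BinOp.bor.eval (σ.reg (V Γ.R₀ v)) (σ.reg (V Γ.R₀ v)) = s.reg v := by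
      simp [BinOp.eval, hs.reg]
    refine Runs.op ?_ (h _ (SameUpTo.rfl.setReg le_rfl _) ?_)
    · rw [hv]; exact lt_of_size hs.below he
    · simp [hv]
  | load a ih =>
    rw [Expr.size] at he
    have : T + ((Expr.load a).time : ℕ) = T + 1 + a.time + 1 := by
      rw [Expr.time]; push_cast; ring
    rw [this]
    refine Runs.seq (ih d hs (by omega) fun σ' h1 h2 => ?_)
    have hs' := h1.sim hs
    have hv : σ'.mem (σ'.reg (Tmp Γ.R₀ d)) = (Expr.load a).eval s := by
      simp [h2, hs'.mem]
    refine Runs.load ?_ (h _ (h1.setReg le_rfl _) ?_)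
    · rw [hv]; exact lt_of_size hs.below (by simpa [Expr.size] using he)
    · simp [hv]
  | op o a b iha ihb =>
    have he' := he
    rw [Expr.size] at he
    have : T + ((Expr.op o a b).time : ℕ) = T + 1 + b.time + 1 + a.time + 1 := by
      rw [Expr.time]; push_cast; ring
    rw [this]
    refine Runs.seq (iha d hs (by omega) fun σ' h1 h2 => ?_)
    refine Runs.seq (ihb (d + 1) (h1.sim hs) (by omega) fun σ'' h3 h4 => ?_)
    have hv : o.toBinOp.eval (σ''.reg (Tmp Γ.R₀ d)) (σ''.reg (Tmp Γ.R₀ (d + 1)))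
        = (Expr.op o a b).eval s := by
      rw [h4, h3.tmp (Nat.lt_succ_self d), h2]; rfl
    refine Runs.op ?_ (h _ ((h1.trans (by omega) h3).setReg le_rfl _) ?_)
    · rw [hv]; exact lt_of_size hs.below he'
    · simp [hv]

theorem Sim.setVar {s : Env} {σ : Store} (h : Γ.Sim s σ) (v : ℕ) {x : ℕ} (hx : x < Γ.X) :
    Γ.Sim (s.setReg v x) (σ.setReg (V Γ.R₀ v) x) := by
  refine ⟨fun u => ?_, h.mem, fun r hr => ?_, fun u => ?_, h.below.2⟩
  · rw [Store.setReg_reg, Env.setReg_reg, h.reg]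
    simp [V]
  · rw [Store.setReg_reg, if_neg (by simp only [V]; omega)]
    exact h.low r hr
  · rw [Env.setReg_reg]
    split_ifs
    · exact hx
    · exact h.below.1 u

theorem Sim.setLow {s : Env} {σ : Store} (h : Γ.Sim s σ) {r : ℕ} (hr : r < Γ.R₀) {x : ℕ}
    (hx : x < Γ.X) : Γ.Sim (s.setLow r x) (σ.setReg r x) := by
  refine ⟨fun u => ?_, h.mem, fun r' hr' => ?_, h.below.1, h.below.2.1, fun u => ?_⟩
  · rw [Store.setReg_reg, if_neg (by simp only [V]; omega)]
    exact h.reg u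
  · rw [Store.setReg_reg, h.low r' hr']
    simp [Env.setLow, Function.update_apply]
  · simp only [Env.setLow, Function.update_apply]
    split_ifs
    · exact hx
    · exact h.below.2.2 u

theorem Sim.setMem {s : Env} {σ : Store} (h : Γ.Sim s σ) (a : ℕ) {x : ℕ} (hx : x < Γ.X) :
    Γ.Sim (s.setMem a x) (σ.setMem a x) := by
  refine ⟨h.reg, ?_, h.low, h.below.1, fun u => ?_, h.below.2.2⟩
  · simp [Store.setMem, Env.setMem, h.mem]
  · simp only [Env.setMem, Function.update_apply]
    split_ifs
    · exact hx
    · exact h.below.2.1 u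

/-! ### Proof rules for compiled statements -/

namespace ARuns

variable {P Q : Prog} {s : Env} {T T' : ℝ≥0∞} {R R' : Env → ℝ≥0∞ → Prop}

theorem mono (h : Γ.ARuns P s T R) (hT : T ≤ T') : Γ.ARuns P s T' R :=
  fun σ hσ => (h σ hσ).mono hT

theorem conseq (h : Γ.ARuns P s T R) (hR : ∀ s' x, s'.Below Γ.X → R s' x → ∃ y ≤ x, R' s' y) :
    Γ.ARuns P s T R' := by
  intro σ hσ
  refine (h σ hσ).conseq ?_
  rintro σ' x ⟨s', hs', hR'⟩
  obtain ⟨y, hy, h'⟩ := hR s' x hs'.below hR'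
  exact ⟨y, hy, s', hs', h'⟩

theorem of_below (h : s.Below Γ.X → Γ.ARuns P s T R) : Γ.ARuns P s T R :=
  fun σ hσ => h hσ.below σ hσ

theorem seq (h : Γ.ARuns P s T fun s' x => Γ.ARuns Q s' x R) :
    Γ.ARuns (.seq P Q) s (T + 1) R := by
  intro σ hσ
  refine Runs.seq ((h σ hσ).imp ?_)
  rintro σ' x ⟨s', hs', hR⟩
  exact hR σ' hs'

theorem skip (h : R s T) : Γ.ARuns .skip s (T + 1) R :=
  fun _ hσ => Runs.skip ⟨s, hσ, h⟩

theorem assign {v : ℕ} {e : Expr} (he : e.size ≤ Γ.S) (hX : e.eval s < Γ.X)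
    (h : R (s.setReg v (e.eval s)) T) :
    Γ.ARuns (assign Γ.R₀ v e) s (T + (e.time + 2 : ℕ)) R := by
  intro σ hσ
  have : T + ((e.time + 2 : ℕ) : ℝ≥0∞) = T + 1 + e.time + 1 := by push_cast; ring
  rw [this]
  refine Runs.seq (runs_comp e 0 hσ he fun σ' h1 h2 => ?_)
  have hv : BinOp.bor.eval (σ'.reg (Tmp Γ.R₀ 0)) (σ'.reg (Tmp Γ.R₀ 0)) = e.eval s := by
    simp [BinOp.eval, h2]
  refine Runs.op ?_ ⟨_, ?_, h⟩
  · rw [hv]; exact lt_of_size hσ.below he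
  · rw [hv]; exact (h1.sim hσ).setVar v hX

theorem setLow {r : ℕ} {e : Expr} (hr : r < Γ.R₀) (he : e.size ≤ Γ.S) (hX : e.eval s < Γ.X)
    (h : R (s.setLow r (e.eval s)) T) :
    Γ.ARuns (setLow Γ.R₀ r e) s (T + (e.time + 2 : ℕ)) R := by
  intro σ hσ
  have : T + ((e.time + 2 : ℕ) : ℝ≥0∞) = T + 1 + e.time + 1 := by push_cast; ring
  rw [this]
  refine Runs.seq (runs_comp e 0 hσ he fun σ' h1 h2 => ?_)
  have hv : BinOp.bor.eval (σ'.reg (Tmp Γ.R₀ 0)) (σ'.reg (Tmp Γ.R₀ 0)) = e.eval s := by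
    simp [BinOp.eval, h2]
  refine Runs.op ?_ ⟨_, ?_, h⟩
  · rw [hv]; exact lt_of_size hσ.below he
  · rw [hv]; exact (h1.sim hσ).setLow hr hX

theorem write {a e : Expr} (ha : a.size ≤ Γ.S) (he : e.size ≤ Γ.S) (hX : e.eval s < Γ.X)
    (h : R (s.setMem (a.eval s) (e.eval s)) T) :
    Γ.ARuns (write Γ.R₀ a e) s (T + (a.time + e.time + 3 : ℕ)) R := by
  intro σ hσ
  have : T + ((a.time + e.time + 3 : ℕ) : ℝ≥0∞) = T + 1 + e.time + 1 + a.time + 1 := by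
    push_cast; ring
  rw [this]
  refine Runs.seq (runs_comp a 0 hσ ha fun σ' h1 h2 => ?_)
  refine Runs.seq (runs_comp e 1 (h1.sim hσ) he fun σ'' h3 h4 => ?_)
  refine Runs.store ⟨_, ?_, h⟩
  rw [h4, h3.tmp one_pos, h2]
  exact (h3.sim (h1.sim hσ)).setMem _ hX

theorem ite {e : Expr} (he : e.size ≤ Γ.S) (h1 : e.eval s ≠ 0 → Γ.ARuns P s T R)
    (h2 : e.eval s = 0 → Γ.ARuns Q s T R) :
    Γ.ARuns (ite Γ.R₀ e P Q) s (T + (e.time + 2 : ℕ)) R := by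
  intro σ hσ
  have : T + ((e.time + 2 : ℕ) : ℝ≥0∞) = T + 1 + e.time + 1 := by push_cast; ring
  rw [this]
  refine Runs.seq (runs_comp e 0 hσ he fun σ' h3 h4 => ?_)
  by_cases h0 : e.eval s = 0
  · exact Runs.cond_false (h4.trans h0) (h2 h0 σ' (h3.sim hσ))
  · exact Runs.cond_true (by rwa [h4]) (h1 h0 σ' (h3.sim hσ))

/-- The overhead of one iteration of a `for` loop. -/
def _root_.WordRAM.Machine.forTime (e : Expr) : ℕ := e.time + 20

/-- Induction on the number of iterations still to come. The credits for the body belong to the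
invariant, so its cost may vary between iterations; only the increment and the test are charged to
`forTime`. The body may change anything but the loop variable. -/
theorem loop_aux {v : ℕ} {e : Expr} {B : ℕ} (Inv : ℕ → Env → ℝ≥0∞ → Prop)
    (he : e.size + 10 ≤ Γ.S) (hv : ∀ j s x, Inv j s x → s.reg v = j) (hB : B < Γ.X)
    (hbound : ∀ j s x, Inv j s x → e.eval s = B)
    (body : ∀ j < B, ∀ s x, s.Below Γ.X → Inv j s x → Γ.ARuns P s x fun s' y =>
      s'.reg v = j ∧ Inv (j + 1) (s'.setReg v (j + 1)) y)
    (k : ℕ) : ∀ (j : ℕ) (s : Env) (σ : Store) (x : ℝ≥0∞), j + k = B → Inv j s x → Γ.Sim s σ →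
      σ.reg (Tmp Γ.R₀ 0) = (Expr.lt (.var v) e).eval s →
      Runs Γ.w (.loop (Tmp Γ.R₀ 0)
        (.seq P (.seq (Machine.assign Γ.R₀ v (.var v + .const 1)) (Machine.comp Γ.R₀ (.lt (.var v) e) 0))))
        σ (x + (forTime e * k + 1 : ℕ)) fun σ' x => ∃ s', Γ.Sim s' σ' ∧ Inv B s' x := by
  induction k with
  | zero =>
    intro j s σ x hj hI hσ h0
    obtain rfl : j = B := by omega
    rw [mul_zero, zero_add, Nat.cast_one]
    refine Runs.loop_false ?_ ⟨s, hσ, hI⟩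
    rw [h0]
    simp [hv j s x hI, hbound j s x hI]
  | succ k ih =>
    intro j s σ x hj hI hσ h0
    have hjB : j < B := by omega
    have h2 : x + ((forTime e * (k + 1) + 1 : ℕ) : ℝ≥0∞)
        = x + (forTime e * k + 1 + (e.time + 18) : ℕ) + 1 + 1 := by
      simp only [forTime]; push_cast; ring
    rw [h2]
    refine Runs.loop_true ?_ (Runs.seq ?_)
    · rw [h0]; simp [hv j s x hI, hbound j s x hI, hjB]
    refine ((body j hjB s x hσ.below hI σ hσ).frame _).imp ?_
    rintro σ' x' ⟨y, rfl, s', hs', hj', hI'⟩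
    have h3 : y + ((forTime e * k + 1 + (e.time + 18) : ℕ) : ℝ≥0∞)
        = ((y + (forTime e * k + 1 : ℕ)) + 3 + ((Expr.lt (.var v) e).time : ℕ))
          + (((Expr.var v + Expr.const 1).time + 2 : ℕ)) + 1 + 3 := by
      have e1 : (Expr.lt (.var v) e).time = 1 + e.time + 3 := rfl
      have e2 : (Expr.var v + Expr.const 1).time = 5 := rfl
      rw [e1, e2]; push_cast; ring
    rw [h3]
    refine Runs.mono (Runs.seq ?_) (le_self_add)
    have hA : Γ.ARuns (Machine.assign Γ.R₀ v (.var v + .const 1)) s'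
        (((y + (forTime e * k + 1 : ℕ)) + 3 + ((Expr.lt (.var v) e).time : ℕ))
          + (((Expr.var v + Expr.const 1).time + 2 : ℕ)))
        fun s'' x => s'' = s'.setReg v (j + 1) ∧
          x = ((y + (forTime e * k + 1 : ℕ)) + 3 + ((Expr.lt (.var v) e).time : ℕ)) := by
      refine ARuns.assign ?_ ?_ ⟨?_, rfl⟩
      · simp only [Expr.size_add, Expr.size_var, Expr.size_const]; omega
      · simp [hj']; omega
      · simp [hj']
    refine (hA σ' hs').imp ?_
    rintro σ'' x'' ⟨s'', hs'', rfl, rfl⟩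
    refine runs_comp _ 0 hs'' (by simp only [Expr.size_lt, Expr.size_var]; omega) fun τ h4 h5 => ?_
    exact (ih (j + 1) _ τ y (by omega) hI' (h4.sim hs'') h5).mono
      (le_self_add)

theorem forLoop {v : ℕ} {e : Expr} {B : ℕ} (Inv : ℕ → Env → ℝ≥0∞ → Prop)
    (he : e.size + 10 ≤ Γ.S) (hB : B < Γ.X)
    (hv : ∀ j s x, Inv j s x → s.reg v = j)
    (hbound : ∀ j s x, Inv j s x → e.eval s = B)
    (initial : Inv 0 (s.setReg v 0) T)
    (body : ∀ j < B, ∀ s x, s.Below Γ.X → Inv j s x → Γ.ARuns P s x fun s' y =>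
      s'.reg v = j ∧ Inv (j + 1) (s'.setReg v (j + 1)) y)
    (fin : ∀ s x, s.Below Γ.X → Inv B s x → R s x) :
    Γ.ARuns (forLoop Γ.R₀ v e P) s (T + (forTime e * (B + 1) : ℕ)) R := by
  intro σ hσ
  have h1 : T + ((forTime e * (B + 1) : ℕ) : ℝ≥0∞)
      = (((T + (forTime e * B + 1 : ℕ)) + ((Expr.lt (.var v) e).time : ℕ)) + 1 +
        (((Expr.const 0).time + 2 : ℕ)) + 1) + 10 := by
    have e1 : (Expr.lt (.var v) e).time = 1 + e.time + 3 := rfl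
    have e2 : (Expr.const 0).time = 1 := rfl
    rw [e1, e2]; simp only [forTime]; push_cast; ring
  rw [h1]
  refine Runs.mono (Runs.seq ?_) le_self_add
  have hA : Γ.ARuns (Machine.assign Γ.R₀ v (.const 0)) s
      (((T + (forTime e * B + 1 : ℕ)) + ((Expr.lt (.var v) e).time : ℕ)) + 1 +
        (((Expr.const 0).time + 2 : ℕ)))
      fun s'' x => s'' = s.setReg v 0 ∧
        x = (((T + (forTime e * B + 1 : ℕ)) + ((Expr.lt (.var v) e).time : ℕ)) + 1) := by
    refine ARuns.assign (by simp; omega) (by have := Γ.two_le; simp; omega) ⟨by simp, rfl⟩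
  refine (hA σ hσ).imp ?_
  rintro σ'' x'' ⟨s'', hs'', rfl, rfl⟩
  refine Runs.seq ?_
  refine runs_comp _ 0 hs'' (by simp only [Expr.size_lt, Expr.size_var]; omega) fun τ h4 h5 => ?_
  refine (loop_aux Inv he hv hB hbound body B 0 _ τ T (by omega) initial (h4.sim hs'') h5).imp ?_
  rintro σ' x ⟨s', hs', h'⟩
  exact ⟨s', hs', fin s' x hs'.below h'⟩

end ARuns

end Machine

/-! ## Relocation of programs -/

namespace Prog

/-- Add the content of the register `base` to all memory addresses, and draw random numbers again
as long as they exceed the content of the register `lim`. -/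
def reloc (base lim tmp flag : ℕ) : Prog → Prog
  | load r a => seq (op .add tmp a base) (load r tmp)
  | store a b => seq (op .add tmp a base) (store tmp b)
  | rand r a => seq (const flag 1) (seq (loop flag (seq (rand tmp a) (op .lt flag lim tmp)))
      (op .bor r tmp tmp))
  | seq P Q => seq (P.reloc base lim tmp flag) (Q.reloc base lim tmp flag)
  | cond a P Q => cond a (P.reloc base lim tmp flag) (Q.reloc base lim tmp flag)
  | loop a P => loop a (P.reloc base lim tmp flag)
  | P => P

/-- The program uses only registers with numbers below `R`. -/
def RegsBelow (R : ℕ) : Prog → Prop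
  | skip => True
  | const r _ => r < R
  | op _ r a b => r < R ∧ a < R ∧ b < R
  | load r a => r < R ∧ a < R
  | store a b => a < R ∧ b < R
  | rand r a => r < R ∧ a < R
  | seq P Q => P.RegsBelow R ∧ Q.RegsBelow R
  | cond a P Q => a < R ∧ P.RegsBelow R ∧ Q.RegsBelow R
  | loop a P => a < R ∧ P.RegsBelow R

theorem RegsBelow.mono {R R' : ℕ} (hR : R ≤ R') {P : Prog} (h : P.RegsBelow R) :
    P.RegsBelow R' := by
  induction P <;> simp only [RegsBelow] at * <;> grind

theorem exists_regsBelow (P : Prog) : ∃ R, P.RegsBelow R := by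
  induction P with
  | skip => exact ⟨0, trivial⟩
  | const r k => exact ⟨r + 1, by simp [RegsBelow]⟩
  | op o r a b => exact ⟨r + a + b + 1, by simp only [RegsBelow]; omega⟩
  | load r a => exact ⟨r + a + 1, by simp only [RegsBelow]; omega⟩
  | store a b => exact ⟨a + b + 1, by simp only [RegsBelow]; omega⟩
  | rand r a => exact ⟨r + a + 1, by simp only [RegsBelow]; omega⟩
  | seq P Q hP hQ =>
    obtain ⟨R, h⟩ := hP
    obtain ⟨R', h'⟩ := hQ
    exact ⟨R + R', h.mono (by omega), h'.mono (by omega)⟩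
  | cond a P Q hP hQ =>
    obtain ⟨R, h⟩ := hP
    obtain ⟨R', h'⟩ := hQ
    exact ⟨R + R' + a + 1, by omega, h.mono (by omega), h'.mono (by omega)⟩
  | loop a P hP =>
    obtain ⟨R, h⟩ := hP
    exact ⟨R + a + 1, by omega, h.mono (by omega)⟩

end Prog

/-- All words are below `D` and only the first `D` memory cells are in use. -/
structure Store.Small (D : ℕ) (τ : Store) : Prop where
  reg : ∀ r, τ.reg r < D
  mem : ∀ a, τ.mem a < D
  zero : ∀ a, D ≤ a → τ.mem a = 0

theorem Store.Small.setReg {D : ℕ} {τ : Store} (h : τ.Small D) (r : ℕ) {x : ℕ} (hx : x < D) :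
    (τ.setReg r x).Small D := by
  refine ⟨fun u => ?_, h.mem, h.zero⟩
  rw [Store.setReg_reg]
  split_ifs
  exacts [hx, h.reg u]

/-- A configuration that uses only registers below `R` and words below `D`. -/
structure Config.Small (R D : ℕ) (c : Config) : Prop where
  regs : ∀ P ∈ c.code, P.RegsBelow R
  store : c.store.Small D

/-- A word written to a register passed the test in `assign`, a word written to memory comes from a
register, and its address is a register content too. The bound `D` is kept apart from `2 ^ w`
because inputs and requests enter the registers without any test and may exceed the words of the
dynamic algorithm. -/
theorem Config.Small.step {R D w : ℕ} (hD : 2 ^ w ≤ D) {c c' : Config} (h : c.Small R D)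
    (hc : c' ∈ (step w c).support) : c'.Small R D := by
  obtain ⟨l, τ⟩ := c
  have key : ∀ (r x : ℕ) (P : Prog) (k : List Prog), l = P :: k →
      (WordRAM.assign w r x k ⟨l, τ⟩).Small R D := by
    intro r x P k hl
    unfold WordRAM.assign
    split_ifs with hx
    · exact ⟨fun Q hQ => h.regs Q (by simp [hl, hQ]), h.store.setReg r (hx.trans_le hD)⟩
    · exact h
  cases l with
  | nil =>
    simp only [WordRAM.step, PMF.mem_support_pure_iff] at hc
    rw [hc]; exact h
  | cons P k =>
    have hP := h.regs P (by simp)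
    have hk : ∀ Q ∈ k, Q.RegsBelow R := fun Q hQ => h.regs Q (by simp [hQ])
    cases P with
    | skip =>
      simp only [WordRAM.step, PMF.mem_support_pure_iff] at hc
      rw [hc]; exact ⟨hk, h.store⟩
    | const r x =>
      simp only [WordRAM.step, PMF.mem_support_pure_iff] at hc
      rw [hc]; exact key _ _ _ _ rfl
    | op o r a b =>
      simp only [WordRAM.step, PMF.mem_support_pure_iff] at hc
      rw [hc]; exact key _ _ _ _ rfl
    | load r a =>
      simp only [WordRAM.step, PMF.mem_support_pure_iff] at hc
      rw [hc]; exact key _ _ _ _ rfl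
    | store a b =>
      simp only [WordRAM.step, PMF.mem_support_pure_iff] at hc
      rw [hc]
      refine ⟨hk, h.store.reg, fun u => ?_, fun u hu => ?_⟩
      · simp only [Store.setMem, Function.update_apply]
        split_ifs
        exacts [h.store.reg b, h.store.mem u]
      · simp only [Store.setMem, Function.update_apply]
        have := h.store.reg a
        rw [if_neg (by simp only at this ⊢; omega)]
        exact h.store.zero u hu
    | rand r a =>
      simp only [WordRAM.step] at hc
      rcases hra : τ.reg a with _ | m
      · rw [hra] at hc
        simp only [PMF.mem_support_pure_iff] at hc
        rw [hc]; exact h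
      · rw [hra] at hc
        simp only [PMF.mem_support_map_iff] at hc
        obtain ⟨i, -, rfl⟩ := hc
        exact key _ _ _ _ rfl
    | seq P Q =>
      simp only [WordRAM.step, PMF.mem_support_pure_iff] at hc
      rw [hc]
      refine ⟨fun Z hZ => ?_, h.store⟩
      simp only [List.mem_cons] at hZ
      rcases hZ with rfl | rfl | hZ
      exacts [hP.1, hP.2, hk Z hZ]
    | cond a P Q =>
      simp only [WordRAM.step, PMF.mem_support_pure_iff] at hc
      rw [hc]
      refine ⟨fun Z hZ => ?_, h.store⟩
      simp only [List.mem_cons] at hZ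
      rcases hZ with rfl | hZ
      · split_ifs
        exacts [hP.2.1, hP.2.2]
      · exact hk Z hZ
    | loop a P =>
      simp only [WordRAM.step, PMF.mem_support_pure_iff] at hc
      rw [hc]
      refine ⟨fun Z hZ => ?_, h.store⟩
      simp only at hZ
      split_ifs at hZ
      · simp only [List.mem_cons] at hZ
        rcases hZ with rfl | rfl | hZ
        exacts [hP.2, hP, hk Z hZ]
      · exact hk Z hZ

/-! ## Simulation of dynamic algorithms -/

/-- A dynamic algorithm that is run on a given input and sequence of requests, with word length
`w`, registers below `R` and words below `D`. -/
structure DynRun where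
  A : DynAlg
  w : ℕ
  R : ℕ
  D : ℕ
  input : Store
  rs : List Request
  pow_le : 2 ^ w ≤ D
  prep_regs : A.prep.RegsBelow R
  upd_regs : A.upd.RegsBelow R
  qry_regs : A.qry.RegsBelow R
  input_small : input.Small D
  requests_small : ∀ e, Request.update e ∈ rs → e.u < D ∧ e.v < D ∧ e.x < D

/-- The answers so far, including the one that is in register `0`. -/
def DynConfig.allAnswers (d : DynConfig) : List ℕ :=
  match d.phase with
  | .query => d.answers ++ [d.run.store.reg 0]
  | _ => d.answers

namespace DynRun

variable (𝒜 : DynRun)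

/-- The expected remaining time. -/
noncomputable def remaining (d : DynConfig) : ℝ≥0∞ :=
  expectedVisits (𝒜.A.dynStep 𝒜.w) d {d | d.phase ≠ .done}

/-- The configuration can be reached, and it is small. -/
structure Good (d : DynConfig) : Prop where
  reach : ∃ t, d ∈ (iter (𝒜.A.dynStep 𝒜.w) (𝒜.A.start 𝒜.input 𝒜.rs) t).support
  small : d.run.Small 𝒜.R 𝒜.D
  pending : ∀ e, Request.update e ∈ d.pending → e.u < 𝒜.D ∧ e.v < 𝒜.D ∧ e.x < 𝒜.D

variable {𝒜}

theorem good_start : 𝒜.Good (𝒜.A.start 𝒜.input 𝒜.rs) where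
  reach := ⟨0, by simp [iter]⟩
  small := ⟨by simpa [DynAlg.start] using 𝒜.prep_regs, 𝒜.input_small⟩
  pending := 𝒜.requests_small

theorem dynStep_run {d : DynConfig} (hp : d.phase ≠ .done) (hc : d.run.code ≠ []) :
    𝒜.A.dynStep 𝒜.w d = (step 𝒜.w d.run).map fun r => { d with run := r } := by
  unfold DynAlg.dynStep
  split
  · contradiction
  · split
    · contradiction
    · rfl

theorem dynStep_halted {d : DynConfig} (hp : d.phase ≠ .done) (hc : d.run.code = []) :
    𝒜.A.dynStep 𝒜.w d = PMF.pure (𝒜.A.nextRequest d) := by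
  unfold DynAlg.dynStep
  split
  · contradiction
  · split
    · rfl
    · rename_i h; rw [hc] at h; cases h

theorem Good.step {d : DynConfig} (h : 𝒜.Good d) (hp : d.phase ≠ .done) (hc : d.run.code ≠ [])
    {r : Config} (hr : r ∈ (WordRAM.step 𝒜.w d.run).support) : 𝒜.Good { d with run := r } where
  reach := by
    obtain ⟨t, ht⟩ := h.reach
    refine ⟨t + 1, mem_support_iter_succ ht ?_⟩
    rw [dynStep_run hp hc, PMF.mem_support_map_iff]
    exact ⟨r, hr, rfl⟩
  small := h.small.step 𝒜.pow_le hr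
  pending := h.pending

theorem nextRequest_answers (d : DynConfig) : (𝒜.A.nextRequest d).answers = d.allAnswers := by
  unfold DynAlg.nextRequest DynConfig.allAnswers
  rcases d.pending with _ | ⟨_ | _, rs⟩ <;> rfl

theorem reach_next {d : DynConfig} (h : 𝒜.Good d) (hp : d.phase ≠ .done) (hc : d.run.code = []) :
    ∃ t, 𝒜.A.nextRequest d ∈ (iter (𝒜.A.dynStep 𝒜.w) (𝒜.A.start 𝒜.input 𝒜.rs) t).support := by
  obtain ⟨t, ht⟩ := h.reach
  refine ⟨t + 1, mem_support_iter_succ ht ?_⟩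
  rw [dynStep_halted hp hc, PMF.mem_support_pure_iff]

theorem good_next {d : DynConfig} (h : 𝒜.Good d) (hp : d.phase ≠ .done) (hc : d.run.code = [])
    : 𝒜.Good (𝒜.A.nextRequest d) := by
  refine ⟨reach_next h hp hc, ?_, ?_⟩
  · unfold DynAlg.nextRequest
    rcases hd : d.pending with _ | ⟨_ | _, rs⟩
    · exact h.small
    · rename_i e
      have he := h.pending e (by simp [hd])
      exact ⟨by simpa using 𝒜.upd_regs,
        ((h.small.store.setReg _ he.1).setReg _ he.2.1).setReg _ he.2.2⟩
    · exact ⟨by simpa using 𝒜.qry_regs, h.small.store⟩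
  · intro e he
    apply h.pending e
    unfold DynAlg.nextRequest at he
    rcases hd : d.pending with _ | ⟨_ | _, rs⟩ <;> rw [hd] at he <;> simp_all

theorem remaining_run {d : DynConfig} (hp : d.phase ≠ .done) (hc : d.run.code ≠ []) :
    𝒜.remaining d = 1 + expect (step 𝒜.w d.run) fun r => 𝒜.remaining { d with run := r } := by
  unfold remaining
  rw [expectedVisits_eq, dynStep_run hp hc, expect_map]
  simp [hp, Function.comp_def]

theorem remaining_next_le {d : DynConfig} (hp : d.phase ≠ .done) (hc : d.run.code = []) :
    𝒜.remaining (𝒜.A.nextRequest d) ≤ 𝒜.remaining d := by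
  unfold remaining
  rw [expectedVisits_eq _ d, dynStep_halted hp hc, expect_pure]
  exact le_add_self

theorem remaining_start : 𝒜.remaining (𝒜.A.start 𝒜.input 𝒜.rs)
    ≤ 𝒜.A.prepTime 𝒜.w 𝒜.input 𝒜.rs + 𝒜.A.requestTime 𝒜.w 𝒜.input 𝒜.rs := by
  unfold remaining DynAlg.prepTime DynAlg.requestTime expectedVisits
  rw [← ENNReal.tsum_add]
  refine ENNReal.tsum_le_tsum fun t => ?_
  refine le_trans (MeasureTheory.OuterMeasure.mono _ ?_) (MeasureTheory.measure_union_le _ _)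
  intro d hd
  rcases h : d.phase <;> simp_all

/-- Meant for an instruction that is stuck forever: its remaining time, scaled by the simulation
factor, satisfies this equation. It is then infinite, and any bound by it is trivial. -/
theorem eq_top_of_eq_add {a : ℝ≥0∞} (h : a = 12 + a) : a = ⊤ := by
  by_contra ha
  have : (0 : ℝ≥0∞) + a = 12 + a := by rw [zero_add]; exact h
  rw [ENNReal.add_left_inj ha] at this
  norm_num at this

/-- The store `τ` of the simulated machine is represented by `σ`, with memory from `base` on. -/
def Match (R base : ℕ) (τ σ : Store) : Prop :=
  (∀ r < R, σ.reg r = τ.reg r) ∧ ∀ a, σ.mem (base + a) = τ.mem a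

/-- Nothing was changed except the simulated machine and the registers `tmp` and `flag`. -/
def Untouched (R base tmp flag : ℕ) (σ σ' : Store) : Prop :=
  (∀ r, R ≤ r → r ≠ tmp → r ≠ flag → σ'.reg r = σ.reg r) ∧ ∀ a < base, σ'.mem a = σ.mem a

theorem Match.setReg {R base : ℕ} {τ σ : Store} (h : Match R base τ σ) (r x : ℕ) :
    Match R base (τ.setReg r x) (σ.setReg r x) := by
  refine ⟨fun r' hr' => ?_, h.2⟩
  rw [Store.setReg_reg, Store.setReg_reg, h.1 r' hr']

theorem Match.setTmp {R base tmp : ℕ} (ht : R ≤ tmp) {τ σ : Store} (h : Match R base τ σ) (x : ℕ) :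
    Match R base τ (σ.setReg tmp x) := by
  refine ⟨fun r' hr' => ?_, h.2⟩
  rw [Store.setReg_reg, if_neg (by omega), h.1 r' hr']

theorem Untouched.setReg {R base tmp flag : ℕ} {σ₀ σ : Store} (h : Untouched R base tmp flag σ₀ σ) (r x : ℕ)
    (hr : r < R ∨ r = tmp ∨ r = flag) : Untouched R base tmp flag σ₀ (σ.setReg r x) := by
  refine ⟨fun r' h1 h2 h3 => ?_, h.2⟩
  rw [Store.setReg_reg, if_neg (by omega), h.1 r' h1 h2 h3]

/-- Every step of the simulated machine is worth twelve credits, more than its translation takes: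
three steps for an access to memory, nine for a random number that is accepted at once. An overflow
in a deterministic instruction stops the simulated machine for good, so that the right-hand side is
infinite. An overflow of a random number merely makes it draw again, and this is what the loop in
`Prog.reloc` imitates. All of this is an induction on the fuel. -/
theorem costWithin_reloc_le {f : Store → ℝ≥0∞} {W base tmp flag breg lreg : ℕ} {x : ℝ≥0∞} {σ₀ : Store}
    (ph : Phase) (pend : List Request) (ans : List ℕ) (hph : ph ≠ .done)
    (hW : 2 ^ 𝒜.w ≤ 2 ^ W) (hbase : base + 𝒜.D ≤ 2 ^ W) (ht : 𝒜.R ≤ tmp) (hb : 𝒜.R ≤ breg)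
    (htf : 𝒜.R ≤ flag) (hl : 𝒜.R ≤ lreg) (htb : tmp ≠ breg) (hfb : flag ≠ breg) (htl : tmp ≠ lreg)
    (hfl : flag ≠ lreg) (hft : flag ≠ tmp) (hbreg : σ₀.reg breg = base)
    (hlreg : σ₀.reg lreg + 1 = 2 ^ 𝒜.w)
    (hf : ∀ (c : Config) (σ' : Store), 𝒜.Good ⟨ph, c, pend, ans⟩ → c.code = [] →
      Match 𝒜.R base c.store σ' → Untouched 𝒜.R base tmp flag σ₀ σ' →
      f σ' ≤ 12 * 𝒜.remaining ⟨ph, c, pend, ans⟩ + x) (n : ℕ) :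
    ∀ (c : Config) (σ : Store), 𝒜.Good ⟨ph, c, pend, ans⟩ → Match 𝒜.R base c.store σ →
      Untouched 𝒜.R base tmp flag σ₀ σ →
      costWithin W f n ⟨c.code.map (Prog.reloc breg lreg tmp flag), σ⟩
        ≤ 12 * 𝒜.remaining ⟨ph, c, pend, ans⟩ + x := by
  induction n with
  | zero => intro c σ _ _ _; exact zero_le
  | succ n ih =>
    rintro ⟨l, τ⟩ σ hg hm hu
    cases l with
    | nil => simpa [costWithin] using hf _ σ hg rfl hm hu
    | cons P k =>
      have hrem : 12 * 𝒜.remaining ⟨ph, ⟨P :: k, τ⟩, pend, ans⟩ + x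
          = 12 + expect (step 𝒜.w ⟨P :: k, τ⟩) fun r => 12 * 𝒜.remaining ⟨ph, r, pend, ans⟩ + x := by
        rw [remaining_run (𝒜 := 𝒜) hph (by simp), mul_add, mul_one, add_assoc, expect_add, expect_const,
          expect_mul_left]
      have hsmall := hg.small.store
      have hP := hg.small.regs P (by simp)
      have hgood : ∀ r ∈ (step 𝒜.w ⟨P :: k, τ⟩).support, 𝒜.Good ⟨ph, r, pend, ans⟩ :=
        fun r hr => hg.step hph (by simp) hr
      have h13 : (1 : ℝ≥0∞) ≤ 12 := by norm_num
      -- a deterministic instruction that is not stuck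
      have one : ∀ (c' : Config) (σ' : Store), step 𝒜.w ⟨P :: k, τ⟩ = PMF.pure c' →
          step W ⟨(P :: k).map (Prog.reloc breg lreg tmp flag), σ⟩
            = PMF.pure ⟨c'.code.map (Prog.reloc breg lreg tmp flag), σ'⟩ →
          Match 𝒜.R base c'.store σ' → Untouched 𝒜.R base tmp flag σ₀ σ' →
          costWithin W f (n + 1) ⟨(P :: k).map (Prog.reloc breg lreg tmp flag), σ⟩
            ≤ 12 * 𝒜.remaining ⟨ph, ⟨P :: k, τ⟩, pend, ans⟩ + x := by
        intro c' σ' h1 h2 h3 h4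
        rw [costWithin, if_neg (by simp), h2, hrem, h1, expect_pure, expect_pure]
        exact add_le_add h13 (ih c' σ' (hgood c' (by simp [h1])) h3 h4)
      -- an instruction that is stuck
      have stuck : step 𝒜.w ⟨P :: k, τ⟩ = PMF.pure ⟨P :: k, τ⟩ →
          costWithin W f (n + 1) ⟨(P :: k).map (Prog.reloc breg lreg tmp flag), σ⟩
            ≤ 12 * 𝒜.remaining ⟨ph, ⟨P :: k, τ⟩, pend, ans⟩ + x := by
        intro h1
        rw [h1, expect_pure] at hrem
        rw [eq_top_of_eq_add hrem]
        exact le_top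
      have addr : ∀ a, a < 𝒜.R → τ.reg a + base < 2 ^ W := fun a _ => by
        have := hsmall.reg a
        simp only at this
        omega
      have hbr : σ.reg breg = base := by rw [hu.1 breg hb htb.symm hfb.symm, hbreg]
      cases P with
      | skip => exact one ⟨k, τ⟩ σ rfl rfl hm hu
      | const r y =>
        by_cases hy : y < 2 ^ 𝒜.w
        · refine one ⟨k, τ.setReg r y⟩ (σ.setReg r y) (by simp [step, assign, hy])
            (by simp [step, assign, hy.trans_le hW, Prog.reloc]) (hm.setReg r y)
            (hu.setReg r y (Or.inl hP))
        · exact stuck (by simp [step, assign, hy])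
      | op o r a b =>
        have h1 : σ.reg a = τ.reg a := hm.1 a hP.2.1
        have h2 : σ.reg b = τ.reg b := hm.1 b hP.2.2
        by_cases hy : o.eval (τ.reg a) (τ.reg b) < 2 ^ 𝒜.w
        · refine one ⟨k, τ.setReg r _⟩ (σ.setReg r (o.eval (τ.reg a) (τ.reg b)))
            (by simp only [step, assign, hy]; rfl)
            (by simp [step, assign, h1, h2, hy.trans_le hW, Prog.reloc]) (hm.setReg r _)
            (hu.setReg r _ (Or.inl hP.1))
        · exact stuck (by simp [step, assign, hy])
      | load r a =>
        have h1 : σ.reg a = τ.reg a := hm.1 a hP.2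
        by_cases hy : τ.mem (τ.reg a) < 2 ^ 𝒜.w
        -- Additional fuel only increases `costWithin`, so three units are provided for the three
        -- translated steps and exactly `n` units remain for the induction hypothesis.
        · refine (costWithin_mono f (by omega : n + 1 ≤ n + 1 + 1 + 1) _).trans ?_
          have hs : step 𝒜.w ⟨.load r a :: k, τ⟩ = PMF.pure ⟨k, τ.setReg r (τ.mem (τ.reg a))⟩ := by
            simp only [step, assign, hy]; rfl
          have e1 : step W ⟨(Prog.load r a :: k).map (Prog.reloc breg lreg tmp flag), σ⟩
              = PMF.pure ⟨.op .add tmp a breg :: .load r tmp :: k.map (Prog.reloc breg lreg tmp flag), σ⟩ := rfl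
          have e2 : step W ⟨.op .add tmp a breg :: .load r tmp :: k.map (Prog.reloc breg lreg tmp flag), σ⟩
              = PMF.pure ⟨.load r tmp :: k.map (Prog.reloc breg lreg tmp flag), σ.setReg tmp (τ.reg a + base)⟩ := by
            simp [step, assign, BinOp.eval, h1, hbr, addr a hP.2]
          have hmem : σ.mem (τ.reg a + base) = τ.mem (τ.reg a) := by
            rw [add_comm]; exact hm.2 _
          have e3 : step W ⟨.load r tmp :: k.map (Prog.reloc breg lreg tmp flag), σ.setReg tmp (τ.reg a + base)⟩
              = PMF.pure ⟨k.map (Prog.reloc breg lreg tmp flag),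
                (σ.setReg tmp (τ.reg a + base)).setReg r (τ.mem (τ.reg a))⟩ := by
            simp [step, assign, hmem, hy.trans_le hW]
          rw [costWithin, if_neg (by simp), e1, expect_pure, costWithin, if_neg (by simp), e2,
            expect_pure, costWithin, if_neg (by simp), e3, expect_pure, hrem, hs, expect_pure,
            ← add_assoc, ← add_assoc]
          refine add_le_add (by norm_num) (ih ⟨k, _⟩ _ (hgood _ (by simp [hs])) ?_ ?_)
          · exact (hm.setTmp ht _).setReg r _
          · exact (hu.setReg tmp _ (Or.inr (Or.inl rfl))).setReg r _ (Or.inl hP.1)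
        · exact stuck (by simp [step, assign, hy])
      | store a b =>
        have h1 : σ.reg a = τ.reg a := hm.1 a hP.1
        have h2 : σ.reg b = τ.reg b := hm.1 b hP.2
        refine (costWithin_mono f (by omega : n + 1 ≤ n + 1 + 1 + 1) _).trans ?_
        have hs : step 𝒜.w ⟨.store a b :: k, τ⟩ = PMF.pure ⟨k, τ.setMem (τ.reg a) (τ.reg b)⟩ := rfl
        have e1 : step W ⟨(Prog.store a b :: k).map (Prog.reloc breg lreg tmp flag), σ⟩
            = PMF.pure ⟨.op .add tmp a breg :: .store tmp b :: k.map (Prog.reloc breg lreg tmp flag), σ⟩ := rfl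
        have e2 : step W ⟨.op .add tmp a breg :: .store tmp b :: k.map (Prog.reloc breg lreg tmp flag), σ⟩
            = PMF.pure ⟨.store tmp b :: k.map (Prog.reloc breg lreg tmp flag), σ.setReg tmp (τ.reg a + base)⟩ := by
          simp [step, assign, BinOp.eval, h1, hbr, addr a hP.1]
        have e3 : step W ⟨.store tmp b :: k.map (Prog.reloc breg lreg tmp flag), σ.setReg tmp (τ.reg a + base)⟩
            = PMF.pure ⟨k.map (Prog.reloc breg lreg tmp flag),
              (σ.setReg tmp (τ.reg a + base)).setMem (base + τ.reg a) (τ.reg b)⟩ := by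
          have : b ≠ tmp := by have := hP.2; omega
          simp [step, Store.setReg_reg, this, h2, add_comm]
        rw [costWithin, if_neg (by simp), e1, expect_pure, costWithin, if_neg (by simp), e2,
          expect_pure, costWithin, if_neg (by simp), e3, expect_pure, hrem, hs, expect_pure,
          ← add_assoc, ← add_assoc]
        refine add_le_add (by norm_num) (ih ⟨k, _⟩ _ (hgood _ (by simp [hs])) ?_ ?_)
        · refine ⟨(hm.setTmp ht _).1, fun u => ?_⟩
          have := hm.2 u
          simp only [Store.setMem, Function.update_apply, Store.setReg_mem, this, add_right_inj]
        · refine ⟨(hu.setReg tmp _ (Or.inr (Or.inl rfl))).1, fun u hu' => ?_⟩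
          simp only [Store.setMem, Function.update_apply, Store.setReg_mem]
          rw [if_neg (by omega)]
          exact hu.2 u hu'
      | rand r a =>
        have h1 : σ.reg a = τ.reg a := hm.1 a hP.2
        rcases hra : τ.reg a with _ | m
        · exact stuck (by simp [step, hra])
        · have hs : step 𝒜.w ⟨.rand r a :: k, τ⟩ = (PMF.uniformOfFintype (Fin (m + 1))).map
              fun i => assign 𝒜.w r i.val k ⟨.rand r a :: k, τ⟩ := by simp [step, hra]
          have hsup : ∀ i : Fin (m + 1), assign 𝒜.w r i.val k ⟨.rand r a :: k, τ⟩
              ∈ (step 𝒜.w ⟨.rand r a :: k, τ⟩).support := by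
            intro i
            rw [hs, PMF.mem_support_map_iff]
            exact ⟨i, by simp, rfl⟩
          rw [hs] at hsup
          set G : Config → ℝ≥0∞ := fun r => 12 * 𝒜.remaining ⟨ph, r, pend, ans⟩ + x with hG
          set p := PMF.uniformOfFintype (Fin (m + 1)) with hp
          set y := expect p fun i => G (assign 𝒜.w r i.val k ⟨.rand r a :: k, τ⟩) with hy
          rw [hs, expect_map] at hrem
          change G ⟨.rand r a :: k, τ⟩ = 12 + y at hrem
          have hmD : m + 1 ≤ 2 ^ W := by
            have := hsmall.reg a
            simp only at this
            omega
          have hW0 : 1 < 2 ^ W := by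
            have := hsmall.reg a
            simp only at this
            omega
          -- the loop that draws random numbers
          have hloop : ∀ n' ≤ n, ∀ σ' : Store, σ'.reg flag ≠ 0 → Match 𝒜.R base τ σ' →
              Untouched 𝒜.R base tmp flag σ₀ σ' →
              costWithin W f n' ⟨.loop flag (.seq (.rand tmp a) (.op .lt flag lreg tmp)) ::
                .op .bor r tmp tmp :: k.map (Prog.reloc breg lreg tmp flag), σ'⟩ ≤ 8 + y := by
            intro n'
            induction n' with
            | zero => intro _ σ' _ _ _; exact zero_le
            | succ n' ih' =>
              intro hn' σ' hfl' hm' hu'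
              refine (costWithin_mono f (by omega : n' + 1 ≤ n' + 1 + 1 + 1 + 1) _).trans ?_
              have ha' : σ'.reg a = m + 1 := (hm'.1 a hP.2).trans hra
              have hl' : σ'.reg lreg + 1 = 2 ^ 𝒜.w := by
                rw [hu'.1 lreg hl htl.symm hfl.symm, hlreg]
              set L := Prog.loop flag (.seq (.rand tmp a) (.op .lt flag lreg tmp)) with hL
              set K := Prog.op .bor r tmp tmp :: k.map (Prog.reloc breg lreg tmp flag) with hK
              have e1 : step W ⟨L :: K, σ'⟩
                  = PMF.pure ⟨.seq (.rand tmp a) (.op .lt flag lreg tmp) :: L :: K, σ'⟩ := by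
                simp [step, hL, hfl']
              have e2 : step W ⟨.seq (.rand tmp a) (.op .lt flag lreg tmp) :: L :: K, σ'⟩
                  = PMF.pure ⟨.rand tmp a :: .op .lt flag lreg tmp :: L :: K, σ'⟩ := rfl
              have e3 : step W ⟨.rand tmp a :: .op .lt flag lreg tmp :: L :: K, σ'⟩
                  = p.map fun i => ⟨.op .lt flag lreg tmp :: L :: K, σ'.setReg tmp i.val⟩ := by
                simp only [step, ha']
                congr 1
                ext i
                simp [assign, i.isLt.trans_le hmD]
              rw [costWithin, if_neg (by simp), e1, expect_pure, costWithin, if_neg (by simp), e2,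
                expect_pure, costWithin, if_neg (by simp), e3, expect_map]
              have e4 : expect p (costWithin W f (n' + 1) ∘
                  fun i => ⟨.op .lt flag lreg tmp :: L :: K, σ'.setReg tmp i.val⟩)
                  ≤ expect p fun i => 5 + G (assign 𝒜.w r i.val k ⟨.rand r a :: k, τ⟩) := by
                refine expect_mono fun i _ => ?_
                have e5 : step W ⟨.op .lt flag lreg tmp :: L :: K, σ'.setReg tmp i.val⟩
                    = PMF.pure ⟨L :: K, (σ'.setReg tmp i.val).setReg flag
                      (if i.val < 2 ^ 𝒜.w then 0 else 1)⟩ := by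
                  have e6 : BinOp.lt.eval ((σ'.setReg tmp i.val).reg lreg) ((σ'.setReg tmp i.val).reg tmp)
                      = if i.val < 2 ^ 𝒜.w then 0 else 1 := by
                    simp only [BinOp.eval, Store.setReg_reg, htl.symm, if_false, if_true]
                    split_ifs <;> omega
                  simp only [step, e6, assign]
                  rw [if_pos]
                  split_ifs <;> omega
                rw [Function.comp_apply, costWithin, if_neg (by simp), e5, expect_pure]
                have hm2 := (hm'.setTmp ht i.val).setTmp htf (if i.val < 2 ^ 𝒜.w then 0 else 1)
                have hu2 := (hu'.setReg tmp i.val (Or.inr (Or.inl rfl))).setReg flag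
                  (if i.val < 2 ^ 𝒜.w then 0 else 1) (Or.inr (Or.inr rfl))
                by_cases hi : i.val < 2 ^ 𝒜.w
                · rw [if_pos hi] at hm2 hu2 ⊢
                  refine (add_le_add le_rfl
                    (costWithin_mono f (by omega : n' ≤ n' + 1 + 1) _)).trans ?_
                  have e7 : step W ⟨L :: K, (σ'.setReg tmp i.val).setReg flag 0⟩
                      = PMF.pure ⟨K, (σ'.setReg tmp i.val).setReg flag 0⟩ := by
                    simp [step, hL]
                  have e8 : step W ⟨K, (σ'.setReg tmp i.val).setReg flag 0⟩
                      = PMF.pure ⟨k.map (Prog.reloc breg lreg tmp flag),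
                        ((σ'.setReg tmp i.val).setReg flag 0).setReg r i.val⟩ := by
                    simp [step, hK, assign, BinOp.eval, Store.setReg_reg, hft.symm,
                      i.isLt.trans_le hmD]
                  have e9 : assign 𝒜.w r i.val k ⟨.rand r a :: k, τ⟩ = ⟨k, τ.setReg r i.val⟩ := by
                    simp [assign, hi]
                  rw [costWithin, if_neg (by simp), e7, expect_pure, costWithin,
                    if_neg (by simp [hK]), e8, expect_pure, e9, ← add_assoc, ← add_assoc]
                  refine add_le_add (by norm_num) ((costWithin_mono f (by omega : n' ≤ n) _).trans
                    (ih ⟨k, _⟩ _ ?_ (hm2.setReg r _) (hu2.setReg r _ (Or.inl hP.1))))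
                  rw [← e9]
                  exact hgood _ (by rw [hs]; exact hsup i)
                -- A rejected number: the simulated machine is back in the same configuration, whose
                -- remaining time provides another twelve credits. They pay for the next round of
                -- the loop.
                · rw [if_neg hi] at hm2 hu2 ⊢
                  have e9 : assign 𝒜.w r i.val k ⟨.rand r a :: k, τ⟩ = ⟨.rand r a :: k, τ⟩ := by
                    simp [assign, hi]
                  rw [e9, hrem]
                  refine (add_le_add le_rfl (ih' (by omega) _ (by simp) hm2 hu2)).trans ?_
                  rw [← add_assoc, ← add_assoc]
                  exact add_le_add (by norm_num) le_rfl
              refine (add_le_add le_rfl (add_le_add le_rfl (add_le_add le_rfl e4))).trans ?_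
              rw [expect_add, expect_const, ← hy, ← add_assoc, ← add_assoc, ← add_assoc]
              exact add_le_add (by norm_num) le_rfl
          change _ ≤ G ⟨.rand r a :: k, τ⟩
          rw [hrem]
          refine (costWithin_mono f (by omega : n + 1 ≤ n + 1 + 1 + 1) _).trans ?_
          set L := Prog.loop flag (.seq (.rand tmp a) (.op .lt flag lreg tmp)) with hL
          have e1 : step W ⟨(Prog.rand r a :: k).map (Prog.reloc breg lreg tmp flag), σ⟩
              = PMF.pure ⟨.const flag 1 :: .seq L (.op .bor r tmp tmp) ::
                k.map (Prog.reloc breg lreg tmp flag), σ⟩ := rfl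
          have e2 : step W ⟨.const flag 1 :: .seq L (.op .bor r tmp tmp) ::
              k.map (Prog.reloc breg lreg tmp flag), σ⟩ = PMF.pure ⟨.seq L (.op .bor r tmp tmp) ::
                k.map (Prog.reloc breg lreg tmp flag), σ.setReg flag 1⟩ := by
            simp only [step, assign, if_pos hW0]
          have e3 : step W ⟨.seq L (.op .bor r tmp tmp) :: k.map (Prog.reloc breg lreg tmp flag),
              σ.setReg flag 1⟩ = PMF.pure ⟨L :: .op .bor r tmp tmp ::
                k.map (Prog.reloc breg lreg tmp flag), σ.setReg flag 1⟩ := rfl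
          rw [costWithin, if_neg (by simp), e1, expect_pure, costWithin, if_neg (by simp), e2,
            expect_pure, costWithin, if_neg (by simp), e3, expect_pure]
          refine (add_le_add le_rfl (add_le_add le_rfl (add_le_add le_rfl (hloop n le_rfl _ (by simp)
            (hm.setTmp htf 1) (hu.setReg flag 1 (Or.inr (Or.inr rfl))))))).trans ?_
          rw [← add_assoc, ← add_assoc, ← add_assoc]
          exact add_le_add (by norm_num) le_rfl
      | seq P Q => exact one ⟨P :: Q :: k, τ⟩ σ rfl rfl hm hu
      | cond a P Q =>
        have h1 : σ.reg a = τ.reg a := hm.1 a hP.1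
        refine one ⟨(if τ.reg a ≠ 0 then P else Q) :: k, τ⟩ σ rfl ?_ hm hu
        simp only [List.map_cons, step, Prog.reloc, h1]
        split_ifs <;> rfl
      | loop a P =>
        have h1 : σ.reg a = τ.reg a := hm.1 a hP.1
        refine one ⟨if τ.reg a ≠ 0 then P :: .loop a P :: k else k, τ⟩ σ rfl ?_ hm hu
        simp only [List.map_cons, step, Prog.reloc, h1]
        split_ifs <;> rfl

end DynRun

/-! ## Variables of the main program -/

namespace Var

abbrev n : ℕ := 0
abbrev N : ℕ := 1
abbrev e : ℕ := 2
abbrev m : ℕ := 3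
abbrev mm : ℕ := 4
abbrev δ : ℕ := 5
abbrev β : ℕ := 6
abbrev stride : ℕ := 7
abbrev lim : ℕ := 8
abbrev ans : ℕ := 9
abbrev base : ℕ := 10
abbrev cnt : ℕ := 11
abbrev idx : ℕ := 12
abbrev round : ℕ := 13
abbrev bit : ℕ := 14
abbrev triple : ℕ := 15
abbrev p : ℕ := 16
abbrev i : ℕ := 17
abbrev q : ℕ := 18
abbrev I₀ : ℕ := 19
abbrev J₀ : ℕ := 20
abbrev K₀ : ℕ := 21
abbrev h : ℕ := 22

end Var

/-! ## Running a dynamic algorithm as a subroutine -/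

namespace Machine

/-- The program `P`, with its memory starting at the address in the variable `base`. -/
def relocate (R₀ : ℕ) (P : Prog) : Prog :=
  P.reloc (V R₀ Var.base) (V R₀ Var.lim) (Tmp R₀ 0) (Tmp R₀ 1)

/-- The environment `s` represents the store of `d`. -/
def Represents (R : ℕ) (s : Env) (d : DynConfig) : Prop :=
  (∀ r < R, s.low r = d.run.store.reg r) ∧ ∀ a, s.mem (s.reg Var.base + a) = d.run.store.mem a

variable {Γ : Machine} {𝒜 : DynRun}

/-- The procedure lives in the registers below `R₀` and the variables and temporaries lie above, so
only the temporaries `0` and `1` are lost. The budget is twelve times the expected remaining time of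
the whole dynamic run, and what remains of it at the end of this procedure is passed on. No bound
for a single request is ever needed. -/
theorem ARuns.relocate {P : Prog} {s : Env} {d : DynConfig} {x : ℝ≥0∞}
    {R : Env → ℝ≥0∞ → Prop} (hR : 𝒜.R = Γ.R₀) (hD : 𝒜.D ≤ Γ.X) (hS : 2 ≤ Γ.S)
    (hd : d.run.code = [P]) (hp : d.phase ≠ .done) (hg : 𝒜.Good d) (hm : Represents Γ.R₀ s d)
    (hlim : s.reg Var.lim + 1 = 2 ^ 𝒜.w)
    (h : ∀ d' s', 𝒜.Good d' → d'.phase = d.phase → d'.pending = d.pending →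
      d'.answers = d.answers → d'.run.code = [] → s'.reg = s.reg →
      (∀ a < s.reg Var.base, s'.mem a = s.mem a) → Represents Γ.R₀ s' d' →
      R s' (12 * 𝒜.remaining d' + x)) :
    Γ.ARuns (relocate Γ.R₀ P) s (12 * 𝒜.remaining d + x) R := by
  intro σ hσ
  obtain ⟨ph, ⟨l, τ⟩, pend, ans⟩ := d
  obtain rfl : l = [P] := hd
  -- Relocated addresses are sums of two numbers below `X`; these must still be words.
  have hXX : Γ.X + Γ.X ≤ 2 ^ Γ.w := by
    refine le_trans ?_ Γ.pow_le
    refine le_trans ?_ (Nat.pow_le_pow_right (by have := Γ.two_le; omega) hS)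
    have := Γ.two_le
    nlinarith
  have hwD := 𝒜.pow_le
  have hbase := hσ.below.1 Var.base
  refine iSup_le fun n => ?_
  have hm' : DynRun.Match 𝒜.R (s.reg Var.base) τ σ := by
    refine ⟨fun r hr => ?_, fun a => ?_⟩
    · rw [hR] at hr
      rw [hσ.low r hr]
      exact hm.1 r hr
    · rw [hσ.mem]; exact hm.2 a
  refine DynRun.costWithin_reloc_le (𝒜 := 𝒜) (σ₀ := σ) (base := s.reg Var.base)
    (breg := V Γ.R₀ Var.base) (lreg := V Γ.R₀ Var.lim) (tmp := Tmp Γ.R₀ 0) (flag := Tmp Γ.R₀ 1)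
    ph pend ans hp (by omega) (by omega)
    ?_ ?_ ?_ ?_ ?_ ?_ ?_ ?_ ?_ (hσ.reg _) (by rw [hσ.reg]; exact hlim) ?_ n ⟨[P], τ⟩ σ hg hm'
    ⟨fun _ _ _ _ => rfl, fun _ _ => rfl⟩
  any_goals simp only [V, Tmp, hR]; omega
  intro c σ' hg' hc hm2 hu
  refine leftover_le ⟨⟨s.reg, σ'.mem, fun r => if r < Γ.R₀ then σ'.reg r else s.low r⟩, ⟨?_, rfl, ?_, ?_⟩, ?_⟩
  · intro v
    rw [hu.1, hσ.reg] <;> simp only [V, Tmp, hR] <;> omega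
  · intro r hr
    simp [hr]
  · refine ⟨hσ.below.1, fun a => ?_, fun r => ?_⟩
    · dsimp only
      by_cases ha : a < s.reg Var.base
      · rw [hu.2 a ha, hσ.mem]; exact hσ.below.2.1 a
      · obtain ⟨b, rfl⟩ := Nat.exists_eq_add_of_le (Nat.not_lt.1 ha)
        rw [hm2.2]
        exact (hg'.small.store.mem b).trans_le hD
    · dsimp only
      split_ifs with hr
      · rw [hm2.1 r (by omega)]
        exact (hg'.small.store.reg r).trans_le hD
      · exact hσ.below.2.2 r
  · refine h ⟨ph, c, pend, ans⟩ _ hg' rfl rfl rfl hc rfl (fun a ha => ?_) ⟨fun r hr => ?_, hm2.2⟩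
    · rw [← hσ.mem]; exact hu.2 a ha
    · simp only [hr, if_true]
      exact hm2.1 r (by omega)

/-- The number of queries in a sequence of requests. -/
def queryCount : List Request → ℕ
  | [] => 0
  | .query :: rs => queryCount rs + 1
  | .update _ :: rs => queryCount rs

/-- The state between two requests: the answers so far are stored from the address `ans` on, in a
region with room for `Q` answers; apart from that, only the variables `cnt` and `idx`, and the memory
of the dynamic algorithm, differ from `s₀`. -/
structure Idle (𝒜 : DynRun) (R Q : ℕ) (s₀ s : Env) (d : DynConfig) : Prop where
  good : 𝒜.Good d
  phase : d.phase ≠ .done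
  code : d.run.code = []
  repr : Represents R s d
  reg : ∀ v, v ≠ Var.cnt → v ≠ Var.idx → s.reg v = s₀.reg v
  cnt : s.reg Var.cnt = d.allAnswers.length
  answers : ∀ i (hi : i < d.allAnswers.length), s.mem (s₀.reg Var.ans + i) = d.allAnswers[i]
  room : d.allAnswers.length + queryCount d.pending ≤ Q
  mem : ∀ a < s₀.reg Var.base, a < s₀.reg Var.ans ∨ s₀.reg Var.ans + Q ≤ a → s.mem a = s₀.mem a

/-- A request whose parameters are given by expressions. -/
inductive Cmd
  | upd (u v x : Expr)
  | qry

namespace Cmd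

def eval (s : Env) : Cmd → Request
  | upd u v x => .update ⟨u.eval s, v.eval s, x.eval s⟩
  | qry => .query

def prog (R₀ : ℕ) (A : DynAlg) : Cmd → Prog
  | upd u v x => .seq (setLow R₀ 0 u) (.seq (setLow R₀ 1 v) (.seq (setLow R₀ 2 x)
      (relocate R₀ A.upd)))
  | qry => .seq (relocate R₀ A.qry) (.seq (write R₀ (.var Var.ans + .var Var.cnt) .reg0)
      (assign R₀ Var.cnt (.var Var.cnt + 1)))

def time : Cmd → ℕ
  | upd u v x => u.time + v.time + x.time + 20
  | qry => 30

/-- The parameters depend only on variables other than `cnt`, and they are of bounded size. -/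
def Stable (S : ℕ) : Cmd → Prop
  | upd u v x => (∀ s s' : Env, (∀ y ≠ Var.cnt, s.reg y = s'.reg y) →
      u.eval s = u.eval s' ∧ v.eval s = v.eval s' ∧ x.eval s = x.eval s') ∧
      u.size ≤ S ∧ v.size ≤ S ∧ x.size ≤ S
  | qry => True

theorem Stable.eval_eq {S : ℕ} {c : Cmd} (h : c.Stable S) {s s' : Env}
    (hs : ∀ y ≠ Var.cnt, s.reg y = s'.reg y) : c.eval s = c.eval s' := by
  cases c with
  | upd u v x => obtain ⟨h1, h2, h3⟩ := h.1 s s' hs; simp [eval, h1, h2, h3]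
  | qry => rfl

end Cmd

/-- Passing on a request is the step `nextRequest` of the dynamic run, which does not increase the
remaining time. After a query, register `0` is copied to the next free cell for answers. This
changes `cnt`, which is why stable commands must not depend on that variable. -/
theorem ARuns.cmd {Q : ℕ} {s₀ s : Env} {d : DynConfig} {rs : List Request} {c : Cmd} {x : ℝ≥0∞}
    {R : Env → ℝ≥0∞ → Prop}
    (hR : 𝒜.R = Γ.R₀) (hD : 𝒜.D ≤ Γ.X) (hS : 10 ≤ Γ.S) (hlim : s₀.reg Var.lim + 1 = 2 ^ 𝒜.w)
    (hroom : s₀.reg Var.ans + Q ≤ s₀.reg Var.base) (hQX : Q < Γ.X)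
    (hI : Idle 𝒜 Γ.R₀ Q s₀ s d) (hc : c.Stable Γ.S) (hpend : d.pending = c.eval s :: rs)
    (h : ∀ s' d', Idle 𝒜 Γ.R₀ Q s₀ s' d' → d'.pending = rs →
      (∀ v ≠ Var.cnt, s'.reg v = s.reg v) → R s' (12 * 𝒜.remaining d' + x)) :
    Γ.ARuns (c.prog Γ.R₀ 𝒜.A) s (12 * 𝒜.remaining d + x + c.time) R := by
  have hgn := DynRun.good_next hI.good hI.phase hI.code
  have hrem : 12 * 𝒜.remaining (𝒜.A.nextRequest d) ≤ 12 * 𝒜.remaining d :=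
    mul_le_mul_right (DynRun.remaining_next_le hI.phase hI.code) _
  have hans := DynRun.nextRequest_answers (𝒜 := 𝒜) d
  have h3 := Γ.three_le
  have hregs : ∀ v, v ≠ Var.cnt → v ≠ Var.idx → s.reg v = s₀.reg v := hI.reg
  cases c with
  | upd u v y =>
    set e : Update := ⟨u.eval s, v.eval s, y.eval s⟩ with he
    have hsm := hI.good.pending e (by rw [hpend]; simp [Cmd.eval, he])
    have hd' : 𝒜.A.nextRequest d = ⟨.update, ⟨[𝒜.A.upd],
        ((d.run.store.setReg 0 e.u).setReg 1 e.v).setReg 2 e.x⟩, rs, d.allAnswers⟩ := by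
      unfold DynAlg.nextRequest
      rw [hpend]
      rfl
    set d₁ := 𝒜.A.nextRequest d with hd₁
    have htime : 12 * 𝒜.remaining d + x + ((Cmd.upd u v y).time : ℕ)
        = (12 * 𝒜.remaining d + x + 11) + (y.time + 2 : ℕ) + 1 + (v.time + 2 : ℕ) + 1
          + (u.time + 2 : ℕ) + 1 := by
      simp only [Cmd.time]; push_cast; ring
    rw [htime]
    have hu := (hc.1 s · ·)
    refine ARuns.seq (ARuns.setLow (by omega) hc.2.1 (hsm.1.trans_le hD) ?_)
    have s1 := hc.1 s (s.setLow 0 (u.eval s)) (fun _ _ => rfl)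
    refine ARuns.seq (ARuns.setLow (by omega) hc.2.2.1 ?_ ?_)
    · rw [← s1.2.1]; exact hsm.2.1.trans_le hD
    rw [← s1.2.1]
    have s2 := hc.1 s ((s.setLow 0 (u.eval s)).setLow 1 (v.eval s)) (fun _ _ => rfl)
    refine ARuns.seq (ARuns.setLow (by omega) hc.2.2.2 ?_ ?_)
    · rw [← s2.2.2]; exact hsm.2.2.trans_le hD
    rw [← s2.2.2]
    refine (ARuns.relocate (𝒜 := 𝒜) (d := d₁) (x := x) hR hD (by omega) (by rw [hd']) (by rw [hd']; simp)
      hgn ⟨fun r hr => ?_, fun a => ?_⟩ ?_ ?_).mono ?_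
    · have := hI.repr.1 r hr
      rw [hd']
      simp only [Store.setReg_reg, Env.setLow, Function.update_apply, this, he]
    · rw [hd']
      exact hI.repr.2 a
    · change s.reg Var.lim + 1 = _
      rw [hregs _ (by decide) (by decide), hlim]
    · intro d' s' hg' hph' hpe' han' hco' hre' hme' hrp'
      have hall : d'.allAnswers = d.allAnswers := by
        unfold DynConfig.allAnswers
        rw [hph', han', hd']
        rfl
      have hre2 : s'.reg = s.reg := hre'
      have hbb : s.reg Var.base = s₀.reg Var.base := hregs _ (by decide) (by decide)
      have hme2 : ∀ a < s₀.reg Var.base, s'.mem a = s.mem a := fun a ha => hme' a (by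
        change a < s.reg Var.base; omega)
      refine h s' d' ⟨hg', by rw [hph', hd']; simp, hco', hrp', ?_, ?_, ?_, ?_, ?_⟩ ?_ ?_
      · intro v h1 h2; rw [hre2]; exact hregs v h1 h2
      · rw [hre2, hall]; exact hI.cnt
      · intro i hi
        have hi' : i < d.allAnswers.length := by rw [← hall]; exact hi
        have := hI.room
        rw [hme2 _ (by omega), hI.answers i hi']
        simp [hall]
      · have := hI.room
        rw [hpend] at this
        rw [hall, hpe', hd']
        exact this
      · intro a ha1 ha2
        rw [hme2 a ha1]; exact hI.mem a ha1 ha2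
      · rw [hpe', hd']
      · intro v _; rw [hre2]
    · exact (add_le_add hrem le_rfl).trans le_self_add
  | qry =>
    have hd' : 𝒜.A.nextRequest d = ⟨.query, ⟨[𝒜.A.qry], d.run.store⟩, rs, d.allAnswers⟩ := by
      unfold DynAlg.nextRequest
      rw [hpend]
      rfl
    set d₁ := 𝒜.A.nextRequest d with hd₁
    have htime : 12 * 𝒜.remaining d + x + ((Cmd.qry).time : ℕ)
        = (12 * 𝒜.remaining d + (x + 29)) + 1 := by
      simp only [Cmd.time]; push_cast; ring
    rw [htime]
    refine ARuns.seq ((ARuns.relocate (𝒜 := 𝒜) (d := d₁) (x := x + 29) hR hD (by omega) (by rw [hd'])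
      (by rw [hd']; simp) hgn ⟨fun r hr => ?_, fun a => ?_⟩ ?_ ?_).mono (add_le_add hrem le_rfl))
    · rw [hd']; exact hI.repr.1 r hr
    · rw [hd']; exact hI.repr.2 a
    · rw [hregs _ (by decide) (by decide), hlim]
    · intro d' s' hg' hph' hpe' han' hco' hre' hme' hrp'
      have hall : d'.allAnswers = d.allAnswers ++ [s'.low 0] := by
        unfold DynConfig.allAnswers
        rw [hph', han', hd']
        rw [hrp'.1 0 (by omega)]
        rfl
      have hbb : s.reg Var.base = s₀.reg Var.base := hregs _ (by decide) (by decide)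
      have hme2 : ∀ a < s₀.reg Var.base, s'.mem a = s.mem a := fun a ha => hme' a (by omega)
      have haa : s'.reg Var.ans = s₀.reg Var.ans := by
        rw [hre']; exact hregs _ (by decide) (by decide)
      have hcc : s'.reg Var.cnt = d.allAnswers.length := by rw [hre']; exact hI.cnt
      have hroom' := hI.room
      rw [hpend, Cmd.eval, queryCount] at hroom'
      refine ARuns.of_below fun hb => ?_
      have ht2 : 12 * 𝒜.remaining d' + (x + 29)
          = (12 * 𝒜.remaining d' + x + 12 + ((Expr.var Var.cnt + 1).time + 2 : ℕ))
            + ((Expr.var Var.ans + Expr.var Var.cnt).time + Expr.reg0.time + 3 : ℕ) + 1 := by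
        have e1 : (Expr.var Var.cnt + 1).time = 5 := rfl
        have e2 : (Expr.var Var.ans + Expr.var Var.cnt).time = 5 := rfl
        have e3 : Expr.reg0.time = 1 := rfl
        rw [e1, e2, e3]; push_cast; ring
      rw [ht2]
      refine ARuns.seq (ARuns.write (by simp; omega) (by simp; omega) (hb.2.2 0) ?_)
      refine ARuns.conseq (R := fun s'' y => s'' = (s'.setMem (s'.reg Var.ans + s'.reg Var.cnt)
        (s'.low 0)).setReg Var.cnt (s'.reg Var.cnt + 1) ∧ y = 12 * 𝒜.remaining d' + x + 12)
        (ARuns.assign (by simp; omega) ?_ ⟨rfl, rfl⟩) ?_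
      · simp only [Expr.eval_add, Expr.eval_var, Expr.eval_ofNat, Env.setMem]
        rw [hcc]; omega
      rintro s'' y _ ⟨rfl, rfl⟩
      refine ⟨_, le_self_add, h _ d' ⟨hg', by rw [hph', hd']; simp, hco', ⟨hrp'.1, fun a => ?_⟩,
        ?_, ?_, ?_, ?_, ?_⟩ ?_ ?_⟩
      · have := hrp'.2 a
        simp only [Env.setReg_mem, Env.setMem, Env.setReg_reg, Function.update_apply]
        rw [if_neg (show ¬ (Var.base = Var.cnt) by decide), if_neg (by rw [haa, hcc, hre', hbb]; omega)]
        exact this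
      · intro v h1 h2
        simp only [Env.setReg_reg, Env.setMem, if_neg h1]
        rw [hre']; exact hregs v h1 h2
      · simp [hall, hcc]
      · intro i hi
        rw [hall] at hi
        simp only [List.length_append, List.length_singleton] at hi
        simp only [hall, Env.setReg_mem, Env.setMem, Function.update_apply, haa, hcc,
          add_right_inj]
        by_cases hi' : i = d.allAnswers.length
        · subst hi'
          simp
        · have hi2 : i < d.allAnswers.length := by omega
          rw [if_neg hi', hme2 _ (by omega), hI.answers i hi2, List.getElem_append_left hi2]
      · rw [hall, hpe', hd']
        simp only [List.length_append, List.length_singleton]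
        omega
      · intro a ha1 ha2
        simp only [Env.setReg_mem, Env.setMem, Function.update_apply]
        rw [if_neg (by rw [haa, hcc]; omega), hme2 a ha1]
        exact hI.mem a ha1 ha2
      · rw [hpe', hd']
      · intro v hv
        simp only [Env.setReg_reg, Env.setMem, if_neg hv, hre']

/-- Execute a list of commands. -/
def cmdsProg (R₀ : ℕ) (A : DynAlg) : List Cmd → Prog
  | [] => .skip
  | c :: cs => .seq (c.prog R₀ A) (cmdsProg R₀ A cs)

def cmdsTime : List Cmd → ℕ
  | [] => 1
  | c :: cs => c.time + 1 + cmdsTime cs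

theorem ARuns.cmds {Q : ℕ} {s₀ : Env}
    (hR : 𝒜.R = Γ.R₀) (hD : 𝒜.D ≤ Γ.X) (hS : 10 ≤ Γ.S) (hlim : s₀.reg Var.lim + 1 = 2 ^ 𝒜.w)
    (hroom : s₀.reg Var.ans + Q ≤ s₀.reg Var.base) (hQX : Q < Γ.X) (cs : List Cmd) :
    ∀ {s : Env} {d : DynConfig} {rs : List Request} {x : ℝ≥0∞} {R : Env → ℝ≥0∞ → Prop},
    Idle 𝒜 Γ.R₀ Q s₀ s d → (∀ c ∈ cs, c.Stable Γ.S) → d.pending = cs.map (Cmd.eval s) ++ rs →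
    (∀ s' d', Idle 𝒜 Γ.R₀ Q s₀ s' d' → d'.pending = rs →
      (∀ v ≠ Var.cnt, s'.reg v = s.reg v) → R s' (12 * 𝒜.remaining d' + x)) →
    Γ.ARuns (cmdsProg Γ.R₀ 𝒜.A cs) s (12 * 𝒜.remaining d + x + cmdsTime cs) R := by
  induction cs with
  | nil =>
    intro s d rs x R hI _ hp h
    rw [cmdsTime, Nat.cast_one]
    exact ARuns.skip (h s d hI hp fun _ _ => rfl)
  | cons c cs ih =>
    intro s d rs x R hI hst hp h
    have ht : 12 * 𝒜.remaining d + x + (cmdsTime (c :: cs) : ℕ)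
        = 12 * 𝒜.remaining d + (x + cmdsTime cs) + c.time + 1 := by
      rw [cmdsTime]; push_cast; ring
    rw [ht]
    refine ARuns.seq (ARuns.cmd hR hD hS hlim hroom hQX hI (hst c (by simp)) hp fun s' d' hI' hp' hv => ?_)
    rw [← add_assoc]
    refine ih hI' (fun c' hc' => hst c' (by simp [hc'])) ?_ fun s'' d'' h1 h2 h3 =>
      h s'' d'' h1 h2 fun v hv' => (h3 v hv').trans (hv v hv')
    -- The later commands were announced with the values of the variables at the beginning; by
    -- stability their parameters are still the same.
    rw [hp']
    congr 1
    refine List.map_congr_left fun c' hc' => ?_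
    exact (hst c' (by simp [hc'])).eval_eq fun y hy => (hv y hy).symm

/-- The requests that the commands give for the values `j, …, j + k - 1` of the variable `idx`. -/
def requestsFrom (cs : List Cmd) (s : Env) (j k : ℕ) : List Request :=
  (List.range' j k).flatMap fun i => cs.map (Cmd.eval (s.setReg Var.idx i))

theorem requestsFrom_succ (cs : List Cmd) (s : Env) (j k : ℕ) :
    requestsFrom cs s j (k + 1)
      = cs.map (Cmd.eval (s.setReg Var.idx j)) ++ requestsFrom cs s (j + 1) k := by
  simp [requestsFrom, List.range'_succ]

/-- Clear the registers below `k`. -/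
def clearLow (R₀ : ℕ) : ℕ → Prog
  | 0 => .skip
  | k + 1 => .seq (clearLow R₀ k) (setLow R₀ k (.const 0))

theorem ARuns.clearLow {s : Env} {R : Env → ℝ≥0∞ → Prop} (hS : 10 ≤ Γ.S) {k : ℕ} (hk : k ≤ Γ.R₀)
    {T : ℝ≥0∞} (h : R { s with low := fun r => if r < k then 0 else s.low r } T) :
    Γ.ARuns (clearLow Γ.R₀ k) s (T + (4 * k + 1 : ℕ)) R := by
  induction k generalizing T R with
  | zero =>
    rw [mul_zero, zero_add, Nat.cast_one]
    exact ARuns.skip (by simpa using h)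
  | succ k ih =>
    have : T + ((4 * (k + 1) + 1 : ℕ) : ℝ≥0∞)
        = T + ((Expr.const 0).time + 2 : ℕ) + (4 * k + 1 : ℕ) + 1 := by
      have e1 : (Expr.const 0).time = 1 := rfl
      rw [e1]; push_cast; ring
    rw [this]
    refine ARuns.seq (ih (by omega) (ARuns.setLow (by omega) (by simp; omega)
      (by have := Γ.two_le; simp; omega) ?_))
    convert h using 1
    simp only [Env.setLow, Expr.eval_const, Env.mk.injEq, true_and]
    ext r
    simp only [Function.update_apply]
    grind

/-- Run a dynamic algorithm on the input in the memory from the address `base` on, with the given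
values of the first three registers; the requests are given by the commands `cs`. -/
def callProg (R₀ : ℕ) (A : DynAlg) (e₀ e₁ e₂ : Expr) (cs : List Cmd) : Prog :=
  .seq (clearLow R₀ R₀) (.seq (setLow R₀ 0 e₀) (.seq (setLow R₀ 1 e₁) (.seq (setLow R₀ 2 e₂)
    (.seq (relocate R₀ A.prep) (.seq (assign R₀ Var.cnt 0)
      (forLoop R₀ Var.idx (.var Var.N) (cmdsProg R₀ A cs)))))))

def callTime (R₀ : ℕ) (e₀ e₁ e₂ : Expr) (cs : List Cmd) (N : ℕ) : ℕ :=
  4 * R₀ + e₀.time + e₁.time + e₂.time + 50 + (cmdsTime cs + forTime (.var Var.N)) * (N + 1)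

/-- When no requests are pending, one more `nextRequest` enters the phase `done` with exactly the
stored answers, so a statement about the final configurations of the dynamic run applies to them.
Words of that run stay below `D`, hence cells from `base + D` on are still zero. The next call can
start there, and no memory is ever cleared. -/
theorem ARuns.call {s : Env} {e₀ e₁ e₂ : Expr} {cs : List Cmd} {Q : ℕ} {x : ℝ≥0∞}
    {R : Env → ℝ≥0∞ → Prop}
    (hR : 𝒜.R = Γ.R₀) (hD : 𝒜.D ≤ Γ.X) (hS : 20 ≤ Γ.S) (hlim : s.reg Var.lim + 1 = 2 ^ 𝒜.w)
    (hroom : s.reg Var.ans + Q ≤ s.reg Var.base) (hQX : Q < Γ.X) (hcs : ∀ c ∈ cs, c.Stable Γ.S)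
    (hQ : queryCount 𝒜.rs ≤ Q)
    (hrs : 𝒜.rs = requestsFrom cs s 0 (s.reg Var.N))
    (hin : ∀ a, s.mem (s.reg Var.base + a) = 𝒜.input.mem a)
    (he : e₀.size ≤ Γ.S ∧ e₁.size ≤ Γ.S ∧ e₂.size ≤ Γ.S)
    (heq : ∀ s' : Env, s'.reg = s.reg → e₀.eval s' = 𝒜.input.reg 0 ∧ e₁.eval s' = 𝒜.input.reg 1 ∧
      e₂.eval s' = 𝒜.input.reg 2)
    (hzero : ∀ r, 3 ≤ r → 𝒜.input.reg r = 0)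
    (h : ∀ s' d, (∃ t, d ∈ (iter (𝒜.A.dynStep 𝒜.w) (𝒜.A.start 𝒜.input 𝒜.rs) t).support) →
      d.phase = .done → (∀ i (hi : i < d.answers.length), s'.mem (s.reg Var.ans + i) = d.answers[i]) →
      (∀ v, v ≠ Var.cnt → v ≠ Var.idx → s'.reg v = s.reg v) →
      (∀ a < s.reg Var.base, a < s.reg Var.ans ∨ s.reg Var.ans + Q ≤ a → s'.mem a = s.mem a) →
      (∀ a, s.reg Var.base + 𝒜.D ≤ a → s'.mem a = 0) → R s' x) :
    Γ.ARuns (callProg Γ.R₀ 𝒜.A e₀ e₁ e₂ cs) s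
      (12 * 𝒜.remaining (𝒜.A.start 𝒜.input 𝒜.rs) + x +
        callTime Γ.R₀ e₀ e₁ e₂ cs (s.reg Var.N)) R := by
  have h3 := Γ.three_le
  have hsm := 𝒜.input_small.reg
  refine ARuns.of_below fun hbel => ?_
  set N := s.reg Var.N with hN
  set ρ := 12 * 𝒜.remaining (𝒜.A.start 𝒜.input 𝒜.rs) with hρ
  have htime : ρ + x + (callTime Γ.R₀ e₀ e₁ e₂ cs N : ℕ)
      = ρ + (x + (37 + (cmdsTime cs + forTime (.var Var.N)) * (N + 1) : ℕ)) + 1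
        + (e₂.time + 2 : ℕ) + 1 + (e₁.time + 2 : ℕ) + 1 + (e₀.time + 2 : ℕ) + 1
        + (4 * Γ.R₀ + 1 : ℕ) + 1 + 1 := by
    simp only [callTime]; push_cast; ring
  rw [htime]
  refine ARuns.mono (ARuns.seq (ARuns.clearLow (by omega) le_rfl ?_)) le_self_add
  obtain ⟨q0, q1, q2⟩ := heq { s with low := fun r => if r < Γ.R₀ then 0 else s.low r } rfl
  refine ARuns.seq (ARuns.setLow (by omega) he.1 (by rw [q0]; exact (hsm 0).trans_le hD) ?_)
  rw [q0]
  -- The argument expressions may read variables but not the low registers that are being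
  -- overwritten. `heq`, which refers to variables only, is therefore available again after each
  -- assignment.
  obtain ⟨q0', q1, q2⟩ := heq (Env.setLow { s with low := fun r => if r < Γ.R₀ then 0 else s.low r }
    0 (𝒜.input.reg 0)) rfl
  refine ARuns.seq (ARuns.setLow (by omega) he.2.1 (by rw [q1]; exact (hsm 1).trans_le hD) ?_)
  rw [q1]
  obtain ⟨q0', q1', q2⟩ := heq ((Env.setLow { s with low := fun r => if r < Γ.R₀ then 0 else s.low r }
    0 (𝒜.input.reg 0)).setLow 1 (𝒜.input.reg 1)) rfl
  refine ARuns.seq (ARuns.setLow (by omega) he.2.2 (by rw [q2]; exact (hsm 2).trans_le hD) ?_)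
  rw [q2]
  refine ARuns.seq (ARuns.relocate (𝒜 := 𝒜) (d := 𝒜.A.start 𝒜.input 𝒜.rs) hR hD (by omega) rfl
    (by simp [DynAlg.start]) DynRun.good_start ⟨fun r hr => ?_, fun a => ?_⟩ hlim ?_)
  · simp only [Env.setLow, Function.update_apply, hr, if_true, DynAlg.start]
    split_ifs with h1 h2 h3
    · rw [h1]
    · rw [h2]
    · rw [h3]
    · exact (hzero r (by omega)).symm
  · exact hin a
  intro d' s' hg' hph' hpe' han' hco' hre' hme' hrp'
  have hre2 : s'.reg = s.reg := hre'
  have hall : d'.allAnswers = [] := by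
    unfold DynConfig.allAnswers
    rw [hph', han']
    rfl
  have ht2 : 12 * 𝒜.remaining d' + (x + ((37 + (cmdsTime cs + forTime (.var Var.N)) * (N + 1) : ℕ)))
      = (((12 * 𝒜.remaining d' + (x + (cmdsTime cs * (N + 1) : ℕ)))
        + (forTime (.var Var.N) * (N + 1) : ℕ)) + ((0 : Expr).time + 2 : ℕ) + 1) + 33 := by
    have e1 : (0 : Expr).time = 1 := rfl
    rw [e1]; push_cast; ring
  rw [ht2]
  refine ARuns.mono (ARuns.seq (ARuns.assign (by simp; omega) (by have := Γ.two_le; simp; omega) ?_))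
    le_self_add
  have hQb : Q ≤ s.reg Var.base := by omega
  set Inv : ℕ → Env → ℝ≥0∞ → Prop := fun j s₁ y => j ≤ N ∧ s₁.reg Var.idx = j ∧
    ∃ d, Idle 𝒜 Γ.R₀ Q s s₁ d ∧ d.pending = requestsFrom cs s j (N - j) ∧
    y = 12 * 𝒜.remaining d + (x + (cmdsTime cs * (N - j + 1) : ℕ)) with hInv
  refine ARuns.conseq (R := Inv N) (ARuns.forLoop Inv (by simp; omega) (hbel.1 Var.N)
    (fun j s₁ y hi => hi.2.1) ?_ ?_ ?_ fun _ _ _ h => h) ?_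
  · rintro j s₁ y ⟨-, -, d, hI, -⟩
    exact hI.reg _ (by decide) (by decide)
  · refine ⟨by omega, by simp, d', ⟨hg', by rw [hph']; simp [DynAlg.start], hco', ⟨hrp'.1, ?_⟩, ?_, ?_, ?_, ?_, ?_⟩, ?_, ?_⟩
    · intro a
      have := hrp'.2 a
      simpa [Env.setReg_reg] using this
    · intro v h1 h2
      rw [Env.setReg_reg, if_neg h2, Env.setReg_reg, if_neg h1, hre2]
    · simp [hall, Env.setReg_reg]
    · intro i hi
      simp [hall] at hi
    · rw [hall, hpe']
      simpa [DynAlg.start] using hQ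
    · intro a ha _
      exact hme' a ha
    · rw [hpe', Nat.sub_zero, ← hrs]
      rfl
    · rfl
  · rintro j hj s₁ y _ ⟨-, hidx, d, hI, hpend, rfl⟩
    obtain ⟨k, hk⟩ : ∃ k, N - j = k + 1 := ⟨N - j - 1, by omega⟩
    have hk' : N - (j + 1) = k := by omega
    rw [hk, requestsFrom_succ] at hpend
    have ht3 : 12 * 𝒜.remaining d + (x + ((cmdsTime cs * (N - j + 1) : ℕ) : ℝ≥0∞))
        = 12 * 𝒜.remaining d + (x + (cmdsTime cs * (k + 1) : ℕ)) + cmdsTime cs := by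
      rw [hk]; push_cast; ring
    rw [ht3]
    refine ARuns.cmds hR hD (by omega) hlim hroom hQX cs hI hcs (rs := requestsFrom cs s (j + 1) k) ?_ ?_
    · rw [hpend]
      congr 1
      refine List.map_congr_left fun c hc => (hcs c hc).eval_eq fun v hv => ?_
      rw [Env.setReg_reg]
      split_ifs with h1
      · rw [h1, hidx]
      · exact (hI.reg v hv h1).symm
    · intro s₂ d₂ hI₂ hp₂ hv₂
      refine ⟨by rw [hv₂ _ (by decide), hidx], by omega, by simp, d₂, ?_, ?_, ?_⟩
      · obtain ⟨a1, a2, a3, a4, a5, a6, a7, a8, a9⟩ := hI₂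
        refine ⟨a1, a2, a3, ⟨a4.1, fun a => ?_⟩, fun v h1 h2 => ?_, ?_, a7, a8, a9⟩
        · simpa [Env.setReg_reg] using a4.2 a
        · rw [Env.setReg_reg, if_neg h2]; exact a5 v h1 h2
        · simpa [Env.setReg_reg] using a6
      · rw [hp₂, hk']
      · rw [hk']
  · rintro s₁ y hb ⟨-, hidx, d, hI, hpend, rfl⟩
    have hnext : 𝒜.A.nextRequest d = ⟨.done, d.run, [], d.allAnswers⟩ := by
      unfold DynAlg.nextRequest
      rw [hpend]
      simp [requestsFrom]
      rfl
    have hreach := DynRun.reach_next hI.good hI.phase hI.code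
    rw [hnext] at hreach
    refine ⟨x, le_self_add.trans le_add_self, h s₁ _ hreach rfl hI.answers hI.reg hI.mem ?_⟩
    intro a ha
    have hbb : s₁.reg Var.base = s.reg Var.base := hI.reg _ (by decide) (by decide)
    obtain ⟨b, rfl⟩ := Nat.exists_eq_add_of_le ha
    have := hI.repr.2 (𝒜.D + b)
    rw [hbb, ← add_assoc] at this
    rw [this]
    exact hI.good.small.store.zero _ (by omega)

end Machine

/-! ## The gadget

The vertices are `i < N`, `N + k`, `2 * N + j`, `3 * N + i`, the source `4 * N` and the sink
`4 * N + 1`. -/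

/-- Weights between three parts of size `N`. -/
structure Gadget where
  N : ℕ
  δ : ℕ
  x : ℕ → ℕ → ℕ
  y : ℕ → ℕ → ℕ
  z : ℕ → ℕ → ℕ
  N_pos : 0 < N
  δ_pos : 0 < δ
  hx : ∀ i k, δ ≤ x i k ∧ x i k ≤ 2 * δ
  hy : ∀ k j, δ ≤ y k j ∧ y k j ≤ 2 * δ
  hz : ∀ i j, δ ≤ z i j ∧ z i j ≤ 2 * δ

/-- Which of the edges at the source or sink are present when `a` of them have been updated. -/
def Mode.Present (a x : ℕ) : Mode → Prop
  | incremental => x < a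
  | decremental => a ≤ x

instance (a x : ℕ) : (mode : Mode) → Decidable (mode.Present a x)
  | .incremental => inferInstanceAs (Decidable (x < a))
  | .decremental => inferInstanceAs (Decidable (a ≤ x))

/-- The weight of the edges from the source to `i` and from `3 * N + i` to the sink. -/
def Mode.weight (N δ i : ℕ) : Mode → ℕ
  | incremental => 2 * δ * (N - i)
  | decremental => 2 * δ * (i + 1)

namespace Gadget

variable (G : Gadget) (mode : Mode)

/-- The weight of the edge from `u` to `v`; it is `0` if there is no edge. -/
def fwd (a b u v : ℕ) : ℕ :=
  if u = 4 * G.N ∧ v < G.N ∧ mode.Present a v then mode.weight G.N G.δ v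
  else if u < G.N ∧ G.N ≤ v ∧ v < 2 * G.N then G.x u (v - G.N)
  else if G.N ≤ u ∧ u < 2 * G.N ∧ 2 * G.N ≤ v ∧ v < 3 * G.N then G.y (u - G.N) (v - 2 * G.N)
  else if 2 * G.N ≤ u ∧ u < 3 * G.N ∧ 3 * G.N ≤ v ∧ v < 4 * G.N then G.z (v - 3 * G.N) (u - 2 * G.N)
  else if 3 * G.N ≤ u ∧ u < 4 * G.N ∧ v = 4 * G.N + 1 ∧ mode.Present b (u - 3 * G.N) then
    mode.weight G.N G.δ (u - 3 * G.N)
  else 0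

/-- There are `k` and `j` such that the triangle `i`, `k`, `j` is light. -/
def Light (i : ℕ) : Prop := ∃ k < G.N, ∃ j < G.N, G.x i k + G.y k j + G.z i j < 4 * G.δ

/-- A lower bound for the distances to the sink when no triangle at `i` is light. -/
def potential (i v : ℕ) : ℕ :=
  if v < G.N then mode.weight G.N G.δ i + 4 * G.δ - (if v = i then 0 else G.δ)
  else if v < 2 * G.N then mode.weight G.N G.δ i + 4 * G.δ - G.x i (v - G.N)
  else if v < 3 * G.N then mode.weight G.N G.δ i + G.z i (v - 2 * G.N)
  else if v < 4 * G.N then mode.weight G.N G.δ i + (if v = 3 * G.N + i then 0 else 2 * G.δ)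
  else if v = 4 * G.N then 2 * mode.weight G.N G.δ i + 4 * G.δ
  else 0

/-- The number `i` is one of the present ones with the least weight. -/
def Active (a i : ℕ) : Prop := i < G.N ∧ mode.Present a i ∧
  ∀ y < G.N, mode.Present a y → y ≠ i →
    mode.weight G.N G.δ i + 2 * G.δ ≤ mode.weight G.N G.δ y

variable {G mode}

/-- Deletions proceed from light to heavy terminal edges and insertions from heavy to light ones. In
both modes the vertex being queried has the lightest present edges, and neighbouring weights differ
by `2 * δ`. -/
theorem active_decremental {i : ℕ} (hi : i < G.N) : G.Active .decremental i i := by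
  refine ⟨hi, le_refl i, fun y _ h1 h2 => ?_⟩
  have h3 : i ≤ y := h1
  obtain ⟨d, rfl⟩ : ∃ d, y = i + 1 + d := ⟨y - i - 1, by omega⟩
  simp only [Mode.weight]
  nlinarith [Nat.zero_le (G.δ * d)]

theorem active_incremental {i : ℕ} (hi : i < G.N) : G.Active .incremental (i + 1) i := by
  refine ⟨hi, Nat.lt_succ_self i, fun y hy h1 h2 => ?_⟩
  have h3 : y < i + 1 := h1
  obtain ⟨d, hd⟩ : ∃ d, G.N - y = G.N - i + 1 + d := ⟨G.N - y - (G.N - i) - 1, by omega⟩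
  simp only [Mode.weight, hd]
  nlinarith [Nat.zero_le (G.δ * d)]

theorem weight_pos {i : ℕ} (hi : i < G.N) : 0 < mode.weight G.N G.δ i := by
  have := G.δ_pos
  cases mode
  · exact Nat.mul_pos (by omega) (by omega)
  · exact Nat.mul_pos (by omega) (by omega)

theorem weight_le {i : ℕ} (hi : i < G.N) : mode.weight G.N G.δ i ≤ 2 * G.δ * G.N := by
  cases mode
  · exact Nat.mul_le_mul_left _ (by omega)
  · exact Nat.mul_le_mul_left _ (by omega)

theorem fwd_cases {a b u v : ℕ} (h : G.fwd mode a b u v ≠ 0) :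
    (∃ i < G.N, mode.Present a i ∧ u = 4 * G.N ∧ v = i ∧ G.fwd mode a b u v = mode.weight G.N G.δ i) ∨
    (∃ i < G.N, ∃ k < G.N, u = i ∧ v = G.N + k ∧ G.fwd mode a b u v = G.x i k) ∨
    (∃ k < G.N, ∃ j < G.N, u = G.N + k ∧ v = 2 * G.N + j ∧ G.fwd mode a b u v = G.y k j) ∨
    (∃ j < G.N, ∃ i < G.N, u = 2 * G.N + j ∧ v = 3 * G.N + i ∧ G.fwd mode a b u v = G.z i j) ∨
    (∃ i < G.N, mode.Present b i ∧ u = 3 * G.N + i ∧ v = 4 * G.N + 1 ∧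
      G.fwd mode a b u v = mode.weight G.N G.δ i) := by
  unfold fwd at h ⊢
  split_ifs at h ⊢ with h1 h2 h3 h4 h5
  · exact Or.inl ⟨v, h1.2.1, h1.2.2, h1.1, rfl, rfl⟩
  · exact Or.inr (Or.inl ⟨u, h2.1, v - G.N, by omega, rfl, by omega, rfl⟩)
  · exact Or.inr (Or.inr (Or.inl ⟨u - G.N, by omega, v - 2 * G.N, by omega, by omega, by omega, rfl⟩))
  · exact Or.inr (Or.inr (Or.inr (Or.inl
      ⟨u - 2 * G.N, by omega, v - 3 * G.N, by omega, by omega, by omega, rfl⟩)))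
  · exact Or.inr (Or.inr (Or.inr (Or.inr
      ⟨u - 3 * G.N, by omega, h5.2.2.2, by omega, h5.2.2.1, rfl⟩)))
  · exact absurd rfl h

theorem fwd_source {a b i : ℕ} (hi : i < G.N) :
    G.fwd mode a b (4 * G.N) i = if mode.Present a i then mode.weight G.N G.δ i else 0 := by
  unfold fwd
  by_cases h : mode.Present a i
  · rw [if_pos ⟨rfl, hi, h⟩, if_pos h]
  · rw [if_neg (by tauto), if_neg (by omega), if_neg (by omega), if_neg (by omega), if_neg (by omega),
      if_neg h]

theorem fwd_x {a b i k : ℕ} (hi : i < G.N) (hk : k < G.N) :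
    G.fwd mode a b i (G.N + k) = G.x i k := by
  unfold fwd
  rw [if_neg (by omega), if_pos (by omega), Nat.add_sub_cancel_left]

theorem fwd_y {a b k j : ℕ} (hk : k < G.N) (hj : j < G.N) :
    G.fwd mode a b (G.N + k) (2 * G.N + j) = G.y k j := by
  unfold fwd
  rw [if_neg (by omega), if_neg (by omega), if_pos (by omega), Nat.add_sub_cancel_left,
    Nat.add_sub_cancel_left]

theorem fwd_z {a b i j : ℕ} (hi : i < G.N) (hj : j < G.N) :
    G.fwd mode a b (2 * G.N + j) (3 * G.N + i) = G.z i j := by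
  unfold fwd
  rw [if_neg (by omega), if_neg (by omega), if_neg (by omega), if_pos (by omega),
    Nat.add_sub_cancel_left, Nat.add_sub_cancel_left]

theorem fwd_sink {a b i : ℕ} (hi : i < G.N) :
    G.fwd mode a b (3 * G.N + i) (4 * G.N + 1)
      = if mode.Present b i then mode.weight G.N G.δ i else 0 := by
  unfold fwd
  rw [if_neg (by omega), if_neg (by omega), if_neg (by omega), if_neg (by omega),
    Nat.add_sub_cancel_left]
  by_cases h : mode.Present b i
  · rw [if_pos (by refine ⟨by omega, by omega, rfl, h⟩), if_pos h]
  · rw [if_neg (by tauto), if_neg h]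

theorem fwd_self (a b u : ℕ) : G.fwd mode a b u u = 0 := by
  by_contra h
  rcases fwd_cases h with ⟨i, h1, -, h2, h3, -⟩ | ⟨i, h1, k, h2, h3, h4, -⟩ |
    ⟨i, h1, k, h2, h3, h4, -⟩ | ⟨i, h1, k, h2, h3, h4, -⟩ | ⟨i, h1, -, h2, h3, -⟩ <;> omega

theorem fwd_le (a b u v : ℕ) : G.fwd mode a b u v ≤ 2 * G.δ * G.N := by
  have hN := G.N_pos
  have : 2 * G.δ ≤ 2 * G.δ * G.N := Nat.le_mul_of_pos_right _ hN
  by_cases h : G.fwd mode a b u v = 0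
  · omega
  rcases fwd_cases h with ⟨i, h1, -, h2, h3, h5⟩ | ⟨i, h1, k, h2, h3, h4, h5⟩ |
    ⟨i, h1, k, h2, h3, h4, h5⟩ | ⟨i, h1, k, h2, h3, h4, h5⟩ | ⟨i, h1, -, h2, h3, h5⟩
  · rw [h5]; exact weight_le h1
  · rw [h5]; exact (G.hx i k).2.trans this
  · rw [h5]; exact (G.hy i k).2.trans this
  · rw [h5]; exact (G.hz k i).2.trans this
  · rw [h5]; exact weight_le h1

theorem fwd_antisymm {a b u v : ℕ} (h : G.fwd mode a b u v ≠ 0) : G.fwd mode a b v u = 0 := by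
  by_contra h'
  rcases fwd_cases h with ⟨i, h1, -, h2, h3, -⟩ | ⟨i, h1, k, h2, h3, h4, -⟩ |
    ⟨i, h1, k, h2, h3, h4, -⟩ | ⟨i, h1, k, h2, h3, h4, -⟩ | ⟨i, h1, -, h2, h3, -⟩ <;>
  rcases fwd_cases h' with ⟨i', h1', -, h2', h3', -⟩ | ⟨i', h1', k', h2', h3', h4', -⟩ |
    ⟨i', h1', k', h2', h3', h4', -⟩ | ⟨i', h1', k', h2', h3', h4', -⟩ | ⟨i', h1', -, h2', h3', -⟩ <;> omega

/-- The potential is feasible in both directions of the edges. -/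
theorem potential_feasible {a b i u v : ℕ} (ha : G.Active mode a i) (hb : G.Active mode b i)
    (hlight : ¬ G.Light i) (h : G.fwd mode a b u v ≠ 0) :
    G.potential mode i u ≤ G.fwd mode a b u v + G.potential mode i v ∧
    G.potential mode i v ≤ G.fwd mode a b u v + G.potential mode i u := by
  have hi := ha.1
  rcases fwd_cases h with ⟨x, h1, hp, h2, h3, h5⟩ | ⟨x, h1, k, h2, h3, h4, h5⟩ |
    ⟨k, h1, j, h2, h3, h4, h5⟩ | ⟨j, h1, x, h2, h3, h4, h5⟩ | ⟨x, h1, hp, h2, h3, h5⟩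
  · rw [h5]
    have e1 : G.potential mode i u = 2 * mode.weight G.N G.δ i + 4 * G.δ := by
      unfold potential
      rw [if_neg (by omega), if_neg (by omega), if_neg (by omega), if_neg (by omega), if_pos h2]
    have e2 : G.potential mode i v
        = mode.weight G.N G.δ i + 4 * G.δ - (if v = i then 0 else G.δ) := by
      unfold potential; rw [if_pos (by omega)]
    rw [e1, e2]
    by_cases hxi : x = i
    · subst hxi
      rw [if_pos h3]; omega
    · rw [if_neg (by omega)]
      -- Entering the graph at another vertex lowers the potential there by only `δ`, which is less
      -- than the additional weight of the edge from the source.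
      have := ha.2.2 x h1 hp hxi
      omega
  · rw [h5]
    have e1 : G.potential mode i u
        = mode.weight G.N G.δ i + 4 * G.δ - (if u = i then 0 else G.δ) := by
      unfold potential; rw [if_pos (by omega)]
    have e2 : G.potential mode i v = mode.weight G.N G.δ i + 4 * G.δ - G.x i k := by
      unfold potential
      rw [if_neg (by omega), if_pos (by omega), h4, Nat.add_sub_cancel_left]
    rw [e1, e2]
    have b1 := G.hx i k
    have b2 := G.hx x k
    by_cases hxi : x = i
    · subst hxi
      rw [if_pos h3]; omega
    · rw [if_neg (by omega)]
      omega
  · rw [h5]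
    have e1 : G.potential mode i u = mode.weight G.N G.δ i + 4 * G.δ - G.x i k := by
      unfold potential
      rw [if_neg (by omega), if_pos (by omega), h3, Nat.add_sub_cancel_left]
    have e2 : G.potential mode i v = mode.weight G.N G.δ i + G.z i j := by
      unfold potential
      rw [if_neg (by omega), if_neg (by omega), if_pos (by omega), h4, Nat.add_sub_cancel_left]
    rw [e1, e2]
    have b1 := G.hx i k
    have b2 := G.hz i j
    have b3 := G.hy k j
    -- The only edges for which the absence of light triangles matters; all others follow from the
    -- ranges of the weights and the margin in `Active`.
    have : ¬ G.x i k + G.y k j + G.z i j < 4 * G.δ := fun hl => hlight ⟨k, h1, j, h2, hl⟩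
    omega
  · rw [h5]
    have e1 : G.potential mode i u = mode.weight G.N G.δ i + G.z i j := by
      unfold potential
      rw [if_neg (by omega), if_neg (by omega), if_pos (by omega), h3, Nat.add_sub_cancel_left]
    have e2 : G.potential mode i v
        = mode.weight G.N G.δ i + (if v = 3 * G.N + i then 0 else 2 * G.δ) := by
      unfold potential
      rw [if_neg (by omega), if_neg (by omega), if_neg (by omega), if_pos (by omega)]
    rw [e1, e2]
    have b1 := G.hz i j
    have b2 := G.hz x j
    by_cases hxi : x = i
    · subst hxi
      rw [if_pos h4]; omega
    · rw [if_neg (by omega)]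
      omega
  · rw [h5]
    have e1 : G.potential mode i u
        = mode.weight G.N G.δ i + (if u = 3 * G.N + i then 0 else 2 * G.δ) := by
      unfold potential
      rw [if_neg (by omega), if_neg (by omega), if_neg (by omega), if_pos (by omega)]
    have e2 : G.potential mode i v = 0 := by
      unfold potential
      rw [if_neg (by omega), if_neg (by omega), if_neg (by omega), if_neg (by omega), if_neg (by omega)]
    rw [e1, e2]
    by_cases hxi : x = i
    · subst hxi
      rw [if_pos h2]; omega
    · rw [if_neg (by omega)]
      -- At the sink the full margin `2 * δ` is used up.
      have := hb.2.2 x h1 hp hxi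
      omega

theorem potential_source (i : ℕ) :
    G.potential mode i (4 * G.N) = 2 * mode.weight G.N G.δ i + 4 * G.δ := by
  have := G.N_pos
  unfold potential
  rw [if_neg (by omega), if_neg (by omega), if_neg (by omega), if_neg (by omega), if_pos rfl]

theorem potential_sink (i : ℕ) : G.potential mode i (4 * G.N + 1) = 0 := by
  unfold potential
  rw [if_neg (by omega), if_neg (by omega), if_neg (by omega), if_neg (by omega), if_neg (by omega)]

theorem potential_le {i : ℕ} (hi : i < G.N) (v : ℕ) :
    G.potential mode i v ≤ 8 * G.δ * (G.N + 1) := by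
  have h1 := weight_le (mode := mode) hi
  have h2 := (G.hz i (v - 2 * G.N)).2
  have h3 : 8 * G.δ * (G.N + 1) = 4 * (2 * G.δ * G.N) + 8 * G.δ := by ring
  rw [h3]
  unfold potential
  split_ifs <;> omega

/-! ### Shortest paths -/

/-- The gadget as an instance of st-shortest path. -/
def stInst (G : Gadget) (mode : Mode) (a b : ℕ) : STInst where
  n := 4 * G.N + 2
  W u v := G.fwd mode a b u v + G.fwd mode a b v u
  s := ⟨4 * G.N, by omega⟩
  t := ⟨4 * G.N + 1, by omega⟩

/-- Weak duality: the inequalities for the edges telescope along the walk. -/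
theorem le_of_hasWalk {n : ℕ} {W : Fin n → Fin n → ℕ} {p : Fin n → ℕ}
    (hp : ∀ u v, W u v ≠ 0 → p u ≤ W u v + p v) {u v : Fin n} {l : ℕ} (h : HasWalk W u v l) :
    p u ≤ l + p v := by
  induction h with
  | nil u => omega
  | cons hne _ ih => have := hp _ _ hne; omega

theorem distance_le {n : ℕ} {W : Fin n → Fin n → ℕ} {u v : Fin n} {l : ℕ} (h : HasWalk W u v l) :
    distance W u v ≤ l := iInf₂_le l h

/-- The returned word is the distance plus one, so the test `≤` on `r` is a strict inequality for
the distance. A light triangle gives a walk below the threshold; if there is none, the potential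
difference between source and sink equals the threshold. -/
theorem stInst_answer {a b i : ℕ} (ha : G.Active mode a i) (hb : G.Active mode b i) {r : ℕ}
    (hr : (stSP mode).Answer (G.stInst mode a b) r) :
    r ≤ 2 * mode.weight G.N G.δ i + 4 * G.δ ↔ G.Light i := by
  have hi := ha.1
  have hδ := G.δ_pos
  set W : Fin (4 * G.N + 2) → Fin (4 * G.N + 2) → ℕ := (G.stInst mode a b).W with hW
  have walk : ∀ k < G.N, ∀ j < G.N, HasWalk W (G.stInst mode a b).s (G.stInst mode a b).t
      (2 * mode.weight G.N G.δ i + (G.x i k + G.y k j + G.z i j)) := by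
    intro k hk j hj
    have edge : ∀ (u v : Fin (4 * G.N + 2)), G.fwd mode a b u v ≠ 0 →
        W u v = G.fwd mode a b u v := by
      intro u v h
      change G.fwd mode a b u v + G.fwd mode a b v u = _
      rw [fwd_antisymm h, add_zero]
    have f1 := fwd_source (mode := mode) (a := a) (b := b) hi
    have f2 := fwd_x (mode := mode) (a := a) (b := b) hi hk
    have f3 := fwd_y (mode := mode) (a := a) (b := b) hk hj
    have f4 := fwd_z (mode := mode) (a := a) (b := b) hi hj
    have f5 := fwd_sink (mode := mode) (a := a) (b := b) hi
    rw [if_pos ha.2.1] at f1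
    rw [if_pos hb.2.1] at f5
    have hw := weight_pos (mode := mode) hi
    have b1 := G.hx i k
    have b2 := G.hy k j
    have b3 := G.hz i j
    have w5 := HasWalk.cons (W := W) (u := ⟨3 * G.N + i, by omega⟩) (v := ⟨4 * G.N + 1, by omega⟩)
      (by rw [edge _ _ (by simp only [f5]; omega)]; simp only [f5]; omega) (HasWalk.nil _)
    have w4 := HasWalk.cons (W := W) (u := ⟨2 * G.N + j, by omega⟩)
      (by rw [edge _ _ (by simp only [f4]; omega)]; simp only [f4]; omega) w5
    have w3 := HasWalk.cons (W := W) (u := ⟨G.N + k, by omega⟩)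
      (by rw [edge _ _ (by simp only [f3]; omega)]; simp only [f3]; omega) w4
    have w2 := HasWalk.cons (W := W) (u := ⟨i, by omega⟩)
      (by rw [edge _ _ (by simp only [f2]; omega)]; simp only [f2]; omega) w3
    have w1 := HasWalk.cons (W := W) (u := ⟨4 * G.N, by omega⟩)
      (by rw [edge _ _ (by simp only [f1]; omega)]; simp only [f1]; omega) w2
    rw [edge _ _ (by simp only [f1]; omega), edge _ _ (by simp only [f2]; omega),
      edge _ _ (by simp only [f3]; omega), edge _ _ (by simp only [f4]; omega),
      edge _ _ (by simp only [f5]; omega)] at w1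
    simp only [f1, f2, f3, f4, f5] at w1
    have heq : 2 * mode.weight G.N G.δ i + (G.x i k + G.y k j + G.z i j) = mode.weight G.N G.δ i +
        (G.x i k + (G.y k j + (G.z i j + (mode.weight G.N G.δ i + 0)))) := by ring
    rw [heq]
    exact w1
  have hN := G.N_pos
  obtain ⟨htop, -⟩ | ⟨d, hd, rfl⟩ := hr
  -- Light or not, the triangle with `k = j = 0` connects source and sink, so the answer is never
  -- the code `0` for an infinite distance.
  · have := distance_le (walk 0 hN 0 hN)
    change distance W _ _ = ⊤ at htop
    rw [htop] at this
    exact absurd (top_le_iff.1 this) (ENat.natCast_ne_top _)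
  · change distance W _ _ = _ at hd
    constructor
    · intro hle
      by_contra hlight
      have hlow : ((2 * mode.weight G.N G.δ i + 4 * G.δ : ℕ) : ℕ∞) ≤ distance W (G.stInst mode a b).s
          (G.stInst mode a b).t := by
        refine le_iInf₂ fun l hl => ?_
        have := le_of_hasWalk (p := fun v => G.potential mode i v) (fun u v huv => ?_) hl
        · change G.potential mode i (4 * G.N) ≤ l + G.potential mode i (4 * G.N + 1) at this
          rw [potential_source, potential_sink] at this
          exact_mod_cast this
        · change G.fwd mode a b u v + G.fwd mode a b v u ≠ 0 at huv
          change _ ≤ G.fwd mode a b u v + G.fwd mode a b v u + _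
          by_cases h1 : G.fwd mode a b u v = 0
          · have := (potential_feasible ha hb hlight (u := v) (v := u) (by omega)).2
            omega
          · have := (potential_feasible ha hb hlight h1).1
            omega
      rw [hd] at hlow
      have : 2 * mode.weight G.N G.δ i + 4 * G.δ ≤ d := by exact_mod_cast hlow
      omega
    · rintro ⟨k, hk, j, hj, hlt⟩
      have := distance_le (walk k hk j hj)
      rw [hd] at this
      have : d ≤ 2 * mode.weight G.N G.δ i + (G.x i k + G.y k j + G.z i j) := by exact_mod_cast this
      omega

end Gadget

namespace Gadget

variable {G : Gadget} {mode : Mode}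

/-! ### Matchings -/

/-- A weight that exceeds all weights and potentials of the gadget. -/
def big (G : Gadget) : ℕ := 8 * G.δ * (G.N + 1)

theorem fwd_lt_big (a b u v : ℕ) : G.fwd mode a b u v < G.big := by
  have h1 := fwd_le (G := G) (mode := mode) a b u v
  have h2 := G.δ_pos
  have h3 : G.big = 4 * (2 * G.δ * G.N) + 8 * G.δ := by unfold big; ring
  omega

/-- The entries of the matrix of the matching instance. -/
def matchEntry (G : Gadget) (mode : Mode) (a b u v : ℕ) : ℕ :=
  if G.fwd mode a b u v ≠ 0 then G.big - G.fwd mode a b u v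
  else if u = v ∧ u < 4 * G.N then G.big else 0

/-- The gadget as an instance of bipartite matching, with two copies of each vertex. -/
def bipInst (G : Gadget) (mode : Mode) (a b : ℕ) : BipInst where
  a := 4 * G.N + 2
  b := 4 * G.N + 2
  W u v := G.matchEntry mode a b u v

/-- The weight of a matching is at most the total weight of a fractional vertex cover. -/
theorem sum_matching_le {a b : ℕ} {W : Fin a → Fin b → ℕ} {M : Finset (Fin a × Fin b)}
    (hM : IsMatching W M) {α : Fin a → ℕ} {β : Fin b → ℕ}
    (h : ∀ u v, W u v ≠ 0 → W u v ≤ α u + β v) :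
    ∑ e ∈ M, W e.1 e.2 ≤ ∑ u, α u + ∑ v, β v := by
  calc ∑ e ∈ M, W e.1 e.2 ≤ ∑ e ∈ M, (α e.1 + β e.2) :=
        Finset.sum_le_sum fun e he => h _ _ (hM.1 e he)
    _ = ∑ e ∈ M, α e.1 + ∑ e ∈ M, β e.2 := Finset.sum_add_distrib
    _ ≤ _ := by
      refine add_le_add ?_ ?_
      · rw [← Finset.sum_image (f := α) (g := Prod.fst)
          fun e he f hf hef => hM.2 e he f hf (Or.inl hef)]
        exact Finset.sum_le_sum_of_subset (Finset.subset_univ _)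
      · rw [← Finset.sum_image (f := β) (g := Prod.snd)
          fun e he f hf hef => hM.2 e he f hf (Or.inr hef)]
        exact Finset.sum_le_sum_of_subset (Finset.subset_univ _)

/-- Weak duality for matchings, with the cover `big - p` on left copies and `p` on right copies. An
edge of weight `big - fwd` is covered because `p` is feasible, and the edge between the two copies
of an inner vertex is covered tightly. The left copy of the sink and the right copy of the source
have no edges and get `0`. The cover therefore has total weight `(4 * N + 1) * big` minus the
potential of the source. -/
theorem matching_le {a b i : ℕ} (ha : G.Active mode a i) (hb : G.Active mode b i)
    (hlight : ¬ G.Light i) {M : Finset (Fin (4 * G.N + 2) × Fin (4 * G.N + 2))}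
    (hM : IsMatching (fun u v => G.matchEntry mode a b u v) M) :
    ∑ e ∈ M, G.matchEntry mode a b e.1 e.2 + (2 * mode.weight G.N G.δ i + 4 * G.δ)
      ≤ (4 * G.N + 1) * G.big := by
  have hi := ha.1
  set p := G.potential mode i with hp
  have hpB : ∀ v, p v ≤ G.big := potential_le hi
  have key := sum_matching_le hM (α := fun u => if u.val = 4 * G.N + 1 then 0 else G.big - p u)
    (β := fun v => if v.val = 4 * G.N then 0 else p v) ?_
  · rw [← Finset.sum_add_distrib, Fin.sum_univ_castSucc, Fin.sum_univ_castSucc] at key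
    have hmid : ∀ v : Fin (4 * G.N), (if (v.castSucc.castSucc).val = 4 * G.N + 1 then 0
        else G.big - p v.castSucc.castSucc) + (if (v.castSucc.castSucc).val = 4 * G.N then 0
        else p v.castSucc.castSucc) = G.big := by
      intro v
      have := hpB v
      have hv := v.isLt
      simp only [Fin.val_castSucc]
      rw [if_neg (by omega), if_neg (by omega)]
      omega
    simp only [hmid] at key
    simp only [Finset.sum_const, Finset.card_univ, Fintype.card_fin, smul_eq_mul, Fin.val_castSucc,
      Fin.val_last] at key
    rw [if_neg (by omega), if_pos trivial, if_pos trivial, if_neg (by omega), hp, potential_source,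
      potential_sink] at key
    have h2 := hpB (4 * G.N)
    rw [hp, potential_source] at h2
    have h3 : (4 * G.N + 1) * G.big = 4 * G.N * G.big + G.big := by ring
    omega
  · intro u v huv
    simp only [matchEntry] at huv ⊢
    have hu := hpB u
    have hv := hpB v
    by_cases h0 : G.fwd mode a b u v = 0
    · simp only [h0, ne_eq, not_true_eq_false, if_false] at huv ⊢
      by_cases h1 : u.val = v.val ∧ u.val < 4 * G.N
      · rw [if_pos h1, if_neg (by omega), if_neg (by omega), h1.1]
        omega
      · rw [if_neg h1] at huv
        exact absurd rfl huv
    · rw [if_pos h0]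
      have h1 := (potential_feasible ha hb hlight h0).1
      rw [← hp] at h1
      have h2 := fwd_lt_big (G := G) (mode := mode) a b u v
      have h3 : u.val ≠ 4 * G.N + 1 ∧ v.val ≠ 4 * G.N := by
        rcases fwd_cases h0 with ⟨i, h1, -, h2, h3, -⟩ | ⟨i, h1, k, h2, h3, h4, -⟩ |
          ⟨i, h1, k, h2, h3, h4, -⟩ | ⟨i, h1, k, h2, h3, h4, -⟩ | ⟨i, h1, -, h2, h3, -⟩ <;> omega
      rw [if_neg h3.1, if_neg h3.2]
      omega

/-- The successor of a vertex on the path through `i`, `k` and `j`. -/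
def next (N i k j v : ℕ) : ℕ :=
  if v = 4 * N then i else if v = i then N + k else if v = N + k then 2 * N + j
  else if v = 2 * N + j then 3 * N + i else if v = 3 * N + i then 4 * N + 1 else v

theorem next_lt {N i k j v : ℕ} (hi : i < N) (hk : k < N) (hj : j < N) (hv : v < 4 * N + 2) :
    next N i k j v < 4 * N + 2 := by
  unfold next
  split_ifs <;> omega

theorem next_injOn {N i k j u v : ℕ} (hi : i < N) (hk : k < N) (hj : j < N) (hu : u < 4 * N + 1)
    (hv : v < 4 * N + 1) (h : next N i k j u = next N i k j v) : u = v := by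
  unfold next at h
  split_ifs at h <;> omega

/-- Every left copy except that of the sink is matched to the right copy of its successor on the
path, or to its own copy if it is not on the path. These `4 * N + 1` edges fall short of `big` by
the lengths of the path edges in total. -/
theorem exists_matching {a b i k j : ℕ} (ha : G.Active mode a i) (hb : G.Active mode b i)
    (hk : k < G.N) (hj : j < G.N) : ∃ M : Finset (Fin (4 * G.N + 2) × Fin (4 * G.N + 2)),
    IsMatching (fun u v => G.matchEntry mode a b u v) M ∧
    ∑ e ∈ M, G.matchEntry mode a b e.1 e.2 +
      (2 * mode.weight G.N G.δ i + (G.x i k + G.y k j + G.z i j)) = (4 * G.N + 1) * G.big := by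
  have hi := ha.1
  have hδ := G.δ_pos
  have hN := G.N_pos
  have f1 := fwd_source (mode := mode) (a := a) (b := b) hi
  have f2 := fwd_x (mode := mode) (a := a) (b := b) hi hk
  have f3 := fwd_y (mode := mode) (a := a) (b := b) hk hj
  have f4 := fwd_z (mode := mode) (a := a) (b := b) hi hj
  have f5 := fwd_sink (mode := mode) (a := a) (b := b) hi
  rw [if_pos ha.2.1] at f1
  rw [if_pos hb.2.1] at f5
  have hw := weight_pos (mode := mode) hi
  have b1 := G.hx i k
  have b2 := G.hy k j
  have b3 := G.hz i j
  set nx : Fin (4 * G.N + 1) → Fin (4 * G.N + 2) := fun v =>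
    ⟨next G.N i k j v, next_lt hi hk hj (by omega)⟩ with hnx
  -- The loss compared with `big` at the left copy of `v`: the length of the path edge that leaves
  -- `v`, or zero off the path.
  set c : ℕ → ℕ := fun v => (if v = 4 * G.N then mode.weight G.N G.δ i else 0) +
    (if v = i then G.x i k else 0) + (if v = G.N + k then G.y k j else 0) +
    (if v = 2 * G.N + j then G.z i j else 0) +
    (if v = 3 * G.N + i then mode.weight G.N G.δ i else 0) with hc
  have hent : ∀ v < 4 * G.N + 1, G.matchEntry mode a b v (next G.N i k j v) + c v = G.big ∧
      G.matchEntry mode a b v (next G.N i k j v) ≠ 0 := by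
    intro v hv
    have edge : ∀ u v, G.fwd mode a b u v ≠ 0 →
        G.matchEntry mode a b u v + G.fwd mode a b u v = G.big ∧ G.matchEntry mode a b u v ≠ 0 := by
      intro u v h
      have := fwd_lt_big (G := G) (mode := mode) a b u v
      unfold matchEntry
      rw [if_pos h]
      omega
    simp only [hc]
    unfold next
    by_cases h1 : v = 4 * G.N
    · have := edge (4 * G.N) i (by omega)
      rw [if_pos h1, if_pos h1, if_neg (by omega), if_neg (by omega), if_neg (by omega),
        if_neg (by omega), h1]
      rw [f1] at this
      omega
    by_cases h2 : v = i
    · have := edge i (G.N + k) (by omega)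
      rw [if_neg h1, if_pos h2, if_neg h1, if_pos h2, if_neg (by omega), if_neg (by omega),
        if_neg (by omega), h2]
      rw [f2] at this
      omega
    by_cases h3 : v = G.N + k
    · have := edge (G.N + k) (2 * G.N + j) (by omega)
      rw [if_neg h1, if_neg h2, if_pos h3, if_neg h1, if_neg h2, if_pos h3, if_neg (by omega),
        if_neg (by omega), h3]
      rw [f3] at this
      omega
    by_cases h4 : v = 2 * G.N + j
    · have := edge (2 * G.N + j) (3 * G.N + i) (by omega)
      rw [if_neg h1, if_neg h2, if_neg h3, if_pos h4, if_neg h1, if_neg h2, if_neg h3, if_pos h4,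
        if_neg (by omega), h4]
      rw [f4] at this
      omega
    by_cases h5 : v = 3 * G.N + i
    · have := edge (3 * G.N + i) (4 * G.N + 1) (by omega)
      rw [if_neg h1, if_neg h2, if_neg h3, if_neg h4, if_pos h5, if_neg h1, if_neg h2, if_neg h3,
        if_neg h4, if_pos h5, h5]
      rw [f5] at this
      omega
    · rw [if_neg h1, if_neg h2, if_neg h3, if_neg h4, if_neg h5, if_neg h1, if_neg h2, if_neg h3,
        if_neg h4, if_neg h5]
      unfold matchEntry
      rw [fwd_self, if_neg (by omega), if_pos ⟨rfl, by omega⟩]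
      have := fwd_lt_big (G := G) (mode := mode) a b v v
      omega
  have hinj : Function.Injective fun v : Fin (4 * G.N + 1) => (v.castSucc, nx v) := by
    intro u v h
    simpa using congrArg Prod.fst h
  refine ⟨Finset.univ.image fun v : Fin (4 * G.N + 1) => (v.castSucc, nx v), ⟨?_, ?_⟩, ?_⟩
  · intro e he
    obtain ⟨v, -, rfl⟩ := Finset.mem_image.1 he
    exact (hent v v.isLt).2
  · intro e he f hf hef
    obtain ⟨u, -, rfl⟩ := Finset.mem_image.1 he
    obtain ⟨v, -, rfl⟩ := Finset.mem_image.1 hf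
    have : u = v := by
      rcases hef with h | h
      · simpa using h
      · exact Fin.ext (next_injOn hi hk hj u.isLt v.isLt (congrArg Fin.val h))
    rw [this]
  · rw [Finset.sum_image fun u _ v _ h => hinj h]
    have hsum : ∑ v : Fin (4 * G.N + 1), c v = 2 * mode.weight G.N G.δ i + (G.x i k + G.y k j + G.z i j) := by
      have one : ∀ (t y : ℕ), t < 4 * G.N + 1 →
          ∑ v : Fin (4 * G.N + 1), (if v.val = t then y else 0) = y := by
        intro t y ht
        rw [Finset.sum_eq_single (⟨t, ht⟩ : Fin (4 * G.N + 1))]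
        · simp
        · intro v _ hv
          rw [if_neg fun h => hv (Fin.ext h)]
        · simp
      simp only [hc, Finset.sum_add_distrib]
      rw [one _ _ (by omega), one _ _ (by omega), one _ _ (by omega), one _ _ (by omega),
        one _ _ (by omega)]
      ring
    rw [← hsum, ← Finset.sum_add_distrib]
    exact (Finset.sum_congr rfl fun v _ => (hent v.val v.isLt).1).trans (by simp)

/-- The deficit `(4 * N + 1) * big - r` plays the part of the distance; the inequality is arranged
so as to avoid truncated subtraction. -/
theorem bipInst_answer {a b i : ℕ} (ha : G.Active mode a i) (hb : G.Active mode b i) {r : ℕ}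
    (hr : (bwMatch mode).Answer (G.bipInst mode a b) r) :
    (4 * G.N + 1) * G.big < r + (2 * mode.weight G.N G.δ i + 4 * G.δ) ↔ G.Light i := by
  obtain ⟨⟨M, hM, rfl⟩, hub⟩ := hr
  constructor
  · intro hlt
    by_contra hlight
    have := matching_le ha hb hlight hM
    simp only [bipInst] at hlt this
    omega
  · rintro ⟨k, hk, j, hj, hlt⟩
    obtain ⟨M', hM', hsum⟩ := exists_matching ha hb hk hj
    have : ∑ e ∈ M', G.matchEntry mode a b e.1 e.2 ≤ _ := hub ⟨M', hM', rfl⟩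
    simp only [bipInst] at this ⊢
    omega

end Gadget

/-! ## The gadget as a dynamic problem -/

/-- The two requests for updates and the query that belong to one vertex. -/
def Mode.phase (u₁ u₂ : Update) : Mode → List Request
  | incremental => [.update u₁, .update u₂, .query]
  | decremental => [.query, .update u₁, .update u₂]

/-- The number of updates of each kind that precede the query for the vertex `i`. -/
def Mode.stage (i : ℕ) : Mode → ℕ
  | incremental => i + 1
  | decremental => i

/-- The requests for the vertices `j, …, j + k - 1`. -/
def Mode.requests (mode : Mode) (u₁ u₂ : ℕ → Update) (j k : ℕ) : List Request :=
  (List.range' j k).flatMap fun i => mode.phase (u₁ i) (u₂ i)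

section sequences

variable {P : DynamicProblem} {c N : ℕ} {inst : ℕ → ℕ → P.Inst} {u₁ u₂ : ℕ → Update} {mode : Mode}

theorem Mode.requests_succ (j k : ℕ) : mode.requests u₁ u₂ j (k + 1)
    = mode.phase (u₁ j) (u₂ j) ++ mode.requests u₁ u₂ (j + 1) k := by
  simp [Mode.requests, List.range'_succ]

theorem Mode.length_requests (j k : ℕ) : (mode.requests u₁ u₂ j k).length = 3 * k := by
  induction k generalizing j with
  | zero => simp [Mode.requests]
  | succ k ih =>
    rw [Mode.requests_succ, List.length_append, ih]
    cases mode <;> simp [Mode.phase] <;> omega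

/-- Here `inst a b` is the instance after `a` updates at the source and `b` at the sink. The
sequence climbs the staircase `(j, j)`, `(j + 1, j)`, `(j + 1, j + 1)`, so two local facts for each
vertex decide the legality of all requests. -/
theorem legalSeq_requests
    (h₁ : ∀ i < N, P.Legal c (inst i i) (u₁ i) ∧ P.apply (inst i i) (u₁ i) = inst (i + 1) i)
    (h₂ : ∀ i < N, P.Legal c (inst (i + 1) i) (u₂ i) ∧
      P.apply (inst (i + 1) i) (u₂ i) = inst (i + 1) (i + 1)) (k : ℕ) :
    ∀ j, j + k ≤ N → P.LegalSeq c (inst j j) (mode.requests u₁ u₂ j k) := by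
  induction k with
  | zero => intro j _; simp [Mode.requests, DynamicProblem.LegalSeq]
  | succ k ih =>
    intro j hj
    have h1 := h₁ j (by omega)
    have h2 := h₂ j (by omega)
    have h3 := ih (j + 1) (by omega)
    rw [Mode.requests_succ]
    cases mode
    · simp only [Mode.phase, List.cons_append, List.nil_append, DynamicProblem.LegalSeq, h1.2, h2.2]
      exact ⟨h1.1, h2.1, h3⟩
    · simp only [Mode.phase, List.cons_append, List.nil_append, DynamicProblem.LegalSeq, h1.2, h2.2]
      exact ⟨h1.1, h2.1, h3⟩

theorem queried_requests
    (h₁ : ∀ i < N, P.apply (inst i i) (u₁ i) = inst (i + 1) i)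
    (h₂ : ∀ i < N, P.apply (inst (i + 1) i) (u₂ i) = inst (i + 1) (i + 1)) (k : ℕ) :
    ∀ j, j + k ≤ N → P.queried (inst j j) (mode.requests u₁ u₂ j k)
      = (List.range' j k).map fun i => inst (mode.stage i) (mode.stage i) := by
  induction k with
  | zero => intro j _; simp [Mode.requests, DynamicProblem.queried]
  | succ k ih =>
    intro j hj
    have h1 := h₁ j (by omega)
    have h2 := h₂ j (by omega)
    have h3 := ih (j + 1) (by omega)
    rw [Mode.requests_succ, List.range'_succ, List.map_cons, ← h3]
    cases mode
    · simp only [Mode.phase, List.cons_append, List.nil_append, DynamicProblem.queried, h1, h2,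
        Mode.stage]
    · simp only [Mode.phase, List.cons_append, List.nil_append, DynamicProblem.queried, h1, h2,
        Mode.stage]

end sequences

/-- Shortest paths or matchings. -/
inductive Kind
  | path | matching

/-- The four dynamic problems. -/
def problem (mode : Mode) : Kind → DynamicProblem
  | .path => stSP mode
  | .matching => bwMatch mode

namespace Gadget

variable (G : Gadget) (mode : Mode)

/-- The weight that the updates at the vertex `i` give to an edge. -/
def newWeight (i : ℕ) (kind : Kind) : ℕ :=
  match mode with
  | .decremental => 0
  | .incremental =>
    match kind with
    | .path => Mode.weight G.N G.δ i .incremental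
    | .matching => G.big - Mode.weight G.N G.δ i .incremental

def sourceUpdate (kind : Kind) (i : ℕ) : Update := ⟨4 * G.N, i, G.newWeight mode i kind⟩

def sinkUpdate (kind : Kind) (i : ℕ) : Update := ⟨3 * G.N + i, 4 * G.N + 1, G.newWeight mode i kind⟩

/-- The entries of the matrix of the initial instance. -/
def entry (u v : ℕ) : Kind → ℕ
  | .path => G.fwd mode 0 0 u v + G.fwd mode 0 0 v u
  | .matching => G.matchEntry mode 0 0 u v

/-- The number of vertices of the instance. -/
def instSize : Kind → ℕ
  | .path => 4 * G.N + 2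
  | .matching => 8 * G.N + 4

/-- The initial instance in the memory. -/
def input (kind : Kind) : Store :=
  match kind with
  | .path => inputStore (4 * G.N + 2) (4 * G.N) (4 * G.N + 1)
      fun u v : Fin (4 * G.N + 2) => G.entry mode u v .path
  | .matching => inputStore (4 * G.N + 2) (4 * G.N + 2) 0
      fun u v : Fin (4 * G.N + 2) => G.entry mode u v .matching

/-- How the answer `r` to the query for the vertex `i` shows whether there is a light triangle. -/
def Test (i r : ℕ) : Kind → Prop
  | .path => r ≤ 2 * mode.weight G.N G.δ i + 4 * G.δ
  | .matching => (4 * G.N + 1) * G.big < r + (2 * mode.weight G.N G.δ i + 4 * G.δ)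

variable {G mode}

theorem active_stage {i : ℕ} (hi : i < G.N) : G.Active mode (mode.stage i) i := by
  cases mode
  · exact active_incremental hi
  · exact active_decremental hi

/-- Passing from stage `i` to stage `i + 1` changes the status of the vertex `i` and of no other. -/
theorem present_iff (i x : ℕ) : mode.Present (i + 1) x ↔
    (x = i ∧ mode = .incremental) ∨ (x ≠ i ∧ mode.Present i x) := by
  cases mode <;> simp only [Mode.Present, reduceCtorEq, and_true, and_false, false_or] <;>
    omega

theorem present_self (i : ℕ) : mode.Present i i ↔ mode = .decremental := by
  cases mode <;> simp [Mode.Present]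

theorem fwd_succ_left (i b u v : ℕ) (hi : i < G.N) : G.fwd mode (i + 1) b u v
    = if u = 4 * G.N ∧ v = i then G.newWeight mode i .path else G.fwd mode i b u v := by
  by_cases h : u = 4 * G.N ∧ v = i
  · rw [if_pos h, h.1, h.2, fwd_source hi]
    cases mode <;> simp [Mode.Present, newWeight]
  · rw [if_neg h]
    unfold fwd
    by_cases h1 : u = 4 * G.N
    · have : mode.Present (i + 1) v ↔ mode.Present i v := by
        rw [present_iff]; tauto
      simp only [this]
    · simp only [h1, false_and, if_false]

theorem fwd_succ_right (a i u v : ℕ) (hi : i < G.N) : G.fwd mode a (i + 1) u v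
    = if u = 3 * G.N + i ∧ v = 4 * G.N + 1 then G.newWeight mode i .path else G.fwd mode a i u v := by
  by_cases h : u = 3 * G.N + i ∧ v = 4 * G.N + 1
  · rw [if_pos h, h.1, h.2, fwd_sink hi]
    cases mode <;> simp [Mode.Present, newWeight]
  · rw [if_neg h]
    unfold fwd
    by_cases h1 : 3 * G.N ≤ u ∧ u < 4 * G.N ∧ v = 4 * G.N + 1
    · have : mode.Present (i + 1) (u - 3 * G.N) ↔ mode.Present i (u - 3 * G.N) := by
        rw [present_iff]
        have : u - 3 * G.N ≠ i := by omega
        tauto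
      simp only [this]
    · have h2 : ∀ p : Prop, (3 * G.N ≤ u ∧ u < 4 * G.N ∧ v = 4 * G.N + 1 ∧ p) ↔ False := by tauto
      simp only [h2, if_false]

theorem newWeight_bounds {i : ℕ} (hi : i < G.N) (h : mode = .incremental) (kind : Kind) :
    1 ≤ G.newWeight mode i kind ∧ G.newWeight mode i kind ≤ G.big := by
  subst h
  have h1 := weight_pos (mode := .incremental) hi
  have h2 := weight_le (mode := .incremental) hi
  have h3 := G.δ_pos
  have h4 : G.big = 4 * (2 * G.δ * G.N) + 8 * G.δ := by unfold big; ring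
  cases kind <;> simp only [newWeight] <;> omega

theorem newWeight_decremental {i : ℕ} (h : mode = .decremental) (kind : Kind) :
    G.newWeight mode i kind = 0 := by
  subst h; rfl

theorem allows {i B old : ℕ} (hi : i < G.N) (hB : G.big ≤ B) (kind : Kind)
    (h : old ≠ 0 ↔ mode.Present i i) : mode.Allows B old (G.newWeight mode i kind) := by
  rw [present_self] at h
  cases hm : mode
  · have := newWeight_bounds (G := G) (mode := mode) hi hm kind
    rw [hm] at h this
    simp only [reduceCtorEq, iff_false, not_not] at h
    exact ⟨h, this.1, this.2.trans hB⟩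
  · rw [hm] at h
    exact ⟨h.2 rfl, newWeight_decremental rfl kind⟩

theorem fwd_source_ne_zero {a b i : ℕ} (hi : i < G.N) :
    G.fwd mode a b (4 * G.N) i ≠ 0 ↔ mode.Present a i := by
  rw [fwd_source hi]
  have := (weight_pos (mode := mode) hi).ne'
  simp [this]

theorem fwd_sink_ne_zero {a b i : ℕ} (hi : i < G.N) :
    G.fwd mode a b (3 * G.N + i) (4 * G.N + 1) ≠ 0 ↔ mode.Present b i := by
  rw [fwd_sink hi]
  have := (weight_pos (mode := mode) hi).ne'
  simp [this]

theorem fwd_to_source (a b v : ℕ) : G.fwd mode a b v (4 * G.N) = 0 := by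
  by_contra h
  rcases fwd_cases h with ⟨i, h1, -, h2, h3, -⟩ | ⟨i, h1, k, h2, h3, h4, -⟩ |
    ⟨i, h1, k, h2, h3, h4, -⟩ | ⟨i, h1, k, h2, h3, h4, -⟩ | ⟨i, h1, -, h2, h3, -⟩ <;> omega

theorem fwd_from_sink (a b v : ℕ) : G.fwd mode a b (4 * G.N + 1) v = 0 := by
  by_contra h
  rcases fwd_cases h with ⟨i, h1, -, h2, h3, -⟩ | ⟨i, h1, k, h2, h3, h4, -⟩ |
    ⟨i, h1, k, h2, h3, h4, -⟩ | ⟨i, h1, k, h2, h3, h4, -⟩ | ⟨i, h1, -, h2, h3, -⟩ <;> omega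

theorem matchEntry_ne_zero {a b u v : ℕ} (h : u ≠ v) :
    G.matchEntry mode a b u v ≠ 0 ↔ G.fwd mode a b u v ≠ 0 := by
  have := fwd_lt_big (G := G) (mode := mode) a b u v
  unfold matchEntry
  by_cases h0 : G.fwd mode a b u v = 0
  · simp [h0, h]
  · simp only [h0, ne_eq, not_false_eq_true, if_true, iff_true]
    omega

theorem matchEntry_le (a b u v : ℕ) : G.matchEntry mode a b u v ≤ G.big := by
  unfold matchEntry
  split_ifs <;> omega

theorem matchEntry_newWeight {i : ℕ} (hi : i < G.N) (u v : ℕ) (huv : u ≠ v) :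
    (if G.newWeight mode i .path ≠ 0 then G.big - G.newWeight mode i .path
      else if u = v ∧ u < 4 * G.N then G.big else 0) = G.newWeight mode i .matching := by
  cases hm : mode
  · have := newWeight_bounds (G := G) (mode := .incremental) hi rfl .path
    rw [if_pos (by omega)]
    rfl
  · simp [newWeight, huv]

theorem stInst_updates {c : ℕ} (hc : G.big ≤ (4 * G.N + 2) ^ c) {i : ℕ} (hi : i < G.N) :
    ((stSP mode).Legal c (G.stInst mode i i) (G.sourceUpdate mode .path i) ∧
      (stSP mode).apply (G.stInst mode i i) (G.sourceUpdate mode .path i) = G.stInst mode (i + 1) i) ∧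
    ((stSP mode).Legal c (G.stInst mode (i + 1) i) (G.sinkUpdate mode .path i) ∧
      (stSP mode).apply (G.stInst mode (i + 1) i) (G.sinkUpdate mode .path i)
        = G.stInst mode (i + 1) (i + 1)) := by
  refine ⟨⟨⟨?_, ?_, ?_, ?_⟩, ?_⟩, ⟨⟨?_, ?_, ?_, ?_⟩, ?_⟩⟩
  · simp only [sourceUpdate]; omega
  · simp only [sourceUpdate, stInst]; omega
  · simp only [sourceUpdate, stInst]; omega
  · change mode.Allows ((4 * G.N + 2) ^ c) _ (G.newWeight mode i .path)
    refine allows hi hc _ ?_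
    simp only [sourceUpdate, stInst, fwd_to_source, add_zero]
    exact fwd_source_ne_zero hi
  · simp only [stSP, stInst, STInst.mk.injEq, heq_eq_eq, true_and, and_true, sourceUpdate]
    funext u v
    rw [fwd_succ_left _ _ _ _ hi, fwd_succ_left _ _ _ _ hi]
    by_cases h1 : u.val = 4 * G.N ∧ v.val = i
    · rw [if_pos (Or.inl h1), if_pos h1, if_neg (by omega), h1.1, fwd_to_source, add_zero]
    · by_cases h2 : v.val = 4 * G.N ∧ u.val = i
      · rw [if_pos (Or.inr h2.symm), if_neg h1, if_pos h2, h2.1, fwd_to_source, zero_add]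
      · rw [if_neg (by tauto), if_neg h1, if_neg h2]
  · simp only [sinkUpdate]; omega
  · simp only [sinkUpdate, stInst]; omega
  · simp only [sinkUpdate, stInst]; omega
  · change mode.Allows ((4 * G.N + 2) ^ c) _ (G.newWeight mode i .path)
    refine allows hi hc _ ?_
    simp only [sinkUpdate, stInst, fwd_from_sink, add_zero]
    exact fwd_sink_ne_zero hi
  · simp only [stSP, stInst, STInst.mk.injEq, heq_eq_eq, true_and, and_true, sinkUpdate]
    funext u v
    rw [fwd_succ_right _ _ _ _ hi, fwd_succ_right _ _ _ _ hi]
    by_cases h1 : u.val = 3 * G.N + i ∧ v.val = 4 * G.N + 1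
    · rw [if_pos (Or.inl h1), if_pos h1, if_neg (by omega), h1.2, fwd_from_sink, add_zero]
    · by_cases h2 : v.val = 3 * G.N + i ∧ u.val = 4 * G.N + 1
      · rw [if_pos (Or.inr h2.symm), if_neg h1, if_pos h2, h2.2, fwd_from_sink, zero_add]
      · rw [if_neg (by tauto), if_neg h1, if_neg h2]

theorem bipInst_updates {c : ℕ} (hc : G.big ≤ (8 * G.N + 4) ^ c) {i : ℕ} (hi : i < G.N) :
    ((bwMatch mode).Legal c (G.bipInst mode i i) (G.sourceUpdate mode .matching i) ∧
      (bwMatch mode).apply (G.bipInst mode i i) (G.sourceUpdate mode .matching i)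
        = G.bipInst mode (i + 1) i) ∧
    ((bwMatch mode).Legal c (G.bipInst mode (i + 1) i) (G.sinkUpdate mode .matching i) ∧
      (bwMatch mode).apply (G.bipInst mode (i + 1) i) (G.sinkUpdate mode .matching i)
        = G.bipInst mode (i + 1) (i + 1)) := by
  have hsz : 4 * G.N + 2 + (4 * G.N + 2) = 8 * G.N + 4 := by ring
  refine ⟨⟨⟨?_, ?_, ?_⟩, ?_⟩, ⟨⟨?_, ?_, ?_⟩, ?_⟩⟩
  · simp only [sourceUpdate, bipInst]; omega
  · simp only [sourceUpdate, bipInst]; omega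
  · change mode.Allows ((4 * G.N + 2 + (4 * G.N + 2)) ^ c) _ (G.newWeight mode i .matching)
    rw [hsz]
    refine allows hi hc _ ?_
    simp only [sourceUpdate, bipInst]
    rw [matchEntry_ne_zero (by omega)]
    exact fwd_source_ne_zero hi
  · simp only [bwMatch, bipInst, BipInst.mk.injEq, heq_eq_eq, true_and, sourceUpdate]
    funext u v
    unfold matchEntry
    rw [fwd_succ_left _ _ _ _ hi]
    by_cases h1 : u.val = 4 * G.N ∧ v.val = i
    · simp only [if_pos h1]
      exact (matchEntry_newWeight hi _ _ (by omega)).symm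
    · simp only [if_neg h1]
  · simp only [sinkUpdate, bipInst]; omega
  · simp only [sinkUpdate, bipInst]; omega
  · change mode.Allows ((4 * G.N + 2 + (4 * G.N + 2)) ^ c) _ (G.newWeight mode i .matching)
    rw [hsz]
    refine allows hi hc _ ?_
    simp only [sinkUpdate, bipInst]
    rw [matchEntry_ne_zero (by omega)]
    exact fwd_sink_ne_zero hi
  · simp only [bwMatch, bipInst, BipInst.mk.injEq, heq_eq_eq, true_and, sinkUpdate]
    funext u v
    unfold matchEntry
    rw [fwd_succ_right _ _ _ _ hi]
    by_cases h1 : u.val = 3 * G.N + i ∧ v.val = 4 * G.N + 1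
    · simp only [if_pos h1]
      exact (matchEntry_newWeight hi _ _ (by omega)).symm
    · simp only [if_neg h1]

/-- The sequence of requests for the gadget. -/
def requests (G : Gadget) (mode : Mode) (kind : Kind) : List Request :=
  mode.requests (G.sourceUpdate mode kind) (G.sinkUpdate mode kind) 0 G.N

theorem answers_of_forall₂ {P : DynamicProblem} {inst : ℕ → P.Inst} {N : ℕ} {l : List ℕ}
    (h : List.Forall₂ P.Answer ((List.range' 0 N).map inst) l) :
    l.length = N ∧ ∀ i (hi : i < l.length), P.Answer (inst i) l[i] := by
  have hlen : l.length = N := by simpa using h.length_eq.symm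
  refine ⟨hlen, fun i hi => ?_⟩
  have := List.Forall₂.get h (i := i) (by simp; omega) hi
  simpa using this

/-- A fast dynamic algorithm finds the vertices with light triangles. -/
theorem exists_dynAlg {kind : Kind} {p q : ℝ} (h : (problem mode kind).Solvable p q) (c : ℕ) :
    ∃ (A : DynAlg) (C : ℕ) (K : ℝ), ∀ G : Gadget, G.big ≤ (4 * G.N + 2) ^ c →
      A.prepTime (wordLength C (G.instSize kind)) (G.input mode kind) (G.requests mode kind)
        ≤ ENNReal.ofReal (K * (G.instSize kind : ℝ) ^ p) ∧
      A.requestTime (wordLength C (G.instSize kind)) (G.input mode kind) (G.requests mode kind)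
        ≤ ENNReal.ofReal (K * ((3 * G.N : ℕ) * (G.instSize kind : ℝ) ^ q)) ∧
      ∀ t, ∀ d ∈ (iter (A.dynStep (wordLength C (G.instSize kind)))
        (A.start (G.input mode kind) (G.requests mode kind)) t).support, d.phase = .done →
        d.answers.length = G.N ∧
          ∀ i (hi : i < d.answers.length), G.Test mode i d.answers[i] kind ↔ G.Light i := by
  obtain ⟨A, C, K, hA⟩ := h c
  refine ⟨A, C, K, fun G hG => ?_⟩
  have hlen : (G.requests mode kind).length = 3 * G.N := Mode.length_requests _ _
  have hle : 2 * G.δ * G.N + 2 * G.δ * G.N ≤ G.big := by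
    have : G.big = 4 * (2 * G.δ * G.N) + 8 * G.δ := by unfold big; ring
    omega
  cases kind with
  | path =>
    have hupd := fun i (hi : i < G.N) => stInst_updates (mode := mode) hG hi
    have hval : (stSP mode).Valid c (G.stInst mode 0 0) := by
      refine ⟨fun i => ?_, fun i j => add_comm _ _, fun i j => ?_⟩
      · simp [stInst, fwd_self]
      · refine le_trans ?_ hG
        have h1 := fwd_le (G := G) (mode := mode) 0 0 i j
        have h2 := fwd_le (G := G) (mode := mode) 0 0 j i
        simp only [stInst]
        omega
    have hleg : (stSP mode).LegalSeq c (G.stInst mode 0 0) (G.requests mode .path) :=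
      legalSeq_requests (P := stSP mode) (mode := mode) (inst := G.stInst mode)
        (u₁ := G.sourceUpdate mode .path) (u₂ := G.sinkUpdate mode .path) (fun i hi => (hupd i hi).1)
        (fun i hi => (hupd i hi).2) G.N 0 (by omega)
    obtain ⟨h1, h2, h3⟩ := hA (G.stInst mode 0 0) hval _ hleg
    refine ⟨h1, by rw [← hlen]; exact h2, fun t d hd hdone => ?_⟩
    have h4 := h3 t d hd hdone
    rw [show (problem mode .path).queried (G.stInst mode 0 0) (G.requests mode .path) = _ from
      queried_requests (P := stSP mode) (mode := mode) (inst := G.stInst mode)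
        (u₁ := G.sourceUpdate mode .path) (u₂ := G.sinkUpdate mode .path) (fun i hi => (hupd i hi).1.2)
        (fun i hi => (hupd i hi).2.2) G.N 0 (by omega)] at h4
    obtain ⟨h5, h6⟩ := answers_of_forall₂ h4
    refine ⟨h5, fun i hi => ?_⟩
    have hi' : i < G.N := by omega
    exact stInst_answer (active_stage hi') (active_stage hi') (h6 i hi)
  | matching =>
    have hsz : 4 * G.N + 2 + (4 * G.N + 2) = 8 * G.N + 4 := by ring
    have hG' : G.big ≤ (8 * G.N + 4) ^ c := hG.trans (Nat.pow_le_pow_left (by omega) c)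
    have hupd := fun i (hi : i < G.N) => bipInst_updates (mode := mode) hG' hi
    have hval : (bwMatch mode).Valid c (G.bipInst mode 0 0) := by
      refine ⟨by simp [bipInst], fun i j => ?_⟩
      refine le_trans (matchEntry_le _ _ _ _) ?_
      simpa only [bipInst, hsz] using hG'
    have hleg : (bwMatch mode).LegalSeq c (G.bipInst mode 0 0) (G.requests mode .matching) :=
      legalSeq_requests (P := bwMatch mode) (mode := mode) (inst := G.bipInst mode)
        (u₁ := G.sourceUpdate mode .matching) (u₂ := G.sinkUpdate mode .matching) (fun i hi => (hupd i hi).1)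
        (fun i hi => (hupd i hi).2) G.N 0 (by omega)
    have hsize : (problem mode .matching).size (G.bipInst mode 0 0) = G.instSize .matching := by
      change 4 * G.N + 2 + (4 * G.N + 2) = 8 * G.N + 4
      omega
    obtain ⟨h1, h2, h3⟩ := hA (G.bipInst mode 0 0) hval _ hleg
    rw [hsize] at h1 h2 h3
    refine ⟨h1, by rw [← hlen]; exact h2, fun t d hd hdone => ?_⟩
    have h4 := h3 t d hd hdone
    rw [show (problem mode .matching).queried (G.bipInst mode 0 0) (G.requests mode .matching) = _ from
      queried_requests (P := bwMatch mode) (mode := mode) (inst := G.bipInst mode)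
        (u₁ := G.sourceUpdate mode .matching) (u₂ := G.sinkUpdate mode .matching) (fun i hi => (hupd i hi).1.2)
        (fun i hi => (hupd i hi).2.2) G.N 0 (by omega)] at h4
    obtain ⟨h5, h6⟩ := answers_of_forall₂ h4
    refine ⟨h5, fun i hi => ?_⟩
    have hi' : i < G.N := by omega
    exact bipInst_answer (active_stage hi') (active_stage hi') (h6 i hi)

end Gadget

/-! ## All pairs shortest paths by repeated squaring -/

/-- The square of the `m × m` matrix `D` with respect to the operations `min` and `+`. -/
noncomputable def minPlusSq (m : ℕ) (D : ℕ → ℕ → ℕ) (i j : ℕ) : ℕ :=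
  sInf {d | ∃ k < m, d = D i k + D k j}

theorem minPlusSq_lt_iff {m : ℕ} (hm : 0 < m) {D : ℕ → ℕ → ℕ} {i j t : ℕ} :
    minPlusSq m D i j < t ↔ ∃ k < m, D i k + D k j < t := by
  constructor
  · intro h
    obtain ⟨k, hk, he⟩ : minPlusSq m D i j ∈ {d | ∃ k < m, d = D i k + D k j} :=
      Nat.sInf_mem ⟨_, 0, hm, rfl⟩
    exact ⟨k, hk, he ▸ h⟩
  · rintro ⟨k, hk, h⟩
    exact lt_of_le_of_lt (Nat.sInf_le (⟨k, hk, rfl⟩ : _ ∈ {d | ∃ k < m, d = D i k + D k j})) h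

theorem minPlusSq_le {m : ℕ} {D : ℕ → ℕ → ℕ} {i j k : ℕ} (hk : k < m) :
    minPlusSq m D i j ≤ D i k + D k j := Nat.sInf_le ⟨k, hk, rfl⟩

/-! ### Short walks and the correctness of repeated squaring -/

section paths

variable {n : ℕ} (W : Fin n → Fin n → ℕ)

/-- The length of the walk through `f 0, …, f k`. -/
def walkLength (f : ℕ → Fin n) (k : ℕ) : ℕ := ∑ p ∈ Finset.range k, W (f p) (f (p + 1))

/-- The vertices `f 0, …, f k` form a walk. -/
def IsWalk (f : ℕ → Fin n) (k : ℕ) : Prop := ∀ p < k, W (f p) (f (p + 1)) ≠ 0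

variable {W}

theorem HasWalk.exists_isWalk {u v : Fin n} {l : ℕ} (h : HasWalk W u v l) :
    ∃ k f, IsWalk W f k ∧ f 0 = u ∧ f k = v ∧ walkLength W f k = l := by
  induction h with
  | nil u => exact ⟨0, fun _ => u, fun p hp => absurd hp (by omega), rfl, rfl, rfl⟩
  | @cons u v x l hne _ ih =>
    obtain ⟨k, f, hf, h0, hk, hl⟩ := ih
    refine ⟨k + 1, fun p => Nat.casesOn p u f, ?_, rfl, hk, ?_⟩
    · intro p hp
      cases p with
      | zero => simpa [h0] using hne
      | succ p => exact hf p (by omega)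
    · simp only [walkLength]
      rw [Finset.sum_range_succ', add_comm]
      simp only [h0]
      rw [← hl]
      rfl

theorem HasWalk.append {u v x : Fin n} {l l' : ℕ} (h : HasWalk W u v l) (h' : HasWalk W v x l') :
    HasWalk W u x (l + l') := by
  induction h with
  | nil u => simpa using h'
  | cons hne _ ih => rw [add_assoc]; exact .cons hne (ih h')

/-- By the pigeonhole principle a vertex is repeated among `f 0, …, f k`; the closed piece between
its two occurrences is cut out. -/
theorem IsWalk.exists_shorter {k : ℕ} {f : ℕ → Fin n} (h : IsWalk W f k) (hk : n ≤ k) :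
    ∃ k' < k, ∃ f', IsWalk W f' k' ∧ f' 0 = f 0 ∧ f' k' = f k ∧ walkLength W f' k' ≤ walkLength W f k := by
  obtain ⟨a, b, hab, hbk, he⟩ : ∃ a b, a < b ∧ b ≤ k ∧ f a = f b := by
    obtain ⟨x, y, hxy, he⟩ := Fintype.exists_ne_map_eq_of_card_lt (fun p : Fin (k + 1) => f p)
      (by simp; omega)
    rcases lt_or_gt_of_ne (fun h => hxy (Fin.ext h) : x.val ≠ y.val) with h1 | h1
    · exact ⟨x, y, h1, by omega, he⟩
    · exact ⟨y, x, h1, by omega, he.symm⟩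
  set g : ℕ → Fin n := fun p => if p ≤ a then f p else f (p + (b - a)) with hg
  have edge1 : ∀ p < a, g p = f p ∧ g (p + 1) = f (p + 1) := by
    intro p hp
    simp only [hg]
    rw [if_pos (by omega), if_pos (by omega)]
    exact ⟨rfl, rfl⟩
  have edge2 : ∀ p, a ≤ p → g p = f (p + (b - a)) ∧ g (p + 1) = f (p + (b - a) + 1) := by
    intro p hp
    simp only [hg]
    rw [if_neg (by omega : ¬ p + 1 ≤ a)]
    refine ⟨?_, by congr 1; omega⟩
    split_ifs with h1
    · obtain rfl : p = a := by omega
      rw [he]; congr 1; omega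
    · rfl
  refine ⟨k - (b - a), by omega, g, ?_, ?_, ?_, ?_⟩
  · intro p hp
    by_cases hpa : p < a
    · rw [(edge1 p hpa).1, (edge1 p hpa).2]; exact h p (by omega)
    · rw [(edge2 p (by omega)).1, (edge2 p (by omega)).2]; exact h _ (by omega)
  · simp [hg]
  · rw [(edge2 _ (by omega)).1]; congr 1; omega
  · unfold walkLength
    obtain ⟨c, rfl⟩ : ∃ c, k = b + c := ⟨k - b, by omega⟩
    have e1 : b + c - (b - a) = a + c := by omega
    rw [e1, Finset.sum_range_add, Finset.sum_range_add]
    refine add_le_add ?_ ?_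
    · calc ∑ p ∈ Finset.range a, W (g p) (g (p + 1))
          = ∑ p ∈ Finset.range a, W (f p) (f (p + 1)) := by
            refine Finset.sum_congr rfl fun p hp => ?_
            rw [(edge1 p (Finset.mem_range.1 hp)).1, (edge1 p (Finset.mem_range.1 hp)).2]
        _ ≤ _ := Finset.sum_le_sum_of_subset (Finset.range_mono (by omega))
    · refine le_of_eq (Finset.sum_congr rfl fun p _ => ?_)
      rw [(edge2 (a + p) (by omega)).1, (edge2 (a + p) (by omega)).2]
      have : a + p + (b - a) = b + p := by omega
      rw [this]

theorem HasWalk.exists_short {u v : Fin n} {l : ℕ} (h : HasWalk W u v l) :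
    ∃ k < n, ∃ f, IsWalk W f k ∧ f 0 = u ∧ f k = v ∧ walkLength W f k ≤ l := by
  classical
  have hex : ∃ k, ∃ f, IsWalk W f k ∧ f 0 = u ∧ f k = v ∧ walkLength W f k ≤ l := by
    obtain ⟨k, f, h1, h2, h3, h4⟩ := h.exists_isWalk
    exact ⟨k, f, h1, h2, h3, h4.le⟩
  obtain ⟨f, h1, h2, h3, h4⟩ := Nat.find_spec hex
  refine ⟨Nat.find hex, ?_, f, h1, h2, h3, h4⟩
  by_contra hn
  obtain ⟨k', hk', f', g1, g2, g3, g4⟩ := h1.exists_shorter (by omega)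
  exact Nat.find_min hex hk' ⟨f', g1, g2.trans h2, g3.trans h3, g4.trans h4⟩

/-- The matrix of `W`, padded to arbitrary indices, with `0` on the diagonal and `B` for the pairs
that are not joined by an edge. -/
def initMatrix (W : Fin n → Fin n → ℕ) (B i j : ℕ) : ℕ :=
  if i = j then 0
  else if h : i < n ∧ j < n then (if W ⟨i, h.1⟩ ⟨j, h.2⟩ = 0 then B else W ⟨i, h.1⟩ ⟨j, h.2⟩) else B

/-- The matrix after `r` squarings. -/
noncomputable def distMatrix (m : ℕ) (W : Fin n → Fin n → ℕ) (B : ℕ) : ℕ → ℕ → ℕ → ℕ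
  | 0 => initMatrix W B
  | r + 1 => minPlusSq m (distMatrix m W B r)

variable {m B : ℕ}

theorem distMatrix_self (r : ℕ) {i : ℕ} (hi : i < m) : distMatrix m W B r i i = 0 := by
  induction r with
  | zero => simp [distMatrix, initMatrix]
  | succ r ih =>
    have := minPlusSq_le (m := m) (D := distMatrix m W B r) (i := i) (j := i) hi
    rw [distMatrix]
    omega

/-- The zero diagonal makes `k = i` a candidate in each minimum, so squaring never increases an
entry and `B` remains an upper bound. -/
theorem distMatrix_le (hW : ∀ i j, W i j ≤ B) (r : ℕ) {i : ℕ} (hi : i < m) (j : ℕ) :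
    distMatrix m W B r i j ≤ B := by
  induction r with
  | zero =>
    rw [distMatrix]
    unfold initMatrix
    split_ifs
    exacts [Nat.zero_le _, le_rfl, hW _ _, le_rfl]
  | succ r ih =>
    have h1 := minPlusSq_le (m := m) (D := distMatrix m W B r) (i := i) (j := j) hi
    have h2 := distMatrix_self (m := m) (W := W) (B := B) r hi
    rw [distMatrix]
    omega

/-- An entry below `B` is a sum of two entries below `B`, so the placeholder for a missing edge was
not used. The first alternative is needed for padded indices, where the diagonal is zero but there
is no vertex. -/
theorem distMatrix_sound (hm : 0 < m) (r : ℕ) {i j : ℕ} (h : distMatrix m W B r i j < B) :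
    (i = j ∧ distMatrix m W B r i j = 0) ∨
      ∃ (hi : i < n) (hj : j < n), HasWalk W ⟨i, hi⟩ ⟨j, hj⟩ (distMatrix m W B r i j) := by
  induction r generalizing i j with
  | zero =>
    rw [distMatrix] at h ⊢
    unfold initMatrix at h ⊢
    split_ifs at h ⊢ with h1 h2 h3
    · exact Or.inl ⟨h1, rfl⟩
    · omega
    · exact Or.inr ⟨h2.1, h2.2, by simpa using HasWalk.cons h3 (HasWalk.nil _)⟩
    · omega
  | succ r ih =>
    rw [distMatrix] at h ⊢
    obtain ⟨k, hk, he⟩ : minPlusSq m (distMatrix m W B r) i j ∈ {d | ∃ k < m, d = _ + _} :=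
      Nat.sInf_mem ⟨_, 0, hm, rfl⟩
    rw [he] at h ⊢
    rcases ih (i := i) (j := k) (by omega) with ⟨h1, h2⟩ | ⟨h1, h2, h3⟩
    · rcases ih (i := k) (j := j) (by omega) with ⟨g1, g2⟩ | ⟨g1, g2, g3⟩
      · exact Or.inl ⟨h1.trans g1, by omega⟩
      · subst h1
        rw [h2, zero_add]
        exact Or.inr ⟨g1, g2, g3⟩
    · rcases ih (i := k) (j := j) (by omega) with ⟨g1, g2⟩ | ⟨g1, g2, g3⟩
      · subst g1
        rw [g2, add_zero]
        exact Or.inr ⟨h1, h2, h3⟩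
      · exact Or.inr ⟨h1, g2, h3.append g3⟩

/-- A walk with at most `2 ^ (r + 1)` edges is cut into two walks with at most `2 ^ r` edges each.
-/
theorem distMatrix_le_walkLength (hnm : n ≤ m) (r : ℕ) {k : ℕ} (hk : k ≤ 2 ^ r) {f : ℕ → Fin n}
    (hf : IsWalk W f k) : distMatrix m W B r (f 0) (f k) ≤ walkLength W f k := by
  induction r generalizing k f with
  | zero =>
    rw [distMatrix]
    rcases Nat.le_one_iff_eq_zero_or_eq_one.1 (by simpa using hk) with rfl | rfl
    · simp [initMatrix]
    · have := hf 0 one_pos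
      unfold initMatrix
      simp only [walkLength, Finset.range_one, Finset.sum_singleton]
      rw [dif_pos ⟨(f 0).isLt, (f 1).isLt⟩, if_neg this]
      split_ifs
      · exact Nat.zero_le _
      · exact le_rfl
  | succ r ih =>
    obtain ⟨a, b, rfl, ha, hb⟩ : ∃ a b, k = a + b ∧ a ≤ 2 ^ r ∧ b ≤ 2 ^ r := by
      rw [pow_succ] at hk
      exact ⟨min k (2 ^ r), k - min k (2 ^ r), by omega, by omega, by omega⟩
    have h1 := ih ha (f := f) fun p hp => hf p (by omega)
    have h2 := ih hb (f := fun p => f (a + p)) fun p hp => by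
      have := hf (a + p) (by omega)
      rwa [add_assoc] at this
    have h3 := minPlusSq_le (m := m) (D := distMatrix m W B r) (i := f 0) (j := f (a + b)) (k := f a)
      ((f a).isLt.trans_le hnm)
    have h4 : walkLength W f (a + b) = walkLength W f a + walkLength W (fun p => f (a + p)) b := by
      simp only [walkLength, Finset.sum_range_add, add_assoc]
    rw [distMatrix, h4]
    simp only [add_zero] at h2
    omega

/-- It suffices to consider walks with fewer than `n` edges. Their lengths are at most `n ^ (c + 1)
< B`, so `B` can stand for infinity, and `r` squarings with `n ≤ 2 ^ r` reach all of them. -/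
theorem distMatrix_encodes {c r : ℕ} (hnm : n ≤ m) (hr : n ≤ 2 ^ r) (hW : ∀ i j, W i j ≤ n ^ c)
    (hB : n ^ (c + 1) < B) (i j : Fin n) :
    EncodesDistance (distance W i j)
      (if distMatrix m W B r i j < B then distMatrix m W B r i j + 1 else 0) := by
  have hm : 0 < m := by have := i.isLt; omega
  have hsound : distMatrix m W B r i j < B → HasWalk W i j (distMatrix m W B r i j) := by
    intro h
    rcases distMatrix_sound hm r h with ⟨h1, h2⟩ | ⟨h1, h2, h3⟩
    · rw [h2, Fin.ext h1]; exact .nil _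
    · exact h3
  have hcomplete : ∀ l, HasWalk W i j l → distMatrix m W B r i j ≤ l ∧ distMatrix m W B r i j < B := by
    intro l hl
    obtain ⟨k, hk, f, h1, h2, h3, h4⟩ := hl.exists_short
    have h5 := distMatrix_le_walkLength (B := B) hnm r (k := k) (by omega) h1
    rw [h2, h3] at h5
    have h6 : walkLength W f k ≤ k * n ^ c := by
      unfold walkLength
      refine (Finset.sum_le_card_nsmul _ _ (n ^ c) fun p _ => hW _ _).trans ?_
      simp
    have h7 : k * n ^ c ≤ n ^ (c + 1) := by
      rw [pow_succ, mul_comm]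
      exact Nat.mul_le_mul_left _ hk.le
    omega
  split_ifs with h
  · refine Or.inr ⟨_, le_antisymm (Gadget.distance_le (hsound h)) (le_iInf₂ fun l hl => ?_), rfl⟩
    exact_mod_cast (hcomplete l hl).1
  · refine Or.inl ⟨?_, rfl⟩
    refine top_le_iff.1 (le_iInf₂ fun l hl => ?_)
    exact absurd (hcomplete l hl).2 h

end paths

namespace Machine

variable {Γ : Machine}

/-! ## Filling arrays -/

/-- The memory after writing `val 0, …, val (k - 1)` from the address `b` on. -/
def fillMem (mem : ℕ → ℕ) (b k : ℕ) (val : ℕ → ℕ) (a : ℕ) : ℕ :=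
  if b ≤ a ∧ a < b + k then val (a - b) else mem a

theorem fillMem_of_lt {mem : ℕ → ℕ} {b k : ℕ} {val : ℕ → ℕ} {a : ℕ} (h : a < b) :
    fillMem mem b k val a = mem a := if_neg (by omega)

theorem fillMem_of_le {mem : ℕ → ℕ} {b k : ℕ} {val : ℕ → ℕ} {a : ℕ} (h : b + k ≤ a) :
    fillMem mem b k val a = mem a := if_neg (by omega)

theorem fillMem_add {mem : ℕ → ℕ} {b k : ℕ} {val : ℕ → ℕ} {j : ℕ} (h : j < k) :
    fillMem mem b k val (b + j) = val j := by
  rw [fillMem, if_pos (by omega), Nat.add_sub_cancel_left]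

/-- `M[a + p] := e` for all `p` below `k` -/
def fill (R₀ : ℕ) (a k e : Expr) : Prog := forLoop R₀ Var.p k (write R₀ (a + .var Var.p) e)

def fillTime (a k e : Expr) : ℕ := forTime k + ((a + .var Var.p).time + e.time + 3)

/-- Entry `j` is computed after the cells before it have been overwritten. Hence an array can be
updated in place, provided that entry `j` depends on its old contents only from position `j` on. -/
theorem ARuns.fill {s : Env} {a k e : Expr} {b B : ℕ} (val : ℕ → ℕ) {T : ℝ≥0∞}
    {R : Env → ℝ≥0∞ → Prop} (hS : a.size + 1 ≤ Γ.S ∧ k.size + 10 ≤ Γ.S ∧ e.size ≤ Γ.S)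
    (hB : B < Γ.X)
    (hab : ∀ s' : Env, (∀ v ≠ Var.p, s'.reg v = s.reg v) → a.eval s' = b ∧ k.eval s' = B)
    (hval : ∀ j < B, e.eval ⟨Function.update s.reg Var.p j, fillMem s.mem b j val, s.low⟩ = val j ∧
      val j < Γ.X)
    (h : R ⟨Function.update s.reg Var.p B, fillMem s.mem b B val, s.low⟩ T) :
    Γ.ARuns (fill Γ.R₀ a k e) s (T + (fillTime a k e * (B + 1) : ℕ)) R := by
  set w := (a + .var Var.p).time + e.time + 3 with hw
  have ht : T + ((fillTime a k e * (B + 1) : ℕ) : ℝ≥0∞)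
      = T + (w * B : ℕ) + (forTime k * (B + 1) : ℕ) + w := by
    simp only [fillTime, ← hw]; push_cast; ring
  rw [ht]
  refine ARuns.mono ?_ le_self_add
  refine ARuns.forLoop (fun j s' x => j ≤ B ∧
    s' = ⟨Function.update s.reg Var.p j, fillMem s.mem b j val, s.low⟩ ∧
    x = T + (w * (B - j) : ℕ)) hS.2.1 hB ?_ ?_ ?_ ?_ ?_
  · rintro j s' x ⟨-, rfl, -⟩
    simp
  · rintro j s' x ⟨-, rfl, -⟩
    exact (hab _ fun v hv => Function.update_of_ne hv _ _).2
  · refine ⟨by omega, ?_, by simp⟩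
    simp only [Env.setReg, Env.mk.injEq, true_and, and_true]
    funext x
    simp [fillMem]
  · rintro j hj s' x _ ⟨-, rfl, rfl⟩
    have hx : T + ((w * (B - j) : ℕ) : ℝ≥0∞) = T + (w * (B - (j + 1)) : ℕ) + w := by
      obtain ⟨d, hd⟩ : ∃ d, B - j = d + 1 := ⟨B - j - 1, by omega⟩
      have hd' : B - (j + 1) = d := by omega
      rw [hd, hd']; push_cast; ring
    rw [hx, hw]
    obtain ⟨e1, e2⟩ := hval j hj
    have ha := (hab ⟨Function.update s.reg Var.p j, fillMem s.mem b j val, s.low⟩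
      fun v hv => Function.update_of_ne hv _ _).1
    refine ARuns.write (by simpa using hS.1) hS.2.2 (by rw [e1]; exact e2) ?_
    refine ⟨by simp [Env.setMem], by omega, ?_, rfl⟩
    simp only [Env.setReg, Env.setMem, Env.mk.injEq, and_true, e1, Expr.eval_add, ha, Expr.eval_var,
      Function.update_self, Function.update_idem, true_and]
    funext x
    simp only [Function.update_apply, fillMem]
    by_cases h1 : x = b + j
    · subst h1
      simp
    · rw [if_neg h1]
      split_ifs <;> first | rfl | omega
  · rintro s' x _ ⟨-, rfl, rfl⟩
    simpa using h

/-- `v := a * b ^ k`, where `k` is the value of the variable `e` -/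
def power (R₀ v a b : ℕ) : Prog :=
  .seq (assign R₀ v (.const a)) (forLoop R₀ Var.p (.var Var.e) (assign R₀ v (.var v * .const b)))

def powerTime (k : ℕ) : ℕ := 28 * (k + 1) + 10

theorem ARuns.power {s : Env} {v a b k : ℕ} {T : ℝ≥0∞} {R : Env → ℝ≥0∞ → Prop}
    (hv : v ≠ Var.p) (hve : v ≠ Var.e) (hS : a + 20 ≤ Γ.S ∧ b + 20 ≤ Γ.S) (hk : s.reg Var.e = k)
    (hX : ∀ j ≤ k, a * b ^ j < Γ.X)
    (h : ∀ s' : Env, s'.reg v = a * b ^ k → (∀ u, u ≠ v → u ≠ Var.p → s'.reg u = s.reg u) →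
      s'.mem = s.mem → R s' T) :
    Γ.ARuns (power Γ.R₀ v a b) s (T + powerTime k) R := by
  refine ARuns.of_below fun hb => ?_
  have ht : T + ((powerTime k : ℕ) : ℝ≥0∞) = T + (7 * k : ℕ) + (forTime (.var Var.e) * (k + 1) : ℕ)
      + ((Expr.const a).time + 2 : ℕ) + 1 + (7 * (k + 1) + 6 - 7 * k : ℕ) := by
    have e1 : (Expr.const a).time = 1 := rfl
    have e2 : forTime (.var Var.e) = 21 := rfl
    have e3 : 7 * (k + 1) + 6 - 7 * k = 13 := by omega
    rw [e1, e2, e3, powerTime]; push_cast; ring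
  rw [ht]
  refine ARuns.mono (ARuns.seq (ARuns.assign (by simp; omega) (by simpa using hX 0 (by omega)) ?_))
    le_self_add
  refine ARuns.forLoop (B := k) (fun j s' x => j ≤ k ∧ s'.reg v = a * b ^ j ∧ s'.reg Var.p = j ∧
    (∀ u, u ≠ v → u ≠ Var.p → s'.reg u = s.reg u) ∧ s'.mem = s.mem ∧ x = T + (7 * (k - j) : ℕ))
    (by simp; omega) (hk ▸ hb.1 _) ?_ ?_ ?_ ?_ ?_
  · rintro j s' x h1; exact h1.2.2.1
  · rintro j s' x ⟨-, -, -, h1, -⟩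
    rw [Expr.eval_var, h1 _ hve.symm (by decide), hk]
  · refine ⟨by omega, by simp [Env.setReg_reg, hv], by simp, ?_, rfl, by simp⟩
    intro u h1 h2
    rw [Env.setReg_reg, if_neg h2, Env.setReg_reg, if_neg h1]
  · rintro j hj s' x _ ⟨-, h1, h2, h3, h4, rfl⟩
    have hx : T + ((7 * (k - j) : ℕ) : ℝ≥0∞)
        = T + (7 * (k - (j + 1)) : ℕ) + ((Expr.var v * Expr.const b).time + 2 : ℕ) := by
      have e1 : (Expr.var v * Expr.const b).time = 5 := rfl
      obtain ⟨d, hd⟩ : ∃ d, k - j = d + 1 := ⟨k - j - 1, by omega⟩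
      have hd' : k - (j + 1) = d := by omega
      rw [e1, hd, hd']; push_cast; ring
    rw [hx]
    have e1 : (Expr.var v * Expr.const b).eval s' = a * b ^ (j + 1) := by
      simp [h1, pow_succ, mul_assoc]
    refine ARuns.assign (by simp; omega) (by rw [e1]; exact hX _ (by omega)) ?_
    refine ⟨?_, by omega, ?_, by simp, ?_, h4, rfl⟩
    · rw [Env.setReg_reg, if_neg hv.symm, h2]
    · rw [Env.setReg_reg, if_neg hv, Env.setReg_reg_self, e1]
    · intro u g1 g2
      rw [Env.setReg_reg, if_neg g2, Env.setReg_reg, if_neg g1, h3 u g1 g2]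
  · rintro s' x _ ⟨-, h1, h2, h3, h4, rfl⟩
    simpa using h s' h1 h3 h4

end Machine

/-! ## Matrices in the memory -/

/-- The entries of the matrix number `b` in the memory; all matrices have `m` columns and `m` rows. -/
def Env.mat (s : Env) (m b i j : ℕ) : ℕ := s.mem (b * (m * m) + (i * m + j))

theorem index_lt {m i j : ℕ} (hi : i < m) (hj : j < m) : i * m + j < m * m := by nlinarith

theorem index_inj {m i j i' j' : ℕ} (hj : j < m) (hj' : j' < m) (h : i * m + j = i' * m + j') :
    i = i' ∧ j = j' := by
  have hm : 0 < m := by omega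
  have h1 : (i * m + j) / m = i := by
    rw [add_comm, Nat.add_mul_div_right _ _ hm, Nat.div_eq_of_lt hj, zero_add]
  have h2 : (i' * m + j') / m = i' := by
    rw [add_comm, Nat.add_mul_div_right _ _ hm, Nat.div_eq_of_lt hj', zero_add]
  have h3 : i = i' := by rw [← h1, h, h2]
  subst h3
  exact ⟨rfl, by omega⟩

theorem Env.mat_setMem {s : Env} {m b i j i' j' x : ℕ} (hj : j < m) (hj' : j' < m) :
    (s.setMem (b * (m * m) + (i * m + j)) x).mat m b i' j'
      = if i' = i ∧ j' = j then x else s.mat m b i' j' := by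
  simp only [Env.mat, Env.setMem, Function.update_apply, add_right_inj]
  by_cases h : i' = i ∧ j' = j
  · rw [if_pos h, if_pos (by rw [h.1, h.2])]
  · rw [if_neg h, if_neg fun h' => h (index_inj hj' hj h')]

/-- The entries of `F'` are those of `F`, except that entries which exceed those of the square of `D`
may have been replaced by `0`. -/
def Refines (m : ℕ) (D F F' : ℕ → ℕ → ℕ) : Prop :=
  ∀ i < m, ∀ j < m, F' i j = F i j ∨ (F' i j = 0 ∧ ∃ k < m, D i k + D k j < F i j)

theorem Refines.refl {m : ℕ} {D F : ℕ → ℕ → ℕ} : Refines m D F F := fun _ _ _ _ => Or.inl rfl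

theorem Refines.trans {m : ℕ} {D F F' F'' : ℕ → ℕ → ℕ} (h : Refines m D F F')
    (h' : Refines m D F' F'') : Refines m D F F'' := by
  intro i hi j hj
  rcases h i hi j hj with h1 | ⟨h1, h2⟩ <;> rcases h' i hi j hj with h3 | ⟨h3, h4⟩
  · exact Or.inl (h3.trans h1)
  · rw [h1] at h4; exact Or.inr ⟨h3, h4⟩
  · exact Or.inr ⟨h3.trans h1, h2⟩
  · exact Or.inr ⟨h3, h2⟩

theorem Refines.eq_of_ne_zero {m : ℕ} {D F F' : ℕ → ℕ → ℕ} (h : Refines m D F F') {i j : ℕ}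
    (hi : i < m) (hj : j < m) (h0 : F' i j ≠ 0) : F' i j = F i j := by
  rcases h i hi j hj with h1 | h1
  · exact h1
  · exact absurd h1.1 h0

/-- The sizes that the main program works with. -/
structure Params where
  n : ℕ
  e : ℕ
  N : ℕ
  m : ℕ
  δ : ℕ
  β : ℕ
  stride : ℕ
  lim : ℕ
  N_pos : 0 < N
  m_eq : m = N ^ 4

namespace Params

theorem m_pos (Λ : Params) : 0 < Λ.m := by rw [Λ.m_eq]; exact Nat.pow_pos Λ.N_pos

theorem N_le (Λ : Params) : Λ.N ≤ Λ.m := by rw [Λ.m_eq]; exact Nat.le_self_pow (by decide) _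

theorem m_le (Λ : Params) : Λ.m ≤ Λ.m * Λ.m := Nat.le_mul_of_pos_left _ Λ.m_pos

theorem N_mul_le (Λ : Params) : Λ.N * Λ.N ≤ Λ.m * Λ.m := Nat.mul_le_mul Λ.N_le Λ.N_le

end Params

/-- The variables for the sizes have the right values. -/
structure Consts (Λ : Params) (s : Env) : Prop where
  n : s.reg Var.n = Λ.n
  N : s.reg Var.N = Λ.N
  e : s.reg Var.e = Λ.e
  m : s.reg Var.m = Λ.m
  mm : s.reg Var.mm = Λ.m * Λ.m
  δ : s.reg Var.δ = Λ.δ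
  β : s.reg Var.β = Λ.β
  stride : s.reg Var.stride = Λ.stride
  lim : s.reg Var.lim = Λ.lim
  ans : s.reg Var.ans = 4 * (Λ.m * Λ.m)

theorem Consts.congr {Λ : Params} {s s' : Env} (h : Consts Λ s)
    (h' : ∀ v < 10, s'.reg v = s.reg v) : Consts Λ s' := by
  obtain ⟨h0, h1, h2, h3, h4, h5, h6, h7, h8, h9⟩ := h
  constructor
  all_goals rw [h' _ (by decide)]; assumption

namespace Expr

/-- An entry of the matrix number `b`. -/
def addr (b i j : Expr) : Expr := b * .var Var.mm + (i * .var Var.m + j)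

def cell (b i j : Expr) : Expr := .load (addr b i j)

theorem eval_addr {Λ : Params} {s : Env} (h : Consts Λ s) (b i j : Expr) : (addr b i j).eval s
    = b.eval s * (Λ.m * Λ.m) + (i.eval s * Λ.m + j.eval s) := by
  simp [addr, h.m, h.mm]

theorem eval_cell {Λ : Params} {s : Env} (h : Consts Λ s) (b i j : Expr) : (cell b i j).eval s
    = s.mat Λ.m (b.eval s) (i.eval s) (j.eval s) := by
  simp [cell, eval_addr h, Env.mat]

/-- The minimum of two numbers. -/
def min (a b : Expr) : Expr := a - (a - b)

@[simp] theorem eval_min (s : Env) (a b : Expr) : (min a b).eval s = Min.min (a.eval s) (b.eval s) := by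
  simp only [min, eval_sub]
  omega

/-- `a` if `c = 1`, and `b` if `c = 0`. -/
def cases (c a b : Expr) : Expr := c * a + (1 - c) * b

theorem eval_cases {s : Env} {c a b : Expr} {P : Prop} [Decidable P]
    (h : c.eval s = if P then 1 else 0) :
    (cases c a b).eval s = if P then a.eval s else b.eval s := by
  simp only [cases, eval_add, eval_mul, eval_sub, h, eval_ofNat]
  split_ifs <;> simp

end Expr

/-! ### Scanning a block for witnesses -/

namespace Machine

variable {Γ : Machine} {Λ : Params}

open WordRAM.Expr in
/-- For all pairs of `j` and `k` in the current block, compare the entry of the third matrix in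
the row `I₀ + i` with the length of the path through `k`. -/
def rowProg (R₀ : ℕ) : Prog :=
  forLoop R₀ Var.q (.var Var.N * .var Var.N)
    (write R₀ (addr 3 (.var Var.I₀ + .var Var.i) (.var Var.J₀ + .var Var.q / .var Var.N))
      (cell 3 (.var Var.I₀ + .var Var.i) (.var Var.J₀ + .var Var.q / .var Var.N) *
        (1 - lt (cell 1 (.var Var.I₀ + .var Var.i) (.var Var.K₀ + .var Var.q % .var Var.N) +
            cell 1 (.var Var.K₀ + .var Var.q % .var Var.N) (.var Var.J₀ + .var Var.q / .var Var.N))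
          (cell 3 (.var Var.I₀ + .var Var.i) (.var Var.J₀ + .var Var.q / .var Var.N)))))

def rowTime (N : ℕ) : ℕ := 300 * (N * N + 1)

/-- The single counter `q` encodes the pair `(q / N, q % N)` of a column and an intermediate vertex.
Once an entry is zero it stays zero, because no sum is below `0`. A nonzero survivor still has its
original value and was compared with all intermediate vertices of the block. -/
theorem ARuns.row {s : Env} {I J K : ℕ} {T : ℝ≥0∞} {R : Env → ℝ≥0∞ → Prop}
    (hc : Consts Λ s) (hS : 100 ≤ Γ.S) (hX : Λ.m * Λ.m < Γ.X)
    (hI : s.reg Var.I₀ + s.reg Var.i = I) (hJ : s.reg Var.J₀ = J) (hK : s.reg Var.K₀ = K)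
    (hIm : I < Λ.m) (hJm : J + Λ.N ≤ Λ.m) (hKm : K + Λ.N ≤ Λ.m)
    (h : ∀ s' : Env, (∀ v ≠ Var.q, s'.reg v = s.reg v) →
      (∀ a, a < 3 * (Λ.m * Λ.m) ∨ 4 * (Λ.m * Λ.m) ≤ a → s'.mem a = s.mem a) →
      (∀ i' j', i' < Λ.m → j' < Λ.m → i' ≠ I → s'.mat Λ.m 3 i' j' = s.mat Λ.m 3 i' j') →
      Refines Λ.m (s.mat Λ.m 1) (s.mat Λ.m 3) (s'.mat Λ.m 3) →
      (∀ j < Λ.N, ∀ k < Λ.N, s'.mat Λ.m 3 I (J + j) ≠ 0 →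
        s'.mat Λ.m 3 I (J + j) ≤ s.mat Λ.m 1 I (K + k) + s.mat Λ.m 1 (K + k) (J + j)) → R s' T) :
    Γ.ARuns (rowProg Γ.R₀) s (T + rowTime Λ.N) R := by
  have hN := Λ.N_pos
  set m := Λ.m with hm
  set N := Λ.N with hN'
  have ht : T + ((rowTime N : ℕ) : ℝ≥0∞) = T + (180 * (N * N) : ℕ)
      + (forTime (.var Var.N * .var Var.N) * (N * N + 1) : ℕ) + (95 * (N * N) + 275 : ℕ) := by
    have e2 : forTime (.var Var.N * .var Var.N) = 25 := rfl
    rw [e2, rowTime]; push_cast; ring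
  rw [ht]
  refine ARuns.mono ?_ le_self_add
  refine ARuns.forLoop (B := N * N) (fun q s' x => q ≤ N * N ∧ s'.reg Var.q = q ∧
      (∀ v ≠ Var.q, s'.reg v = s.reg v) ∧
      (∀ a, a < 3 * (m * m) ∨ 4 * (m * m) ≤ a → s'.mem a = s.mem a) ∧
      (∀ i' j', i' < m → j' < m → i' ≠ I → s'.mat m 3 i' j' = s.mat m 3 i' j') ∧
      Refines m (s.mat m 1) (s.mat m 3) (s'.mat m 3) ∧
      (∀ q' < q, s'.mat m 3 I (J + q' / N) ≠ 0 →
        s'.mat m 3 I (J + q' / N) ≤ s.mat m 1 I (K + q' % N) + s.mat m 1 (K + q' % N) (J + q' / N)) ∧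
      x = T + (180 * (N * N - q) : ℕ))
    (by simp; omega) (Λ.N_mul_le.trans_lt hX) (fun j s' x h1 => h1.2.1) ?_ ?_ ?_ ?_
  · rintro q s' x ⟨-, -, h1, -⟩
    simp only [Expr.eval_mul, Expr.eval_var]
    rw [h1 _ (by decide), hc.N]
  · refine ⟨by omega, by simp, fun v hv => by rw [Env.setReg_reg, if_neg hv], fun _ _ => rfl,
      fun _ _ _ _ _ => rfl, Refines.refl, fun q' hq' => absurd hq' (by omega), by simp⟩
  · rintro q hq s' x hb ⟨-, hqv, hreg, hmem, hrow, href, hset, rfl⟩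
    have hc' : Consts Λ s' := hc.congr fun v hv => hreg v (by simp only [Var.q]; omega)
    have hqN : q / N < N := Nat.div_lt_of_lt_mul hq
    have hqN' : q % N < N := Nat.mod_lt _ hN
    have hD : ∀ i < m, ∀ j < m, s'.mat m 1 i j = s.mat m 1 i j := by
      intro i hi j hj
      refine hmem _ (Or.inl ?_)
      have := index_lt hi hj
      omega
    have hx : T + ((180 * (N * N - q) : ℕ) : ℝ≥0∞) = T + (180 * (N * N - (q + 1)) : ℕ) + 180 := by
      obtain ⟨d, hd⟩ : ∃ d, N * N - q = d + 1 := ⟨N * N - q - 1, by omega⟩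
      have hd' : N * N - (q + 1) = d := by omega
      rw [hd, hd']; push_cast; ring
    rw [hx]
    have r1 : s'.reg Var.I₀ + s'.reg Var.i = I := by
      rw [hreg _ (by decide), hreg _ (by decide), hI]
    have r2 : s'.reg Var.J₀ = J := by rw [hreg _ (by decide), hJ]
    have r3 : s'.reg Var.K₀ = K := by rw [hreg _ (by decide), hK]
    refine ARuns.mono (ARuns.write (T := T + (180 * (N * N - (q + 1)) : ℕ)) ?_ ?_ ?_ ?_) ?_
    · exact le_trans (by decide) hS
    · exact le_trans (by decide) hS
    · simp only [Expr.eval_mul, Expr.eval_cell hc', Expr.eval_add, Expr.eval_var, r1, r2]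
      refine lt_of_le_of_lt (Nat.mul_le_mul_left _ (Nat.sub_le _ _)) ?_
      simp only [Expr.eval_ofNat, mul_one]
      exact hb.2.1 _
    · simp only [Expr.eval_mul, Expr.eval_cell hc', Expr.eval_addr hc', Expr.eval_add, Expr.eval_var,
        r1, r2, r3, Expr.eval_sub, Expr.eval_lt, Expr.eval_div, Expr.eval_mod, hqv, hc'.N,
        Expr.eval_ofNat]
      rw [← hN', ← hm]
      set v := s'.mat m 3 I (J + q / N) * (1 - if s'.mat m 1 I (K + q % N) +
        s'.mat m 1 (K + q % N) (J + q / N) < s'.mat m 3 I (J + q / N) then 1 else 0) with hv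
      rw [hD _ hIm _ (by omega), hD _ (by omega) _ (by omega)] at hv
      have hmat : ∀ i', ∀ j' < m, (s'.setMem (3 * (m * m) + (I * m + (J + q / N))) v).mat m 3 i' j'
          = if i' = I ∧ j' = J + q / N then v else s'.mat m 3 i' j' :=
        fun i' j' hj' => Env.mat_setMem (by omega) hj'
      have hstep : Refines m (s.mat m 1) (s'.mat m 3)
          ((s'.setMem (3 * (m * m) + (I * m + (J + q / N))) v).mat m 3) := by
        intro i' hi' j' hj'
        rw [hmat i' j' hj']
        by_cases h1 : i' = I ∧ j' = J + q / N
        · rw [if_pos h1, h1.1, h1.2]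
          by_cases h2 : s.mat m 1 I (K + q % N) + s.mat m 1 (K + q % N) (J + q / N)
            < s'.mat m 3 I (J + q / N)
          · right
            refine ⟨by rw [hv, if_pos h2]; simp, K + q % N, by omega, h2⟩
          · left
            rw [hv, if_neg h2]; simp
        · rw [if_neg h1]; exact Or.inl rfl
      refine ⟨hqv, by omega, by simp, ?_, ?_, ?_, ?_, ?_, trivial⟩
      · intro u hu
        rw [Env.setReg_reg, if_neg hu]
        exact hreg u hu
      · intro a ha
        have := index_lt hIm (show J + q / N < m by omega)
        rw [← hmem a ha]
        simp only [Env.setReg_mem, Env.setMem, Function.update_apply]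
        generalize I * m + (J + q / N) = w at this ⊢
        rw [if_neg (by omega)]
      · intro i' j' hi' hj' hne
        rw [← hrow i' j' hi' hj' hne]
        exact (hmat i' j' hj').trans (if_neg fun h => hne h.1)
      · exact href.trans hstep
      · intro q' hq' h0
        change (s'.setMem (3 * (m * m) + (I * m + (J + q / N))) v).mat m 3 I (J + q' / N) ≠ 0 at h0
        change (s'.setMem (3 * (m * m) + (I * m + (J + q / N))) v).mat m 3 I (J + q' / N) ≤ _
        have hq'N : q' / N < N := Nat.div_lt_of_lt_mul (by omega)
        rw [hstep.eq_of_ne_zero hIm (by omega) h0]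
        rcases Nat.lt_succ_iff_lt_or_eq.1 hq' with h1 | rfl
        · refine hset q' h1 ?_
          rwa [← hstep.eq_of_ne_zero hIm (by omega) h0]
        · by_contra hlt
          rw [hmat _ _ (by omega), if_pos ⟨rfl, rfl⟩, hv, if_pos (by omega)] at h0
          simp at h0
    · refine add_le_add le_rfl ?_
      have : ∀ a e : Expr, (a.time + e.time + 3 ≤ 180) → ((a.time + e.time + 3 : ℕ) : ℝ≥0∞) ≤ 180 :=
        fun a e h => by exact_mod_cast h
      exact this _ _ (by decide)
  · rintro s' x _ ⟨-, -, h1, h2, h3, h4, h5, rfl⟩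
    simp only [Nat.sub_self, mul_zero, Nat.cast_zero, add_zero]
    refine h s' h1 h2 h3 h4 fun j hj k hk h0 => ?_
    have e1 : (j * N + k) / N = j := by
      rw [add_comm, Nat.add_mul_div_right _ _ hN, Nat.div_eq_of_lt hk, zero_add]
    have e2 : (j * N + k) % N = k := by
      rw [add_comm, Nat.add_mul_mod_self_right, Nat.mod_eq_of_lt hk]
    have := h5 (j * N + k) (index_lt hj hk)
    rw [e1, e2] at this
    exact this h0

/-- The number of nonzero entries of the third matrix. -/
def nonzero (m : ℕ) (s : Env) : ℕ :=
  (((Finset.range m) ×ˢ (Finset.range m)).filter fun p => s.mat m 3 p.1 p.2 ≠ 0).card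

theorem nonzero_le (m : ℕ) (s : Env) : nonzero m s ≤ m * m := by
  refine (Finset.card_filter_le _ _).trans ?_
  simp

theorem nonzero_lt {m : ℕ} {s s' : Env} {D : ℕ → ℕ → ℕ} {i j : ℕ} (hi : i < m) (hj : j < m)
    (h : Refines m D (s.mat m 3) (s'.mat m 3)) (h1 : s.mat m 3 i j ≠ 0) (h2 : s'.mat m 3 i j = 0) :
    nonzero m s' + 1 ≤ nonzero m s := by
  refine Finset.card_lt_card ?_
  rw [Finset.ssubset_iff_of_subset]
  · exact ⟨(i, j), by simp [hi, hj, h1], by simp [h2]⟩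
  · intro p hp
    simp only [Finset.mem_filter, Finset.mem_product, Finset.mem_range] at hp ⊢
    refine ⟨hp.1, ?_⟩
    rw [← h.eq_of_ne_zero hp.1.1 hp.1.2 hp.2]
    exact hp.2

/-- Examine the rows for which the test succeeds. -/
def scanProg (R₀ : ℕ) (test : Expr) : Prog :=
  forLoop R₀ Var.i (.var Var.N) (ite R₀ test (rowProg R₀) .skip)

def scanTime (test : Expr) (N : ℕ) : ℕ := (test.time + 25) * (N + 1)

/-- This is the amortized part of the reduction. A row is searched only if some entry in it has a
witness in the block, and the search then sets that entry to zero; its cost is paid by the decrease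
of `nonzero`. The stored answers refer to the matrix before the scan. They are still valid for row
`i` when its turn comes, as only earlier rows have been changed. -/
theorem ARuns.scan {s : Env} {test : Expr} {I J K : ℕ} {T : ℝ≥0∞} {R : Env → ℝ≥0∞ → Prop}
    (hc : Consts Λ s) (hS : 100 ≤ Γ.S) (hX : Λ.m * Λ.m < Γ.X)
    (hI : s.reg Var.I₀ = I) (hJ : s.reg Var.J₀ = J) (hK : s.reg Var.K₀ = K)
    (hIm : I + Λ.N ≤ Λ.m) (hJm : J + Λ.N ≤ Λ.m) (hKm : K + Λ.N ≤ Λ.m) (htS : test.size ≤ Γ.S)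
    (htest : ∀ s' : Env, Consts Λ s' → ∀ i < Λ.N, s'.reg Var.i = i →
      (∀ a, a < 3 * (Λ.m * Λ.m) ∨ 4 * (Λ.m * Λ.m) ≤ a → s'.mem a = s.mem a) →
      (test.eval s' ≠ 0 ↔ ∃ k < Λ.N, ∃ j < Λ.N, s.mat Λ.m 1 (I + i) (K + k) +
        s.mat Λ.m 1 (K + k) (J + j) < s.mat Λ.m 3 (I + i) (J + j)))
    (h : ∀ s' : Env, (∀ v, v ≠ Var.q → v ≠ Var.i → s'.reg v = s.reg v) →
      (∀ a, a < 3 * (Λ.m * Λ.m) ∨ 4 * (Λ.m * Λ.m) ≤ a → s'.mem a = s.mem a) →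
      Refines Λ.m (s.mat Λ.m 1) (s.mat Λ.m 3) (s'.mat Λ.m 3) →
      (∀ i < Λ.N, ∀ j < Λ.N, ∀ k < Λ.N, s'.mat Λ.m 3 (I + i) (J + j) ≠ 0 →
        s'.mat Λ.m 3 (I + i) (J + j) ≤ s.mat Λ.m 1 (I + i) (K + k) + s.mat Λ.m 1 (K + k) (J + j)) →
      R s' (T + (rowTime Λ.N * nonzero Λ.m s' : ℕ))) :
    Γ.ARuns (scanProg Γ.R₀ test) s
      (T + (rowTime Λ.N * nonzero Λ.m s : ℕ) + scanTime test Λ.N) R := by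
  have hN := Λ.N_pos
  set m := Λ.m with hm
  set N := Λ.N with hN'
  set ρ := rowTime N with hρ
  have ht : T + ((ρ * nonzero m s : ℕ) : ℝ≥0∞) + (scanTime test N : ℕ)
      = T + ((ρ * nonzero m s : ℕ) : ℝ≥0∞) + ((test.time + 3) * N : ℕ)
      + (forTime (.var Var.N) * (N + 1) : ℕ) + (N + test.time + 4 : ℕ) := by
    have e2 : forTime (.var Var.N) = 21 := rfl
    rw [e2, scanTime]; push_cast; ring
  rw [ht]
  refine ARuns.mono ?_ le_self_add
  refine ARuns.conseq (R := fun s' x => R s' (T + (ρ * nonzero m s' : ℕ)) ∧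
    T + (ρ * nonzero m s' : ℕ) ≤ x) ?_ fun s' x _ hx => ⟨_, hx.2, hx.1⟩
  refine ARuns.forLoop (B := N) (fun i s' x => i ≤ N ∧ s'.reg Var.i = i ∧
      (∀ v, v ≠ Var.q → v ≠ Var.i → s'.reg v = s.reg v) ∧
      (∀ a, a < 3 * (m * m) ∨ 4 * (m * m) ≤ a → s'.mem a = s.mem a) ∧
      (∀ i' j', i ≤ i' → i' < N → j' < m → s'.mat m 3 (I + i') j' = s.mat m 3 (I + i') j') ∧
      Refines m (s.mat m 1) (s.mat m 3) (s'.mat m 3) ∧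
      (∀ i' < i, ∀ j < N, ∀ k < N, s'.mat m 3 (I + i') (J + j) ≠ 0 →
        s'.mat m 3 (I + i') (J + j) ≤ s.mat m 1 (I + i') (K + k) + s.mat m 1 (K + k) (J + j)) ∧
      T + (ρ * nonzero m s' : ℕ) + ((test.time + 3) * (N - i) : ℕ) ≤ x)
    (by simp; omega) ((Λ.N_le.trans Λ.m_le).trans_lt hX) (fun j s' x h1 => h1.2.1) ?_ ?_ ?_ ?_
  · rintro i s' x ⟨-, -, h1, -⟩
    rw [Expr.eval_var, h1 _ (by decide) (by decide), hc.N]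
  · refine ⟨by omega, by simp, fun v _ hv => by rw [Env.setReg_reg, if_neg hv], fun _ _ => rfl,
      fun _ _ _ _ _ => rfl, Refines.refl, fun q' hq' => absurd hq' (by omega), le_rfl⟩
  · rintro i hi s' x hb ⟨-, hiv, hreg, hmem, hrow, href, hset, hxle⟩
    refine ARuns.mono ?_ hxle
    have hc' : Consts Λ s' := hc.congr fun v hv => hreg v (by simp only [Var.q]; omega)
      (by simp only [Var.i]; omega)
    have hD : ∀ i < m, ∀ j < m, s'.mat m 1 i j = s.mat m 1 i j := by
      intro i hi j hj
      refine hmem _ (Or.inl ?_)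
      have := index_lt hi hj
      omega
    have hx : T + (ρ * nonzero m s' : ℕ) + (((test.time + 3) * (N - i) : ℕ) : ℝ≥0∞)
        = T + (ρ * nonzero m s' : ℕ) + ((test.time + 3) * (N - (i + 1)) : ℕ) + 1
          + (test.time + 2 : ℕ) := by
      obtain ⟨d, hd⟩ : ∃ d, N - i = d + 1 := ⟨N - i - 1, by omega⟩
      have hd' : N - (i + 1) = d := by omega
      rw [hd, hd']; push_cast; ring
    rw [hx]
    have r1 : s'.reg Var.I₀ + s'.reg Var.i = I + i := by
      rw [hreg _ (by decide) (by decide), hI, hiv]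
    have r2 : s'.reg Var.J₀ = J := by rw [hreg _ (by decide) (by decide), hJ]
    have r3 : s'.reg Var.K₀ = K := by rw [hreg _ (by decide) (by decide), hK]
    have htst := htest s' hc' i hi hiv hmem
    refine ARuns.ite htS (fun hne => ?_) (fun heq => ?_)
    · obtain ⟨k₁, hk₁, j₁, hj₁, hlt⟩ := htst.1 hne
      rw [← hrow i (J + j₁) le_rfl hi (by omega)] at hlt
      -- One nonzero entry is surrendered in advance; its `rowTime` credits pay for this search.
      refine ARuns.mono (T := T + (ρ * (nonzero m s' - 1) : ℕ)
        + ((test.time + 3) * (N - (i + 1)) : ℕ) + rowTime N) ?_ ?_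
      · refine ARuns.row hc' hS hX r1 r2 r3 (by omega) hJm hKm ?_
        intro s₁ g1 g2 g3 g4 g5
        have g4' : Refines m (s.mat m 1) (s'.mat m 3) (s₁.mat m 3) := by
          intro a ha b hb
          rcases g4 a ha b hb with h1 | ⟨h1, k, hk, h2⟩
          · exact Or.inl h1
          · rw [hD a ha k hk, hD k hk b hb] at h2
            exact Or.inr ⟨h1, k, hk, h2⟩
        refine ⟨by rw [g1 _ (by decide), hiv], by omega, by simp, ?_, ?_, ?_, ?_, ?_, ?_⟩
        · intro v h1 h2
          rw [Env.setReg_reg, if_neg h2, g1 v h1, hreg v h1 h2]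
        · intro a ha
          exact (g2 a ha).trans (hmem a ha)
        · intro i' j' h1 h2 h3
          rw [← hrow i' j' (by omega) h2 h3]
          exact g3 (I + i') j' (by omega) h3 (by omega)
        · exact href.trans g4'
        · intro i' hi' j hj k hk h0
          change s₁.mat m 3 (I + i') (J + j) ≠ 0 at h0
          change s₁.mat m 3 (I + i') (J + j) ≤ _
          rcases Nat.lt_succ_iff_lt_or_eq.1 hi' with h1 | rfl
          · have := g3 (I + i') (J + j) (by omega) (by omega) (by omega)
            rw [this] at h0 ⊢
            exact hset i' h1 j hj k hk h0
          · have := g5 j hj k hk h0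
            rwa [hD _ (by omega) _ (by omega), hD _ (by omega) _ (by omega)] at this
        · refine add_le_add (add_le_add le_rfl ?_) le_rfl
          refine Nat.cast_le.2 (Nat.mul_le_mul_left _ ?_)
          refine Nat.le_sub_one_of_lt (nonzero_lt (i := I + i) (j := J + j₁) (by omega) (by omega) g4'
            (by omega) ?_)
          by_contra h0
          have h1 := g5 j₁ hj₁ k₁ hk₁ h0
          rw [hD _ (by omega) _ (by omega), hD _ (by omega) _ (by omega),
            g4'.eq_of_ne_zero (by omega) (by omega) h0] at h1
          omega
      · have : 1 ≤ nonzero m s' := by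
          refine Finset.card_pos.2 ⟨(I + i, J + j₁), ?_⟩
          simp only [Finset.mem_filter, Finset.mem_product, Finset.mem_range]
          refine ⟨⟨by omega, by omega⟩, by omega⟩
        obtain ⟨d, hd⟩ : ∃ d, nonzero m s' = d + 1 := ⟨nonzero m s' - 1, by omega⟩
        rw [hd, Nat.add_sub_cancel, ← hρ]
        refine le_trans (le_of_eq ?_) le_self_add
        push_cast; ring
    · refine ARuns.skip ⟨hiv, by omega, by simp, ?_, hmem, ?_, href, ?_, le_rfl⟩
      · intro v h1 h2
        rw [Env.setReg_reg, if_neg h2, hreg v h1 h2]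
      · intro i' j' h1 h2 h3
        exact hrow i' j' (by omega) h2 h3
      · intro i' hi' j hj k hk h0
        change s'.mat m 3 (I + i') (J + j) ≠ 0 at h0
        change s'.mat m 3 (I + i') (J + j) ≤ _
        rcases Nat.lt_succ_iff_lt_or_eq.1 hi' with h1 | rfl
        · exact hset i' h1 j hj k hk h0
        · by_contra hlt
          rw [hrow i' _ le_rfl hi (by omega)] at hlt
          exact htst.2 ⟨k, hk, j, hj, by omega⟩ heq
  · rintro s' x _ ⟨-, -, h1, h2, h3, h4, h5, hx⟩
    simp only [Nat.sub_self, mul_zero, Nat.cast_zero, add_zero] at hx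
    exact ⟨h s' h1 h2 h4 h5, hx⟩

end Machine

/-! ## Expressions for the gadget -/

/-- The gadget for the blocks of the matrices `D` and `F` that start at the rows or columns
`I`, `J` and `K`. -/
def Params.gadget (Λ : Params) (hδ : 0 < Λ.δ) (D F : ℕ → ℕ → ℕ) (I J K : ℕ) : Gadget where
  N := Λ.N
  δ := Λ.δ
  x i k := Λ.δ + min (D (I + i % Λ.N) (K + k % Λ.N)) Λ.δ
  y k j := Λ.δ + min (D (K + k % Λ.N) (J + j % Λ.N)) Λ.δ
  z i j := 2 * Λ.δ - min (F (I + i % Λ.N) (J + j % Λ.N)) Λ.δ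
  N_pos := Λ.N_pos
  δ_pos := hδ
  hx i k := by omega
  hy k j := by omega
  hz i j := by omega

/-- The environment contains the data of the gadget. -/
structure HasGadget (Λ : Params) (D F : ℕ → ℕ → ℕ) (I J K : ℕ) (s : Env) : Prop where
  consts : Consts Λ s
  I₀ : s.reg Var.I₀ = I
  J₀ : s.reg Var.J₀ = J
  K₀ : s.reg Var.K₀ = K
  D : ∀ i < Λ.m, ∀ j < Λ.m, s.mat Λ.m 1 i j = D i j
  F : ∀ i < Λ.m, ∀ j < Λ.m, s.mat Λ.m 3 i j = F i j

namespace Expr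

def xWeight (i k : Expr) : Expr := .var Var.δ +
  min (cell 1 (.var Var.I₀ + i % .var Var.N) (.var Var.K₀ + k % .var Var.N)) (.var Var.δ)

def yWeight (k j : Expr) : Expr := .var Var.δ +
  min (cell 1 (.var Var.K₀ + k % .var Var.N) (.var Var.J₀ + j % .var Var.N)) (.var Var.δ)

def zWeight (i j : Expr) : Expr := 2 * .var Var.δ -
  min (cell 3 (.var Var.I₀ + i % .var Var.N) (.var Var.J₀ + j % .var Var.N)) (.var Var.δ)

/-- Only initial instances are written by the program, and in these either none or all of the
terminal edges are present. -/
def present : Mode → Expr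
  | .incremental => 0
  | .decremental => 1

def weight (i : Expr) : Mode → Expr
  | .incremental => 2 * .var Var.δ * (.var Var.N - i)
  | .decremental => 2 * .var Var.δ * (i + 1)

def le (a b : Expr) : Expr := lt a (b + 1)

@[simp] theorem eval_le (s : Env) (a b : Expr) :
    (le a b).eval s = if a.eval s ≤ b.eval s then 1 else 0 := by
  simp [le]

def fwd (mode : Mode) (u v : Expr) : Expr :=
  cases (eq u (4 * .var Var.N) * (lt v (.var Var.N) * present mode)) (weight v mode) <|
  cases (lt u (.var Var.N) * (le (.var Var.N) v * lt v (2 * .var Var.N)))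
    (xWeight u (v - .var Var.N)) <|
  cases (le (.var Var.N) u * (lt u (2 * .var Var.N) * (le (2 * .var Var.N) v *
    lt v (3 * .var Var.N)))) (yWeight (u - .var Var.N) (v - 2 * .var Var.N)) <|
  cases (le (2 * .var Var.N) u * (lt u (3 * .var Var.N) * (le (3 * .var Var.N) v *
    lt v (4 * .var Var.N)))) (zWeight (v - 3 * .var Var.N) (u - 2 * .var Var.N)) <|
  cases (le (3 * .var Var.N) u * (lt u (4 * .var Var.N) * (eq v (4 * .var Var.N + 1) *
    present mode))) (weight (u - 3 * .var Var.N) mode) 0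

def big : Expr := 8 * .var Var.δ * (.var Var.N + 1)

def side : Expr := 4 * .var Var.N + 2

def entry (mode : Mode) : Kind → Expr
  | .path => fwd mode (.var Var.p / side) (.var Var.p % side) +
      fwd mode (.var Var.p % side) (.var Var.p / side)
  | .matching => cases (lt 0 (fwd mode (.var Var.p / side) (.var Var.p % side)))
      (big - fwd mode (.var Var.p / side) (.var Var.p % side))
      (cases (eq (.var Var.p / side) (.var Var.p % side) * lt (.var Var.p / side) (4 * .var Var.N))
        big 0)

def newWeight : Mode → Kind → Expr
  | .decremental, _ => 0
  | .incremental, .path => weight (.var Var.idx) .incremental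
  | .incremental, .matching => big - weight (.var Var.idx) .incremental

def test (mode : Mode) : Kind → Expr
  | .path => le (.load (.var Var.ans + .var Var.i))
      (2 * weight (.var Var.i) mode + 4 * .var Var.δ)
  | .matching => lt ((4 * .var Var.N + 1) * big)
      (.load (.var Var.ans + .var Var.i) + (2 * weight (.var Var.i) mode + 4 * .var Var.δ))

theorem ite_mul_ite (P Q : Prop) [Decidable P] [Decidable Q] :
    (if P then 1 else 0) * (if Q then 1 else 0) = if P ∧ Q then 1 else 0 := by
  by_cases P <;> by_cases Q <;> simp_all

theorem eval_present (s : Env) (mode : Mode) (x : ℕ) :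
    (present mode).eval s = if mode.Present 0 x then 1 else 0 := by
  cases mode
  · simp [present, Mode.Present]
  · simp [present, Mode.Present]

theorem eval_weight {Λ : Params} {s : Env} (h : Consts Λ s) (mode : Mode) (i : Expr) :
    (weight i mode).eval s = mode.weight Λ.N Λ.δ (i.eval s) := by
  cases mode <;> simp [weight, Mode.weight, h.δ, h.N]

theorem eval_big {Λ : Params} {s : Env} (h : Consts Λ s) :
    big.eval s = 8 * Λ.δ * (Λ.N + 1) := by
  simp [big, h.δ, h.N]

theorem eval_side {Λ : Params} {s : Env} (h : Consts Λ s) : side.eval s = 4 * Λ.N + 2 := by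
  simp [side, h.N]

section gadget

variable {Λ : Params} {hδ : 0 < Λ.δ} {D F : ℕ → ℕ → ℕ} {I J K : ℕ} {s : Env} {mode : Mode}

theorem eval_fwd (h : HasGadget Λ D F I J K s) (hI : I + Λ.N ≤ Λ.m) (hJ : J + Λ.N ≤ Λ.m)
    (hK : K + Λ.N ≤ Λ.m) (u v : Expr) :
    (fwd mode u v).eval s = (Λ.gadget hδ D F I J K).fwd mode 0 0 (u.eval s) (v.eval s) := by
  have hc := h.consts
  have hmod : ∀ a, a % Λ.N < Λ.N := fun a => Nat.mod_lt _ Λ.N_pos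
  have hx : ∀ i k : Expr, (xWeight i k).eval s = (Λ.gadget hδ D F I J K).x (i.eval s) (k.eval s) := by
    intro i k
    have h1 := hmod (i.eval s)
    have h2 := hmod (k.eval s)
    simp only [xWeight, eval_add, eval_min, eval_cell hc, eval_var, eval_mod, eval_ofNat, hc.δ, hc.N,
      h.I₀, h.K₀, Params.gadget]
    rw [h.D _ (by omega) _ (by omega)]
  have hy : ∀ k j : Expr, (yWeight k j).eval s = (Λ.gadget hδ D F I J K).y (k.eval s) (j.eval s) := by
    intro k j
    have h1 := hmod (k.eval s)
    have h2 := hmod (j.eval s)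
    simp only [yWeight, eval_add, eval_min, eval_cell hc, eval_var, eval_mod, eval_ofNat, hc.δ, hc.N,
      h.J₀, h.K₀, Params.gadget]
    rw [h.D _ (by omega) _ (by omega)]
  have hz : ∀ i j : Expr, (zWeight i j).eval s = (Λ.gadget hδ D F I J K).z (i.eval s) (j.eval s) := by
    intro i j
    have h1 := hmod (i.eval s)
    have h2 := hmod (j.eval s)
    simp only [zWeight, eval_add, eval_sub, eval_mul, eval_min, eval_cell hc, eval_var, eval_mod,
      eval_ofNat, hc.δ, hc.N, h.I₀, h.J₀, Params.gadget]
    rw [h.F _ (by omega) _ (by omega)]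
  unfold fwd Gadget.fwd
  rw [eval_cases (P := u.eval s = 4 * Λ.N ∧ v.eval s < Λ.N ∧ mode.Present 0 (v.eval s)),
    eval_cases (P := u.eval s < Λ.N ∧ Λ.N ≤ v.eval s ∧ v.eval s < 2 * Λ.N),
    eval_cases (P := Λ.N ≤ u.eval s ∧ u.eval s < 2 * Λ.N ∧ 2 * Λ.N ≤ v.eval s ∧ v.eval s < 3 * Λ.N),
    eval_cases (P := 2 * Λ.N ≤ u.eval s ∧ u.eval s < 3 * Λ.N ∧ 3 * Λ.N ≤ v.eval s ∧
      v.eval s < 4 * Λ.N),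
    eval_cases (P := 3 * Λ.N ≤ u.eval s ∧ u.eval s < 4 * Λ.N ∧ v.eval s = 4 * Λ.N + 1 ∧
      mode.Present 0 (u.eval s - 3 * Λ.N)), hx, hy, hz, eval_weight hc, eval_weight hc]
  · simp only [eval_sub, eval_mul, eval_var, eval_ofNat, hc.N]
    rfl
  · simp only [eval_mul, eval_eq, eval_lt, eval_le, eval_add, eval_var, eval_ofNat, hc.N,
      eval_present s mode (u.eval s - 3 * Λ.N), ite_mul_ite]
  all_goals
    simp only [eval_mul, eval_eq, eval_lt, eval_le, eval_var, eval_ofNat, hc.N,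
      eval_present s mode (v.eval s), ite_mul_ite]

theorem eval_entry (h : HasGadget Λ D F I J K s) (hI : I + Λ.N ≤ Λ.m) (hJ : J + Λ.N ≤ Λ.m)
    (hK : K + Λ.N ≤ Λ.m) (kind : Kind) :
    (entry mode kind).eval s = (Λ.gadget hδ D F I J K).entry mode (s.reg Var.p / (4 * Λ.N + 2))
      (s.reg Var.p % (4 * Λ.N + 2)) kind := by
  have hc := h.consts
  have hf := eval_fwd (hδ := hδ) (mode := mode) h hI hJ hK
  cases kind with
  | path =>
    simp only [entry, eval_add, hf, eval_div, eval_mod, eval_var, eval_side hc, Gadget.entry]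
  | matching =>
    simp only [entry, Gadget.entry, Gadget.matchEntry]
    rw [eval_cases (P := (Λ.gadget hδ D F I J K).fwd mode 0 0 (s.reg Var.p / (4 * Λ.N + 2))
      (s.reg Var.p % (4 * Λ.N + 2)) ≠ 0), eval_cases (P := s.reg Var.p / (4 * Λ.N + 2)
        = s.reg Var.p % (4 * Λ.N + 2) ∧ s.reg Var.p / (4 * Λ.N + 2) < 4 * Λ.N)]
    · simp only [eval_sub, hf, eval_div, eval_mod, eval_var, eval_side hc, eval_big hc, eval_ofNat]
      rfl
    · simp only [eval_mul, eval_eq, eval_lt, eval_div, eval_mod, eval_var, eval_side hc, eval_ofNat,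
        hc.N, ite_mul_ite]
    · simp only [eval_lt, hf, eval_div, eval_mod, eval_var, eval_side hc, eval_ofNat,
        Nat.pos_iff_ne_zero]

end gadget

theorem size_entry_le (mode : Mode) (kind : Kind) : (entry mode kind).size ≤ 3000 := by
  cases mode <;> cases kind <;> decide

theorem size_test_le (mode : Mode) (kind : Kind) : (test mode kind).size ≤ 100 := by
  cases mode <;> cases kind <;> decide

end Expr

namespace Machine

open WordRAM.Expr (side)

/-- The updates and the query for the vertex `idx`. -/
def commands : Mode → Kind → List Cmd
  | .incremental, kind => [.upd (4 * .var Var.N) (.var Var.idx) (Expr.newWeight .incremental kind),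
      .upd (3 * .var Var.N + .var Var.idx) (4 * .var Var.N + 1) (Expr.newWeight .incremental kind),
      .qry]
  | .decremental, kind => [.qry,
      .upd (4 * .var Var.N) (.var Var.idx) (Expr.newWeight .decremental kind),
      .upd (3 * .var Var.N + .var Var.idx) (4 * .var Var.N + 1) (Expr.newWeight .decremental kind)]

theorem commands_stable {S : ℕ} (hS : 100 ≤ S) (mode : Mode) (kind : Kind) :
    ∀ c ∈ commands mode kind, c.Stable S := by
  have hn : ∀ s s' : Env, (∀ y ≠ Var.cnt, s.reg y = s'.reg y) →
      (Expr.newWeight mode kind).eval s = (Expr.newWeight mode kind).eval s' := by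
    intro s s' h
    have h1 := h Var.N (by decide)
    have h2 := h Var.δ (by decide)
    have h3 := h Var.idx (by decide)
    cases mode <;> cases kind <;> simp [Expr.newWeight, Expr.weight, Expr.big, h1, h2, h3]
  have hsz : (Expr.newWeight mode kind).size ≤ S :=
    le_trans (by cases mode <;> cases kind <;> decide) hS
  have hu : (Cmd.upd (4 * .var Var.N) (.var Var.idx) (Expr.newWeight mode kind)).Stable S := by
    refine ⟨fun s s' h => ⟨?_, ?_, hn s s' h⟩, by simp; omega, by simp; omega, hsz⟩
    · simp [h Var.N (by decide)]
    · simp [h Var.idx (by decide)]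
  have hv : (Cmd.upd (3 * .var Var.N + .var Var.idx) (4 * .var Var.N + 1)
      (Expr.newWeight mode kind)).Stable S := by
    refine ⟨fun s s' h => ⟨?_, ?_, hn s s' h⟩, by simp; omega, by simp; omega, hsz⟩
    · simp [h Var.N (by decide), h Var.idx (by decide)]
    · simp [h Var.N (by decide)]
  intro c hc
  cases mode
  · simp only [commands, List.mem_cons, List.not_mem_nil, or_false] at hc
    rcases hc with rfl | rfl | rfl
    exacts [hu, hv, trivial]
  · simp only [commands, List.mem_cons, List.not_mem_nil, or_false] at hc
    rcases hc with rfl | rfl | rfl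
    exacts [trivial, hu, hv]

/-- The requests do not depend on the answers, so those issued during the loop form a list that is
fixed in advance, as the definition of solvability requires. -/
theorem requestsFrom_commands {Λ : Params} {s : Env} (hc : Consts Λ s) {G : Gadget} (hN : G.N = Λ.N)
    (hδ : G.δ = Λ.δ) (mode : Mode) (kind : Kind) :
    requestsFrom (commands mode kind) s 0 Λ.N = G.requests mode kind := by
  unfold requestsFrom Gadget.requests Mode.requests
  rw [hN]
  refine List.flatMap_congr fun i _ => ?_
  have hc' : Consts Λ (s.setReg Var.idx i) := hc.congr fun v hv => by
    rw [Env.setReg_reg, if_neg (by simp only [Var.idx]; omega)]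
  have hw : (Expr.newWeight mode kind).eval (s.setReg Var.idx i) = G.newWeight mode i kind := by
    cases mode <;> cases kind <;>
      simp [Expr.newWeight, Gadget.newWeight, Expr.eval_weight hc', Expr.eval_big hc', hN, hδ,
        Gadget.big]
  cases mode <;>
    simp [commands, Mode.phase, Cmd.eval, hw, Gadget.sourceUpdate, Gadget.sinkUpdate, hc'.N, hN]

theorem queryCount_append (l l' : List Request) :
    queryCount (l ++ l') = queryCount l + queryCount l' := by
  induction l with
  | nil => simp [queryCount]
  | cons r l ih => cases r <;> simp [queryCount, ih] <;> omega

theorem queryCount_requests (mode : Mode) (u₁ u₂ : ℕ → Update) (j k : ℕ) :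
    queryCount (mode.requests u₁ u₂ j k) = k := by
  induction k generalizing j with
  | zero => simp [Mode.requests, queryCount]
  | succ k ih =>
    rw [Mode.requests_succ, queryCount_append, ih]
    cases mode <;> (simp [Mode.phase, queryCount]; omega)

/-- Together with `arg₂`, the contents of the registers `1` and `2` in the input: source and sink
for paths, the size of the second part and `0` for matchings. Register `0` contains `4 * N + 2` in
both cases. -/
def arg₁ : Kind → Expr
  | .path => 4 * .var Var.N
  | .matching => side

def arg₂ : Kind → Expr
  | .path => 4 * .var Var.N + 1
  | .matching => 0

end Machine

/-! ### Bounds for the words in instances and requests -/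

namespace Gadget

variable {G : Gadget} {mode : Mode} {kind : Kind}

theorem entry_le (u v : ℕ) : G.entry mode u v kind ≤ G.big := by
  cases kind with
  | path =>
    have h1 := fwd_le (G := G) (mode := mode) 0 0 u v
    have h2 := fwd_le (G := G) (mode := mode) 0 0 v u
    have : G.big = 4 * (2 * G.δ * G.N) + 8 * G.δ := by unfold big; ring
    simp only [entry]
    omega
  | matching => exact matchEntry_le _ _ _ _

theorem input_mem (a : ℕ) : (G.input mode kind).mem a
    = if a < (4 * G.N + 2) * (4 * G.N + 2) then
        G.entry mode (a / (4 * G.N + 2)) (a % (4 * G.N + 2)) kind else 0 := by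
  cases kind <;> simp only [input, inputStore, matrixMem] <;> split_ifs <;> rfl

theorem input_reg : (G.input mode kind).reg 0 = 4 * G.N + 2 ∧
    (∀ r, 3 ≤ r → (G.input mode kind).reg r = 0) ∧
    ∀ r, (G.input mode kind).reg r ≤ 4 * G.N + 2 := by
  cases kind
  · refine ⟨rfl, fun r hr => ?_, fun r => ?_⟩
    · simp only [input, inputStore]
      rw [if_neg (by omega), if_neg (by omega), if_neg (by omega)]
    · simp only [input, inputStore]
      split_ifs <;> omega
  · refine ⟨rfl, fun r hr => ?_, fun r => ?_⟩
    · simp only [input, inputStore]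
      rw [if_neg (by omega), if_neg (by omega), if_neg (by omega)]
    · simp only [input, inputStore]
      split_ifs <;> omega

theorem input_small {B : ℕ} (h1 : (4 * G.N + 2) * (4 * G.N + 2) ≤ B) (h2 : G.big < B) :
    (G.input mode kind).Small B := by
  have h3 : 4 * G.N + 2 < (4 * G.N + 2) * (4 * G.N + 2) := by nlinarith
  refine ⟨fun r => (input_reg.2.2 r).trans_lt (h3.trans_le h1), fun a => ?_, fun a ha => ?_⟩
  · rw [input_mem]
    split_ifs
    · exact (entry_le _ _).trans_lt h2
    · omega
  · rw [input_mem, if_neg (by omega)]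

theorem requests_small {B : ℕ} (h1 : (4 * G.N + 2) * (4 * G.N + 2) ≤ B) (h2 : G.big < B)
    (e : Update) (he : Request.update e ∈ G.requests mode kind) : e.u < B ∧ e.v < B ∧ e.x < B := by
  have h3 : 4 * G.N + 2 < (4 * G.N + 2) * (4 * G.N + 2) := by nlinarith
  simp only [requests, Mode.requests, List.mem_flatMap, List.mem_range'_1] at he
  obtain ⟨i, hi, he⟩ := he
  have hi' : i < G.N := by omega
  have hw : G.newWeight mode i kind < B := by
    cases hm : mode
    · exact (newWeight_bounds hi' rfl kind).2.trans_lt h2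
    · rw [newWeight_decremental rfl]; omega
  have : e = G.sourceUpdate mode kind i ∨ e = G.sinkUpdate mode kind i := by
    cases mode <;> simpa [Mode.phase] using he
  rcases this with rfl | rfl
  · exact ⟨by simp only [sourceUpdate]; omega, by simp only [sourceUpdate]; omega, hw⟩
  · exact ⟨by simp only [sinkUpdate]; omega, by simp only [sinkUpdate]; omega, hw⟩

end Gadget

namespace Machine

variable {Γ : Machine} {Λ : Params}

/-! ## Sequences of assignments -/

/-- Assign values to several variables, one after the other. -/
def assigns (R₀ : ℕ) : List (ℕ × Expr) → Prog
  | [] => .skip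
  | (v, e) :: l => .seq (assign R₀ v e) (assigns R₀ l)

def assignsTime : List (ℕ × Expr) → ℕ
  | [] => 1
  | (_, e) :: l => e.time + 3 + assignsTime l

/-- The environment after the assignments. -/
def afterAssigns (s : Env) : List (ℕ × Expr) → Env
  | [] => s
  | (v, e) :: l => afterAssigns (s.setReg v (e.eval s)) l

/-- All values are small enough. -/
def AssignsFit (Γ : Machine) (s : Env) : List (ℕ × Expr) → Prop
  | [] => True
  | (v, e) :: l => e.size ≤ Γ.S ∧ e.eval s < Γ.X ∧ AssignsFit Γ (s.setReg v (e.eval s)) l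

theorem ARuns.assigns {l : List (ℕ × Expr)} : ∀ {s : Env} {T : ℝ≥0∞} {R : Env → ℝ≥0∞ → Prop},
    AssignsFit Γ s l → R (afterAssigns s l) T →
    Γ.ARuns (assigns Γ.R₀ l) s (T + assignsTime l) R := by
  induction l with
  | nil =>
    intro s T R _ h
    rw [assignsTime, Nat.cast_one]
    exact ARuns.skip h
  | cons p l ih =>
    obtain ⟨v, e⟩ := p
    rintro s T R ⟨h1, h2, h3⟩ h
    have ht : T + ((assignsTime ((v, e) :: l) : ℕ) : ℝ≥0∞)
        = T + assignsTime l + (e.time + 2 : ℕ) + 1 := by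
      rw [assignsTime]; push_cast; ring
    rw [ht]
    exact ARuns.seq (ARuns.assign h1 h2 (ih h3 h))

/-! ## One block -/

/-- What the main program needs to know about the dynamic algorithm. -/
structure Subroutine (Γ : Machine) (Λ : Params) (A : DynAlg) (mode : Mode) (kind : Kind)
    (τ : ℝ≥0∞) : Prop where
  prep_regs : A.prep.RegsBelow Γ.R₀
  upd_regs : A.upd.RegsBelow Γ.R₀
  qry_regs : A.qry.RegsBelow Γ.R₀
  size_le : 3000 ≤ Γ.S
  δ_pos : 0 < Λ.δ
  lim_lt : Λ.lim + 1 ≤ Λ.stride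
  side_le : (4 * Λ.N + 2) * (4 * Λ.N + 2) ≤ Λ.stride
  big_lt : 8 * Λ.δ * (Λ.N + 1) < Λ.stride
  correct : ∀ G : Gadget, G.N = Λ.N → G.δ = Λ.δ → ∃ w, Λ.lim + 1 = 2 ^ w ∧
    A.prepTime w (G.input mode kind) (G.requests mode kind) +
      A.requestTime w (G.input mode kind) (G.requests mode kind) ≤ τ ∧
    ∀ t, ∀ d ∈ (iter (A.dynStep w) (A.start (G.input mode kind) (G.requests mode kind)) t).support,
      d.phase = .done → d.answers.length = G.N ∧
        ∀ i (hi : i < d.answers.length), G.Test mode i d.answers[i] kind ↔ G.Light i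

open WordRAM.Expr (side)

def cube : Expr := .var Var.N * .var Var.N * .var Var.N

/-- The positions of the blocks. -/
def corners : List (ℕ × Expr) :=
  [(Var.I₀, .var Var.triple / cube / cube * .var Var.N),
    (Var.J₀, .var Var.triple / cube % cube * .var Var.N),
    (Var.K₀, .var Var.triple % cube * .var Var.N)]

/-- Treat one triple of blocks with the dynamic algorithm. -/
def blockProg (R₀ : ℕ) (A : DynAlg) (mode : Mode) (kind : Kind) : Prog :=
  .seq (assigns R₀ corners) (.seq (fill R₀ (.var Var.base) (side * side) (Expr.entry mode kind))
    (.seq (callProg R₀ A side (arg₁ kind) (arg₂ kind) (commands mode kind))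
      (.seq (scanProg R₀ (Expr.test mode kind))
        (assign R₀ Var.base (.var Var.base + .var Var.stride)))))

def blockTime (R₀ : ℕ) (mode : Mode) (kind : Kind) (N : ℕ) : ℕ :=
  assignsTime corners + fillTime (.var Var.base) (side * side) (Expr.entry mode kind) *
      ((4 * N + 2) * (4 * N + 2) + 1)
    + callTime R₀ side (arg₁ kind) (arg₂ kind) (commands mode kind) N
    + scanTime (Expr.test mode kind) N + 11

/-- The number of the triple of blocks that contain `i`, `j`, `k`. -/
def tripleIndex (N i j k : ℕ) : ℕ := (i / N * N ^ 3 + j / N) * N ^ 3 + k / N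

/-- The three block numbers are the digits of the index in base `N ^ 3`, which `corners` extracts by
division and remainder. -/
theorem tripleIndex_corner {N i j k : ℕ} (hN : 0 < N) (hj : j < N ^ 4) (hk : k < N ^ 4) :
    tripleIndex N i j k / N ^ 3 / N ^ 3 = i / N ∧ tripleIndex N i j k / N ^ 3 % N ^ 3 = j / N ∧
      tripleIndex N i j k % N ^ 3 = k / N := by
  have hc : 0 < N ^ 3 := Nat.pow_pos hN
  have hj' : j / N < N ^ 3 := Nat.div_lt_of_lt_mul (by rw [← pow_succ']; exact hj)
  have hk' : k / N < N ^ 3 := Nat.div_lt_of_lt_mul (by rw [← pow_succ']; exact hk)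
  have h1 : tripleIndex N i j k / N ^ 3 = i / N * N ^ 3 + j / N := by
    rw [tripleIndex, add_comm, Nat.add_mul_div_right _ _ hc, Nat.div_eq_of_lt hk', zero_add]
  refine ⟨?_, ?_, ?_⟩
  · rw [h1, add_comm, Nat.add_mul_div_right _ _ hc, Nat.div_eq_of_lt hj', zero_add]
  · rw [h1, add_comm, Nat.add_mul_mod_self_right, Nat.mod_eq_of_lt hj']
  · rw [tripleIndex, add_comm, Nat.add_mul_mod_self_right, Nat.mod_eq_of_lt hk']

theorem tripleIndex_lt {N i j k : ℕ} (hi : i < N ^ 4) (hj : j < N ^ 4) (hk : k < N ^ 4) :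
    tripleIndex N i j k < N ^ 9 := by
  have hi' : i / N < N ^ 3 := Nat.div_lt_of_lt_mul (by rw [← pow_succ']; exact hi)
  have hj' : j / N < N ^ 3 := Nat.div_lt_of_lt_mul (by rw [← pow_succ']; exact hj)
  have hk' : k / N < N ^ 3 := Nat.div_lt_of_lt_mul (by rw [← pow_succ']; exact hk)
  have h1 := index_lt hi' hj'
  rw [show N ^ 9 = N ^ 3 * N ^ 3 * N ^ 3 by ring, tripleIndex]
  have h2 : (i / N * N ^ 3 + j / N + 1) * N ^ 3 ≤ N ^ 3 * N ^ 3 * N ^ 3 := Nat.mul_le_mul_right _ h1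
  rw [Nat.succ_mul] at h2
  omega

/-- When all entries are at most `δ`, the truncations in the gadget have no effect and the triangle
weighs `4 * δ + D + D - F`. Truncation and reduction modulo `N` only serve to give weights in the
right range for all arguments. -/
theorem gadget_light {hδ : 0 < Λ.δ} {D F : ℕ → ℕ → ℕ} {I J K i : ℕ}
    (hI : I + Λ.N ≤ Λ.m) (hJ : J + Λ.N ≤ Λ.m) (hK : K + Λ.N ≤ Λ.m) (hi : i < Λ.N)
    (hD : ∀ i < Λ.m, ∀ j < Λ.m, D i j ≤ Λ.δ) (hF : ∀ i < Λ.m, ∀ j < Λ.m, F i j ≤ Λ.δ) :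
    (Λ.gadget hδ D F I J K).Light i ↔
      ∃ k < Λ.N, ∃ j < Λ.N, D (I + i) (K + k) + D (K + k) (J + j) < F (I + i) (J + j) := by
  unfold Gadget.Light
  refine exists_congr fun k => and_congr_right fun hk => exists_congr fun j =>
    and_congr_right fun hj => ?_
  change k < Λ.N at hk
  change j < Λ.N at hj
  simp only [Params.gadget, Nat.mod_eq_of_lt hi, Nat.mod_eq_of_lt hj, Nat.mod_eq_of_lt hk]
  have h1 := hD (I + i) (by omega) (K + k) (by omega)
  have h2 := hD (K + k) (by omega) (J + j) (by omega)
  have h3 := hF (I + i) (by omega) (J + j) (by omega)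
  omega

theorem eval_test {s : Env} (hc : Consts Λ s) {G : Gadget} (hN : G.N = Λ.N) (hδ : G.δ = Λ.δ)
    (mode : Mode) (kind : Kind) :
    (Expr.test mode kind).eval s ≠ 0 ↔
      G.Test mode (s.reg Var.i) (s.mem (4 * (Λ.m * Λ.m) + s.reg Var.i)) kind := by
  cases kind
  · simp [Expr.test, Gadget.Test, Expr.eval_weight hc, hc.δ, hc.ans, hN, hδ]
  · simp [Expr.test, Gadget.Test, Expr.eval_weight hc, Expr.eval_big hc, hc.δ, hc.N, hc.ans, hN, hδ,
      Gadget.big]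

/-- For one triple of blocks, the instance is written to fresh memory, the dynamic algorithm is run
on it, and its answers direct the scan. Here `τ` bounds the expected time of the whole run, `12` is
the simulation factor, and the cost of the scan is hidden in the difference of the two `nonzero`
terms. -/
theorem ARuns.block {A : DynAlg} {mode : Mode} {kind : Kind} {τ : ℝ≥0∞} {s : Env} {T : ℝ≥0∞}
    {R : Env → ℝ≥0∞ → Prop} (hA : Subroutine Γ Λ A mode kind τ) (hc : Consts Λ s) {t base : ℕ}
    (hb : s.reg Var.base = base) (hb5 : 5 * (Λ.m * Λ.m) ≤ base) (hbX : base + Λ.stride < Γ.X)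
    (hfresh : ∀ a, base ≤ a → s.mem a = 0)
    (hD : ∀ i < Λ.m, ∀ j < Λ.m, s.mat Λ.m 1 i j ≤ Λ.δ)
    (hF : ∀ i < Λ.m, ∀ j < Λ.m, s.mat Λ.m 3 i j ≤ Λ.δ)
    (ht : s.reg Var.triple = t) (htN : t < Λ.N ^ 9)
    (h : ∀ s' : Env, (∀ v, v < 10 ∨ v = Var.round ∨ v = Var.bit ∨ v = Var.triple ∨ v = Var.h →
        s'.reg v = s.reg v) →
      s'.reg Var.base = base + Λ.stride → (∀ a, base + Λ.stride ≤ a → s'.mem a = 0) →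
      (∀ a < 3 * (Λ.m * Λ.m), s'.mem a = s.mem a) →
      Refines Λ.m (s.mat Λ.m 1) (s.mat Λ.m 3) (s'.mat Λ.m 3) →
      (∀ i < Λ.m, ∀ j < Λ.m, ∀ k < Λ.m, tripleIndex Λ.N i j k = t → s'.mat Λ.m 3 i j ≠ 0 →
        s'.mat Λ.m 3 i j ≤ s.mat Λ.m 1 i k + s.mat Λ.m 1 k j) →
      R s' (T + (rowTime Λ.N * nonzero Λ.m s' : ℕ))) :
    Γ.ARuns (blockProg Γ.R₀ A mode kind) s
      (T + (rowTime Λ.N * nonzero Λ.m s : ℕ) + (12 * τ + blockTime Γ.R₀ mode kind Λ.N)) R := by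
  have hS := hA.size_le
  have hN := Λ.N_pos
  set m := Λ.m with hm
  set N := Λ.N with hN'
  have hmN : m = N ^ 3 * N := by rw [hm, Λ.m_eq, ← pow_succ]
  have hNm : N ≤ m := Λ.N_le
  have hmm : m ≤ m * m := Λ.m_le
  have hc3 : 0 < N ^ 3 := Nat.pow_pos hN
  set I := t / N ^ 3 / N ^ 3 * N with hI
  set J := t / N ^ 3 % N ^ 3 * N with hJ
  set K := t % N ^ 3 * N with hK
  have hblk : ∀ x, x < N ^ 3 → x * N + N ≤ m := by
    intro x hx
    rw [hmN, ← Nat.succ_mul]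
    exact Nat.mul_le_mul_right _ hx
  have hIm : I + N ≤ m := hblk _ (Nat.div_lt_of_lt_mul (Nat.div_lt_of_lt_mul
    (by rw [show N ^ 3 * (N ^ 3 * N ^ 3) = N ^ 9 by ring]; exact htN)))
  have hJm : J + N ≤ m := hblk _ (Nat.mod_lt _ hc3)
  have hKm : K + N ≤ m := hblk _ (Nat.mod_lt _ hc3)
  set D := s.mat m 1 with hDdef
  set F := s.mat m 3 with hFdef
  set G := Λ.gadget hA.δ_pos D F I J K with hG
  obtain ⟨w, hw, hτ, hcor⟩ := hA.correct G rfl rfl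
  have hbig : G.big < Λ.stride := hA.big_lt
  have hside : (4 * G.N + 2) * (4 * G.N + 2) ≤ Λ.stride := hA.side_le
  -- The stride exceeds the input, the requests and all words of the dynamic algorithm. So it bounds
  -- the memory that this call can touch.
  set 𝒜 : DynRun := ⟨A, w, Γ.R₀, Λ.stride, G.input mode kind, G.requests mode kind,
    by rw [← hw]; exact hA.lim_lt, hA.prep_regs, hA.upd_regs, hA.qry_regs,
    Gadget.input_small hside hbig, Gadget.requests_small hside hbig⟩ with h𝒜
  have hrem : 𝒜.remaining (𝒜.A.start 𝒜.input 𝒜.rs) ≤ τ := DynRun.remaining_start.trans hτ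
  set W := 4 * N + 2 with hW
  set Φ : ℝ≥0∞ := T + (rowTime N * nonzero m s : ℕ) with hΦ
  have htime : Φ + (12 * 𝒜.remaining (𝒜.A.start 𝒜.input 𝒜.rs) + (blockTime Γ.R₀ mode kind N : ℕ))
      = (((((12 * 𝒜.remaining (𝒜.A.start 𝒜.input 𝒜.rs) +
        (Φ + ((Expr.var Var.base + .var Var.stride).time + 2 : ℕ) +
        (scanTime (Expr.test mode kind) N : ℕ) + 1)
        + (callTime Γ.R₀ side (arg₁ kind) (arg₂ kind) (commands mode kind) N : ℕ)) + 1)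
        + (fillTime (.var Var.base) (side * side) (Expr.entry mode kind) * (W * W + 1) : ℕ)) + 1)
        + (assignsTime corners : ℕ)) + 1 := by
    have e1 : (Expr.var Var.base + .var Var.stride).time = 5 := rfl
    rw [e1]
    simp only [blockTime, ← hW]
    push_cast
    ring
  refine ARuns.mono ?_ (add_le_add le_rfl (add_le_add (mul_le_mul_right hrem 12) le_rfl))
  rw [htime]
  -- the corners
  have ecube : ∀ s' : Env, s'.reg Var.N = N → cube.eval s' = N ^ 3 := by
    intro s' h'
    simp [cube, h']
    ring
  set s₁ : Env := ((s.setReg Var.I₀ I).setReg Var.J₀ J).setReg Var.K₀ K with hs₁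
  have hmX : m < Γ.X := by omega
  have ev1 : (Expr.var Var.triple / cube / cube * .var Var.N).eval s = I := by
    simp only [Expr.eval_mul, Expr.eval_div, Expr.eval_var, ecube s hc.N, ht, hc.N, hI, hN']
  have ev2 : (Expr.var Var.triple / cube % cube * .var Var.N).eval (s.setReg Var.I₀ I) = J := by
    have : (s.setReg Var.I₀ I).reg Var.N = N := by rw [Env.setReg_reg, if_neg (by decide), hc.N]
    simp [ecube _ this, this, hJ, Env.setReg_reg, ht]
  have ev3 : (Expr.var Var.triple % cube * .var Var.N).eval
      ((s.setReg Var.I₀ I).setReg Var.J₀ J) = K := by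
    have : ((s.setReg Var.I₀ I).setReg Var.J₀ J).reg Var.N = N := by
      rw [Env.setReg_reg, if_neg (by decide), Env.setReg_reg, if_neg (by decide), hc.N]
    simp [ecube _ this, this, hK, Env.setReg_reg, ht]
  have hafter : afterAssigns s corners = s₁ := by
    simp only [corners, afterAssigns, ev1, ev2, ev3, hs₁]
  refine ARuns.seq (ARuns.assigns ⟨?_, ?_, ?_, ?_, ?_, ?_, trivial⟩ ?_)
  · exact le_trans (by decide) hS
  · rw [ev1]; omega
  · exact le_trans (by decide) hS
  · rw [ev1, ev2]; omega
  · exact le_trans (by decide) hS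
  · rw [ev1, ev2, ev3]; omega
  rw [hafter]
  have hreg₁ : ∀ v, v ≠ Var.I₀ → v ≠ Var.J₀ → v ≠ Var.K₀ → s₁.reg v = s.reg v := by
    intro v h1 h2 h3
    rw [hs₁, Env.setReg_reg, if_neg h3, Env.setReg_reg, if_neg h2, Env.setReg_reg, if_neg h1]
  -- the instance
  have hasG : ∀ s' : Env, (∀ v ≠ Var.p, s'.reg v = s₁.reg v) →
      (∀ a < base, s'.mem a = s.mem a) → HasGadget Λ D F I J K s' := by
    intro s' hr hmem
    refine ⟨hc.congr fun v hv => ?_, ?_, ?_, ?_, fun i hi j hj => ?_, fun i hi j hj => ?_⟩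
    · rw [hr v (by simp only [Var.p]; omega), hreg₁ v] <;>
        simp only [Var.I₀, Var.J₀, Var.K₀] <;> omega
    · rw [hr _ (by decide)]; simp [hs₁, Env.setReg_reg]
    · rw [hr _ (by decide)]; simp [hs₁, Env.setReg_reg]
    · rw [hr _ (by decide)]; simp [hs₁]
    · have : i * m + j < m * m := index_lt hi hj
      exact hmem (1 * (m * m) + (i * m + j)) (by omega)
    · have : i * m + j < m * m := index_lt hi hj
      exact hmem (3 * (m * m) + (i * m + j)) (by omega)
  set val : ℕ → ℕ := fun p => G.entry mode (p / W) (p % W) kind with hval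
  set s₂ : Env := ⟨Function.update s₁.reg Var.p (W * W), fillMem s₁.mem base (W * W) val, s₁.low⟩
    with hs₂
  have hWs : W * W ≤ Λ.stride := hA.side_le
  refine ARuns.seq (ARuns.fill (b := base) (B := W * W) val ⟨?_, ?_, ?_⟩ (by omega) ?_ ?_ ?_)
  · simp; omega
  · have : (side * side).size ≤ 100 := by decide
    omega
  · exact (Expr.size_entry_le mode kind).trans hS
  · intro s' hr
    have hN₁ : s'.reg Var.N = N := by
      rw [hr _ (by decide), hreg₁ _ (by decide) (by decide) (by decide), hc.N]
    refine ⟨?_, ?_⟩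
    · rw [Expr.eval_var, hr _ (by decide), hreg₁ _ (by decide) (by decide) (by decide), hb]
    · simp only [Expr.eval_mul, side, Expr.eval_add, Expr.eval_ofNat, Expr.eval_var, hN₁, hW]
  · intro j hj
    refine ⟨?_, (Gadget.entry_le _ _).trans_lt (by omega)⟩
    have := Expr.eval_entry (hδ := hA.δ_pos) (mode := mode) (kind := kind)
      (hasG ⟨Function.update s₁.reg Var.p j, fillMem s₁.mem base j val, s₁.low⟩
        (fun v hv => Function.update_of_ne hv _ _)
        (fun a ha => (fillMem_of_lt ha : fillMem s₁.mem base j val a = s₁.mem a))) hIm hJm hKm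
    rw [this]
    simp [hval, hG]
    rfl
  -- the call
  have hg₂ : HasGadget Λ D F I J K s₂ := hasG s₂ (fun v hv => Function.update_of_ne hv _ _)
    (fun a ha => (fillMem_of_lt ha : fillMem s₁.mem base (W * W) val a = s₁.mem a))
  have hc₂ := hg₂.consts
  have hbase₂ : s₂.reg Var.base = base := by
    rw [hs₂]
    change Function.update s₁.reg Var.p (W * W) Var.base = base
    rw [Function.update_of_ne (by decide), hreg₁ _ (by decide) (by decide) (by decide), hb]
  have hreg₂ : ∀ v, v ≠ Var.I₀ → v ≠ Var.J₀ → v ≠ Var.K₀ → v ≠ Var.p → s₂.reg v = s.reg v := by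
    intro v h1 h2 h3 h4
    rw [← hreg₁ v h1 h2 h3]
    exact Function.update_of_ne h4 _ _
  have hN₂ : s₂.reg Var.N = N := hc₂.N
  refine ARuns.seq ?_
  change Γ.ARuns _ s₂ _ _
  have hans₂ : s₂.reg Var.ans = 4 * (m * m) := hc₂.ans
  have hct : callTime Γ.R₀ side (arg₁ kind) (arg₂ kind) (commands mode kind) N
      = callTime Γ.R₀ side (arg₁ kind) (arg₂ kind) (commands mode kind) (s₂.reg Var.N) := by rw [hN₂]
  rw [hct]
  refine ARuns.call (𝒜 := 𝒜) (Q := N) rfl (by change Λ.stride ≤ Γ.X; omega) (by omega)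
    (by rw [hc₂.lim]; exact hw) (by rw [hans₂, hbase₂]; omega) (by omega)
    (commands_stable (by omega) mode kind) ?_ ?_ ?_ ?_ ?_ (Gadget.input_reg.2.1) ?_
  · exact (queryCount_requests _ _ _ _ _).le
  · rw [hN₂]
    exact (requestsFrom_commands hc₂ rfl rfl mode kind).symm
  · intro a
    rw [hbase₂]
    change fillMem s₁.mem base (W * W) val (base + a) = (G.input mode kind).mem a
    rw [Gadget.input_mem]
    split_ifs with h1
    · exact fillMem_add h1
    · change ¬ a < W * W at h1
      rw [fillMem_of_le (by omega)]
      exact hfresh _ (by omega)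
  · refine ⟨?_, ?_, ?_⟩
    · exact le_trans (by decide) hS
    · exact le_trans (by cases kind <;> decide) hS
    · exact le_trans (by cases kind <;> decide) hS
  · intro s' hr
    have hc' : Consts Λ s' := hc₂.congr fun v _ => by rw [hr]
    refine ⟨(Expr.eval_side hc').trans (Gadget.input_reg (G := G) (mode := mode) (kind := kind)).1.symm, ?_, ?_⟩
    · cases kind
      · simp [arg₁, hc'.N]; rfl
      · exact Expr.eval_side hc'
    · cases kind
      · simp [arg₂, hc'.N]; rfl
      · rfl
  -- the scan
  intro s₃ d ⟨td, hd⟩ hdone hans hreg₃ hmem₃ hzero₃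
  rw [hbase₂] at hmem₃ hzero₃
  rw [hans₂] at hans hmem₃
  obtain ⟨hlen, htst⟩ := hcor td d hd hdone
  have hc₃ : Consts Λ s₃ := hc₂.congr fun v hv => hreg₃ v (by simp only [Var.cnt]; omega)
    (by simp only [Var.idx]; omega)
  have hmem₃' : ∀ a < 4 * (m * m), s₃.mem a = s.mem a := by
    intro a ha
    rw [hmem₃ a (by omega) (Or.inl ha)]
    exact (fillMem_of_lt (by omega) : fillMem s₁.mem base (W * W) val a = s₁.mem a)
  have hD₃ : ∀ i < m, ∀ j < m, s₃.mat m 1 i j = D i j := fun i hi j hj => hmem₃' _ (by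
    have := index_lt hi hj; omega)
  have hF₃ : ∀ i < m, ∀ j < m, s₃.mat m 3 i j = F i j := fun i hi j hj => hmem₃' _ (by
    have := index_lt hi hj; omega)
  have hnz : nonzero m s₃ = nonzero m s := by
    unfold nonzero
    congr 1
    refine Finset.filter_congr fun p hp => ?_
    simp only [Finset.mem_product, Finset.mem_range] at hp
    rw [hF₃ _ hp.1 _ hp.2]
  rw [hΦ, ← hnz]
  have hscan : T + ((rowTime N * nonzero m s₃ : ℕ) : ℝ≥0∞)
      + ((Expr.var Var.base + .var Var.stride).time + 2 : ℕ)
      + (scanTime (Expr.test mode kind) N : ℕ) + 1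
      = (T + ((Expr.var Var.base + .var Var.stride).time + 2 : ℕ))
        + ((rowTime N * nonzero m s₃ : ℕ) : ℝ≥0∞) + (scanTime (Expr.test mode kind) N : ℕ) + 1 := by
    ring
  rw [hscan]
  have hregI : ∀ v, v ≠ Var.cnt → v ≠ Var.idx → s₃.reg v = s₂.reg v := hreg₃
  refine ARuns.seq (ARuns.scan (Λ := Λ) hc₃ (by omega) (by rw [← hm]; omega)
    ((hregI _ (by decide) (by decide)).trans hg₂.I₀) ((hregI _ (by decide) (by decide)).trans hg₂.J₀)
    ((hregI _ (by decide) (by decide)).trans hg₂.K₀) hIm hJm hKm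
    ((Expr.size_test_le mode kind).trans (by omega)) ?_ ?_)
  · intro s' hc' i hi hiv hmem'
    have hlt : i < d.answers.length := by rw [hlen]; exact hi
    -- The answers lie in the slab behind the third matrix, which the scan leaves alone.
    rw [eval_test hc' (G := G) rfl rfl, hiv, hmem' _ (Or.inr (by omega)), hans i hlt, htst i hlt,
      hG, gadget_light hIm hJm hKm hi hD hF]
    refine exists_congr fun k => and_congr_right fun hk => exists_congr fun j =>
      and_congr_right fun hj => ?_
    rw [hD₃ _ (by omega) _ (by omega), hD₃ _ (by omega) _ (by omega), hF₃ _ (by omega) _ (by omega)]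
  intro s₄ hreg₄ hmem₄ href hset
  have hc₄ : Consts Λ s₄ := hc₃.congr fun v hv => hreg₄ v (by simp only [Var.q]; omega)
    (by simp only [Var.i]; omega)
  have hbase₄ : s₄.reg Var.base = base := by
    rw [hreg₄ _ (by decide) (by decide), hregI _ (by decide) (by decide), hbase₂]
  have evb : (Expr.var Var.base + .var Var.stride).eval s₄ = base + Λ.stride := by
    simp [hbase₄, hc₄.stride]
  have hcm : T + ((Expr.var Var.base + .var Var.stride).time + 2 : ℕ)
      + ((rowTime N * nonzero m s₄ : ℕ) : ℝ≥0∞) = T + ((rowTime N * nonzero m s₄ : ℕ) : ℝ≥0∞)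
      + ((Expr.var Var.base + .var Var.stride).time + 2 : ℕ) := by ring
  rw [hcm]
  refine ARuns.assign (by simp; omega) (by rw [evb]; exact hbX) ?_
  rw [evb]
  refine h (s₄.setReg Var.base (base + Λ.stride)) ?_ (by simp) ?_ ?_ ?_ ?_
  · intro v hv
    simp only [Var.round, Var.bit, Var.triple, Var.h] at hv
    rw [Env.setReg_reg, if_neg (by simp only [Var.base]; omega), hreg₄, hregI, hreg₂] <;>
      simp only [Var.q, Var.i, Var.cnt, Var.idx, Var.I₀, Var.J₀, Var.K₀, Var.p] <;> omega
  · intro a ha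
    rw [Env.setReg_mem, hmem₄ a (Or.inr (by rw [← hm]; omega))]
    exact hzero₃ a ha
  · intro a ha
    rw [Env.setReg_mem, hmem₄ a (Or.inl ha), hmem₃' a (by omega)]
  · intro i hi j hj
    rcases href i hi j hj with h1 | ⟨h1, k, hk, h2⟩
    · exact Or.inl (h1.trans (hF₃ i hi j hj))
    · rw [hD₃ i hi k hk, hD₃ k hk j hj, hF₃ i hi j hj] at h2
      exact Or.inr ⟨h1, k, hk, h2⟩
  · intro i hi j hj k hk htri h0
    have hm4 : m = N ^ 4 := Λ.m_eq
    obtain ⟨t1, t2, t3⟩ := tripleIndex_corner (N := N) (i := i) (j := j) (k := k) hN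
      (by rw [← hm4]; exact hj) (by rw [← hm4]; exact hk)
    rw [htri] at t1 t2 t3
    have ei : I + i % N = i := by rw [hI, t1]; exact Nat.div_add_mod' i N
    have ej : J + j % N = j := by rw [hJ, t2]; exact Nat.div_add_mod' j N
    have ek : K + k % N = k := by rw [hK, t3]; exact Nat.div_add_mod' k N
    have := hset (i % N) (Nat.mod_lt _ hN) (j % N) (Nat.mod_lt _ hN) (k % N) (Nat.mod_lt _ hN)
    rw [ei, ej, ek, hD₃ i hi k hk, hD₃ k hk j hj] at this
    exact this h0

end Machine

namespace Machine

variable {Γ : Machine} {Λ : Params}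

/-! ## Filling matrices -/

/-- Fill the matrix number `b`. -/
def fillMatrix (R₀ : ℕ) (b e : Expr) : Prog := fill R₀ (b * .var Var.mm) (.var Var.mm) e

def fillMatrixTime (e : Expr) (m : ℕ) : ℕ := (e.time + 40) * (m * m + 1)

theorem ARuns.fillMatrix {s : Env} {e : Expr} {b : ℕ} (f : ℕ → ℕ → ℕ) {T : ℝ≥0∞}
    {R : Env → ℝ≥0∞ → Prop} (hc : Consts Λ s) (hS : 100 ≤ Γ.S) (hb : b ≤ 10) (he : e.size ≤ Γ.S)
    (hX : Λ.m * Λ.m < Γ.X)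
    (hval : ∀ (s' : Env) (p : ℕ), Consts Λ s' → p < Λ.m * Λ.m → s'.reg Var.p = p →
      (∀ v ≠ Var.p, s'.reg v = s.reg v) →
      (∀ a, a < b * (Λ.m * Λ.m) ∨ b * (Λ.m * Λ.m) + p ≤ a → s'.mem a = s.mem a) →
      e.eval s' = f (p / Λ.m) (p % Λ.m) ∧ f (p / Λ.m) (p % Λ.m) < Γ.X)
    (h : ∀ s' : Env, (∀ v ≠ Var.p, s'.reg v = s.reg v) →
      (∀ a, a < b * (Λ.m * Λ.m) ∨ b * (Λ.m * Λ.m) + Λ.m * Λ.m ≤ a → s'.mem a = s.mem a) →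
      (∀ i < Λ.m, ∀ j < Λ.m, s'.mat Λ.m b i j = f i j) → R s' T) :
    Γ.ARuns (fillMatrix Γ.R₀ (.const b) e) s (T + fillMatrixTime e Λ.m) R := by
  set m := Λ.m with hm
  have ht : fillTime (.const b * .var Var.mm) (.var Var.mm) e * (m * m + 1) ≤ fillMatrixTime e m := by
    unfold fillTime fillMatrixTime
    refine Nat.mul_le_mul_right _ ?_
    have e1 : (Expr.const b * Expr.var Var.mm + Expr.var Var.p).time = 9 := rfl
    have e2 : forTime (Expr.var Var.mm) = 21 := rfl
    omega
  refine ARuns.mono ?_ (add_le_add le_rfl (Nat.cast_le.2 ht))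
  refine ARuns.fill (b := b * (m * m)) (B := m * m) (fun p => f (p / m) (p % m))
    ⟨by simp; omega, by simp; omega, he⟩ hX ?_ ?_ ?_
  · intro s' hr
    have : s'.reg Var.mm = m * m := by rw [hr _ (by decide), hc.mm]
    simp [this]
  · intro j hj
    refine hval ⟨Function.update s.reg Var.p j, fillMem s.mem (b * (m * m)) j
      (fun p => f (p / m) (p % m)), s.low⟩ j (hc.congr fun v hv => ?_) hj (by simp) ?_ ?_
    · exact Function.update_of_ne (by simp only [Var.p]; omega) _ _
    · intro v hv; exact Function.update_of_ne hv _ _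
    · intro a ha
      change fillMem s.mem (b * (m * m)) j (fun p => f (p / m) (p % m)) a = s.mem a
      exact ha.elim fillMem_of_lt fillMem_of_le
  · refine h _ (fun v hv => Function.update_of_ne hv _ _) ?_ ?_
    · intro a ha
      change fillMem s.mem (b * (m * m)) (m * m) (fun p => f (p / m) (p % m)) a = s.mem a
      exact ha.elim fillMem_of_lt fillMem_of_le
    · intro i hi j hj
      have := fillMem_add (mem := s.mem) (b := b * (m * m)) (val := fun p => f (p / m) (p % m))
        (index_lt hi hj)
      refine this.trans ?_
      have hm0 : 0 < m := by omega
      rw [add_comm (i * m), Nat.add_mul_div_right _ _ hm0, Nat.div_eq_of_lt hj, zero_add,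
        Nat.add_mul_mod_self_right, Nat.mod_eq_of_lt hj]

/-! ## The square of a matrix -/

/-- The state of the main program when `c` comparisons of matrices are still to be made. -/
structure Ready (Γ : Machine) (Λ : Params) (D : ℕ → ℕ → ℕ) (c : ℕ) (s : Env) : Prop where
  consts : Consts Λ s
  base_le : 5 * (Λ.m * Λ.m) ≤ s.reg Var.base
  room : s.reg Var.base + c * (Λ.N ^ 9 * Λ.stride) < Γ.X
  fresh : ∀ a, s.reg Var.base ≤ a → s.mem a = 0
  D : ∀ i < Λ.m, ∀ j < Λ.m, s.mat Λ.m 1 i j = D i j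

theorem Ready.lt {D : ℕ → ℕ → ℕ} {c : ℕ} {s : Env} (h : Ready Γ Λ D c s) : Λ.m * Λ.m < Γ.X := by
  have := h.base_le
  have := h.room
  omega

/-- Compare the third matrix with the square of the first matrix. -/
def compareProg (R₀ : ℕ) (A : DynAlg) (mode : Mode) (kind : Kind) : Prog :=
  forLoop R₀ Var.triple (cube * cube * cube) (blockProg R₀ A mode kind)

/-- The time for the comparison if the time for each block is `κ`. -/
noncomputable def compareTime (κ : ℝ≥0∞) (Λ : Params) : ℝ≥0∞ :=
  (rowTime Λ.N * (Λ.m * Λ.m) : ℕ) + (Λ.N ^ 9 : ℕ) * κ + (70 * (Λ.N ^ 9 + 1) : ℕ)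

/-- Each triple of indices belongs to one triple of blocks, so an entry that survives all `N ^ 9`
blocks is at most every sum, while an entry is set to zero only because of a witness. Since all
thresholds are positive at the start, zero is an unambiguous mark. The scans of all blocks together
are paid by `rowTime` for each of the `m * m` entries. -/
theorem ARuns.compare {A : DynAlg} {mode : Mode} {kind : Kind} {τ : ℝ≥0∞} {s : Env} {T : ℝ≥0∞}
    {R : Env → ℝ≥0∞ → Prop} (hA : Subroutine Γ Λ A mode kind τ) {D : ℕ → ℕ → ℕ} {c : ℕ}
    (hs : Ready Γ Λ D (c + 1) s) (hD : ∀ i < Λ.m, ∀ j < Λ.m, D i j ≤ Λ.δ)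
    (hF : ∀ i < Λ.m, ∀ j < Λ.m, 0 < s.mat Λ.m 3 i j ∧ s.mat Λ.m 3 i j ≤ Λ.δ)
    (h : ∀ s' : Env, Ready Γ Λ D c s' →
      (∀ v, v = Var.round ∨ v = Var.bit ∨ v = Var.h → s'.reg v = s.reg v) →
      (∀ a < 3 * (Λ.m * Λ.m), s'.mem a = s.mem a) →
      (∀ i < Λ.m, ∀ j < Λ.m, s'.mat Λ.m 3 i j ≠ 0 ↔ s.mat Λ.m 3 i j ≤ minPlusSq Λ.m D i j) →
      R s' T) :
    Γ.ARuns (compareProg Γ.R₀ A mode kind) s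
      (T + compareTime (12 * τ + blockTime Γ.R₀ mode kind Λ.N) Λ) R := by
  have hS := hA.size_le
  have hN := Λ.N_pos
  set m := Λ.m with hm
  set N := Λ.N with hN'
  set κ : ℝ≥0∞ := 12 * τ + blockTime Γ.R₀ mode kind N with hκ
  set base := s.reg Var.base with hbase
  have hstr : 0 < Λ.stride := by have := hA.lim_lt; omega
  have hroom : base + (c + 1) * (N ^ 9 * Λ.stride) < Γ.X := hs.room
  have hb5 : 5 * (m * m) ≤ base := hs.base_le
  have hexp : (c + 1) * (N ^ 9 * Λ.stride) = c * (N ^ 9 * Λ.stride) + N ^ 9 * Λ.stride := by ring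
  have hfor : forTime (cube * cube * cube) ≤ 70 := by decide
  refine ARuns.mono (T := T + (rowTime N * nonzero m s : ℕ) + (N ^ 9 : ℕ) * κ +
    (forTime (cube * cube * cube) * (N ^ 9 + 1) : ℕ)) ?_ ?_
  swap
  · rw [compareTime, ← add_assoc, ← add_assoc]
    refine add_le_add (add_le_add (add_le_add le_rfl (Nat.cast_le.2 ?_)) le_rfl) (Nat.cast_le.2 ?_)
    · exact Nat.mul_le_mul_left _ (nonzero_le m s)
    · exact Nat.mul_le_mul_right _ hfor
  refine ARuns.conseq (R := fun s' x => R s' T ∧ T ≤ x) ?_ fun s' x _ hx => ⟨_, hx.2, hx.1⟩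
  refine ARuns.forLoop (B := N ^ 9) (fun t s' x => t ≤ N ^ 9 ∧ s'.reg Var.triple = t ∧
      (∀ v, v < 10 ∨ v = Var.round ∨ v = Var.bit ∨ v = Var.h → s'.reg v = s.reg v) ∧
      s'.reg Var.base = base + t * Λ.stride ∧ (∀ a, base + t * Λ.stride ≤ a → s'.mem a = 0) ∧
      (∀ a < 3 * (m * m), s'.mem a = s.mem a) ∧
      Refines m D (s.mat m 3) (s'.mat m 3) ∧
      (∀ i < m, ∀ j < m, ∀ k < m, tripleIndex N i j k < t → s'.mat m 3 i j ≠ 0 →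
        s'.mat m 3 i j ≤ D i k + D k j) ∧
      x = T + (N ^ 9 - t : ℕ) * κ + (rowTime N * nonzero m s' : ℕ)) ?_ ?_
      (fun j s' x h1 => h1.2.1) ?_ ?_ ?_ ?_
  · have : (cube * cube * cube).size + 10 ≤ 100 := by decide
    omega
  · have : N ^ 9 ≤ N ^ 9 * Λ.stride := Nat.le_mul_of_pos_right _ hstr
    omega
  · rintro j s' x ⟨-, -, h1, -⟩
    have : s'.reg Var.N = N := by rw [h1 _ (Or.inl (by decide)), hs.consts.N]
    simp only [cube, Expr.eval_mul, Expr.eval_var, this]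
    ring
  · refine ⟨by omega, by simp, ?_, ?_, ?_, fun _ _ => rfl, Refines.refl, ?_, ?_⟩
    · intro v hv
      simp only [Var.round, Var.bit, Var.h] at hv
      rw [Env.setReg_reg, if_neg (by simp only [Var.triple]; omega)]
    · rw [Env.setReg_reg, if_neg (by decide), zero_mul, add_zero]
    · rw [zero_mul, add_zero]; exact hs.fresh
    · intro i hi j hj k hk h0; omega
    · rw [Nat.sub_zero]
      have : nonzero m (s.setReg Var.triple 0) = nonzero m s := rfl
      rw [this]
      ring
  · rintro t ht s' x _ ⟨-, htv, hreg, hb', hfr, hmem, href, hset, rfl⟩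
    have hmat1 : ∀ i < m, ∀ j < m, s'.mat m 1 i j = D i j := by
      intro i hi j hj
      rw [← hs.D i hi j hj]
      have : i * m + j < m * m := index_lt hi hj
      exact hmem (1 * (m * m) + (i * m + j)) (by omega)
    have hx : T + (N ^ 9 - t : ℕ) * κ + ((rowTime N * nonzero m s' : ℕ) : ℝ≥0∞)
        = (T + (N ^ 9 - (t + 1) : ℕ) * κ) + (rowTime N * nonzero m s' : ℕ) + κ := by
      obtain ⟨d, hd⟩ : ∃ d, N ^ 9 - t = d + 1 := ⟨N ^ 9 - t - 1, by omega⟩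
      have hd' : N ^ 9 - (t + 1) = d := by omega
      rw [hd, hd']; push_cast; ring
    rw [hx]
    have hstep : (t + 1) * Λ.stride ≤ N ^ 9 * Λ.stride := Nat.mul_le_mul_right _ ht
    have hexp2 : (t + 1) * Λ.stride = t * Λ.stride + Λ.stride := by ring
    refine ARuns.block hA (hs.consts.congr fun v hv => hreg v (Or.inl hv)) hb' ?_ ?_ hfr ?_ ?_ htv ht ?_
    · rw [← hm]; omega
    · omega
    · intro i hi j hj
      change s'.mat m 1 i j ≤ Λ.δ
      rw [hmat1 i hi j hj]; exact hD i hi j hj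
    · intro i hi j hj
      rcases href i hi j hj with h1 | ⟨h1, -⟩
      · exact h1.le.trans (hF i hi j hj).2
      · exact h1.le.trans (Nat.zero_le _)
    · intro s₁ g1 g2 g3 g4 g5 g6
      have g5' : Refines m D (s'.mat m 3) (s₁.mat m 3) := by
        intro i hi j hj
        rcases g5 i hi j hj with h1 | ⟨h1, k, hk, h2⟩
        · exact Or.inl h1
        · refine Or.inr ⟨h1, k, hk, ?_⟩
          rw [← hmat1 i hi k hk, ← hmat1 k hk j hj]
          exact h2
      refine ⟨by rw [g1 _ (by decide), htv], by omega, by simp, ?_, ?_, ?_, ?_, ?_, ?_, rfl⟩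
      · intro v hv
        simp only [Var.round, Var.bit, Var.h] at hv
        rw [Env.setReg_reg, if_neg (by simp only [Var.triple]; omega), g1, hreg]
        all_goals simp only [Var.round, Var.bit, Var.triple, Var.h]; omega
      · rw [Env.setReg_reg, if_neg (by decide), g2, hexp2, add_assoc]
      · intro a ha
        exact g3 a (by omega)
      · intro a ha
        exact (g4 a ha).trans (hmem a ha)
      · exact href.trans g5'
      · intro i hi j hj k hk hlt h0
        change s₁.mat m 3 i j ≠ 0 at h0
        change s₁.mat m 3 i j ≤ _
        rcases Nat.lt_succ_iff_lt_or_eq.1 hlt with h1 | h1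
        · have h2 := g5'.eq_of_ne_zero hi hj h0
          rw [h2] at h0 ⊢
          exact hset i hi j hj k hk h1 h0
        · have := g6 i hi j hj k hk h1 h0
          rw [← hmat1 i hi k hk, ← hmat1 k hk j hj]
          exact this
  · rintro s' x _ ⟨-, htv, hreg, hb', hfr, hmem, href, hset, rfl⟩
    refine ⟨h s' ⟨hs.consts.congr fun v hv => hreg v (Or.inl hv), by rw [hb']; change 5 * (m * m) ≤ _; omega,
      by rw [hb']; change base + N ^ 9 * Λ.stride + c * (N ^ 9 * Λ.stride) < Γ.X; omega, ?_, ?_⟩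
      (fun v hv => hreg v (Or.inr hv)) hmem ?_, (le_self_add).trans le_self_add⟩
    · intro a ha; exact hfr a (by omega)
    · intro i hi j hj
      rw [← hs.D i hi j hj]
      have : i * m + j < m * m := index_lt hi hj
      exact hmem (1 * (m * m) + (i * m + j)) (by omega)
    · intro i hi j hj
      have hm4 : m = N ^ 4 := Λ.m_eq
      constructor
      · intro h0
        rw [← href.eq_of_ne_zero hi hj h0]
        by_contra hlt
        rw [not_le, minPlusSq_lt_iff Λ.m_pos] at hlt
        obtain ⟨k, hk, hlt⟩ := hlt
        have := hset i hi j hj k hk (tripleIndex_lt (by rw [← hm4]; exact hi)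
          (by rw [← hm4]; exact hj) (by rw [← hm4]; exact hk)) h0
        omega
      · intro hle h0
        rcases href i hi j hj with h1 | ⟨-, k, hk, h2⟩
        · have := (hF i hi j hj).1
          omega
        · have := minPlusSq_le (D := D) (i := i) (j := j) hk
          omega

open WordRAM.Expr (lt)

/-- Determine one bit of the entries of the square. -/
def bitProg (R₀ : ℕ) (A : DynAlg) (mode : Mode) (kind : Kind) : Prog :=
  .seq (assign R₀ Var.h (.var Var.h / 2))
    (.seq (fillMatrix R₀ (.const 3) (.load (2 * .var Var.mm + .var Var.p) + .var Var.h))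
      (.seq (compareProg R₀ A mode kind)
        (fillMatrix R₀ (.const 2) (.load (2 * .var Var.mm + .var Var.p) +
          .var Var.h * lt 0 (.load (3 * .var Var.mm + .var Var.p))))))

noncomputable def bitTime (κ : ℝ≥0∞) (Λ : Params) : ℝ≥0∞ :=
  compareTime κ Λ + (200 * (Λ.m * Λ.m + 1) : ℕ)

/-- One round of binary search in all entries simultaneously: the square lies in an interval of
length `2 * g` from `T`, and the threshold `T + g` decides which half to keep. The condition `T + 2
* g ≤ δ` keeps thresholds in the range of the gadget, and `0 < g` makes them positive. -/
theorem ARuns.bit {A : DynAlg} {mode : Mode} {kind : Kind} {τ : ℝ≥0∞} {s : Env} {T : ℝ≥0∞}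
    {R : Env → ℝ≥0∞ → Prop} (hA : Subroutine Γ Λ A mode kind τ) {D : ℕ → ℕ → ℕ} {c g : ℕ}
    (hs : Ready Γ Λ D (c + 1) s) (hD : ∀ i < Λ.m, ∀ j < Λ.m, D i j ≤ Λ.δ)
    (hδX : Λ.δ < Γ.X) (hg : 0 < g) (hh : s.reg Var.h = 2 * g)
    (hT : ∀ i < Λ.m, ∀ j < Λ.m, s.mat Λ.m 2 i j ≤ minPlusSq Λ.m D i j ∧
      minPlusSq Λ.m D i j < s.mat Λ.m 2 i j + 2 * g ∧ s.mat Λ.m 2 i j + 2 * g ≤ Λ.δ)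
    (h : ∀ s' : Env, Ready Γ Λ D c s' →
      (∀ v, v = Var.round ∨ v = Var.bit → s'.reg v = s.reg v) → s'.reg Var.h = g →
      (∀ i < Λ.m, ∀ j < Λ.m, s'.mat Λ.m 2 i j ≤ minPlusSq Λ.m D i j ∧
        minPlusSq Λ.m D i j < s'.mat Λ.m 2 i j + g ∧ s'.mat Λ.m 2 i j + g ≤ Λ.δ) →
      R s' T) :
    Γ.ARuns (bitProg Γ.R₀ A mode kind) s
      (T + bitTime (12 * τ + blockTime Γ.R₀ mode kind Λ.N) Λ) R := by
  have hS := hA.size_le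
  have hXm := hs.lt
  set m := Λ.m with hm
  have hm0 : 0 < m := Λ.m_pos
  set κ : ℝ≥0∞ := 12 * τ + blockTime Γ.R₀ mode kind Λ.N with hκ
  set E₁ : Expr := .load (2 * .var Var.mm + .var Var.p) + .var Var.h with hE₁
  set E₂ : Expr := .load (2 * .var Var.mm + .var Var.p) +
          .var Var.h * lt 0 (.load (3 * .var Var.mm + .var Var.p)) with hE₂
  have hb5 : 5 * (m * m) ≤ s.reg Var.base := hs.base_le
  refine ARuns.mono (T := (T + (fillMatrixTime E₂ m : ℕ)) + compareTime κ Λ + 1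
      + (fillMatrixTime E₁ m : ℕ) + 1 + ((Expr.var Var.h / 2).time + 2 : ℕ) + 1) ?_ ?_
  swap
  · have e : (T + (fillMatrixTime E₂ m : ℕ)) + compareTime κ Λ + 1
        + (fillMatrixTime E₁ m : ℕ) + 1 + ((Expr.var Var.h / 2).time + 2 : ℕ) + 1
        = T + (compareTime κ Λ + (fillMatrixTime E₁ m + fillMatrixTime E₂ m + 10 : ℕ)) := by
      have e3 : (Expr.var Var.h / 2).time = 5 := rfl
      rw [e3]; push_cast; ring
    rw [e, bitTime]
    refine add_le_add le_rfl (add_le_add le_rfl (Nat.cast_le.2 ?_))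
    have e1 : E₁.time ≤ 40 := by decide
    have e2 : E₂.time ≤ 60 := by decide
    have e1' : fillMatrixTime E₁ m ≤ 80 * (m * m + 1) := Nat.mul_le_mul_right _ (by omega)
    have e2' : fillMatrixTime E₂ m ≤ 100 * (m * m + 1) := Nat.mul_le_mul_right _ (by omega)
    rw [← hm]
    omega
  have evh : (Expr.var Var.h / 2).eval s = g := by
    simp [hh]
  obtain ⟨-, htop⟩ := hT 0 hm0 0 hm0
  refine ARuns.seq (ARuns.assign (by simp; omega) (by rw [evh]; omega) ?_)
  rw [evh]
  set s₁ := s.setReg Var.h g with hs₁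
  have hreg₁ : ∀ v ≠ Var.h, s₁.reg v = s.reg v := fun v hv => by rw [hs₁, Env.setReg_reg, if_neg hv]
  have hc₁ : Consts Λ s₁ := hs.consts.congr fun v hv => hreg₁ v (by simp only [Var.h]; omega)
  refine ARuns.seq (ARuns.fillMatrix (Λ := Λ) (fun i j => s.mat m 2 i j + g) hc₁ (by omega) (by omega)
    ?_ hXm ?_ ?_)
  · exact le_trans (by decide) hS
  · intro s' p hc' hp hpv hreg' hmem'
    replace hp : p < m * m := hp
    have hdm : p / m * m + p % m = p := Nat.div_add_mod' p m
    have hp1 : p / m < m := Nat.div_lt_of_lt_mul hp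
    have hp2 : p % m < m := Nat.mod_lt _ hm0
    refine ⟨?_, ?_⟩
    · simp only [Expr.eval_add, Expr.eval_load, Expr.eval_mul, Expr.eval_ofNat, Expr.eval_var,
        hc'.mm, hpv]
      rw [hmem' _ (Or.inl (by rw [← hm]; omega)), hreg' _ (by decide), ← hm]
      rw [Env.mat, hdm]
      simp [hs₁]
    · have := hT _ hp1 _ hp2
      change s.mat m 2 (p / m) (p % m) + g < Γ.X
      omega
  intro s₂ hreg₂ hmem₂ hF₂
  have hr₂ : Ready Γ Λ D (c + 1) s₂ := by
    have hb : s₂.reg Var.base = s.reg Var.base := by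
      rw [hreg₂ _ (by decide), hreg₁ _ (by decide)]
    refine ⟨hc₁.congr fun v hv => hreg₂ v (by simp only [Var.p]; omega), by rw [hb]; exact hb5,
      by rw [hb]; exact hs.room, fun a ha => ?_, fun i hi j hj => ?_⟩
    · rw [hb] at ha
      rw [hmem₂ a (Or.inr (by rw [← hm]; omega))]
      exact hs.fresh a ha
    · rw [← hs.D i hi j hj]
      have : i * m + j < m * m := index_lt hi hj
      exact hmem₂ (1 * (m * m) + (i * m + j)) (Or.inl (by rw [← hm]; omega))
  refine ARuns.seq (ARuns.compare hA hr₂ hD ?_ ?_)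
  · intro i hi j hj
    rw [hF₂ i hi j hj]
    have := hT i hi j hj
    omega
  intro s₃ hr₃ hreg₃ hmem₃ hcmp
  have hh₃ : s₃.reg Var.h = g := by
    rw [hreg₃ _ (by decide), hreg₂ _ (by decide), hs₁, Env.setReg_reg_self]
  have hT₃ : ∀ i < m, ∀ j < m, s₃.mat m 2 i j = s.mat m 2 i j := by
    intro i hi j hj
    have : i * m + j < m * m := index_lt hi hj
    refine (hmem₃ (2 * (m * m) + (i * m + j)) (by rw [← hm]; omega)).trans ?_
    exact hmem₂ (2 * (m * m) + (i * m + j)) (Or.inl (by rw [← hm]; omega))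
  refine ARuns.fillMatrix (Λ := Λ) (fun i j => s₃.mat m 2 i j +
    g * if 0 < s₃.mat m 3 i j then 1 else 0) hr₃.consts (by omega) (by omega) ?_ hXm ?_ ?_
  · exact le_trans (by decide) hS
  · intro s' p hc' hp hpv hreg' hmem'
    replace hp : p < m * m := hp
    have hdm : p / m * m + p % m = p := Nat.div_add_mod' p m
    have hp1 : p / m < m := Nat.div_lt_of_lt_mul hp
    have hp2 : p % m < m := Nat.mod_lt _ hm0
    refine ⟨?_, ?_⟩
    · simp only [Expr.eval_add, Expr.eval_load, Expr.eval_mul, Expr.eval_ofNat, Expr.eval_var,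
        Expr.eval_lt, hc'.mm, hpv]
      -- The second matrix is updated in place: its cell `p` is read immediately before it is
      -- overwritten.
      rw [hmem' _ (Or.inr le_rfl), hmem' _ (Or.inr (by omega)), hreg' _ (by decide), hh₃, ← hm]
      rw [Env.mat, Env.mat, hdm]
    · have h1 := hT _ hp1 _ hp2
      have h2 := hT₃ _ hp1 _ hp2
      change s₃.mat m 2 (p / m) (p % m) + g * _ < Γ.X
      split_ifs <;> omega
  intro s₄ hreg₄ hmem₄ hT₄
  have hb₄ : s₄.reg Var.base = s₃.reg Var.base := hreg₄ _ (by decide)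
  have hb5₃ : 5 * (m * m) ≤ s₃.reg Var.base := hr₃.base_le
  refine h s₄ ⟨hr₃.consts.congr fun v hv => hreg₄ v (by simp only [Var.p]; omega),
    by rw [hb₄]; exact hb5₃, by rw [hb₄]; exact hr₃.room, fun a ha => ?_, fun i hi j hj => ?_⟩
    ?_ ?_ ?_
  · rw [hb₄] at ha
    rw [hmem₄ a (Or.inr (by rw [← hm]; omega))]
    exact hr₃.fresh a ha
  · rw [← hr₃.D i hi j hj]
    have : i * m + j < m * m := index_lt hi hj
    exact hmem₄ (1 * (m * m) + (i * m + j)) (Or.inl (by rw [← hm]; omega))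
  · intro v hv
    simp only [Var.round, Var.bit] at hv
    rw [hreg₄ v (by simp only [Var.p]; omega), hreg₃ v (by simp only [Var.round, Var.bit, Var.h]; omega),
      hreg₂ v (by simp only [Var.p]; omega), hreg₁ v (by simp only [Var.h]; omega)]
  · rw [hreg₄ _ (by decide), hh₃]
  · intro i hi j hj
    have h1 := hcmp i hi j hj
    rw [hF₂ i hi j hj] at h1
    have h2 := hT i hi j hj
    rw [hT₄ i hi j hj, hT₃ i hi j hj]
    change s₃.mat m 3 i j ≠ 0 ↔ s.mat m 2 i j + g ≤ minPlusSq m D i j at h1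
    change s.mat m 2 i j ≤ minPlusSq m D i j ∧ minPlusSq m D i j < s.mat m 2 i j + 2 * g ∧ _ at h2
    split_ifs with h3
    · have := h1.1 (by omega)
      omega
    · have : ¬ (s.mat m 2 i j + g ≤ minPlusSq m D i j) := fun h4 => h3 (Nat.pos_of_ne_zero (h1.2 h4))
      omega

end Machine

/-! ### All bits of the square, and repeated squaring -/

namespace Machine

variable {Γ : Machine} {Λ : Params}

theorem Ready.setReg {D : ℕ → ℕ → ℕ} {c : ℕ} {s : Env} (h : Ready Γ Λ D c s) {v : ℕ} (hv : 10 < v)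
    (x : ℕ) : Ready Γ Λ D c (s.setReg v x) := by
  have hb : (s.setReg v x).reg Var.base = s.reg Var.base := by
    rw [Env.setReg_reg, if_neg (by simp only [Var.base]; omega)]
  refine ⟨h.consts.congr fun u hu => ?_, by rw [hb]; exact h.base_le, by rw [hb]; exact h.room,
    fun a ha => h.fresh a (by rwa [hb] at ha), h.D⟩
  rw [Env.setReg_reg, if_neg (by omega)]

theorem Ready.congr {D D' : ℕ → ℕ → ℕ} {c c' : ℕ} {s s' : Env} (h : Ready Γ Λ D c s) (hc : c' ≤ c)
    (hreg : ∀ v ≤ 10, s'.reg v = s.reg v)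
    (hmem : ∀ a, 5 * (Λ.m * Λ.m) ≤ a → s'.mem a = s.mem a)
    (hD : ∀ i < Λ.m, ∀ j < Λ.m, s'.mat Λ.m 1 i j = D' i j) : Ready Γ Λ D' c' s' := by
  have hb : s'.reg Var.base = s.reg Var.base := hreg _ (by decide)
  have hb5 := h.base_le
  refine ⟨h.consts.congr fun v hv => hreg v (by omega), by rw [hb]; exact hb5, ?_,
    fun a ha => ?_, hD⟩
  · rw [hb]
    exact lt_of_le_of_lt (Nat.add_le_add_left (Nat.mul_le_mul_right _ hc) _) h.room
  · rw [hb] at ha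
    rw [hmem a (by omega)]
    exact h.fresh a ha

def bitsProg (R₀ : ℕ) (A : DynAlg) (mode : Mode) (kind : Kind) : Prog :=
  forLoop R₀ Var.bit (.var Var.β) (bitProg R₀ A mode kind)

/-- At the start `T = 0` and the interval has length `δ = 2 ^ β`. After `β` halvings its length is
`1`, and `T` is the square. -/
theorem ARuns.bits {A : DynAlg} {mode : Mode} {kind : Kind} {τ : ℝ≥0∞} {s : Env} {T : ℝ≥0∞}
    {R : Env → ℝ≥0∞ → Prop} (hA : Subroutine Γ Λ A mode kind τ) {D : ℕ → ℕ → ℕ} {c : ℕ}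
    (hs : Ready Γ Λ D (c + Λ.β) s) (hD : ∀ i < Λ.m, ∀ j < Λ.m, D i j ≤ Λ.δ)
    (hδX : Λ.δ < Γ.X) (hβ : Λ.δ = 2 ^ Λ.β) (hh : s.reg Var.h = Λ.δ)
    (hT : ∀ i < Λ.m, ∀ j < Λ.m, s.mat Λ.m 2 i j = 0 ∧ minPlusSq Λ.m D i j < Λ.δ)
    (h : ∀ s' : Env, Ready Γ Λ D c s' → s'.reg Var.round = s.reg Var.round →
      (∀ i < Λ.m, ∀ j < Λ.m, s'.mat Λ.m 2 i j = minPlusSq Λ.m D i j) → R s' T) :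
    Γ.ARuns (bitsProg Γ.R₀ A mode kind) s
      (T + Λ.β * bitTime (12 * τ + blockTime Γ.R₀ mode kind Λ.N) Λ + (21 * (Λ.β + 1) : ℕ)) R := by
  have hS := hA.size_le
  set κ := bitTime (12 * τ + blockTime Γ.R₀ mode kind Λ.N) Λ with hκ
  set β := Λ.β with hβ'
  refine ARuns.forLoop (e := .var Var.β) (B := β) (fun b s' x => b ≤ β ∧ s'.reg Var.bit = b ∧
    Ready Γ Λ D (c + (β - b)) s' ∧ s'.reg Var.round = s.reg Var.round ∧
    s'.reg Var.h = 2 ^ (β - b) ∧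
    (∀ i < Λ.m, ∀ j < Λ.m, s'.mat Λ.m 2 i j ≤ minPlusSq Λ.m D i j ∧
      minPlusSq Λ.m D i j < s'.mat Λ.m 2 i j + 2 ^ (β - b) ∧
      s'.mat Λ.m 2 i j + 2 ^ (β - b) ≤ Λ.δ) ∧ x = T + (β - b : ℕ) * κ) (by simp; omega) ?_
    (fun j s' x h1 => h1.2.1) ?_ ?_ ?_ ?_
  · have : β < 2 ^ β := Nat.lt_two_pow_self
    omega
  · rintro j s' x ⟨-, -, h1, -⟩
    exact h1.consts.β
  · refine ⟨by omega, by simp, hs.setReg (by decide) _, by simp [Env.setReg_reg], ?_, ?_, by simp⟩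
    · rw [Env.setReg_reg, if_neg (by decide), hh, hβ, Nat.sub_zero]
    · intro i hi j hj
      change s.mat Λ.m 2 i j ≤ _ ∧ _ < s.mat Λ.m 2 i j + _ ∧ s.mat Λ.m 2 i j + _ ≤ _
      rw [(hT i hi j hj).1, Nat.sub_zero, ← hβ]
      have := (hT i hi j hj).2
      omega
  · rintro b hb s' x _ ⟨-, h1, h2, h3, h4, h5, rfl⟩
    obtain ⟨d, hd⟩ : ∃ d, β - b = d + 1 := ⟨β - b - 1, by omega⟩
    have hd' : β - (b + 1) = d := by omega
    rw [hd, pow_succ'] at h5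
    rw [hd, pow_succ'] at h4
    rw [hd, ← add_assoc] at h2
    have hx : T + ((β - b : ℕ) : ℝ≥0∞) * κ = (T + d * κ) + κ := by
      rw [hd]; push_cast; ring
    rw [hx]
    refine ARuns.bit hA h2 hD hδX (Nat.two_pow_pos d) h4 h5 fun s₁ g1 g2 g3 g4 => ?_
    refine ⟨by rw [g2 _ (Or.inr rfl), h1], by omega, by simp, ?_, ?_, ?_, ?_, ?_⟩
    · rw [hd']; exact g1.setReg (by decide) _
    · rw [Env.setReg_reg, if_neg (by decide), g2 _ (Or.inl rfl), h3]
    · rw [Env.setReg_reg, if_neg (by decide), g3, hd']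
    · rw [hd']; exact g4
    · rw [hd']
  · rintro s' x _ ⟨-, h1, h2, h3, h4, h5, rfl⟩
    rw [Nat.sub_self] at *
    rw [Nat.cast_zero, zero_mul, add_zero]
    refine h s' h2 h3 fun i hi j hj => ?_
    have := h5 i hi j hj
    rw [pow_zero] at this
    omega

/-- Replace the first matrix by its square. -/
def squareProg (R₀ : ℕ) (A : DynAlg) (mode : Mode) (kind : Kind) : Prog :=
  .seq (fillMatrix R₀ (.const 2) 0) (.seq (assign R₀ Var.h (.var Var.δ))
    (.seq (bitsProg R₀ A mode kind)
      (fillMatrix R₀ (.const 1) (.load (2 * .var Var.mm + .var Var.p)))))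

noncomputable def squareTime (κ : ℝ≥0∞) (Λ : Params) : ℝ≥0∞ :=
  Λ.β * bitTime κ Λ + (21 * (Λ.β + 1) + 150 * (Λ.m * Λ.m + 1) : ℕ)

theorem ARuns.square {A : DynAlg} {mode : Mode} {kind : Kind} {τ : ℝ≥0∞} {s : Env} {T : ℝ≥0∞}
    {R : Env → ℝ≥0∞ → Prop} (hA : Subroutine Γ Λ A mode kind τ) {D : ℕ → ℕ → ℕ} {c : ℕ}
    (hs : Ready Γ Λ D (c + Λ.β) s) (hD : ∀ i < Λ.m, ∀ j < Λ.m, D i j ≤ Λ.δ)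
    (hδX : Λ.δ < Γ.X) (hβ : Λ.δ = 2 ^ Λ.β)
    (hv : ∀ i < Λ.m, ∀ j < Λ.m, minPlusSq Λ.m D i j < Λ.δ)
    (h : ∀ s' : Env, Ready Γ Λ (minPlusSq Λ.m D) c s' → s'.reg Var.round = s.reg Var.round → R s' T) :
    Γ.ARuns (squareProg Γ.R₀ A mode kind) s
      (T + squareTime (12 * τ + blockTime Γ.R₀ mode kind Λ.N) Λ) R := by
  have hS := hA.size_le
  have hXm := hs.lt
  set m := Λ.m with hm
  have hm0 : 0 < m := Λ.m_pos
  set κ := 12 * τ + blockTime Γ.R₀ mode kind Λ.N with hκ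
  set E : Expr := .load (2 * .var Var.mm + .var Var.p) with hE
  refine ARuns.mono (T := T + (fillMatrixTime E m : ℕ) + Λ.β * bitTime κ Λ + (21 * (Λ.β + 1) : ℕ) + 1
    + ((Expr.var Var.δ).time + 2 : ℕ) + 1 + (fillMatrixTime 0 m : ℕ) + 1) ?_ ?_
  swap
  · have e : T + (fillMatrixTime E m : ℕ) + Λ.β * bitTime κ Λ + (21 * (Λ.β + 1) : ℕ) + 1
        + ((Expr.var Var.δ).time + 2 : ℕ) + 1 + (fillMatrixTime 0 m : ℕ) + 1
        = T + (Λ.β * bitTime κ Λ + (21 * (Λ.β + 1) + (fillMatrixTime E m + fillMatrixTime 0 m + 6) : ℕ))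
        := by
      have e3 : (Expr.var Var.δ).time = 1 := rfl
      rw [e3]; push_cast; ring
    rw [e, squareTime]
    refine add_le_add le_rfl (add_le_add le_rfl (Nat.cast_le.2 (Nat.add_le_add_left ?_ _)))
    have e1 : E.time ≤ 30 := by decide
    have e2 : (0 : Expr).time ≤ 1 := by decide
    have e1' : fillMatrixTime E m ≤ 70 * (m * m + 1) := Nat.mul_le_mul_right _ (by omega)
    have e2' : fillMatrixTime 0 m ≤ 50 * (m * m + 1) := Nat.mul_le_mul_right _ (by omega)
    rw [← hm]
    omega
  refine ARuns.seq (ARuns.fillMatrix (Λ := Λ) (fun _ _ => 0) hs.consts (by omega) (by omega)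
    (by simp; omega) hXm (fun s' p _ _ _ _ _ => ⟨rfl, by omega⟩) ?_)
  intro s₁ hreg₁ hmem₁ hT₁
  have hr₁ : Ready Γ Λ D (c + Λ.β) s₁ := by
    refine hs.congr le_rfl (fun v hv => hreg₁ v (by simp only [Var.p]; omega)) (fun a ha => ?_)
      (fun i hi j hj => ?_)
    · exact hmem₁ a (Or.inr (by omega))
    · rw [← hs.D i hi j hj]
      have : i * m + j < m * m := index_lt hi hj
      exact hmem₁ (1 * (m * m) + (i * m + j)) (Or.inl (by rw [← hm]; omega))
  have evδ : (Expr.var Var.δ).eval s₁ = Λ.δ := hr₁.consts.δ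
  refine ARuns.seq (ARuns.assign (by simp; omega) (by rw [evδ]; exact hδX) ?_)
  rw [evδ]
  refine ARuns.seq (ARuns.bits hA (hr₁.setReg (by decide) _) hD hδX hβ (by simp) ?_ ?_)
  · exact fun i hi j hj => ⟨hT₁ i hi j hj, hv i hi j hj⟩
  intro s₂ hr₂ hround hT₂
  refine ARuns.fillMatrix (Λ := Λ) (minPlusSq m D) hr₂.consts (by omega) (by omega)
    (le_trans (by decide) hS) hXm ?_ ?_
  · intro s' p hc' hp hpv hreg' hmem'
    replace hp : p < m * m := hp
    have hdm : p / m * m + p % m = p := Nat.div_add_mod' p m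
    have hp1 : p / m < m := Nat.div_lt_of_lt_mul hp
    have hp2 : p % m < m := Nat.mod_lt _ hm0
    refine ⟨?_, (hv _ hp1 _ hp2).trans hδX⟩
    simp only [Expr.eval_load, Expr.eval_add, Expr.eval_mul, Expr.eval_ofNat, Expr.eval_var,
      hc'.mm, hpv]
    rw [hmem' _ (Or.inr (by omega)), ← hm, ← hT₂ _ hp1 _ hp2, Env.mat, hdm]
  · intro s₃ hreg₃ hmem₃ hD₃
    refine h s₃ (hr₂.congr le_rfl (fun v hv => hreg₃ v (by simp only [Var.p]; omega))
      (fun a ha => hmem₃ a (Or.inr (by omega))) hD₃) ?_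
    rw [hreg₃ _ (by decide), hround, Env.setReg_reg, if_neg (by decide), hreg₁ _ (by decide)]

def roundsProg (R₀ : ℕ) (A : DynAlg) (mode : Mode) (kind : Kind) : Prog :=
  forLoop R₀ Var.round (4 * .var Var.e) (squareProg R₀ A mode kind)

/-- The counter in `Ready` is a supply of fresh memory, measured in comparisons; each squaring
consumes `β` of them. Entries stay at most `B < δ` in all rounds, which leaves room for the strict
inequality that the binary search needs at its start. -/
theorem ARuns.rounds {A : DynAlg} {mode : Mode} {kind : Kind} {τ : ℝ≥0∞} {s : Env} {T : ℝ≥0∞}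
    {R : Env → ℝ≥0∞ → Prop} (hA : Subroutine Γ Λ A mode kind τ) {n B ρ : ℕ} {W : Fin n → Fin n → ℕ}
    (hs : Ready Γ Λ (distMatrix Λ.m W B 0) (ρ * Λ.β) s) (hρ : 4 * Λ.e = ρ) (hW : ∀ i j, W i j ≤ B) (hB : B < Λ.δ)
    (hδX : Λ.δ < Γ.X) (heX : ρ < Γ.X) (hβ : Λ.δ = 2 ^ Λ.β)
    (h : ∀ s' : Env, Ready Γ Λ (distMatrix Λ.m W B ρ) 0 s' → R s' T) :
    Γ.ARuns (roundsProg Γ.R₀ A mode kind) s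
      (T + ρ * squareTime (12 * τ + blockTime Γ.R₀ mode kind Λ.N) Λ
        + (25 * (ρ + 1) : ℕ)) R := by
  have hS := hA.size_le
  set κ := squareTime (12 * τ + blockTime Γ.R₀ mode kind Λ.N) Λ with hκ
  have hfor : forTime (4 * .var Var.e) = 25 := rfl
  suffices hgoal : Γ.ARuns (Machine.forLoop Γ.R₀ Var.round (4 * .var Var.e)
      (squareProg Γ.R₀ A mode kind)) s (T + ρ * κ + (forTime (4 * .var Var.e) * (ρ + 1) : ℕ)) R by
    rw [hfor] at hgoal
    exact hgoal
  clear hfor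
  refine ARuns.forLoop (fun r s' x => r ≤ ρ ∧ s'.reg Var.round = r ∧
    Ready Γ Λ (distMatrix Λ.m W B r) ((ρ - r) * Λ.β) s' ∧ x = T + (ρ - r : ℕ) * κ)
    (by simp; omega) heX (fun j s' x h1 => h1.2.1) ?_ ?_ ?_ ?_
  · rintro j s' x ⟨-, -, h1, -⟩
    simp [h1.consts.e, hρ]
  · exact ⟨by omega, by simp, hs.setReg (by decide) _, by simp⟩
  · rintro r hr s' x _ ⟨-, h1, h2, rfl⟩
    obtain ⟨d, hd⟩ : ∃ d, ρ - r = d + 1 := ⟨ρ - r - 1, by omega⟩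
    have hd' : ρ - (r + 1) = d := by omega
    rw [hd, Nat.succ_mul] at h2
    have hx : T + ((ρ - r : ℕ) : ℝ≥0∞) * κ = (T + d * κ) + κ := by
      rw [hd]; push_cast; ring
    rw [hx]
    refine ARuns.square hA h2 (fun i hi j _ => (distMatrix_le hW r hi j).trans hB.le) hδX hβ
      (fun i hi j _ => (distMatrix_le hW (r + 1) hi j).trans_lt hB) fun s₁ g1 g2 => ?_
    refine ⟨by rw [g2, h1], by omega, by simp, ?_, ?_⟩
    · rw [hd']; exact g1.setReg (by decide) _
    · rw [hd']
  · rintro s' x _ ⟨-, h1, h2, rfl⟩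
    rw [Nat.sub_self] at *
    rw [Nat.cast_zero, zero_mul, add_zero]
    rw [zero_mul] at h2
    exact h s' h2

/-! ## Input and output -/

open WordRAM.Expr (lt eq cell)

/-- An entry of the initial matrix. -/
def initEntry : Expr :=
  .cases (eq (.var Var.p / .var Var.m) (.var Var.p % .var Var.m)) 0
    (.cases (lt (.var Var.p / .var Var.m) (.var Var.n) * lt (.var Var.p % .var Var.m) (.var Var.n))
      (.cases (eq (.load (.var Var.p / .var Var.m * .var Var.n + .var Var.p % .var Var.m)) 0)
        (.var Var.δ / 2) (.load (.var Var.p / .var Var.m * .var Var.n + .var Var.p % .var Var.m)))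
      (.var Var.δ / 2))

theorem matrixMem_index {n : ℕ} (W : Fin n → Fin n → ℕ) {i j : ℕ} (hi : i < n) (hj : j < n) :
    matrixMem W (i * n + j) = W ⟨i, hi⟩ ⟨j, hj⟩ := by
  have hn : 0 < n := by omega
  unfold matrixMem
  rw [dif_pos (index_lt hi hj)]
  congr 1
  · ext
    simp [add_comm (i * n), Nat.add_mul_div_right _ _ hn, Nat.div_eq_of_lt hj]
  · ext
    simp [add_comm (i * n), Nat.mod_eq_of_lt hj]

/-- The input has rows of length `n` in the first slab and the padded matrix has rows of length `m`
in the second, so nothing is overwritten before it is read. The placeholder for a missing edge is `δ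
/ 2`. -/
theorem ARuns.initMatrix {s : Env} {W : Fin Λ.n → Fin Λ.n → ℕ} {T : ℝ≥0∞} {R : Env → ℝ≥0∞ → Prop}
    (hc : Consts Λ s) (hS : 3000 ≤ Γ.S) (hX : Λ.m * Λ.m < Γ.X) (hn : Λ.n ≤ Λ.m)
    (hmem : s.mem = matrixMem W) (hδX : Λ.δ < Γ.X) (hW : ∀ i j, W i j ≤ Λ.δ)
    (h : ∀ s' : Env, (∀ v ≠ Var.p, s'.reg v = s.reg v) →
      (∀ a, 2 * (Λ.m * Λ.m) ≤ a → s'.mem a = 0) →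
      (∀ i < Λ.m, ∀ j < Λ.m, s'.mat Λ.m 1 i j = initMatrix W (Λ.δ / 2) i j) → R s' T) :
    Γ.ARuns (Machine.fillMatrix Γ.R₀ (.const 1) initEntry) s (T + (400 * (Λ.m * Λ.m + 1) : ℕ)) R := by
  have hle : fillMatrixTime initEntry Λ.m ≤ 400 * (Λ.m * Λ.m + 1) :=
    Nat.mul_le_mul_right _ (by decide)
  have hnm : Λ.n * Λ.n ≤ Λ.m * Λ.m := Nat.mul_le_mul hn hn
  refine ARuns.mono ?_ (add_le_add le_rfl (Nat.cast_le.2 hle))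
  refine ARuns.fillMatrix (Λ := Λ) (WordRAM.initMatrix W (Λ.δ / 2)) hc (by omega) (by omega)
    (le_trans (by decide) hS) hX ?_ ?_
  · intro s' p hc' hp hpv _ hmem'
    have hm0 := Λ.m_pos
    set i := p / Λ.m with hi
    set j := p % Λ.m with hj
    have hi' : (Expr.var Var.p / .var Var.m).eval s' = i := by simp [hpv, hc'.m, hi]
    have hj' : (Expr.var Var.p % .var Var.m).eval s' = j := by simp [hpv, hc'.m, hj]
    have hload : i < Λ.n ∧ j < Λ.n →
        (Expr.load (.var Var.p / .var Var.m * .var Var.n + .var Var.p % .var Var.m)).eval s'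
          = matrixMem W (i * Λ.n + j) := by
      intro hij
      have := index_lt hij.1 hij.2
      rw [Expr.eval_load, Expr.eval_add, Expr.eval_mul, hi', hj', Expr.eval_var, hc'.n,
        hmem' _ (Or.inl (by omega)), hmem]
    refine ⟨?_, ?_⟩
    · unfold initEntry WordRAM.initMatrix
      rw [Expr.eval_cases (P := i = j), Expr.eval_cases (P := i < Λ.n ∧ j < Λ.n)]
      · split_ifs with h1 h2 h3
        · rfl
        · rw [Expr.eval_cases (P := True), if_pos trivial]
          · simp [hc'.δ]
          · rw [Expr.eval_eq, hload h2, matrixMem_index W h2.1 h2.2, h3]; simp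
        · rw [Expr.eval_cases (P := False), if_neg not_false, hload h2,
            matrixMem_index W h2.1 h2.2]
          rw [Expr.eval_eq, hload h2, matrixMem_index W h2.1 h2.2]; simp [h3]
        · simp [hc'.δ]
      · rw [Expr.eval_mul, Expr.eval_lt, Expr.eval_lt, hi', hj', Expr.eval_var, hc'.n,
          Expr.ite_mul_ite]
      · rw [Expr.eval_eq, hi', hj']
    · unfold WordRAM.initMatrix
      split_ifs with h1 h2 h3
      · omega
      · omega
      · exact (hW _ _).trans_lt hδX
      · omega
  · intro s' h1 h2 h3
    refine h s' h1 (fun a ha => ?_) h3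
    rw [h2 a (Or.inr (by omega)), hmem, matrixMem, dif_neg (by omega)]

/-- Write the result to the memory from the address `0` on. -/
def outputProg (R₀ : ℕ) : Prog :=
  fill R₀ 0 (.var Var.n * .var Var.n)
    ((cell 1 (.var Var.p / .var Var.n) (.var Var.p % .var Var.n) + 1) *
      lt (cell 1 (.var Var.p / .var Var.n) (.var Var.p % .var Var.n)) (.var Var.δ / 2))

theorem ARuns.output {s : Env} {D : ℕ → ℕ → ℕ} {T : ℝ≥0∞} {R : Env → ℝ≥0∞ → Prop} {c : ℕ}
    (hs : Ready Γ Λ D c s) (hS : 3000 ≤ Γ.S) (hn : Λ.n ≤ Λ.m) (hδX : Λ.δ < Γ.X)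
    (h : ∀ s' : Env, (∀ i < Λ.n, ∀ j < Λ.n, s'.mem (i * Λ.n + j)
      = if D i j < Λ.δ / 2 then D i j + 1 else 0) → R s' T) :
    Γ.ARuns (outputProg Γ.R₀) s (T + (300 * (Λ.m * Λ.m + 1) : ℕ)) R := by
  have hX := hs.lt
  have hc := hs.consts
  set E : Expr := (cell 1 (.var Var.p / .var Var.n) (.var Var.p % .var Var.n) + 1) *
      lt (cell 1 (.var Var.p / .var Var.n) (.var Var.p % .var Var.n)) (.var Var.δ / 2) with hE
  have hnm : Λ.n * Λ.n ≤ Λ.m * Λ.m := Nat.mul_le_mul hn hn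
  have hle : fillTime 0 (.var Var.n * .var Var.n) E * (Λ.n * Λ.n + 1) ≤ 300 * (Λ.m * Λ.m + 1) :=
    Nat.mul_le_mul (by decide) (by omega)
  refine ARuns.mono ?_ (add_le_add le_rfl (Nat.cast_le.2 hle))
  refine ARuns.fill (b := 0) (B := Λ.n * Λ.n)
    (fun p => if D (p / Λ.n) (p % Λ.n) < Λ.δ / 2 then D (p / Λ.n) (p % Λ.n) + 1 else 0)
    ⟨by simp; omega, by simp; omega, le_trans (by decide) hS⟩ (by omega) ?_ ?_ ?_
  · intro s' hr
    have : s'.reg Var.n = Λ.n := by rw [hr _ (by decide), hc.n]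
    simp [this]
  · intro p hp
    have hn0 : 0 < Λ.n := Nat.pos_of_ne_zero fun h0 => by simp [h0] at hp
    have hp1 : p / Λ.n < Λ.n := Nat.div_lt_of_lt_mul hp
    have hp2 : p % Λ.n < Λ.n := Nat.mod_lt _ hn0
    refine ⟨?_, by split_ifs <;> omega⟩
    set s' : Env := ⟨Function.update s.reg Var.p p, fillMem s.mem 0 p (fun p =>
      if D (p / Λ.n) (p % Λ.n) < Λ.δ / 2 then D (p / Λ.n) (p % Λ.n) + 1 else 0), s.low⟩ with hs'
    have hc' : Consts Λ s' := hc.congr fun v hv =>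
      Function.update_of_ne (by simp only [Var.p]; omega) _ _
    have hpv : s'.reg Var.p = p := by simp [hs']
    have hmat : s'.mat Λ.m 1 (p / Λ.n) (p % Λ.n) = D (p / Λ.n) (p % Λ.n) := by
      rw [← hs.D _ (by omega) _ (by omega)]
      have hle : 0 + p ≤ 1 * (Λ.m * Λ.m) + (p / Λ.n * Λ.m + p % Λ.n) := by omega
      unfold Env.mat
      rw [hs']
      dsimp only
      exact fillMem_of_le hle
    simp only [Expr.eval_mul, Expr.eval_add, Expr.eval_lt, Expr.eval_cell hc', Expr.eval_div,
      Expr.eval_mod, Expr.eval_var, hpv, hc'.n, hc'.δ, Expr.eval_ofNat, hmat]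
    split_ifs <;> simp
  · refine h _ fun i hi j hj => ?_
    have := fillMem_add (mem := s.mem) (b := 0) (val := fun p =>
      if D (p / Λ.n) (p % Λ.n) < Λ.δ / 2 then D (p / Λ.n) (p % Λ.n) + 1 else 0) (index_lt hi hj)
    rw [zero_add] at this
    refine this.trans ?_
    have hn0 : 0 < Λ.n := by omega
    have e1 : (i * Λ.n + j) / Λ.n = i := by
      rw [add_comm, Nat.add_mul_div_right _ _ hn0, Nat.div_eq_of_lt hj, zero_add]
    have e2 : (i * Λ.n + j) % Λ.n = j := by
      rw [add_comm, Nat.add_mul_mod_self_right, Nat.mod_eq_of_lt hj]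
    simp only [e1, e2]

end Machine

/-- The logarithm of the size of the instances exceeds that of `N` by this number minus one. -/
def Kind.shift : Kind → ℕ
  | .path => 3
  | .matching => 4

namespace Machine

/-! ## The parameters -/

/-- The exponent of the memory of the dynamic algorithm. -/
def memExp (c C : ℕ) : ℕ := 4 * C + 4 * (c + 1) + 20

/-- The exponent of the memory of the main program. -/
def mainExp (c C : ℕ) : ℕ := memExp c C + 4 * (c + 1) + 30

/-- A bound for the size of expressions. -/
def exprSize (c C : ℕ) : ℕ := 2 ^ memExp c C + 4000

/-- The parameters for graphs with `n` vertices and weights up to `n ^ c`, if the word length of the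
dynamic algorithm has the factor `C`. -/
def params (c C : ℕ) (kind : Kind) (n : ℕ) : Params where
  n := n
  e := Nat.clog 16 n
  N := 2 ^ Nat.clog 16 n
  m := (2 ^ Nat.clog 16 n) ^ 4
  δ := 2 ^ (4 * (c + 1) * Nat.clog 16 n + 2)
  β := 4 * (c + 1) * Nat.clog 16 n + 2
  stride := 2 ^ (memExp c C * (Nat.clog 16 n + 1))
  lim := 2 ^ (C * (Nat.clog 16 n + kind.shift)) - 1
  N_pos := Nat.two_pow_pos _
  m_eq := rfl

/-- The parameters are powers of two with exponents linear in `Nat.clog 16 n + 1`, and word lengths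
are multiples of `Nat.log 2 n + 1`; this translates the former into the latter. -/
theorem clog_succ_le (n : ℕ) : Nat.clog 16 n + 1 ≤ 2 * (Nat.log 2 n + 1) := by
  have : Nat.clog 16 n ≤ Nat.log 2 n + 1 := by
    refine Nat.clog_le_of_le_pow ?_
    refine (Nat.lt_pow_succ_log_self one_lt_two n).le.trans ?_
    exact Nat.pow_le_pow_left (by norm_num) _
  omega

/-- The machine that runs the main program. -/
def machine (c C R : ℕ) (hR : 3 ≤ R) (n : ℕ) : Machine where
  w := wordLength (2 * mainExp c C * exprSize c C) n
  R₀ := R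
  X := 2 ^ (mainExp c C * (Nat.clog 16 n + 1))
  S := exprSize c C
  two_le := by
    refine Nat.le_self_pow ?_ 2
    have : 0 < mainExp c C := by unfold mainExp; omega
    positivity
  three_le := hR
  pow_le := by
    rw [← pow_mul]
    refine Nat.pow_le_pow_right two_pos ?_
    unfold wordLength
    calc mainExp c C * (Nat.clog 16 n + 1) * exprSize c C
        ≤ mainExp c C * (2 * (Nat.log 2 n + 1)) * exprSize c C :=
          Nat.mul_le_mul_right _ (Nat.mul_le_mul_left _ (clog_succ_le n))
      _ = 2 * mainExp c C * exprSize c C * (Nat.log 2 n + 1) := by ring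

section bounds

variable {c C R : ℕ} {hR : 3 ≤ R} {n : ℕ} {kind : Kind}

theorem n_le_pow (n : ℕ) : n ≤ (2 ^ Nat.clog 16 n) ^ 4 := by
  rw [← pow_mul, mul_comm, pow_mul]
  exact Nat.le_pow_clog (by norm_num) n

theorem pow_lt_X {k : ℕ} (h : k < mainExp c C * (Nat.clog 16 n + 1)) :
    2 ^ k < (machine c C R hR n).X := Nat.pow_lt_pow_right one_lt_two h

/-- There are `4 * e` squarings with `β` comparisons of `N ^ 9` calls, and every call uses up
`stride` fresh cells. This is still polynomial in `n`, so addresses remain words of `O(log n)` bits.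
-/
theorem room (Λ : Params) (hΛ : Λ = params c C kind n) :
    5 * (Λ.m * Λ.m) + 4 * Λ.e * Λ.β * (Λ.N ^ 9 * Λ.stride) < (machine c C R hR n).X := by
  subst hΛ
  set E := Nat.clog 16 n with hE
  have h1 : 5 * ((params c C kind n).m * (params c C kind n).m) ≤ 2 ^ (8 * E + 3) := by
    have : (params c C kind n).m * (params c C kind n).m = 2 ^ (8 * E) := by
      change (2 ^ E) ^ 4 * (2 ^ E) ^ 4 = _
      rw [← pow_mul, ← pow_add]; congr 1; ring
    rw [this, pow_add]
    omega
  have h2 : 4 * (params c C kind n).e * (params c C kind n).β *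
      ((params c C kind n).N ^ 9 * (params c C kind n).stride)
      ≤ 2 ^ ((E + 2) + (4 * (c + 1) * E + 2) + (E * 9 + memExp c C * (E + 1))) := by
    rw [pow_add, pow_add _ (E + 2)]
    refine Nat.mul_le_mul (Nat.mul_le_mul ?_ ?_) (le_of_eq ?_)
    · change 4 * E ≤ _
      have : E < 2 ^ E := Nat.lt_two_pow_self
      rw [pow_add]
      omega
    · exact Nat.lt_two_pow_self.le
    · change (2 ^ E) ^ 9 * 2 ^ (memExp c C * (E + 1)) = _
      rw [pow_add, ← pow_mul]
  have h3 : 2 ^ (8 * E + 3) ≤ 2 ^ (mainExp c C * (E + 1) - 1) := by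
    refine Nat.pow_le_pow_right two_pos ?_
    unfold mainExp memExp
    refine Nat.le_sub_one_of_lt ?_
    nlinarith [Nat.zero_le E, Nat.zero_le (C * E), Nat.zero_le (c * E)]
  have h4 : (E + 2) + (4 * (c + 1) * E + 2) + (E * 9 + memExp c C * (E + 1)) + 1
      < mainExp c C * (E + 1) := by
    unfold mainExp
    generalize memExp c C = k
    nlinarith [Nat.zero_le E, Nat.zero_le (c * E)]
  have h5 : 2 ^ ((E + 2) + (4 * (c + 1) * E + 2) + (E * 9 + memExp c C * (E + 1)))
      < 2 ^ (mainExp c C * (E + 1) - 1) := Nat.pow_lt_pow_right one_lt_two (by omega)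
  have h6 : (machine c C R hR n).X = 2 * 2 ^ (mainExp c C * (E + 1) - 1) := by
    change 2 ^ (mainExp c C * (E + 1)) = _
    rw [← pow_succ']
    congr 1
  omega

end bounds

/-! ## Computation of the parameters -/

open WordRAM.Expr (lt)

def quartic : Expr := .var Var.N * .var Var.N * .var Var.N * .var Var.N

/-- Double `N` while it is too small. -/
def doubling (R₀ : ℕ) : Prog := forLoop R₀ Var.p (.var Var.n) (assigns R₀
  [(Var.e, .var Var.e + lt quartic (.var Var.n)), (Var.N, .var Var.N + .var Var.N * lt quartic (.var Var.n))])

/-- The remaining variables. -/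
def derived (c : ℕ) : List (ℕ × Expr) :=
  [(Var.m, quartic), (Var.mm, .var Var.m * .var Var.m), (Var.lim, .var Var.lim - 1),
    (Var.β, .const (4 * (c + 1)) * .var Var.e + 2), (Var.ans, 4 * .var Var.mm),
    (Var.base, 5 * .var Var.mm)]

def setupProg (R₀ c C : ℕ) (kind : Kind) : Prog :=
  .seq (assigns R₀ [(Var.n, .reg0), (Var.N, 1), (Var.e, 0)]) (.seq (doubling R₀)
    (.seq (power R₀ Var.δ 4 (2 ^ (4 * (c + 1))))
      (.seq (power R₀ Var.stride (2 ^ memExp c C) (2 ^ memExp c C))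
        (.seq (power R₀ Var.lim (2 ^ (C * kind.shift)) (2 ^ C)) (assigns R₀ (derived c))))))

variable {Γ : Machine}

/-- The test `N ^ 4 < n` reads `16 ^ k < n` when `N = 2 ^ k`, so the value stops changing at
`Nat.clog 16 n`. The loop goes on idly for `n` rounds in all; linear time is harmless here. -/
theorem ARuns.doubling {s : Env} {n : ℕ} {T : ℝ≥0∞} {R : Env → ℝ≥0∞ → Prop} (hS : 100 ≤ Γ.S)
    (hn : s.reg Var.n = n) (hN : s.reg Var.N = 1) (he : s.reg Var.e = 0)
    (hX : 2 ^ Nat.clog 16 n < Γ.X)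
    (h : ∀ s' : Env, s'.reg Var.n = n → s'.reg Var.e = Nat.clog 16 n →
      s'.reg Var.N = 2 ^ Nat.clog 16 n → s'.mem = s.mem → R s' T) :
    Γ.ARuns (doubling Γ.R₀) s (T + (200 * (n + 1) : ℕ)) R := by
  refine ARuns.of_below fun hb => ?_
  have hEn : Nat.clog 16 n ≤ n :=
    Nat.clog_le_of_le_pow (Nat.lt_pow_self (by norm_num)).le
  set l : List (ℕ × Expr) := [(Var.e, .var Var.e + lt quartic (.var Var.n)),
    (Var.N, .var Var.N + .var Var.N * lt quartic (.var Var.n))] with hl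
  have htl : assignsTime l ≤ 100 := by decide
  have hf : forTime (.var Var.n) ≤ 30 := by decide
  refine ARuns.mono (T := T + (assignsTime l * n : ℕ) + (forTime (.var Var.n) * (n + 1) : ℕ)) ?_ ?_
  swap
  · rw [add_assoc, ← Nat.cast_add]
    refine add_le_add le_rfl (Nat.cast_le.2 ?_)
    nlinarith
  refine ARuns.forLoop (B := n) (fun j s' x => j ≤ n ∧ s'.reg Var.p = j ∧ s'.reg Var.n = n ∧
    s'.reg Var.e = min j (Nat.clog 16 n) ∧ s'.reg Var.N = 2 ^ (min j (Nat.clog 16 n)) ∧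
    s'.mem = s.mem ∧ x = T + (assignsTime l * (n - j) : ℕ)) (by simp; omega) (hn ▸ hb.1 _)
    (fun j s' x h1 => h1.2.1) (fun j s' x h1 => h1.2.2.1) ?_ ?_ ?_
  · exact ⟨by omega, by simp, by simp [Env.setReg_reg, hn], by simp [Env.setReg_reg, he],
      by simp [Env.setReg_reg, hN], rfl, by simp⟩
  · rintro j hj s' x _ ⟨-, h1, h2, h3, h4, h5, rfl⟩
    set k := min j (Nat.clog 16 n) with hk
    have hx : T + ((assignsTime l * (n - j) : ℕ) : ℝ≥0∞)
        = T + (assignsTime l * (n - (j + 1)) : ℕ) + (assignsTime l : ℕ) := by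
      obtain ⟨d, hd⟩ : ∃ d, n - j = d + 1 := ⟨n - j - 1, by omega⟩
      have hd' : n - (j + 1) = d := by omega
      rw [hd, hd']; push_cast; ring
    rw [hx]
    have hq : ∀ s₁ : Env, s₁.reg Var.N = 2 ^ k → s₁.reg Var.n = n →
        (lt quartic (.var Var.n)).eval s₁ = if k < Nat.clog 16 n then 1 else 0 := by
      intro s₁ g1 g2
      have e1 : quartic.eval s₁ = 16 ^ k := by
        simp only [quartic, Expr.eval_mul, Expr.eval_var, g1]
        rw [show (16 : ℕ) = 2 ^ 4 by norm_num, ← pow_mul, ← pow_add, ← pow_add, ← pow_add]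
        congr 1; ring
      rw [Expr.eval_lt, e1, Expr.eval_var, g2]
      have : 16 ^ k < n ↔ k < Nat.clog 16 n := (Nat.lt_clog_iff_pow_lt (by norm_num)).symm
      simp only [this]
    have hstep : min (j + 1) (Nat.clog 16 n) = k + if k < Nat.clog 16 n then 1 else 0 := by
      split_ifs <;> omega
    have hpow : 2 ^ (min (j + 1) (Nat.clog 16 n))
        = 2 ^ k + 2 ^ k * if k < Nat.clog 16 n then 1 else 0 := by
      rw [hstep]
      split_ifs
      · rw [pow_succ]; ring
      · simp
    have ev1 : (Expr.var Var.e + lt quartic (.var Var.n)).eval s' = min (j + 1) (Nat.clog 16 n) := by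
      rw [Expr.eval_add, hq s' h4 h2, Expr.eval_var, h3, hstep]
    have ev2 : (Expr.var Var.N + .var Var.N * lt quartic (.var Var.n)).eval
        (s'.setReg Var.e (min (j + 1) (Nat.clog 16 n))) = 2 ^ (min (j + 1) (Nat.clog 16 n)) := by
      rw [Expr.eval_add, Expr.eval_mul, hq, Expr.eval_var, hpow] <;>
        simp [Env.setReg_reg, h4, h2]
    have hle : 2 ^ (min (j + 1) (Nat.clog 16 n)) < Γ.X :=
      lt_of_le_of_lt (Nat.pow_le_pow_right two_pos (min_le_right _ _)) hX
    refine ARuns.assigns ⟨?_, ?_, ?_, ?_, trivial⟩ ?_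
    · exact le_trans (by decide) hS
    · rw [ev1]; exact lt_trans Nat.lt_two_pow_self hle
    · exact le_trans (by decide) hS
    · rw [ev1, ev2]; exact hle
    · simp only [afterAssigns, l, ev1, ev2]
      refine ⟨?_, by omega, by simp, ?_, ?_, ?_, h5, trivial⟩
      · simp [Env.setReg_reg, h1]
      · simp [Env.setReg_reg, h2]
      · simp [Env.setReg_reg]
      · simp [Env.setReg_reg]
  · rintro s' x _ ⟨-, h1, h2, h3, h4, h5, rfl⟩
    rw [min_eq_right hEn] at h3 h4
    simpa using h s' h2 h3 h4 h5

end Machine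

/-! ### Correctness of the setup and of the complete program -/

namespace Machine

variable {c C R : ℕ} {hR : 3 ≤ R} {n : ℕ} {kind : Kind}

/-- `Γ` and `Λ` are the machine and the parameters for graphs with `n` vertices, and `E` is the
logarithm of `N`. -/
structure Fits (c C : ℕ) (kind : Kind) (n E : ℕ) (Γ : Machine) (Λ : Params) : Prop where
  S_eq : Γ.S = 2 ^ memExp c C + 4000
  lt_X : ∀ k, k < mainExp c C * (E + 1) → 2 ^ k < Γ.X
  E_eq : Nat.clog 16 n = E
  n_eq : Λ.n = n
  e_eq : Λ.e = E
  N_eq : Λ.N = 2 ^ E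
  δ_eq : Λ.δ = 2 ^ (4 * (c + 1) * E + 2)
  β_eq : Λ.β = 4 * (c + 1) * E + 2
  stride_eq : Λ.stride = 2 ^ (memExp c C * (E + 1))
  lim_eq : Λ.lim = 2 ^ (C * (E + kind.shift)) - 1
  room : 5 * (Λ.m * Λ.m) + 4 * Λ.e * Λ.β * (Λ.N ^ 9 * Λ.stride) < Γ.X

theorem fits : Fits c C kind n (Nat.clog 16 n) (machine c C R hR n) (params c C kind n) :=
  ⟨rfl, fun _ => pow_lt_X, rfl, rfl, rfl, rfl, rfl, rfl, rfl, rfl, room _ rfl⟩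

variable {Γ : Machine} {Λ : Params} {E : ℕ}

theorem Fits.le_m (hF : Fits c C kind n E Γ Λ) : n ≤ Λ.m := by
  rw [Λ.m_eq, hF.N_eq, ← hF.E_eq]
  exact n_le_pow n

theorem Fits.δ_lt (hF : Fits c C kind n E Γ Λ) : Λ.δ < Γ.X := by
  rw [hF.δ_eq]
  refine hF.lt_X _ ?_
  unfold mainExp memExp
  nlinarith [Nat.zero_le E, Nat.zero_le (C * E)]

theorem ARuns.derived {s : Env} {T : ℝ≥0∞} {Q : Env → ℝ≥0∞ → Prop} (hF : Fits c C kind n E Γ Λ)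
    (hn : s.reg Var.n = n) (hN : s.reg Var.N = 2 ^ E) (he : s.reg Var.e = E)
    (hδ : s.reg Var.δ = 4 * (2 ^ (4 * (c + 1))) ^ E)
    (hstr : s.reg Var.stride = 2 ^ memExp c C * (2 ^ memExp c C) ^ E)
    (hlim : s.reg Var.lim = 2 ^ (C * kind.shift) * (2 ^ C) ^ E)
    (h : ∀ s' : Env, Consts Λ s' → s'.reg Var.base = 5 * (Λ.m * Λ.m) → s'.mem = s.mem → Q s' T) :
    Γ.ARuns (Machine.assigns Γ.R₀ (Machine.derived c)) s (T + assignsTime (Machine.derived c)) Q := by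
  have hS' := hF.S_eq
  have hpow := Nat.lt_two_pow_self (n := memExp c C)
  have hroom := hF.room
  have hm : Λ.m = (2 ^ E) ^ 4 := by rw [Λ.m_eq, hF.N_eq]
  have hmm' := Λ.m_le
  generalize hmdef : Λ.m = m at *
  refine ARuns.of_below fun hb => ?_
  have hq : quartic.eval s = m := by
    simp only [quartic, Expr.eval_mul, Expr.eval_var, hN, hm]; ring
  have hβX : 4 * (c + 1) * E + 2 < Γ.X :=
    Nat.lt_two_pow_self.trans (hF.δ_eq ▸ hF.δ_lt)
  have hafter : ∀ s', s' = afterAssigns s (Machine.derived c) → s'.mem = s.mem ∧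
      s'.reg Var.m = m ∧ s'.reg Var.mm = m * m ∧
      s'.reg Var.lim = s.reg Var.lim - 1 ∧ s'.reg Var.β = 4 * (c + 1) * E + 2 ∧
      s'.reg Var.ans = 4 * (m * m) ∧ s'.reg Var.base = 5 * (m * m) ∧
      (∀ v, v = Var.n ∨ v = Var.N ∨ v = Var.e ∨ v = Var.δ ∨ v = Var.stride → s'.reg v = s.reg v) := by
    rintro s' rfl
    simp only [Machine.derived, afterAssigns, hq]
    refine ⟨rfl, ?_, ?_, ?_, ?_, ?_, ?_, ?_⟩
    all_goals simp [Env.setReg_reg, he]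
  refine ARuns.assigns ⟨le_trans (by decide) (show 4000 ≤ Γ.S by omega), by rw [hq]; omega,
    by simp; omega, ?_, by simp; omega, ?_, ?_, ?_, by simp; omega, ?_, by simp; omega, ?_, trivial⟩ ?_
  · simp [hq]; omega
  · have := hb.1 Var.lim
    simp [Env.setReg_reg]; omega
  · simp only [Expr.size_add, Expr.size_mul, Expr.size_const, Expr.size_var, Expr.size_ofNat]
    have : 4 * (c + 1) ≤ memExp c C := by unfold memExp; omega
    omega
  · simp [Env.setReg_reg, he]; omega
  · simp [Env.setReg_reg, hq]; omega
  · simp [Env.setReg_reg, hq]; omega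
  obtain ⟨a1, a2, a3, a4, a5, a6, a7, a8⟩ := hafter _ rfl
  refine h _ ⟨?_, ?_, ?_, ?_, ?_, ?_, ?_, ?_, ?_, ?_⟩ a7 ?_
  · rw [a8 _ (by decide), hn, hF.n_eq]
  · rw [a8 _ (by decide), hN, hF.N_eq]
  · rw [a8 _ (by decide), he, hF.e_eq]
  · rw [a2, hmdef]
  · rw [a3, hmdef]
  · rw [a8 _ (by decide), hδ, hF.δ_eq, ← pow_mul, show (4 : ℕ) = 2 ^ 2 by norm_num, ← pow_add,
      add_comm]
  · rw [a5, hF.β_eq]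
  · rw [a8 _ (by decide), hstr, hF.stride_eq, ← pow_succ', ← pow_mul]
  · rw [a4, hlim, hF.lim_eq, ← pow_mul, ← pow_add, ← mul_add, add_comm]
  · rw [a6, hmdef]
  · exact a1

theorem add_mul_lt_mainExp {a b j : ℕ} (ha : a ≤ memExp c C) (hb : b ≤ memExp c C) (hj : j ≤ E) :
    a + b * j < mainExp c C * (E + 1) := by
  have h1 := Nat.mul_le_mul hb hj
  have h2 : (memExp c C + 30) * (E + 1) ≤ mainExp c C * (E + 1) :=
    Nat.mul_le_mul_right _ (by unfold mainExp; omega)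
  rw [add_mul, mul_add] at h2
  omega

theorem ARuns.setup {s : Env} {T : ℝ≥0∞} {Q : Env → ℝ≥0∞ → Prop} (hF : Fits c C kind n E Γ Λ)
    (hn : s.low 0 = n)
    (h : ∀ s' : Env, Consts Λ s' → s'.reg Var.base = 5 * (Λ.m * Λ.m) → s'.mem = s.mem → Q s' T) :
    Γ.ARuns (setupProg Γ.R₀ c C kind) s (T + (1000 * (Λ.m * Λ.m + 1) : ℕ)) Q := by
  have hS' := hF.S_eq
  have hS0 := Nat.two_pow_pos (memExp c C)
  have hpow : ∀ k ≤ memExp c C, 2 ^ k ≤ 2 ^ memExp c C := fun k hk => Nat.pow_le_pow_right two_pos hk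
  have hX := hF.lt_X
  have hmain : memExp c C + 30 ≤ mainExp c C := by unfold mainExp; omega
  have hmE : 30 * (E + 1) ≤ mainExp c C * (E + 1) := Nat.mul_le_mul_right _ (by omega)
  have hmem20 : 20 ≤ memExp c C := by unfold memExp; omega
  have hroom := hF.room
  have hm : Λ.m = (2 ^ E) ^ 4 := by rw [Λ.m_eq, hF.N_eq]
  have hnm : n ≤ Λ.m := hF.le_m
  generalize hmdef : Λ.m = m at *
  have hE2 : E < 2 ^ E := Nat.lt_two_pow_self
  have hEm : 2 ^ E ≤ m := by rw [hm]; exact Nat.le_self_pow (by decide) _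
  have hmm' : m ≤ m * m := Nat.le_mul_of_pos_left _ (by omega)
  refine ARuns.of_below fun hb => ?_
  have hnX : n < Γ.X := hn ▸ hb.2.2 0
  set l₀ : List (ℕ × Expr) := [(Var.n, .reg0), (Var.N, 1), (Var.e, 0)] with hl₀
  have ht₀ : assignsTime l₀ = 13 := rfl
  have ht₁ : assignsTime (Machine.derived c) = 61 := rfl
  refine ARuns.mono (T := T + assignsTime (Machine.derived c) + powerTime E + 1 + powerTime E + 1
    + powerTime E + 1 + (200 * (n + 1) : ℕ) + 1 + assignsTime l₀ + 1) ?_ ?_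
  swap
  · have e : T + assignsTime (Machine.derived c) + powerTime E + 1 + powerTime E + 1
        + powerTime E + 1 + (200 * (n + 1) : ℕ) + 1 + assignsTime l₀ + 1
        = T + ((3 * powerTime E + 200 * (n + 1) + 79 : ℕ) : ℝ≥0∞) := by
      rw [ht₀, ht₁]; push_cast; ring
    rw [e]
    refine add_le_add le_rfl (Nat.cast_le.2 ?_)
    rw [powerTime]
    omega
  refine ARuns.seq (ARuns.assigns ⟨by simp; omega, by simpa [hn] using hnX, by simp; omega, ?_,
    by simp; omega, ?_, trivial⟩ ?_)
  · have := Γ.two_le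
    simp; omega
  · have := Γ.two_le
    simp; omega
  simp only [afterAssigns, Expr.eval_reg0, Expr.eval_ofNat, hn]
  refine ARuns.seq (ARuns.doubling (n := n) (by omega) (by simp [Env.setReg_reg])
    (by simp [Env.setReg_reg]) (by simp) (by rw [hF.E_eq]; exact hX _ (by omega)) ?_)
  rw [hF.E_eq]
  intro s₁ hn₁ he₁ hN₁ hmem₁
  refine ARuns.seq (ARuns.power (k := E) (by decide) (by decide) ⟨by omega, ?_⟩ he₁ ?_ ?_)
  · have := hpow (4 * (c + 1)) (by unfold memExp; omega)
    omega
  · intro j hj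
    have h4 : 4 * (2 ^ (4 * (c + 1))) ^ j = 2 ^ (2 + 4 * (c + 1) * j) := by
      rw [pow_add, pow_mul 2 (4 * (c + 1))]; norm_num
    rw [h4]
    exact hX _ (add_mul_lt_mainExp (by omega) (by unfold memExp; omega) hj)
  intro s₂ hδ₂ hreg₂ hmem₂
  refine ARuns.seq (ARuns.power (k := E) (by decide) (by decide) ⟨by omega, by omega⟩
    (by rw [hreg₂ _ (by decide) (by decide), he₁]) ?_ ?_)
  · intro j hj
    rw [← pow_mul, ← pow_add]
    exact hX _ (add_mul_lt_mainExp le_rfl le_rfl hj)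
  intro s₃ hstr₃ hreg₃ hmem₃
  have hshift : kind.shift ≤ 4 := by cases kind <;> decide
  have hCs : C * kind.shift ≤ 4 * C := by rw [mul_comm]; exact Nat.mul_le_mul_right _ hshift
  refine ARuns.seq (ARuns.power (k := E) (by decide) (by decide) ⟨?_, ?_⟩
    (by rw [hreg₃ _ (by decide) (by decide), hreg₂ _ (by decide) (by decide), he₁]) ?_ ?_)
  · have := hpow (C * kind.shift) (by unfold memExp; omega)
    omega
  · have := hpow C (by unfold memExp; omega)
    omega
  · intro j hj
    rw [← pow_mul, ← pow_add]
    exact hX _ (add_mul_lt_mainExp (by unfold memExp; omega) (by unfold memExp; omega) hj)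
  intro s₄ hlim₄ hreg₄ hmem₄
  have hn₄ : s₄.reg Var.n = n := by
    rw [hreg₄ _ (by decide) (by decide), hreg₃ _ (by decide) (by decide),
      hreg₂ _ (by decide) (by decide), hn₁]
  have hN₄ : s₄.reg Var.N = 2 ^ E := by
    rw [hreg₄ _ (by decide) (by decide), hreg₃ _ (by decide) (by decide),
      hreg₂ _ (by decide) (by decide), hN₁]
  have he₄ : s₄.reg Var.e = E := by
    rw [hreg₄ _ (by decide) (by decide), hreg₃ _ (by decide) (by decide),
      hreg₂ _ (by decide) (by decide), he₁]
  have hδ₄ : s₄.reg Var.δ = 4 * (2 ^ (4 * (c + 1))) ^ E := by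
    rw [hreg₄ _ (by decide) (by decide), hreg₃ _ (by decide) (by decide), hδ₂]
  have hstr₄ : s₄.reg Var.stride = 2 ^ memExp c C * (2 ^ memExp c C) ^ E := by
    rw [hreg₄ _ (by decide) (by decide), hstr₃]
  exact ARuns.derived hF hn₄ hN₄ he₄ hδ₄ hstr₄ hlim₄ fun s' h1 h2 h3 => h s' h1 (hmdef ▸ h2) (by
    rw [h3, hmem₄, hmem₃, hmem₂, hmem₁]; rfl)

/-- All pairs shortest paths with the help of a dynamic algorithm. -/
def apspProg (R₀ c C : ℕ) (A : DynAlg) (mode : Mode) (kind : Kind) : Prog :=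
  .seq (setupProg R₀ c C kind) (.seq (fillMatrix R₀ (.const 1) initEntry)
    (.seq (roundsProg R₀ A mode kind) (outputProg R₀)))

noncomputable def apspTime (κ : ℝ≥0∞) (Λ : Params) : ℝ≥0∞ :=
  (4 * Λ.e : ℕ) * squareTime κ Λ + (2000 * (Λ.m * Λ.m + 1) : ℕ)

/-- From `n ≤ N ^ 4 = 2 ^ (4 * E)` it follows that `n ^ (c + 1)` is below `δ / 2 = 2 ^ (4 * (c + 1)
* E + 1)`, so `δ / 2` can represent infinity, and that `4 * E` squarings cover all walks with fewer
than `n` edges. -/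
theorem runs_apsp {A : DynAlg} {mode : Mode} {τ : ℝ≥0∞} (hF : Fits c C kind Λ.n E Γ Λ)
    (hA : Subroutine Γ Λ A mode kind τ) {W : Fin Λ.n → Fin Λ.n → ℕ} (hW : ∀ i j, W i j ≤ Λ.n ^ c)
    (hn : 0 < Λ.n) :
    Runs Γ.w (apspProg Γ.R₀ c C A mode kind) (inputStore Λ.n 0 0 W)
      (apspTime (12 * τ + blockTime Γ.R₀ mode kind Λ.N) Λ)
      fun σ _ => ∀ i j : Fin Λ.n, EncodesDistance (distance W i j) (σ.mem (i * Λ.n + j)) := by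
  have hS := hA.size_le
  have hroom := hF.room
  have hδX := hF.δ_lt
  have hnm := hF.le_m
  have hmm := Λ.m_le
  have hδ : Λ.δ = 2 * 2 ^ (4 * (c + 1) * E + 1) := by rw [hF.δ_eq, pow_succ']
  have hδ2 : Λ.δ / 2 = 2 ^ (4 * (c + 1) * E + 1) := by omega
  have hmE : Λ.m = (2 ^ E) ^ 4 := by rw [Λ.m_eq, hF.N_eq]
  have hB : Λ.n ^ (c + 1) < Λ.δ / 2 := by
    rw [hδ2]
    have h1 : Λ.n ^ (c + 1) ≤ ((2 ^ E) ^ 4) ^ (c + 1) := Nat.pow_le_pow_left (hmE ▸ hnm) _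
    refine h1.trans_lt ?_
    rw [← pow_mul, ← pow_mul]
    exact Nat.pow_lt_pow_right one_lt_two (by ring_nf; omega)
  have hWB : ∀ i j, W i j ≤ Λ.δ / 2 := fun i j =>
    ((hW i j).trans (Nat.pow_le_pow_right hn (Nat.le_succ c))).trans hB.le
  have hBδ : Λ.δ / 2 < Λ.δ := by
    have := Nat.two_pow_pos (4 * (c + 1) * E + 1)
    omega
  have hE2 : E < 2 ^ E := Nat.lt_two_pow_self
  have hNm : 2 ^ E ≤ Λ.m := hF.N_eq ▸ Λ.N_le
  have hEm : Λ.e ≤ Λ.m * Λ.m := by rw [hF.e_eq]; omega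
  set s₀ : Env := ⟨fun v => (inputStore Λ.n 0 0 W).reg (V Γ.R₀ v), matrixMem W,
    (inputStore Λ.n 0 0 W).reg⟩ with hs₀
  have hreg : ∀ r, (inputStore Λ.n 0 0 W).reg r ≤ Λ.n := by
    intro r
    simp only [inputStore]
    split_ifs <;> omega
  have hsim : Γ.Sim s₀ (inputStore Λ.n 0 0 W) := by
    refine ⟨fun v => rfl, rfl, fun r _ => rfl, fun v => ?_, fun a => ?_, fun r => ?_⟩
    · exact (hreg _).trans_lt (by omega)
    · change matrixMem W a < Γ.X
      unfold matrixMem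
      split_ifs
      · exact (hWB _ _).trans_lt (by omega)
      · omega
    · exact (hreg _).trans_lt (by omega)
  set κ := 12 * τ + blockTime Γ.R₀ mode kind Λ.N with hκ
  have main : Γ.ARuns (apspProg Γ.R₀ c C A mode kind) s₀ (apspTime κ Λ) fun s' _ =>
      ∀ i j : Fin Λ.n, EncodesDistance (distance W i j) (s'.mem (i * Λ.n + j)) := by
    refine ARuns.mono (T := (0 + (300 * (Λ.m * Λ.m + 1) : ℕ)) + (4 * Λ.e : ℕ) * squareTime κ Λ
      + (25 * (4 * Λ.e + 1) : ℕ) + 1 + (400 * (Λ.m * Λ.m + 1) : ℕ) + 1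
      + (1000 * (Λ.m * Λ.m + 1) : ℕ) + 1) ?_ ?_
    swap
    · have e : (0 + ((300 * (Λ.m * Λ.m + 1) : ℕ) : ℝ≥0∞)) + (4 * Λ.e : ℕ) * squareTime κ Λ
          + (25 * (4 * Λ.e + 1) : ℕ) + 1 + (400 * (Λ.m * Λ.m + 1) : ℕ) + 1
          + (1000 * (Λ.m * Λ.m + 1) : ℕ) + 1
          = (4 * Λ.e : ℕ) * squareTime κ Λ
            + (1700 * (Λ.m * Λ.m + 1) + 25 * (4 * Λ.e + 1) + 3 : ℕ) := by
        push_cast; ring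
      rw [e, apspTime]
      refine add_le_add le_rfl (Nat.cast_le.2 ?_)
      omega
    refine ARuns.seq (ARuns.setup hF (by simp [hs₀, inputStore]) ?_)
    intro s₁ hc₁ hb₁ hmem₁
    refine ARuns.seq (ARuns.initMatrix (Λ := Λ) (W := W) hc₁ hS (by omega) hnm hmem₁ hδX
      (fun i j => (hWB i j).trans hBδ.le) ?_)
    intro s₂ hreg₂ hmem₂ hD₂
    have hb₂ : s₂.reg Var.base = 5 * (Λ.m * Λ.m) := by rw [hreg₂ _ (by decide)]; exact hb₁
    refine ARuns.seq (ARuns.rounds (ρ := 4 * Λ.e) (W := W) (B := Λ.δ / 2) hA ⟨?_, ?_, ?_, ?_, ?_⟩ rfl hWB hBδ hδX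
      ?_ (hF.δ_eq.trans (by rw [hF.β_eq])) ?_)
    · exact hc₁.congr fun v hv => hreg₂ v (by simp only [Var.p]; omega)
    · exact hb₂.ge
    · rw [hb₂]; exact hroom
    · intro a ha
      rw [hb₂] at ha
      exact hmem₂ a (by omega)
    · exact hD₂
    · have h1 : 0 < Λ.N ^ 9 * Λ.stride := Nat.mul_pos (Nat.pow_pos Λ.N_pos) (by rw [hF.stride_eq]; exact Nat.two_pow_pos _)
      have h2 : 4 * Λ.e ≤ 4 * Λ.e * Λ.β := Nat.le_mul_of_pos_right _ (by
        rw [hF.β_eq]; omega)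
      have h3 : 4 * Λ.e * Λ.β ≤ 4 * Λ.e * Λ.β * (Λ.N ^ 9 * Λ.stride) := Nat.le_mul_of_pos_right _ h1
      omega
    intro s₃ hr₃
    refine ARuns.output hr₃ hS hnm hδX fun s₄ hout i j => ?_
    have := hout i i.isLt j j.isLt
    change s₄.mem (i * Λ.n + j) = _ at this
    rw [this]
    refine distMatrix_encodes (c := c) hnm ?_ hW hB i j
    refine (n_le_pow Λ.n).trans (le_of_eq ?_)
    rw [hF.E_eq, hF.e_eq, ← pow_mul, mul_comm]
  refine (main _ hsim).imp ?_
  rintro σ x ⟨s', hs', h⟩ i j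
  rw [hs'.mem]
  exact h i j

end Machine

/-- The number of vertices of the instances. -/
def Kind.size (N : ℕ) : Kind → ℕ
  | .path => 4 * N + 2
  | .matching => 8 * N + 4

theorem Gadget.instSize_eq (G : Gadget) (kind : Kind) : G.instSize kind = kind.size G.N := by
  cases kind <;> rfl

/-- As `N` is a power of two, the word length of the dynamic algorithm is an exact linear function
of `E`. Its largest word can then be computed by multiplications alone. -/
theorem Kind.log_size (kind : Kind) (E : ℕ) : Nat.log 2 (kind.size (2 ^ E)) + 1 = E + kind.shift := by
  have h := Nat.two_pow_pos E
  cases kind with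
  | path =>
    have : Nat.log 2 (4 * 2 ^ E + 2) = E + 2 :=
      Nat.log_eq_of_pow_le_of_lt_pow (by rw [pow_add]; omega) (by rw [pow_add, pow_add]; omega)
    simp [Kind.size, Kind.shift, this]
  | matching =>
    have : Nat.log 2 (8 * 2 ^ E + 4) = E + 3 :=
      Nat.log_eq_of_pow_le_of_lt_pow (by rw [pow_add]; omega) (by rw [pow_add, pow_add]; omega)
    simp [Kind.size, Kind.shift, this]

theorem Kind.size_le (kind : Kind) {N : ℕ} (hN : 0 < N) : kind.size N ≤ 12 * N := by
  cases kind <;> simp only [Kind.size] <;> omega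

theorem Kind.size_pos (kind : Kind) (N : ℕ) : 0 < kind.size N := by
  cases kind <;> simp only [Kind.size] <;> omega

/-! ### The parameters fit the dynamic algorithm -/

namespace Machine

variable {c C n E : ℕ} {kind : Kind} {Γ : Machine} {Λ : Params}

/-- The weights of the gadget are at most `2 ^ (4 * (c + 1) * E + E + 6)`, and an instance has at
least `2 ^ (E + 2)` vertices. Hence the weights are polynomial in its size, with the constant
exponent `4 * (c + 1) + 6`, as the dynamic problem demands. -/
theorem Fits.subroutine {A : DynAlg} {mode : Mode} {τ : ℝ≥0∞} (hF : Fits c C kind n E Γ Λ)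
    (hprep : A.prep.RegsBelow Γ.R₀) (hupd : A.upd.RegsBelow Γ.R₀) (hqry : A.qry.RegsBelow Γ.R₀)
    (h : ∀ G : Gadget, G.N = Λ.N → G.big ≤ (4 * G.N + 2) ^ (4 * (c + 1) + 6) →
      A.prepTime (wordLength C (G.instSize kind)) (G.input mode kind) (G.requests mode kind) +
      A.requestTime (wordLength C (G.instSize kind)) (G.input mode kind) (G.requests mode kind) ≤ τ ∧
      ∀ t, ∀ d ∈ (iter (A.dynStep (wordLength C (G.instSize kind)))
        (A.start (G.input mode kind) (G.requests mode kind)) t).support, d.phase = .done →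
        d.answers.length = G.N ∧
          ∀ i (hi : i < d.answers.length), G.Test mode i d.answers[i] kind ↔ G.Light i) :
    Subroutine Γ Λ A mode kind τ := by
  have hshift : kind.shift ≤ 4 := by cases kind <;> decide
  have hlim : Λ.lim + 1 = 2 ^ (C * (E + kind.shift)) := by
    have := Nat.two_pow_pos (C * (E + kind.shift))
    rw [hF.lim_eq]
    omega
  have hE := Nat.two_pow_pos E
  have hside : 4 * 2 ^ E + 2 ≤ 2 ^ (E + 3) := by rw [pow_add]; omega
  have hbig : 8 * Λ.δ * (Λ.N + 1) ≤ 2 ^ (4 * (c + 1) * E + E + 6) := by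
    rw [hF.δ_eq, hF.N_eq]
    calc 8 * 2 ^ (4 * (c + 1) * E + 2) * (2 ^ E + 1)
        ≤ 8 * 2 ^ (4 * (c + 1) * E + 2) * (2 * 2 ^ E) := Nat.mul_le_mul_left _ (by omega)
      _ = 2 ^ (4 * (c + 1) * E + E + 6) := by
        simp only [pow_add]
        ring
  refine ⟨hprep, hupd, hqry, hF.S_eq ▸ le_add_left (by norm_num), ?_, ?_, ?_, ?_, ?_⟩
  · rw [hF.δ_eq]; exact Nat.two_pow_pos _
  · rw [hlim, hF.stride_eq]
    refine Nat.pow_le_pow_right two_pos ?_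
    unfold memExp
    nlinarith [Nat.mul_le_mul_left C hshift, Nat.zero_le (C * E), Nat.zero_le (c * E)]
  · rw [hF.N_eq, hF.stride_eq]
    refine (Nat.mul_le_mul hside hside).trans ?_
    rw [← pow_add]
    refine Nat.pow_le_pow_right two_pos ?_
    unfold memExp
    nlinarith [Nat.zero_le (C * E), Nat.zero_le (c * E)]
  · rw [hF.stride_eq]
    refine hbig.trans_lt (Nat.pow_lt_pow_right one_lt_two ?_)
    unfold memExp
    nlinarith [Nat.zero_le (C * E), Nat.zero_le (c * E)]
  · intro G hN hδ
    refine ⟨_, ?_, h G hN ?_⟩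
    · rw [hlim, wordLength, G.instSize_eq, hN, hF.N_eq, kind.log_size]
    · rw [Gadget.big, hδ, hN]
      refine hbig.trans ?_
      rw [hF.N_eq]
      calc 2 ^ (4 * (c + 1) * E + E + 6) ≤ 2 ^ ((E + 2) * (4 * (c + 1) + 6)) :=
            Nat.pow_le_pow_right two_pos (by nlinarith [Nat.zero_le (c * E)])
        _ = (2 ^ (E + 2)) ^ (4 * (c + 1) + 6) := pow_mul _ _ _
        _ ≤ (4 * 2 ^ E + 2) ^ (4 * (c + 1) + 6) :=
          Nat.pow_le_pow_left (by rw [pow_add]; omega) _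

/-! ## The running time -/

/-- Only writing the `(4 * N + 2) * (4 * N + 2)` entries of the instance is quadratic; the other
overheads are linear or constant. The time of the dynamic algorithm and of the row searches is
accounted for elsewhere. -/
theorem exists_blockTime_le (R₀ : ℕ) (mode : Mode) (kind : Kind) :
    ∃ b : ℕ, ∀ N, 0 < N → blockTime R₀ mode kind N ≤ b * N ^ 2 := by
  unfold blockTime callTime scanTime
  generalize assignsTime corners = x₁
  generalize fillTime _ _ _ = x₂
  generalize cmdsTime _ + forTime _ = x₃
  generalize (Expr.test mode kind).time + 25 = x₄
  generalize 4 * R₀ + Expr.side.time + (arg₁ kind).time + (arg₂ kind).time + 50 = x₅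
  refine ⟨x₁ + 37 * x₂ + x₅ + 2 * x₃ + 2 * x₄ + 11, fun N hN => ?_⟩
  have h1 : 1 ≤ N ^ 2 := Nat.one_le_pow _ _ hN
  have h2 : N + 1 ≤ 2 * N ^ 2 := by nlinarith
  have h3 : (4 * N + 2) * (4 * N + 2) + 1 ≤ 37 * N ^ 2 := by nlinarith
  calc _ ≤ x₁ * N ^ 2 + x₂ * (37 * N ^ 2) + (x₅ * N ^ 2 + x₃ * (2 * N ^ 2)) + x₄ * (2 * N ^ 2)
        + 11 * N ^ 2 := by
        gcongr
        · exact Nat.le_mul_of_pos_right _ h1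
        · exact Nat.le_mul_of_pos_right _ h1
        · omega
    _ = _ := by ring

/-- A comparison costs `N ^ 9` blocks, scans of total size `O(N ^ 10)` and passes over `N ^ 8`
entries. As `y` is at least `N ^ 2`, all of this is within a constant multiple of `N ^ 9 * y`. The
factors `e + 1` and `β + 1` count squarings and bits, up to constants. -/
theorem apspTime_le (Λ : Params) {κ k y : ℝ≥0∞} (hκ : κ ≤ k * y) (hy : (Λ.N ^ 2 : ℕ) ≤ y) :
    apspTime κ Λ ≤ (4 * (Λ.e + 1) * (Λ.β + 1) : ℕ) * (k + 2461) * ((Λ.N ^ 9 : ℕ) * y) := by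
  have hN := Λ.N_pos
  set Y : ℝ≥0∞ := (Λ.N ^ 9 : ℕ) * y with hY
  have hmm : Λ.m * Λ.m = Λ.N ^ 8 := by rw [Λ.m_eq]; ring
  have hle : ∀ i ≤ 11, Λ.N ^ i ≤ Λ.N ^ 11 := fun i hi => Nat.pow_le_pow_right hN hi
  have h0 := hle 0 (by norm_num)
  have h8 := hle 8 (by norm_num)
  have h9 := hle 9 (by norm_num)
  have h10 := hle 10 (by norm_num)
  rw [pow_zero] at h0
  have hNY : ((Λ.N ^ 11 : ℕ) : ℝ≥0∞) ≤ Y := by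
    rw [show Λ.N ^ 11 = Λ.N ^ 9 * Λ.N ^ 2 by ring, Nat.cast_mul]
    exact mul_le_mul' le_rfl hy
  have key : ∀ {a b : ℕ}, a ≤ b * Λ.N ^ 11 → (a : ℝ≥0∞) ≤ b * Y := by
    intro a b hab
    calc (a : ℝ≥0∞) ≤ ((b * Λ.N ^ 11 : ℕ) : ℝ≥0∞) := Nat.cast_le.2 hab
      _ = b * (Λ.N ^ 11 : ℕ) := Nat.cast_mul _ _
      _ ≤ b * Y := by gcongr
  have e1 : ((rowTime Λ.N * (Λ.m * Λ.m) : ℕ) : ℝ≥0∞) ≤ (600 : ℕ) * Y := by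
    refine key ?_
    rw [hmm, rowTime, show 300 * (Λ.N * Λ.N + 1) * Λ.N ^ 8 = 300 * Λ.N ^ 10 + 300 * Λ.N ^ 8 by ring]
    omega
  have e2 : ((70 * (Λ.N ^ 9 + 1) : ℕ) : ℝ≥0∞) ≤ (140 : ℕ) * Y := key (by omega)
  have e3 : ((200 * (Λ.m * Λ.m + 1) : ℕ) : ℝ≥0∞) ≤ (400 : ℕ) * Y := key (by rw [hmm]; omega)
  have e4 : ((21 * (Λ.β + 1) + 150 * (Λ.m * Λ.m + 1) : ℕ) : ℝ≥0∞)
      ≤ (21 * (Λ.β + 1) + 300 : ℕ) * Y := by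
    refine key ?_
    rw [hmm, add_mul]
    have := Nat.le_mul_of_pos_right (21 * (Λ.β + 1)) h0
    omega
  have e5 : ((2000 * (Λ.m * Λ.m + 1) : ℕ) : ℝ≥0∞) ≤ (4000 : ℕ) * Y := key (by rw [hmm]; omega)
  have e6 : ((Λ.N ^ 9 : ℕ) : ℝ≥0∞) * κ ≤ k * Y := by
    calc ((Λ.N ^ 9 : ℕ) : ℝ≥0∞) * κ ≤ (Λ.N ^ 9 : ℕ) * (k * y) := by gcongr
      _ = k * Y := by rw [hY]; ring
  have hbit : bitTime κ Λ ≤ (k + 1140) * Y := by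
    rw [bitTime, compareTime]
    calc _ ≤ (600 : ℕ) * Y + k * Y + (140 : ℕ) * Y + (400 : ℕ) * Y := by gcongr
      _ = (k + 1140) * Y := by push_cast; ring
  have hsq : squareTime κ Λ ≤ (Λ.β + 1 : ℕ) * (k + 1461) * Y := by
    rw [squareTime]
    calc _ ≤ Λ.β * ((k + 1140) * Y) + (21 * (Λ.β + 1) + 300 : ℕ) * Y := by gcongr
      _ ≤ Λ.β * ((k + 1140) * Y) + (21 * (Λ.β + 1) + 300 : ℕ) * Y
          + ((k + 1140) * Y + (300 * Λ.β : ℕ) * Y) := le_self_add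
      _ = (Λ.β + 1 : ℕ) * (k + 1461) * Y := by push_cast; ring
  rw [apspTime]
  calc _ ≤ (4 * Λ.e : ℕ) * ((Λ.β + 1 : ℕ) * (k + 1461) * Y) + (4000 : ℕ) * Y := by gcongr
    _ ≤ (4 * Λ.e : ℕ) * ((Λ.β + 1 : ℕ) * (k + 1461) * Y) + (4000 : ℕ) * Y
        + ((4 * (Λ.β + 1) : ℕ) * (k + 1461) * Y
          + (4000 * (Λ.e + 1) * Λ.β + 4000 * Λ.e : ℕ) * Y) := le_self_add
    _ = _ := by push_cast; ring

end Machine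

/-! ### Estimates with real exponents -/

/-- Rounding `n` up to the fourth power of a power of two costs at most a factor `16`. -/
theorem pow_clog_le {n : ℕ} (hn : 0 < n) : (2 ^ Nat.clog 16 n) ^ 4 ≤ 16 * n := by
  have h : (2 ^ Nat.clog 16 n) ^ 4 = 16 ^ Nat.clog 16 n := by
    rw [← pow_mul, mul_comm, pow_mul]
    norm_num
  rw [h]
  rcases Nat.lt_or_ge 1 n with h1 | h1
  · have h2 := Nat.pow_pred_clog_lt_self (b := 16) (by norm_num) h1
    have h3 : 0 < Nat.clog 16 n := Nat.clog_pos (by norm_num) h1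
    obtain ⟨d, hd⟩ : ∃ d, Nat.clog 16 n = d + 1 := ⟨Nat.clog 16 n - 1, by omega⟩
    rw [hd] at h2 ⊢
    rw [Nat.pred_succ] at h2
    rw [pow_succ]
    omega
  · rw [Nat.clog_of_right_le_one h1]
    omega

/-- With `a = η * log 2` the power is `exp (a * E)`, which is at least `a * E + 1`. -/
theorem succ_le_mul_rpow {η : ℝ} (hη : 0 < η) (E : ℕ) :
    (E + 1 : ℝ) ≤ (1 / (η * Real.log 2) + 1) * ((2 ^ E : ℕ) : ℝ) ^ η := by
  have ha : 0 < η * Real.log 2 := mul_pos hη (Real.log_pos one_lt_two)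
  set a := η * Real.log 2 with ha'
  have h1 : ((2 ^ E : ℕ) : ℝ) ^ η = Real.exp (a * E) := by
    rw [Real.rpow_def_of_pos (by positivity), ha']
    push_cast
    rw [Real.log_pow]
    congr 1
    ring
  rw [h1]
  have h2 := Real.add_one_le_exp (a * E)
  calc (E + 1 : ℝ) ≤ (1 / a + 1) * (a * E + 1) := by
        have h3 : (1 / a + 1) * (a * E + 1) = E + 1 + (1 / a + a * E) := by field_simp; ring
        rw [h3]
        have : 0 ≤ 1 / a + a * E := by positivity
        linarith
    _ ≤ _ := by gcongr

/-- The two logarithmic factors are each bounded by a multiple of `N ^ (ε / 4)`. This leaves `N ^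
(12 - ε / 2) = (N ^ 4) ^ (3 - ε / 8)`: half of the gain `ε / 4` is lost to them. -/
theorem exists_rpow_bound {ε : ℝ} (hε : 0 < ε) (hε₁ : ε ≤ 1) : ∃ K : ℝ, 0 ≤ K ∧ ∀ n : ℕ, 0 < n →
    ((Nat.clog 16 n + 1 : ℝ)) ^ 2 * (((2 ^ Nat.clog 16 n : ℕ) : ℝ) ^ 9 *
      ((2 ^ Nat.clog 16 n : ℕ) : ℝ) ^ (3 - ε)) ≤ K * (n : ℝ) ^ (3 - ε / 8) := by
  refine ⟨(1 / (ε / 4 * Real.log 2) + 1) ^ 2 * 16 ^ (3 - ε / 8), by positivity, fun n hn => ?_⟩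
  set a := 1 / (ε / 4 * Real.log 2) + 1
  have h1 := succ_le_mul_rpow (η := ε / 4) (by positivity) (Nat.clog 16 n)
  have h4 : (((2 ^ Nat.clog 16 n : ℕ) : ℝ)) ^ (4 : ℕ) ≤ 16 * n := by
    exact_mod_cast pow_clog_le hn
  set N : ℝ := ((2 ^ Nat.clog 16 n : ℕ) : ℝ) with hN
  have hN0 : 0 < N := by positivity
  have h2 : (N ^ (ε / 4)) ^ 2 * (N ^ 9 * N ^ (3 - ε)) = (N ^ (4 : ℕ)) ^ (3 - ε / 8) := by
    rw [← Real.rpow_natCast N 4, ← Real.rpow_natCast N 9, ← Real.rpow_natCast _ 2, ← Real.rpow_mul hN0.le,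
      ← Real.rpow_mul hN0.le, ← Real.rpow_add hN0, ← Real.rpow_add hN0]
    congr 1
    push_cast
    ring
  calc _ ≤ (a * N ^ (ε / 4)) ^ 2 * (N ^ 9 * N ^ (3 - ε)) := by gcongr
    _ = a ^ 2 * (N ^ (4 : ℕ)) ^ (3 - ε / 8) := by rw [← h2]; ring
    _ ≤ a ^ 2 * (16 * n) ^ (3 - ε / 8) := by
      gcongr
      linarith
    _ = _ := by rw [Real.mul_rpow (by norm_num) (by positivity)]; ring

/-- A bound for the running time of the dynamic algorithm. -/
theorem exists_dynTime_le {ε : ℝ} (hε : 0 < ε) (K : ℝ) : ∃ k : ℝ, 0 ≤ k ∧ ∀ (kind : Kind) (N : ℕ), 0 < N →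
    ENNReal.ofReal (K * (kind.size N : ℝ) ^ (3 - ε)) +
      ENNReal.ofReal (K * ((3 * N : ℕ) * (kind.size N : ℝ) ^ (2 - ε)))
      ≤ ENNReal.ofReal (k * (N : ℝ) ^ (3 - min ε 1)) := by
  -- The constant is `12 ^ 3` for the preprocessing plus `3 * 12 ^ 2` for the `3 * N` requests, as
  -- an instance has at most `12 * N` vertices.
  refine ⟨2160 * |K|, by positivity, fun kind N hN => ?_⟩
  set ε₁ := min ε 1 with hε₁
  have h1 : ε₁ ≤ 1 := min_le_right _ _
  have h2 : ε₁ ≤ ε := min_le_left _ _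
  have h0 : 0 < ε₁ := lt_min hε one_pos
  have hs : (1 : ℝ) ≤ kind.size N := by exact_mod_cast kind.size_pos N
  have hs' : (kind.size N : ℝ) ≤ 12 * N := by exact_mod_cast kind.size_le hN
  have hN' : (0 : ℝ) < N := by exact_mod_cast hN
  have key : ∀ (a : ℝ) (b : ℕ), 0 ≤ a → a ≤ b → (12 * N : ℝ) ^ a ≤ 12 ^ b * (N : ℝ) ^ a := by
    intro a b _ hab
    rw [Real.mul_rpow (by norm_num) hN'.le]
    gcongr
    rw [← Real.rpow_natCast]
    exact Real.rpow_le_rpow_of_exponent_le (by norm_num) hab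
  have hA : K * (kind.size N : ℝ) ^ (3 - ε) ≤ |K| * (12 ^ 3 * (N : ℝ) ^ (3 - ε₁)) := by
    calc _ ≤ |K| * (kind.size N : ℝ) ^ (3 - ε₁) := by
          gcongr
          exact le_abs_self K
      _ ≤ |K| * (12 * N : ℝ) ^ (3 - ε₁) := by
          gcongr
          linarith
      _ ≤ _ := by
          gcongr
          exact key _ 3 (by linarith) (by push_cast; linarith)
  have hB : K * ((3 * N : ℕ) * (kind.size N : ℝ) ^ (2 - ε)) ≤ |K| * (432 * (N : ℝ) ^ (3 - ε₁)) := by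
    calc _ ≤ |K| * ((3 * N : ℕ) * (kind.size N : ℝ) ^ (2 - ε₁)) := by
          gcongr
          exact le_abs_self K
      _ ≤ |K| * ((3 * N : ℕ) * (12 * N : ℝ) ^ (2 - ε₁)) := by
          gcongr
          linarith
      _ ≤ |K| * ((3 * N : ℕ) * (12 ^ 2 * (N : ℝ) ^ (2 - ε₁))) := by
          gcongr
          exact key _ 2 (by linarith) (by push_cast; linarith)
      _ = _ := by
          rw [show 3 - ε₁ = (2 - ε₁) + 1 by ring, Real.rpow_add_one hN'.ne']
          push_cast
          ring
  calc _ ≤ ENNReal.ofReal (|K| * (12 ^ 3 * (N : ℝ) ^ (3 - ε₁)))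
        + ENNReal.ofReal (|K| * (432 * (N : ℝ) ^ (3 - ε₁))) := by gcongr
    _ = _ := by
      rw [← ENNReal.ofReal_add (by positivity) (by positivity)]
      congr 1
      ring

open Machine in
/-- A dynamic algorithm for one of the four problems gives an algorithm for all pairs shortest
paths. -/
theorem apspSolvable_of_solvable {ε : ℝ} (hε : 0 < ε) {mode : Mode} {kind : Kind}
    (h : (problem mode kind).Solvable (3 - ε) (2 - ε)) (c : ℕ) : APSPSolvable c (min ε 1 / 8) := by
  -- The exponent is the one for which `Fits.subroutine` bounds the weights of the gadgets.
  obtain ⟨A, C, K, hA⟩ := Gadget.exists_dynAlg h (4 * (c + 1) + 6)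
  obtain ⟨R₁, hR₁⟩ := A.prep.exists_regsBelow
  obtain ⟨R₂, hR₂⟩ := A.upd.exists_regsBelow
  obtain ⟨R₃, hR₃⟩ := A.qry.exists_regsBelow
  obtain ⟨R, hR, h1, h2, h3⟩ : ∃ R, 3 ≤ R ∧ R₁ ≤ R ∧ R₂ ≤ R ∧ R₃ ≤ R :=
    ⟨R₁ + R₂ + R₃ + 3, by omega, by omega, by omega, by omega⟩
  obtain ⟨k, hk, hdyn⟩ := exists_dynTime_le hε K
  obtain ⟨b, hb⟩ := exists_blockTime_le R mode kind
  have hε₁ : 0 < min ε 1 := lt_min hε one_pos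
  obtain ⟨K', hK', hbound⟩ := exists_rpow_bound hε₁ (min_le_right ε 1)
  -- With `ε₁ ≤ 1`, the quadratic time for writing an instance is within the budget `N ^ (3 - ε₁)`
  -- of a call.
  set ε₁ := min ε 1 with hε₁'
  have hε₁1 : ε₁ ≤ 1 := min_le_right ε 1
  refine ⟨apspProg R c C A mode kind, 2 * mainExp c C * exprSize c C,
    4 * (4 * (c + 1) + 3) * (12 * k + b + 2461) * K', fun n hn W hW => ?_⟩
  have hF : Fits c C kind n (Nat.clog 16 n) (machine c C R hR n) (params c C kind n) := fits
  have hw : (machine c C R hR n).w = wordLength (2 * mainExp c C * exprSize c C) n := rfl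
  have hR₀ : (machine c C R hR n).R₀ = R := rfl
  have hΛn : (params c C kind n).n = n := rfl
  generalize machine c C R hR n = Γ at hF hw hR₀
  generalize params c C kind n = Λ at hF hΛn
  subst hΛn
  have hN := Λ.N_pos
  have hN' : (1 : ℝ) ≤ Λ.N := by exact_mod_cast hN
  set τ : ℝ≥0∞ := ENNReal.ofReal (k * (Λ.N : ℝ) ^ (3 - ε₁)) with hτ
  have hsub : Subroutine Γ Λ A mode kind τ := by
    refine hF.subroutine (hR₁.mono (hR₀ ▸ h1)) (hR₂.mono (hR₀ ▸ h2)) (hR₃.mono (hR₀ ▸ h3)) ?_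
    intro G hGN hG
    obtain ⟨g1, g2, g3⟩ := hA G hG
    refine ⟨(add_le_add g1 g2).trans ?_, g3⟩
    rw [G.instSize_eq, hGN]
    exact hdyn kind Λ.N hN
  have hruns := runs_apsp hF hsub hW hn
  rw [hw, hR₀] at hruns
  have hy : ((Λ.N ^ 2 : ℕ) : ℝ≥0∞) ≤ ENNReal.ofReal ((Λ.N : ℝ) ^ (3 - ε₁)) := by
    rw [← ENNReal.ofReal_natCast]
    refine ENNReal.ofReal_le_ofReal ?_
    push_cast
    rw [← Real.rpow_natCast]
    exact Real.rpow_le_rpow_of_exponent_le hN' (by push_cast; linarith)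
  have hκ : 12 * τ + (blockTime R mode kind Λ.N : ℕ)
      ≤ ENNReal.ofReal (12 * k + b) * ENNReal.ofReal ((Λ.N : ℝ) ^ (3 - ε₁)) := by
    calc 12 * τ + (blockTime R mode kind Λ.N : ℕ) ≤ 12 * τ + (b * Λ.N ^ 2 : ℕ) := by
          gcongr
          exact hb _ hN
      _ = 12 * τ + b * (Λ.N ^ 2 : ℕ) := by push_cast; rfl
      _ ≤ 12 * τ + b * ENNReal.ofReal ((Λ.N : ℝ) ^ (3 - ε₁)) := add_le_add le_rfl (mul_le_mul' le_rfl hy)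
      _ = _ := by
        rw [hτ, ENNReal.ofReal_add (by positivity) (by positivity), ENNReal.ofReal_mul hk,
          ENNReal.ofReal_mul (by norm_num), ENNReal.ofReal_natCast, ENNReal.ofReal_ofNat]
        ring
  have hT := apspTime_le Λ hκ hy
  have hreal : apspTime (12 * τ + (blockTime R mode kind Λ.N : ℕ)) Λ
      ≤ ENNReal.ofReal (4 * (4 * (c + 1) + 3) * (12 * k + b + 2461) * K' * (Λ.n : ℝ) ^ (3 - ε₁ / 8)) := by
    refine hT.trans ?_
    rw [← ENNReal.ofReal_natCast (4 * (Λ.e + 1) * (Λ.β + 1)), ← ENNReal.ofReal_natCast (Λ.N ^ 9),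
      ← ENNReal.ofReal_ofNat 2461, ← ENNReal.ofReal_add (by positivity) (by norm_num),
      ← ENNReal.ofReal_mul (by positivity), ← ENNReal.ofReal_mul (by positivity),
      ← ENNReal.ofReal_mul (by positivity)]
    refine ENNReal.ofReal_le_ofReal ?_
    have hbd := hbound Λ.n hn
    rw [hF.E_eq, ← hF.N_eq] at hbd
    rw [hF.e_eq, hF.β_eq]
    generalize Nat.clog 16 Λ.n = E at *
    -- Both the number of squarings and the number of bits are linear in `E`, whence the square of
    -- `E + 1`.
    have hβ : ((4 * (E + 1) * (4 * (c + 1) * E + 2 + 1) : ℕ) : ℝ)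
        ≤ 4 * (4 * (c + 1) + 3) * (E + 1 : ℝ) ^ 2 := by
      have : 4 * (E + 1) * (4 * (c + 1) * E + 2 + 1) ≤ 4 * (4 * (c + 1) + 3) * (E + 1) ^ 2 := by
        have h0 : 4 * (c + 1) * E + 2 + 1 ≤ (4 * (c + 1) + 3) * (E + 1) := by nlinarith
        calc _ ≤ 4 * (E + 1) * ((4 * (c + 1) + 3) * (E + 1)) := Nat.mul_le_mul_left _ h0
          _ = _ := by ring
      exact_mod_cast this
    push_cast at hβ ⊢
    calc _ ≤ 4 * (4 * (c + 1) + 3) * (E + 1 : ℝ) ^ 2 * (12 * k + b + 2461)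
          * ((Λ.N : ℝ) ^ 9 * (Λ.N : ℝ) ^ (3 - ε₁)) := by gcongr
      _ = 4 * (4 * (c + 1) + 3) * (12 * k + b + 2461) *
          ((E + 1 : ℝ) ^ 2 * ((Λ.N : ℝ) ^ 9 * (Λ.N : ℝ) ^ (3 - ε₁))) := by ring
      _ ≤ 4 * (4 * (c + 1) + 3) * (12 * k + b + 2461) * (K' * (Λ.n : ℝ) ^ (3 - ε₁ / 8)) := by gcongr
      _ = _ := by ring
  refine ⟨hruns.expectedTime_le.trans hreal, fun σ' hσ' => ?_⟩
  obtain ⟨-, hx⟩ := hruns.of_possibleResult (ne_top_of_le_ne_top ENNReal.ofReal_ne_top hreal) hσ'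
  exact hx

end WordRAM

theorem theorem4 (ε : ℝ) (hε : 0 < ε)
    (h : (WordRAM.stSP .decremental).Solvable (3 - ε) (2 - ε) ∨
      (WordRAM.stSP .incremental).Solvable (3 - ε) (2 - ε) ∨
      (WordRAM.bwMatch .decremental).Solvable (3 - ε) (2 - ε) ∨
      (WordRAM.bwMatch .incremental).Solvable (3 - ε) (2 - ε)) :
    ¬ WordRAM.APSPConjecture := by
  rintro ⟨c, hc⟩
  refine hc (min ε 1 / 8) (div_pos (lt_min hε one_pos) (by norm_num)) ?_
  rcases h with h | h | h | h
  · exact WordRAM.apspSolvable_of_solvable (kind := .path) hε h c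
  · exact WordRAM.apspSolvable_of_solvable (kind := .path) hε h c
  · exact WordRAM.apspSolvable_of_solvable (kind := .matching) hε h c
  · exact WordRAM.apspSolvable_of_solvable (kind := .matching) hε h c
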